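/- Write $[a_1,\dots,a_m]=\cfrac{1}{a_1+\cfrac{1}{\cdots+\cfrac{1}{a_m}}}$. The Farey graph $\mathcal F$ has vertex set $\mathbb Q\cup\{\frac10\}$, where two vertices $\frac pq,\frac rs$ (in lowest terms) are joined by an edge iff $|ps-qr|=1$. Realize $\mathcal F$ in the upper half-plane together with its ideal boundary $\mathbb R\cup\{\frac10\}$, with edges the hyperbolic geodesics; a Farey triangle is an ideal triangle whose three sides are edges of $\mathcal F$. For $x,y\in\mathbb Q\cup\{\frac10\}$ the ladder $\mathcal L(x,y)$ is the union of all Farey triangles whose interior meets the hyperbolic geodesic $\gamma$ joining $x$ and $y$; a pivot point of $\mathcal L(x,y)$ is a point which is the whole intersection of two of its triangles. If $\mathcal L(x,y)$ contains at least three triangles, its spine is the simplicial path in $\mathcal L(x,y)$ from $x$ to $y$ whose vertices other than the endpoints are exactly the pivot points, and whose edges other than the first and the last all cross $\gamma$. A geodesic in $\mathcal F$ is a simplicial path whose length is the distance in $\mathcal F$ of its endpoints. **Theorem.** (1) Let $n\ge 2$ and let $a_1,\dots,a_{n-1}$ be integers with $a_i\ge 3$ for every $i$, and let $\frac pq=[a_1,\dots,a_{n-1}]$.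 Then the ladder $\mathcal L(\frac10,\frac pq)$ has exactly one spine; this spine has length $n$, and it is the unique geodesic in $\mathcal F$ connecting $\frac10$ and $\frac pq$. (2) Let $S$ be a 4-punctured sphere (a 2-sphere minus four points), respectively a torus with at most one hole (a torus, a once-punctured torus, or a torus minus an open disk). Let $\mathcal C(S)$ be the curve complex of $S$: its vertices are the ambient isotopy classes of essential simple closed curves in $S$ (those which bound neither a disk nor a once-punctured disk and are not parallel to a component of $\partial S$), and $k+1$ vertices span a $k$-simplex iff they can be realized by curves that mutually intersect transversely in exactly two points, respectively in exactly one point. Then $\mathcal C(S)$ has infinite diameter: for every $N$ there are two vertices that are joined by a simplicial path in $\mathcal C(S)$ and whose distance (the least number of edges of such a path) is at least $N$. -/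

import Mathlib

open scoped OnePoint

/-! ### Continued fractions and the Farey graph -/

/-- `contFrac [a₁, …, aₘ] = 1 / (a₁ + 1 / (a₂ + ⋯ + 1 / aₘ))`. -/
def contFrac : List ℕ → ℚ
  | [] => 0
  | a :: l => 1 / ((a : ℚ) + contFrac l)

/-- Numerator of an extended rational in lowest terms (`∞` is `1/0`). -/
def extNum (x : OnePoint ℚ) : ℤ := x.elim 1 Rat.num

/-- Denominator of an extended rational in lowest terms (`∞` is `1/0`). -/
def extDen (x : OnePoint ℚ) : ℤ := x.elim 0 (fun q => (q.den : ℤ))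

/-- The Farey graph: `p/q` and `r/s` are adjacent iff `|ps - qr| = 1`. -/
def fareyGraph : SimpleGraph (OnePoint ℚ) where
  Adj x y := |extNum x * extDen y - extDen x * extNum y| = 1
  symm := ⟨by
    intro x y h
    rw [← h, abs_sub_comm]
    congr 1
    ring⟩
  loopless := ⟨by
    intro x h
    simp [mul_comm] at h⟩

/-! ### The Farey tessellation of the upper half-plane, ladders and spines -/

/-- For `x = p/q`, `y = r/s` and `z` in the upper half-plane this is
`Re ((q z - p) * conj (s z - r))`. If `x ≠ y` it vanishes exactly on the hyperbolic geodesic with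
ideal endpoints `x` and `y` (a vertical half-line if one of them is `∞`, a half-circle
`(Re z - x) (Re z - y) + (Im z) ^ 2 = 0` otherwise), and its sign tells the two open
half-planes bounded by that geodesic apart. -/
noncomputable def sideForm (x y : OnePoint ℚ) (z : UpperHalfPlane) : ℝ :=
  (((extDen x : ℂ) * (z : ℂ) - (extNum x : ℂ)) *
    (starRingEnd ℂ) ((extDen y : ℂ) * (z : ℂ) - (extNum y : ℂ))).re

/-- The same form at an ideal point `w = a/b` different from `x` and `y`, in homogeneous
coordinates: its sign is that of `sideForm x y` near `w`. -/
def idealSideForm (x y w : OnePoint ℚ) : ℤ :=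
  (extDen x * extNum w - extNum x * extDen w) * (extDen y * extNum w - extNum y * extDen w)

/-- The hyperbolic geodesic in the upper half-plane with ideal endpoints `x ≠ y`. -/
def hypGeodesic (x y : OnePoint ℚ) : Set UpperHalfPlane :=
  {z | sideForm x y z = 0}

/-- A Farey triangle, given by its three ideal vertices: its sides are edges of the Farey graph. -/
def IsFareyTriangle (Δ : Finset (OnePoint ℚ)) : Prop :=
  fareyGraph.IsNClique 3 Δ

/-- The interior of the ideal triangle with vertex set `Δ`: the points that lie, for each side
`{u, v}`, strictly on the same side of the geodesic from `u` to `v` as the third vertex `w`. -/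
def idealTriangleInterior (Δ : Finset (OnePoint ℚ)) : Set UpperHalfPlane :=
  {z | ∀ u ∈ Δ, ∀ v ∈ Δ, ∀ w ∈ Δ, u ≠ v → u ≠ w → v ≠ w →
    0 < sideForm u v z * (idealSideForm u v w : ℝ)}

/-- The ladder of `x` and `y`: the Farey triangles whose interior meets the hyperbolic geodesic
joining `x` and `y`. -/
def ladder (x y : OnePoint ℚ) : Set (Finset (OnePoint ℚ)) :=
  {Δ | IsFareyTriangle Δ ∧ (idealTriangleInterior Δ ∩ hypGeodesic x y).Nonempty}

/-- The pivot points of the ladder: the points `v` such that two of its triangles meet exactly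
in `v`. (Consecutive triangles of the ladder meet in an edge.) -/
def ladderPivots (x y : OnePoint ℚ) : Set (OnePoint ℚ) :=
  {v | ∃ Δ₁ ∈ ladder x y, ∃ Δ₂ ∈ ladder x y, (Δ₁ : Set (OnePoint ℚ)) ∩ (Δ₂ : Set _) = {v}}

/-- `K` is a spine of the ladder of `x` and `y`, a ladder with at least three triangles. -/
structure IsSpine {x y : OnePoint ℚ} (K : fareyGraph.Walk x y) : Prop where
  three_le : 3 ≤ (ladder x y).encard
  isPath : K.IsPath
  /-- `K` runs in the ladder. -/
  edges_mem : ∀ e ∈ K.edges, ∃ Δ ∈ ladder x y, ∀ v ∈ e, v ∈ Δ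
  /-- The vertices of `K` other than the endpoints are exactly the pivot points. -/
  inner_vertices : {v | v ∈ K.support ∧ v ≠ x ∧ v ≠ y} = ladderPivots x y
  /-- All edges of `K` but the first and the last cross the geodesic from `x` to `y`. -/
  inner_edges : ∀ i : ℕ, 0 < i → i + 1 < K.length →
    (hypGeodesic (K.getVert i) (K.getVert (i + 1)) ∩ hypGeodesic x y).Nonempty

/-- A simplicial geodesic: a path whose length is the distance of its endpoints. -/
def IsGeodesicWalk {V : Type*} {G : SimpleGraph V} {x y : V} (P : G.Walk x y) : Prop :=
  P.length = G.dist x y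

/-! ### Curves on surfaces -/

/-- Simple closed curves in (the interior of) an orientable surface, as subsets: the cores of
open annuli embedded in the surface. (Every embedded circle in the interior of an orientable
surface has such an annular neighbourhood.) -/
def IsSimpleClosedCurve {S : Type*} [TopologicalSpace S] (α : Set S) : Prop :=
  ∃ f : Circle × ℝ → S, Topology.IsOpenEmbedding f ∧ f '' (Set.univ ×ˢ {0}) = α

/-- `α` bounds a closed disk embedded in the surface. -/
def BoundsDisk {S : Type*} [TopologicalSpace S] (α : Set S) : Prop :=
  ∃ d : {z : ℂ // ‖z‖ ≤ 1} → S, Topology.IsEmbedding d ∧ d '' {z | ‖(z : ℂ)‖ = 1} = α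

/-- `α` bounds a once-punctured disk. The disk minus its centre is embedded as a closed subset,
that is, its centre corresponds to a puncture of the surface. -/
def BoundsPuncturedDisk {S : Type*} [TopologicalSpace S] (α : Set S) : Prop :=
  ∃ d : {z : ℂ // 0 < ‖z‖ ∧ ‖z‖ ≤ 1} → S,
    Topology.IsClosedEmbedding d ∧ d '' {z | ‖(z : ℂ)‖ = 1} = α

/-- The boundary of a topological surface: the points without a neighbourhood homeomorphic to
an open subset of the plane. -/
def surfaceBoundary (S : Type*) [TopologicalSpace S] : Set S :=
  {x | ¬ ∃ e : OpenPartialHomeomorph S (ℝ × ℝ), x ∈ e.source}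

/-- `α` is parallel to a component of the boundary: together they bound an embedded annulus. -/
def IsBoundaryParallel {S : Type*} [TopologicalSpace S] (α : Set S) : Prop :=
  ∃ h : Circle × unitInterval → S, Topology.IsEmbedding h ∧ h '' (Set.univ ×ˢ {0}) = α ∧
    ∃ x ∈ surfaceBoundary S,
      h '' (Set.univ ×ˢ {1}) = connectedComponentIn (surfaceBoundary S) x

/-- Essential simple closed curves. -/
structure IsEssentialCurve {S : Type*} [TopologicalSpace S] (α : Set S) : Prop where
  isSimpleClosedCurve : IsSimpleClosedCurve α
  not_boundsDisk : ¬ BoundsDisk α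
  not_boundsPuncturedDisk : ¬ BoundsPuncturedDisk α
  not_isBoundaryParallel : ¬ IsBoundaryParallel α

/-- The type of essential simple closed curves in `S`. -/
def EssentialCurve (S : Type*) [TopologicalSpace S] : Type _ :=
  {α : Set S // IsEssentialCurve α}

/-- Some ambient isotopy of `S` carries `α` to `β`. -/
def AmbientIsotopic {S : Type*} [TopologicalSpace S] (α β : Set S) : Prop :=
  ∃ H : unitInterval → S → S, Continuous (fun p : unitInterval × S => H p.1 p.2) ∧
    (∀ t, IsHomeomorph (H t)) ∧ H 0 = id ∧ H 1 '' α = β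

theorem AmbientIsotopic.refl {S : Type*} [TopologicalSpace S] (α : Set S) :
    AmbientIsotopic α α :=
  ⟨fun _ => id, continuous_snd, fun _ => IsHomeomorph.id, rfl, Set.image_id α⟩

theorem AmbientIsotopic.symm {S : Type*} [TopologicalSpace S] {α β : Set S}
    (h : AmbientIsotopic α β) : AmbientIsotopic β α := by
  obtain ⟨H, hc, hh, h0, h1⟩ := h
  obtain ⟨g, hg⟩ := isHomeomorph_iff_exists_homeomorph.mp (hh 1)
  refine ⟨fun t x => H (unitInterval.symm t) (g.symm x), ?_, fun t => ?_, ?_, ?_⟩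
  · exact hc.comp (f := fun p : unitInterval × S => (unitInterval.symm p.1, g.symm p.2))
      (by fun_prop)
  · exact (hh _).comp g.symm.isHomeomorph
  · funext x
    simp [← hg]
  · rw [← h1, ← hg, Set.image_image]
    simp [h0]

theorem AmbientIsotopic.trans {S : Type*} [TopologicalSpace S] {α β γ : Set S}
    (h : AmbientIsotopic α β) (h' : AmbientIsotopic β γ) : AmbientIsotopic α γ := by
  obtain ⟨H, hc, hh, h0, h1⟩ := h
  obtain ⟨H', hc', hh', h0', h1'⟩ := h'
  refine ⟨fun t x => H' t (H t x), ?_, fun t => (hh' t).comp (hh t), ?_, ?_⟩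
  · exact hc'.comp (f := fun p : unitInterval × S => (p.1, H p.1 p.2))
      (continuous_fst.prodMk hc)
  · funext x
    simp [h0, h0']
  · rw [← h1', ← h1, Set.image_image]

/-- Isotopy of essential simple closed curves. -/
def curveSetoid (S : Type*) [TopologicalSpace S] : Setoid (EssentialCurve S) where
  r α β := AmbientIsotopic α.1 β.1
  iseqv := ⟨fun α => AmbientIsotopic.refl α.1, AmbientIsotopic.symm, AmbientIsotopic.trans⟩

/-- Isotopy classes of essential simple closed curves: the vertices of the curve complex. -/
def CurveClass (S : Type*) [TopologicalSpace S] : Type _ :=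
  Quotient (curveSetoid S)

/-- `α` and `β` cross transversely at `x`: some chart around `x` takes them to the two
coordinate axes of the plane. -/
def CrossAt {S : Type*} [TopologicalSpace S] (α β : Set S) (x : S) : Prop :=
  ∃ e : OpenPartialHomeomorph S (ℝ × ℝ), x ∈ e.source ∧ e x = (0, 0) ∧
    ∀ y ∈ e.source, (y ∈ α ↔ (e y).2 = 0) ∧ (y ∈ β ↔ (e y).1 = 0)

/-- `α` and `β` intersect transversely, in exactly `k` points. -/
def MeetTransversely {S : Type*} [TopologicalSpace S] (k : ℕ) (α β : Set S) : Prop :=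
  (α ∩ β).encard = k ∧ ∀ x ∈ α ∩ β, CrossAt α β x

/-- The curve complex of a sporadic surface: a finite non-empty set of vertices is a simplex iff
its elements can be realized by curves that mutually intersect transversely in exactly `k`
points. Here `k = 1` for a torus with at most one hole, `k = 2` for the 4-punctured sphere. -/
def sporadicCurveComplex (k : ℕ) (S : Type*) [TopologicalSpace S] :
    AbstractSimplicialComplex (CurveClass S) where
  faces := {σ | σ.Nonempty ∧ ∃ c : CurveClass S → EssentialCurve S,
    (∀ v ∈ σ, Quotient.mk (curveSetoid S) (c v) = v) ∧
    ∀ v ∈ σ, ∀ w ∈ σ, v ≠ w → MeetTransversely k (c v).1 (c w).1}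
  isRelLowerSet_faces := by
    rintro σ ⟨hσ, c, hc, hm⟩
    refine ⟨hσ, fun τ hτ hne => ⟨hne, c, fun v hv => hc v (hτ hv), fun v hv w hw => ?_⟩⟩
    exact hm v (hτ hv) w (hτ hw)
  singleton_mem := by
    intro v
    refine ⟨Finset.singleton_nonempty v, Quotient.out, fun w _ => Quotient.out_eq w, ?_⟩
    intro a ha b hb hab
    rw [Finset.mem_singleton] at ha hb
    exact absurd (ha.trans hb.symm) hab

/-- The 1-skeleton of an abstract simplicial complex. -/
def oneSkeleton {V : Type*} (K : AbstractSimplicialComplex V) : SimpleGraph V where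
  Adj v w := v ≠ w ∧ ∃ σ ∈ K.faces, (σ : Set V) = {v, w}
  symm := ⟨by
    rintro v w ⟨hvw, σ, hσ, h⟩
    exact ⟨hvw.symm, σ, hσ, h.trans (Set.pair_comm v w)⟩⟩
  loopless := ⟨fun _ h => h.1 rfl⟩

/-- A simplicial complex has infinite diameter: the distances of pairs of vertices that are joined
by simplicial paths are unbounded. (In particular the supremum of all distances is infinite; a
mere failure of connectedness does not count.) -/
def HasInfiniteDiameter {V : Type*} (K : AbstractSimplicialComplex V) : Prop :=
  ∀ N : ℕ, ∃ v w : V, (oneSkeleton K).Reachable v w ∧ N ≤ (oneSkeleton K).dist v w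

/-- `S` is (homeomorphic to) a 2-sphere minus four points. -/
def IsFourPuncturedSphere (S : Type*) [TopologicalSpace S] : Prop :=
  ∃ P : Finset (Metric.sphere (0 : EuclideanSpace ℝ (Fin 3)) 1), P.card = 4 ∧
    Nonempty (S ≃ₜ {x : Metric.sphere (0 : EuclideanSpace ℝ (Fin 3)) 1 // x ∉ P})

/-- `S` is (homeomorphic to) a torus, a once-punctured torus, or a torus minus an open disk
(here an open square, for the maximum norm on the product of two circles of length `1`). -/
def IsTorusWithAtMostOneHole (S : Type*) [TopologicalSpace S] : Prop :=
  Nonempty (S ≃ₜ UnitAddCircle × UnitAddCircle) ∨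
  Nonempty (S ≃ₜ {x : UnitAddCircle × UnitAddCircle // x ≠ 0}) ∨
  Nonempty (S ≃ₜ {x : UnitAddCircle × UnitAddCircle // 1 / 4 ≤ ‖x‖})

/-! Part (1). The Möbius map `x ↦ 1 / (a + x)` is an automorphism of the Farey graph that carries
`∞` to `0` and `[a₂, …]` to `[a, a₂, …]`, so partial quotients can be peeled off one at a time. A
walk from `∞` to `[a, …]` that visits `0` splits there, and its tail is the image of a walk for the
shorter list. A walk that avoids `0` must run through `1, 1/2, …, 1/a`: Farey edges do not cross,
and the edges from `0` to `1/j` separate `∞` from the target (unless the target is `1/a` itself). As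
`a ≥ 3`, this detour is strictly longer. Hence the walk through the convergents is the unique
shortest one (`length_walk_ge`).

The hyperbolic geodesic from `∞` to `r` is a vertical line, and a Farey triangle belongs to the
ladder iff one of its sides has endpoints on both sides of `r` (`mem_ladder_infty`). The same
induction shows that the pivot points are the proper convergents (`ladderPivots_infty`). A spine is
thus a path with a known vertex set; counting vertices gives its length, which is the distance, and
uniqueness of the geodesic identifies it (`isSpine_iff`).

Part (2). All the surfaces are treated as subsurfaces of a quotient of the plane, either the torus
or its quotient by `x ↦ -x`, which is a sphere with four cone points (`FlatCover`, `IsPillowMap`). A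
curve that lifts to a path with period `v ∈ ℤ²` has class `v`. The class survives isotopies and is
unique up to integer multiples, and a simple closed curve with non-zero class is essential. The
slope of `v` sends isotopy classes to vertices of the Farey graph. Two facts finish the proof
(`FlatCover.hasInfiniteDiameter`). A homeomorphism of the surface acts on slopes by `x ↦ 1 / (3 +
x)` and moves a base curve to one that meets it in the prescribed number of points, so its iterates
form a path with slopes `0, [3], [3, 3], …`. And neighbours in the curve complex have equal or
adjacent slopes, so by part (1) the distances along this path are unbounded.

For the second fact, a collared curve `α` of class `v` has a dual function `G` on the plane with `G
(x + n) = G x + u · n` and `u · v = 0`, which takes half-integral values only on the translates of a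
lift of `α` (`exists_dual_function`). Along a lift of `β` with period `w` it grows by `u · w` per
turn. A single transverse intersection on the torus forces `|u · w| = 1`. On the sphere a lift and
its negative both produce intersections, so two points leave room only for `|u · w| ≤ 1`.

On the sphere it must also be shown that `u` and `v` do not vanish. This rests on there being two
punctures on each side of an essential curve (`exists_two_punctures`), hence on the Schoenflies
theorem for collared curves, proved by collapsing and shrinking the sides of the curve in the manner
of Morton Brown (`IsCollarFunction.exists_disk`). The torus with a hole needs a form of invariance
of domain, that open annuli avoid the boundary; a winding number gives it (`norm_ne_of_isCollar`).
-/

open Topology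

/-! ### Extended rationals in homogeneous coordinates -/

/-- The extended rational with homogeneous coordinates `(p, q)`. -/
def mkExt (p q : ℤ) : OnePoint ℚ :=
  if q = 0 then ∞ else (((p : ℚ) / q : ℚ) : OnePoint ℚ)

@[simp] theorem extNum_infty : extNum ∞ = 1 := rfl
@[simp] theorem extDen_infty : extDen ∞ = 0 := rfl
@[simp] theorem extNum_coe (x : ℚ) : extNum (x : OnePoint ℚ) = x.num := rfl
@[simp] theorem extDen_coe (x : ℚ) : extDen (x : OnePoint ℚ) = x.den := rfl

theorem fareyGraph_adj {x y : OnePoint ℚ} :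
    fareyGraph.Adj x y ↔ |extNum x * extDen y - extDen x * extNum y| = 1 := Iff.rfl

theorem isCoprime_extNum_extDen (x : OnePoint ℚ) : IsCoprime (extNum x) (extDen x) := by
  induction x using OnePoint.rec with
  | infty => exact isCoprime_one_left
  | coe q => simpa using Rat.isCoprime_num_den q

theorem mkExt_extNum_extDen (x : OnePoint ℚ) : mkExt (extNum x) (extDen x) = x := by
  induction x using OnePoint.rec with
  | infty => simp [mkExt]
  | coe q => simp [mkExt, Rat.num_div_den]

theorem mkExt_mul {k : ℤ} (hk : k ≠ 0) (p q : ℤ) : mkExt (k * p) (k * q) = mkExt p q := by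
  unfold mkExt
  have hk' : (k : ℚ) ≠ 0 := by exact_mod_cast hk
  by_cases hq : q = 0
  · simp [hq]
  · simp only [hq, mul_eq_zero, hk, or_self, if_false]
    push_cast
    rw [mul_div_mul_left _ _ hk']

theorem exists_extNum_mkExt {p q : ℤ} (h : p ≠ 0 ∨ q ≠ 0) :
    ∃ k : ℤ, k ≠ 0 ∧ p = k * extNum (mkExt p q) ∧ q = k * extDen (mkExt p q) := by
  by_cases hq : q = 0
  · subst hq
    exact ⟨p, by simpa using h, by simp [mkExt], by simp [mkExt]⟩
  · have hq' : (q : ℚ) ≠ 0 := by exact_mod_cast hq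
    obtain ⟨c, hc1, hc2⟩ := Rat.num_den_mk (q := (p : ℚ) / q) (n := p) (d := q) hq
      (by rw [Rat.divInt_eq_div])
    refine ⟨c, ?_, by simpa [mkExt, hq] using hc1, by simpa [mkExt, hq] using hc2⟩
    rintro rfl
    exact hq (by simpa using hc2)

/-- Coprime coordinates are reduced up to a unit of `ℤ`. This gives the coordinates of a Möbius
image up to a common sign, which the Farey determinant does not see in absolute value. -/
theorem exists_sign_mkExt {p q : ℤ} (h : IsCoprime p q) :
    ∃ e : ℤ, (e = 1 ∨ e = -1) ∧ extNum (mkExt p q) = e * p ∧ extDen (mkExt p q) = e * q := by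
  have h0 : p ≠ 0 ∨ q ≠ 0 := by
    by_contra! hc
    obtain ⟨u, v, huv⟩ := h
    simp [hc.1, hc.2] at huv
  obtain ⟨k, hk, hp, hq⟩ := exists_extNum_mkExt h0
  have hu : IsUnit k := by
    obtain ⟨u, v, huv⟩ := h
    refine IsUnit.of_mul_eq_one (u * extNum (mkExt p q) + v * extDen (mkExt p q)) ?_
    calc _ = u * (k * extNum (mkExt p q)) + v * (k * extDen (mkExt p q)) := by ring
      _ = 1 := by rw [← hp, ← hq, huv]
  have hkk := Int.isUnit_mul_self hu
  refine ⟨k, Int.isUnit_iff.1 hu, ?_, ?_⟩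
  · conv_rhs => rw [hp, ← mul_assoc, hkk, one_mul]
  · conv_rhs => rw [hq, ← mul_assoc, hkk, one_mul]

/-- The Möbius transformation `x ↦ 1 / (a + x)`. -/
def fareyStep (a : ℕ) (x : OnePoint ℚ) : OnePoint ℚ :=
  mkExt (extDen x) (extNum x + a * extDen x)

/-- The Möbius transformation `x ↦ 1 / x - a`. -/
def fareyUnstep (a : ℕ) (x : OnePoint ℚ) : OnePoint ℚ :=
  mkExt (extDen x - a * extNum x) (extNum x)

theorem exists_sign_fareyStep (a : ℕ) (x : OnePoint ℚ) :
    ∃ e : ℤ, (e = 1 ∨ e = -1) ∧ extNum (fareyStep a x) = e * extDen x ∧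
      extDen (fareyStep a x) = e * (extNum x + a * extDen x) := by
  apply exists_sign_mkExt
  have := (isCoprime_extNum_extDen x).symm
  simpa [mul_comm] using this.add_mul_left_right (a : ℤ)

theorem exists_sign_fareyUnstep (a : ℕ) (x : OnePoint ℚ) :
    ∃ e : ℤ, (e = 1 ∨ e = -1) ∧ extNum (fareyUnstep a x) = e * (extDen x - a * extNum x) ∧
      extDen (fareyUnstep a x) = e * extNum x := by
  apply exists_sign_mkExt
  have := (isCoprime_extNum_extDen x).symm
  have := this.add_mul_left_left (-(a : ℤ))
  rwa [show extDen x - a * extNum x = extDen x + -(a : ℤ) * extNum x by ring, neg_mul,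
    mul_comm (a : ℤ), ← mul_neg]

theorem fareyUnstep_fareyStep (a : ℕ) (x : OnePoint ℚ) : fareyUnstep a (fareyStep a x) = x := by
  obtain ⟨e, he, h1, h2⟩ := exists_sign_fareyStep a x
  have he0 : e ≠ 0 := by rcases he with rfl | rfl <;> norm_num
  have : fareyUnstep a (fareyStep a x) = mkExt (e * extNum x) (e * extDen x) := by
    unfold fareyUnstep
    rw [h1, h2]
    congr 1
    ring
  rw [this, mkExt_mul he0, mkExt_extNum_extDen]

theorem fareyStep_fareyUnstep (a : ℕ) (x : OnePoint ℚ) : fareyStep a (fareyUnstep a x) = x := by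
  obtain ⟨e, he, h1, h2⟩ := exists_sign_fareyUnstep a x
  have he0 : e ≠ 0 := by rcases he with rfl | rfl <;> norm_num
  have : fareyStep a (fareyUnstep a x) = mkExt (e * extNum x) (e * extDen x) := by
    unfold fareyStep
    rw [h1, h2]
    congr 1
    ring
  rw [this, mkExt_mul he0, mkExt_extNum_extDen]

/-- `x ↦ 1 / (a + x)` as an automorphism of the Farey graph. -/
def fareyIso (a : ℕ) : fareyGraph ≃g fareyGraph where
  toFun := fareyStep a
  invFun := fareyUnstep a
  left_inv := fareyUnstep_fareyStep a
  right_inv := fareyStep_fareyUnstep a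
  map_rel_iff' := by
    intro x y
    obtain ⟨e, he, h1, h2⟩ := exists_sign_fareyStep a x
    obtain ⟨e', he', h1', h2'⟩ := exists_sign_fareyStep a y
    change |_| = 1 ↔ |_| = 1
    simp only [Equiv.coe_fn_mk, h1, h2, h1', h2']
    have : e * extDen x * (e' * (extNum y + a * extDen y)) -
        e * (extNum x + a * extDen x) * (e' * extDen y) =
        (-(e * e')) * (extNum x * extDen y - extDen x * extNum y) := by ring
    rw [this, abs_mul]
    have : |-(e * e')| = 1 := by rcases he with rfl | rfl <;> rcases he' with rfl | rfl <;> simp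
    rw [this, one_mul]

@[simp] theorem fareyIso_apply (a : ℕ) (x : OnePoint ℚ) : fareyIso a x = fareyStep a x := rfl

@[simp] theorem fareyStep_infty (a : ℕ) : fareyStep a ∞ = ((0 : ℚ) : OnePoint ℚ) := by
  simp [fareyStep, mkExt]

theorem fareyStep_coe (a : ℕ) (x : ℚ) (h : (a : ℚ) + x ≠ 0) :
    fareyStep a (x : OnePoint ℚ) = ((1 / (a + x) : ℚ) : OnePoint ℚ) := by
  have hd : (x.den : ℚ) ≠ 0 := by exact_mod_cast x.den_nz
  have hx : (x.num : ℚ) = x * x.den := (Rat.mul_den_eq_num x).symm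
  have h1 : x.num + (a : ℤ) * x.den ≠ 0 := by
    intro hc
    have : (x.num : ℚ) + a * x.den = 0 := by exact_mod_cast hc
    rw [hx, ← add_mul] at this
    rcases mul_eq_zero.1 this with h' | h'
    · exact h (by linarith)
    · exact hd h'
  simp only [fareyStep, mkExt, extNum_coe, extDen_coe, h1, if_false]
  congr 1
  push_cast
  rw [hx, ← add_mul, div_eq_div_iff (by
    exact mul_ne_zero (by rwa [add_comm]) hd) h]
  ring

theorem fareyStep_zero (a : ℕ) (ha : a ≠ 0) :
    fareyStep a ((0 : ℚ) : OnePoint ℚ) = ((1 / a : ℚ) : OnePoint ℚ) := by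
  rw [fareyStep_coe] <;> simp [ha]

theorem fareyGraph_adj_coe {x y : ℚ} : fareyGraph.Adj (x : OnePoint ℚ) (y : OnePoint ℚ) ↔
    |x.num * y.den - x.den * y.num| = 1 := Iff.rfl

theorem fareyGraph_adj_infty_coe {y : ℚ} :
    fareyGraph.Adj (∞ : OnePoint ℚ) (y : OnePoint ℚ) ↔ y.den = 1 := by
  rw [fareyGraph_adj]
  simp

/-! ### Continued fractions -/

theorem contFrac_nonneg (l : List ℕ) : 0 ≤ contFrac l := by
  induction l with
  | nil => simp [contFrac]
  | cons a l ih => simp only [contFrac]; positivity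

theorem contFrac_pos {a : ℕ} (ha : 3 ≤ a) (l : List ℕ) : 0 < contFrac (a :: l) := by
  have := contFrac_nonneg l
  have : (3 : ℚ) ≤ a := by exact_mod_cast ha
  simp only [contFrac]
  positivity

theorem contFrac_lt_half {l : List ℕ} (hl : ∀ i ∈ l, 3 ≤ i) : contFrac l < 1 / 2 := by
  cases l with
  | nil => norm_num [contFrac]
  | cons a l =>
    have h0 := contFrac_nonneg l
    have ha : (3 : ℚ) ≤ a := by exact_mod_cast hl a (by simp)
    simp only [contFrac]
    apply one_div_lt_one_div_of_lt <;> linarith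

theorem fareyStep_contFrac {a : ℕ} (ha : 3 ≤ a) (l : List ℕ) :
    fareyStep a (contFrac l : OnePoint ℚ) = (contFrac (a :: l) : OnePoint ℚ) := by
  have h0 := contFrac_nonneg l
  have : (3 : ℚ) ≤ a := by exact_mod_cast ha
  rw [fareyStep_coe _ _ (by positivity)]
  rfl

/-- The vertices `∞, 0, [a₁], [a₁, a₂], …` of the spine. -/
def spineList : List ℕ → List (OnePoint ℚ)
  | [] => [∞, ((0 : ℚ) : OnePoint ℚ)]
  | a :: l => ∞ :: (spineList l).map (fareyStep a)

/-- The proper convergents `0, [a₁], …, [a₁, …, aₘ₋₁]` of `[a₁, …, aₘ]`. -/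
def convergents : List ℕ → List (OnePoint ℚ)
  | [] => []
  | a :: l => ((0 : ℚ) : OnePoint ℚ) :: (convergents l).map (fareyStep a)

theorem length_spineList (l : List ℕ) : (spineList l).length = l.length + 2 := by
  induction l with
  | nil => rfl
  | cons a l ih => simp [spineList, ih]

theorem length_convergents (l : List ℕ) : (convergents l).length = l.length := by
  induction l with
  | nil => rfl
  | cons a l ih => simp [convergents, ih]

theorem spineList_eq {l : List ℕ} (hl : ∀ i ∈ l, 3 ≤ i) :
    spineList l = ∞ :: (convergents l ++ [(contFrac l : OnePoint ℚ)]) := by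
  induction l with
  | nil => rfl
  | cons a l ih =>
    rw [spineList, ih (fun i hi => hl i (by simp [hi]))]
    simp [convergents, fareyStep_contFrac (hl a (by simp))]

/-! ### Walks from `∞` in the Farey graph: existence, length and uniqueness of the shortest one. -/

theorem SimpleGraph.Walk.exists_map_iso {V : Type*} {G : SimpleGraph V} (f : G ≃g G)
    {x y x' y' : V} (P : G.Walk x y) (hx : f x = x') (hy : f y = y') :
    ∃ Q : G.Walk x' y', Q.length = P.length ∧ Q.support = P.support.map f := by
  subst hx hy
  exact ⟨P.map f.toHom, P.length_map _, P.support_map _⟩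

theorem exists_walk_spineList {l : List ℕ} (hl : ∀ i ∈ l, 3 ≤ i) :
    ∃ K : fareyGraph.Walk ∞ (contFrac l : OnePoint ℚ), K.support = spineList l := by
  induction l with
  | nil =>
    have h : fareyGraph.Adj ∞ ((contFrac [] : ℚ) : OnePoint ℚ) := by
      simp [fareyGraph_adj_infty_coe, contFrac]
    exact ⟨h.toWalk, rfl⟩
  | cons a l ih =>
    obtain ⟨K, hK⟩ := ih (fun i hi => hl i (by simp [hi]))
    have h : fareyGraph.Adj ∞ ((0 : ℚ) : OnePoint ℚ) := by
      simp [fareyGraph_adj_infty_coe]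
    obtain ⟨K', -, hK'⟩ := K.exists_map_iso (fareyIso a) (fareyStep_infty a)
      (fareyStep_contFrac (hl a (by simp)) l)
    refine ⟨.cons h K', ?_⟩
    rw [SimpleGraph.Walk.support_cons, hK', hK, spineList]
    rfl

/-- `x` lies strictly between `0` and `1 / j`. -/
def InsideUnitFraction (j : ℤ) (x : OnePoint ℚ) : Prop :=
  0 < extNum x ∧ 0 < extDen x - j * extNum x

theorem extDen_nonneg (x : OnePoint ℚ) : 0 ≤ extDen x := by
  induction x using OnePoint.rec with
  | infty => simp
  | coe q => simp

/-- A vector proportional to a primitive one is an integer multiple of it; the Bézout coefficients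
supply the factor. -/
theorem eq_mkExt_of {x : OnePoint ℚ} {p q : ℤ} (h : extNum x * q = extDen x * p)
    (hpq : p ≠ 0 ∨ q ≠ 0) : x = mkExt p q := by
  have h1 := isCoprime_extNum_extDen x
  obtain ⟨u, v, huv⟩ := h1
  have hp : p = (u * p + v * q) * extNum x := by
    linear_combination (-p) * huv - v * h
  have hq : q = (u * p + v * q) * extDen x := by
    linear_combination (-q) * huv + u * h
  have hk : u * p + v * q ≠ 0 := by
    intro hk
    rw [hk] at hp hq
    simp at hp hq
    tauto
  have := mkExt_mul hk (extNum x) (extDen x)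
  rw [← hp, ← hq, mkExt_extNum_extDen] at this
  exact this.symm

/-- Farey edges do not cross the edge from `0` to `1/j`. The determinant is a difference of two
products in the coordinates `p` and `q - j p`. If both coordinates of the outer vertex are non-zero,
they have opposite signs, the two integral products do too, and the determinant is at least `2` in
absolute value. -/
theorem eq_of_adj_insideUnitFraction {j : ℤ} (hj : 0 < j) {s t : OnePoint ℚ}
    (hst : fareyGraph.Adj s t) (ht : InsideUnitFraction j t) (hs : ¬ InsideUnitFraction j s) :
    s = mkExt 0 1 ∨ s = mkExt 1 j := by
  rw [fareyGraph_adj] at hst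
  obtain ⟨h1, h2⟩ := ht
  have hd := extDen_nonneg s
  set p := extNum s with hp
  set q := extDen s with hq
  set p' := extNum t with hp'
  set q' := extDen t with hq'
  have key : |(q' - j * p') * p - (q - j * p) * p'| = 1 := by
    rw [← hst]; congr 1; ring
  by_cases hp0 : p = 0
  · left
    exact eq_mkExt_of (by rw [← hp, hp0]; simp) (by simp)
  by_cases hq0 : q - j * p = 0
  · right
    exact eq_mkExt_of (by rw [← hp, ← hq]; linarith) (by simp)
  exfalso
  unfold InsideUnitFraction at hs
  rw [← hp, ← hq] at hs
  rcases lt_or_gt_of_ne hp0 with hp1 | hp1 <;> rcases lt_or_gt_of_ne hq0 with hq1 | hq1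
  · nlinarith
  · have a1 : (q' - j * p') * p ≤ -1 := by nlinarith
    have a2 : 1 ≤ (q - j * p) * p' := by nlinarith
    rw [abs_of_neg (by linarith)] at key
    linarith
  · have a1 : 1 ≤ (q' - j * p') * p := by nlinarith
    have a2 : (q - j * p) * p' ≤ -1 := by nlinarith
    rw [abs_of_pos (by linarith)] at key
    linarith
  · exact hs ⟨hp1, hq1⟩

theorem mem_support_of_insideUnitFraction {j : ℤ} (hj : 0 < j) {s t : OnePoint ℚ}
    (P : fareyGraph.Walk s t) (hs : ¬ InsideUnitFraction j s) (ht : InsideUnitFraction j t) :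
    mkExt 0 1 ∈ P.support ∨ mkExt 1 j ∈ P.support := by
  induction P with
  | nil => exact absurd ht hs
  | cons h P ih =>
    rename_i u v w
    by_cases hv : InsideUnitFraction j v
    · rcases eq_of_adj_insideUnitFraction hj h hv hs with rfl | rfl
      · left; simp
      · right; simp
    · rcases ih hv ht with h' | h'
      · left; simp [h']
      · right; simp [h']

theorem insideUnitFraction_coe {j : ℤ} (x : ℚ) :
    InsideUnitFraction j (x : OnePoint ℚ) ↔ 0 < x ∧ j * x < 1 := by
  have hd : (0 : ℚ) < x.den := by exact_mod_cast x.den_pos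
  have hx : (x.num : ℚ) = x * x.den := (Rat.mul_den_eq_num x).symm
  unfold InsideUnitFraction
  simp only [extNum_coe, extDen_coe, Rat.num_pos]
  refine and_congr_right fun _ => ?_
  rw [← Int.cast_lt (R := ℚ)]
  push_cast
  rw [hx]
  constructor
  · intro h
    have : 0 < (1 - j * x) * x.den := by linarith
    have := pos_of_mul_pos_left this hd.le
    linarith
  · intro h
    have : 0 < (1 - j * x) * x.den := mul_pos (by linarith) hd
    linarith

theorem not_insideUnitFraction_infty {j : ℤ} (hj : 0 < j) : ¬ InsideUnitFraction j ∞ := by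
  rintro ⟨_, h⟩
  simp at h
  omega

theorem mkExt_zero_one : mkExt 0 1 = ((0 : ℚ) : OnePoint ℚ) := by simp [mkExt]

/-- The lower bound and the equality case are proved together, by peeling off the first partial
quotient. Visiting `0` costs at least one edge and leaves a walk for the tail of the list. Avoiding
`0` costs at least three edges before `1 / a`, which is never optimal; this is where `a ≥ 3` enters.
-/
theorem length_walk_ge {l : List ℕ} (hl : ∀ i ∈ l, 3 ≤ i)
    (P : fareyGraph.Walk ∞ (contFrac l : OnePoint ℚ)) :
    l.length + 1 ≤ P.length ∧ (P.length = l.length + 1 → P.support = spineList l) := by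
  induction l with
  | nil =>
    cases P with
    | cons h P =>
      refine ⟨by simp, fun hP => ?_⟩
      simp at hP
      cases P with
      | nil => rfl
      | cons h' P => simp at hP
  | cons a l ih =>
    have ha := hl a (by simp)
    have ih := ih (fun i hi => hl i (by simp [hi]))
    have haQ : (3 : ℚ) ≤ a := by exact_mod_cast ha
    have hr0 := contFrac_nonneg l
    have hun0 : fareyUnstep a ((0 : ℚ) : OnePoint ℚ) = ∞ := by
      rw [← fareyStep_infty a, fareyUnstep_fareyStep]
    have hunr : fareyUnstep a (contFrac (a :: l) : OnePoint ℚ) = (contFrac l : OnePoint ℚ) := by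
      rw [← fareyStep_contFrac ha, fareyUnstep_fareyStep]
    by_cases h0 : ((0 : ℚ) : OnePoint ℚ) ∈ P.support
    · obtain ⟨P1, P2, hP⟩ := SimpleGraph.Walk.mem_support_iff_exists_append.1 h0
      obtain ⟨P2', hlen, hsup'⟩ := P2.exists_map_iso (fareyIso a).symm hun0 hunr
      have hsup : P2.support = P2'.support.map (fareyStep a) := by
        rw [hsup', List.map_map]
        conv_lhs => rw [← List.map_id P2.support]
        apply List.map_congr_left
        intro x _
        exact (fareyStep_fareyUnstep a x).symm
      obtain ⟨i1, i2⟩ := ih P2'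
      have hP1pos : 1 ≤ P1.length := by
        by_contra hc
        have : P1.length = 0 := by omega
        have := SimpleGraph.Walk.eq_of_length_eq_zero this
        exact absurd this (OnePoint.infty_ne_coe _)
      have hl' : P.length = P1.length + P2.length := by rw [hP]; simp
      refine ⟨by simp; omega, fun hPl => ?_⟩
      simp at hPl
      have h1 : P1.length = 1 := by omega
      have h2 := i2 (by omega)
      rw [hP, SimpleGraph.Walk.support_append_eq_support_dropLast_append, hsup, h2, spineList]
      have : P1.support.dropLast = [∞] := by
        revert h1
        generalize P1 = P1
        intro h1
        cases P1 with
        | cons h P =>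
          simp at h1
          cases P with
          | nil => simp
          | cons h' P => simp at h1
      rw [this]
      rfl
    · suffices h : l.length + 3 ≤ P.length by
        simp only [List.length_cons]
        exact ⟨by omega, fun h' => by omega⟩
      have ha0 : a ≠ 0 := by omega
      have hr := fareyStep_contFrac ha l
      have hpos := contFrac_pos ha l
      -- The target is `1 / a`, or it lies strictly between `0` and `1 / a`; in the latter case the
      -- walk has to pass an end of that edge, and `0` is excluded.
      have hmem : ((1 / a : ℚ) : OnePoint ℚ) ∈ P.support := by
        rcases hr0.eq_or_lt with h | h
        · rw [← h, fareyStep_zero a ha0] at hr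
          rw [hr]
          simp
        · have hin : InsideUnitFraction a (contFrac (a :: l) : OnePoint ℚ) := by
            rw [insideUnitFraction_coe]
            refine ⟨hpos, ?_⟩
            simp only [contFrac, Int.cast_natCast]
            rw [mul_one_div, div_lt_one (by linarith)]
            linarith
          have := mem_support_of_insideUnitFraction (by omega) P
            (not_insideUnitFraction_infty (by omega)) hin
          rw [mkExt_zero_one] at this
          simpa [h0, mkExt, ha0] using this
      obtain ⟨P1, P2, hP⟩ := SimpleGraph.Walk.mem_support_iff_exists_append.1 hmem
      have h01 : ((0 : ℚ) : OnePoint ℚ) ∉ P1.support := by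
        intro h
        apply h0
        rw [hP, SimpleGraph.Walk.mem_support_append_iff]
        exact Or.inl h
      -- The same separation argument, now for the part of the walk that ends at `1 / a`.
      have hj : ∀ j : ℕ, 0 < j → j < a → ((1 / j : ℚ) : OnePoint ℚ) ∈ P1.support := by
        intro j hj hja
        have hin : InsideUnitFraction j ((1 / a : ℚ) : OnePoint ℚ) := by
          rw [insideUnitFraction_coe]
          refine ⟨by positivity, ?_⟩
          rw [Int.cast_natCast, mul_one_div, div_lt_one (by linarith)]
          exact_mod_cast hja
        have := mem_support_of_insideUnitFraction (by omega) P1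
            (not_insideUnitFraction_infty (by omega)) hin
        rw [mkExt_zero_one] at this
        simpa [h01, mkExt, hj.ne'] using this
      -- The four vertices `∞, 1, 1/2, 1/a` are distinct.
      have hP1 : 3 ≤ P1.length := by
        classical
        have hsub : ({∞, ((1 / (1 : ℕ) : ℚ) : OnePoint ℚ), ((1 / (2 : ℕ) : ℚ) : OnePoint ℚ),
            ((1 / a : ℚ) : OnePoint ℚ)} : Finset (OnePoint ℚ)) ⊆ P1.support.toFinset := by
          intro x hx
          simp only [Finset.mem_insert, Finset.mem_singleton] at hx
          rw [List.mem_toFinset]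
          rcases hx with rfl | rfl | rfl | rfl
          · simp
          · exact hj 1 (by omega) (by omega)
          · exact hj 2 (by omega) (by omega)
          · exact P1.end_mem_support
        have h1 := Finset.card_le_card hsub
        have hna : (1 : ℚ) ≠ a := by linarith
        have hnb : (2 : ℚ) ≠ a := by linarith
        rw [Finset.card_insert_of_notMem, Finset.card_insert_of_notMem,
          Finset.card_insert_of_notMem, Finset.card_singleton] at h1
        · have h2 := P1.support.toFinset_card_le
          rw [SimpleGraph.Walk.length_support] at h2
          omega
        · simpa using hnb
        · simp only [Finset.mem_insert, Finset.mem_singleton, OnePoint.coe_eq_coe]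
          push_cast
          norm_num
          exact fun h => by simp [h] at hna
        · simp
      have hunr' : fareyUnstep a ((1 / a : ℚ) : OnePoint ℚ) = ((0 : ℚ) : OnePoint ℚ) := by
        rw [← fareyStep_zero a ha0, fareyUnstep_fareyStep]
      obtain ⟨P2', hlen, -⟩ := P2.exists_map_iso (fareyIso a).symm hunr' hunr
      have hadj : fareyGraph.Adj ∞ ((0 : ℚ) : OnePoint ℚ) := by
        simp [fareyGraph_adj_infty_coe]
      -- The pulled back tail starts at `0`, so one edge from `∞` is added before the induction
      -- hypothesis applies.
      have := (ih (.cons hadj P2')).1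
      rw [SimpleGraph.Walk.length_cons] at this
      have hl' : P.length = P1.length + P2.length := by rw [hP]; simp
      omega

theorem dist_infty_contFrac {l : List ℕ} (hl : ∀ i ∈ l, 3 ≤ i) :
    fareyGraph.dist ∞ (contFrac l : OnePoint ℚ) = l.length + 1 := by
  obtain ⟨K, hK⟩ := exists_walk_spineList hl
  have hKl : K.length = l.length + 1 := by
    have := K.length_support
    rw [hK, length_spineList] at this
    omega
  refine le_antisymm (hKl ▸ SimpleGraph.dist_le K) ?_
  obtain ⟨P, hP⟩ := K.reachable.exists_walk_length_eq_dist
  rw [← hP]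
  exact (length_walk_ge hl P).1

theorem isGeodesicWalk_iff {l : List ℕ} (hl : ∀ i ∈ l, 3 ≤ i)
    (P : fareyGraph.Walk ∞ (contFrac l : OnePoint ℚ)) :
    IsGeodesicWalk P ↔ P.support = spineList l := by
  rw [IsGeodesicWalk, dist_infty_contFrac hl]
  refine ⟨(length_walk_ge hl P).2, fun h => ?_⟩
  have := P.length_support
  rw [h, length_spineList] at this
  omega

/-! ### Triangles of the ladder from `∞` -/

instance : DecidableEq (OnePoint ℚ) := inferInstanceAs (DecidableEq (Option ℚ))

/-- The Farey edge from `u` to `w` separates `r` from `∞`. -/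
def SepEdge (r : ℚ) (u w : OnePoint ℚ) : Prop :=
  ∃ x y : ℚ, u = x ∧ w = y ∧ fareyGraph.Adj u w ∧ (x - r) * (y - r) < 0

theorem SepEdge.symm {r : ℚ} {u w : OnePoint ℚ} (h : SepEdge r u w) : SepEdge r w u := by
  obtain ⟨x, y, hx, hy, ha, hs⟩ := h
  exact ⟨y, x, hy, hx, ha.symm, by linarith⟩

/-- A Farey triangle with a side that separates `r` from `∞`. -/
def SepTriangle (r : ℚ) (Δ : Finset (OnePoint ℚ)) : Prop :=
  IsFareyTriangle Δ ∧ ∃ u ∈ Δ, ∃ w ∈ Δ, SepEdge r u w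

theorem sideForm_coe_coe (x y : ℚ) (z : UpperHalfPlane) :
    sideForm x y z = x.den * y.den * ((z.re - x) * (z.re - y) + z.im ^ 2) := by
  have hx : (x : ℝ) * x.den = x.num := by exact_mod_cast Rat.mul_den_eq_num x
  have hy : (y : ℝ) * y.den = y.num := by exact_mod_cast Rat.mul_den_eq_num y
  unfold sideForm
  simp [Complex.mul_re, ← hx, ← hy]
  ring

theorem sideForm_infty_coe (y : ℚ) (z : UpperHalfPlane) :
    sideForm ∞ y z = - (y.den * (z.re - y)) := by
  have hy : (y : ℝ) * y.den = y.num := by exact_mod_cast Rat.mul_den_eq_num y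
  unfold sideForm
  simp [Complex.mul_re, ← hy]
  ring

theorem sideForm_comm (u w : OnePoint ℚ) (z : UpperHalfPlane) :
    sideForm u w z = sideForm w u z := by
  unfold sideForm
  rw [← Complex.conj_re]
  simp [mul_comm]

theorem idealSideForm_comm (u w v : OnePoint ℚ) : idealSideForm u w v = idealSideForm w u v :=
  mul_comm _ _

theorem idealSideForm_coe (x y w : ℚ) : (idealSideForm x y w : ℝ) =
    x.den * y.den * w.den ^ 2 * ((w - x) * (w - y)) := by
  have hx : (x : ℝ) * x.den = x.num := by exact_mod_cast Rat.mul_den_eq_num x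
  have hy : (y : ℝ) * y.den = y.num := by exact_mod_cast Rat.mul_den_eq_num y
  have hw : (w : ℝ) * w.den = w.num := by exact_mod_cast Rat.mul_den_eq_num w
  simp [idealSideForm, ← hx, ← hy, ← hw]
  ring

theorem idealSideForm_coe_infty (x y : ℚ) : (idealSideForm x y ∞ : ℝ) = x.den * y.den := by
  simp [idealSideForm]

theorem idealSideForm_infty_coe (y w : ℚ) : (idealSideForm ∞ y w : ℝ) =
    - (y.den * w.den ^ 2 * (w - y)) := by
  have hy : (y : ℝ) * y.den = y.num := by exact_mod_cast Rat.mul_den_eq_num y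
  have hw : (w : ℝ) * w.den = w.num := by exact_mod_cast Rat.mul_den_eq_num w
  simp [idealSideForm, ← hy, ← hw]
  ring

theorem mem_hypGeodesic_infty (r : ℚ) (z : UpperHalfPlane) :
    z ∈ hypGeodesic ∞ r ↔ z.re = r := by
  have hd : (r.den : ℝ) ≠ 0 := by exact_mod_cast r.den_nz
  rw [hypGeodesic, Set.mem_ofPred_eq, sideForm_infty_coe, neg_eq_zero, mul_eq_zero]
  simp [hd, sub_eq_zero]

theorem mul_pos_side_coe (x y w : ℚ) (z : UpperHalfPlane) :
    0 < sideForm x y z * (idealSideForm x y w : ℝ) ↔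
      0 < ((z.re - x) * (z.re - y) + z.im ^ 2) * ((w - x) * (w - y)) := by
  rw [sideForm_coe_coe, idealSideForm_coe]
  have hx : (0 : ℝ) < x.den := by exact_mod_cast x.den_pos
  have hy : (0 : ℝ) < y.den := by exact_mod_cast y.den_pos
  have hw : (0 : ℝ) < w.den := by exact_mod_cast w.den_pos
  rw [show (x.den : ℝ) * y.den * ((z.re - x) * (z.re - y) + z.im ^ 2) *
    (x.den * y.den * w.den ^ 2 * ((w - x) * (w - y))) =
    (x.den * y.den * w.den) ^ 2 *
      (((z.re - x) * (z.re - y) + z.im ^ 2) * ((w - x) * (w - y))) by ring]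
  exact mul_pos_iff_of_pos_left (by positivity)

theorem mul_pos_side_coe_infty (x y : ℚ) (z : UpperHalfPlane) :
    0 < sideForm x y z * (idealSideForm x y ∞ : ℝ) ↔
      0 < (z.re - x) * (z.re - y) + z.im ^ 2 := by
  rw [sideForm_coe_coe, idealSideForm_coe_infty]
  have hx : (0 : ℝ) < x.den := by exact_mod_cast x.den_pos
  have hy : (0 : ℝ) < y.den := by exact_mod_cast y.den_pos
  rw [mul_right_comm, ← mul_assoc]
  rw [show (x.den : ℝ) * y.den * x.den * y.den * ((z.re - x) * (z.re - y) + z.im ^ 2) =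
    (x.den * y.den) ^ 2 * ((z.re - x) * (z.re - y) + z.im ^ 2) by ring]
  exact mul_pos_iff_of_pos_left (by positivity)

theorem mul_pos_side_infty_coe (y w : ℚ) (z : UpperHalfPlane) :
    0 < sideForm ∞ y z * (idealSideForm ∞ y w : ℝ) ↔ 0 < (z.re - y) * (w - y) := by
  rw [sideForm_infty_coe, idealSideForm_infty_coe]
  have hy : (0 : ℝ) < y.den := by exact_mod_cast y.den_pos
  have hw : (0 : ℝ) < w.den := by exact_mod_cast w.den_pos
  rw [show -((y.den : ℝ) * (z.re - y)) * -(y.den * w.den ^ 2 * (w - y)) =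
    (y.den * w.den) ^ 2 * ((z.re - y) * (w - y)) by ring]
  exact mul_pos_iff_of_pos_left (by positivity)

/-- The condition defining the interior of a triangle, for one side and its opposite vertex. -/
def SideCond (z : UpperHalfPlane) (u v w : OnePoint ℚ) : Prop :=
  0 < sideForm u v z * (idealSideForm u v w : ℝ)

theorem SideCond.symm {z : UpperHalfPlane} {u v w : OnePoint ℚ} (h : SideCond z u v w) :
    SideCond z v u w := by
  unfold SideCond at *
  rwa [sideForm_comm, idealSideForm_comm]

theorem mem_idealTriangleInterior {z : UpperHalfPlane} {a b c : OnePoint ℚ} (hab : a ≠ b)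
    (hac : a ≠ c) (hbc : b ≠ c) : z ∈ idealTriangleInterior {a, b, c} ↔
      SideCond z a b c ∧ SideCond z a c b ∧ SideCond z b c a := by
  constructor
  · intro h
    exact ⟨h a (by simp) b (by simp) c (by simp) hab hac hbc,
      h a (by simp) c (by simp) b (by simp) hac hab hbc.symm,
      h b (by simp) c (by simp) a (by simp) hbc hab.symm hac.symm⟩
  · rintro ⟨h1, h2, h3⟩ u hu v hv w hw huv huw hvw
    simp only [Finset.mem_insert, Finset.mem_singleton] at hu hv hw
    change SideCond z u v w
    rcases hu with rfl | rfl | rfl <;> rcases hv with rfl | rfl | rfl <;>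
      rcases hw with rfl | rfl | rfl <;>
      first
        | exact absurd rfl huv
        | exact absurd rfl huw
        | exact absurd rfl hvw
        | assumption
        | exact SideCond.symm (by assumption)

/-- If `∞` is a vertex, the vertical sides confine `r` to lie between the other two. If all vertices
are finite and no side separates `r` from `∞`, then `z` is outside the half-disks of all three
sides, so each vertex would have to lie on the outer side of the other two, which is impossible on a
line. -/
theorem exists_sepEdge_of_sideCond {r : ℚ} {z : UpperHalfPlane} (hz : z.re = r)
    {a b c : OnePoint ℚ} (hab : fareyGraph.Adj a b) (hac : fareyGraph.Adj a c)
    (hbc : fareyGraph.Adj b c) (h1 : SideCond z a b c) (h2 : SideCond z a c b)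
    (h3 : SideCond z b c a) : SepEdge r a b ∨ SepEdge r a c ∨ SepEdge r b c := by
  have key : ∀ {b c : OnePoint ℚ}, fareyGraph.Adj ∞ b → fareyGraph.Adj ∞ c →
      fareyGraph.Adj b c → SideCond z ∞ b c → SideCond z ∞ c b → SepEdge r b c := by
    intro b c hb hc hbc h1 h2
    induction b using OnePoint.rec with
    | infty => exact absurd hb (fareyGraph.loopless.irrefl _)
    | coe x =>
    induction c using OnePoint.rec with
    | infty => exact absurd hc (fareyGraph.loopless.irrefl _)
    | coe y =>
    refine ⟨x, y, rfl, rfl, hbc, ?_⟩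
    have e1 := (mul_pos_side_infty_coe x y z).1 h1
    have e2 := (mul_pos_side_infty_coe y x z).1 h2
    rw [hz] at e1 e2
    have e1 : 0 < (r - x) * (y - x) := by exact_mod_cast e1
    have e2 : 0 < (r - y) * (x - y) := by exact_mod_cast e2
    nlinarith [mul_pos e1 e2, sq_nonneg (x - y)]
  induction a using OnePoint.rec with
  | infty => exact Or.inr (Or.inr (key hab hac hbc h1 h2))
  | coe x =>
  induction b using OnePoint.rec with
  | infty => exact Or.inr (Or.inl (key hab.symm hbc hac h1.symm h3))
  | coe y =>
  induction c using OnePoint.rec with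
  | infty => exact Or.inl (key hac.symm hbc.symm hab h2.symm h3.symm)
  | coe w =>
  by_contra! hc
  obtain ⟨c1, c2, c3⟩ := hc
  have c1 : 0 ≤ (x - r) * (y - r) := by
    by_contra h; exact c1 ⟨x, y, rfl, rfl, hab, by linarith⟩
  have c2 : 0 ≤ (x - r) * (w - r) := by
    by_contra h; exact c2 ⟨x, w, rfl, rfl, hac, by linarith⟩
  have c3 : 0 ≤ (y - r) * (w - r) := by
    by_contra h; exact c3 ⟨y, w, rfl, rfl, hbc, by linarith⟩
  have e1 := (mul_pos_side_coe x y w z).1 h1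
  have e2 := (mul_pos_side_coe x w y z).1 h2
  have e3 := (mul_pos_side_coe y w x z).1 h3
  rw [hz] at e1 e2 e3
  have c1 : (0 : ℝ) ≤ (x - r) * (y - r) := by exact_mod_cast c1
  have c2 : (0 : ℝ) ≤ (x - r) * (w - r) := by exact_mod_cast c2
  have c3 : (0 : ℝ) ≤ (y - r) * (w - r) := by exact_mod_cast c3
  have hi : 0 < z.im ^ 2 := pow_pos z.im_pos 2
  have f1 := (mul_pos_iff_of_pos_left (by nlinarith)).1 e1
  have f2 := (mul_pos_iff_of_pos_left (by nlinarith)).1 e2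
  have f3 := (mul_pos_iff_of_pos_left (by nlinarith)).1 e3
  -- The product of the three is minus a square.
  have := mul_pos (mul_pos f1 f2) f3
  nlinarith [sq_nonneg (((w : ℝ) - x) * (w - y) * (y - x))]

-- The vertical line over `r` crosses the side from `a` to `b` at height `√(-(x - r)(y - r))`.
-- Moving slightly off this side towards the third vertex reaches the interior.
open Filter Topology in
theorem exists_sideCond_of_sepEdge {r : ℚ} {a b c : OnePoint ℚ} (hac : a ≠ c)
    (hbc : b ≠ c) (h : SepEdge r a b) :
    ∃ z : UpperHalfPlane, z.re = r ∧ SideCond z a b c ∧ SideCond z a c b ∧ SideCond z b c a := by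
  obtain ⟨x, y, rfl, rfl, -, hs⟩ := h
  have hsR : ((x : ℝ) - r) * (y - r) < 0 := by exact_mod_cast hs
  have mk : ∀ Y : ℝ, 0 < Y → ∃ z : UpperHalfPlane, z.re = r ∧ z.im ^ 2 = Y := by
    intro Y hY
    refine ⟨⟨⟨r, √Y⟩, Real.sqrt_pos.2 hY⟩, rfl, ?_⟩
    exact Real.sq_sqrt hY.le
  induction c using OnePoint.rec with
  | infty =>
    -- With third vertex `∞`, any height above the half-circle will do.
    obtain ⟨z, hz, hY⟩ := mk (1 - ((x : ℝ) - r) * (y - r)) (by linarith)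
    refine ⟨z, hz, ?_, ?_, ?_⟩
    · refine (mul_pos_side_coe_infty x y z).2 ?_
      rw [hz, hY]; ring_nf; norm_num
    · refine SideCond.symm ((mul_pos_side_infty_coe x y z).2 ?_)
      rw [hz]; nlinarith [sq_nonneg ((x : ℝ) - r)]
    · refine SideCond.symm ((mul_pos_side_infty_coe y x z).2 ?_)
      rw [hz]; nlinarith [sq_nonneg ((y : ℝ) - r)]
  | coe w =>
    have hxw : (w : ℝ) - x ≠ 0 := by
      rw [sub_ne_zero]; exact_mod_cast fun h => hac (by rw [h])
    have hyw : (w : ℝ) - y ≠ 0 := by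
      rw [sub_ne_zero]; exact_mod_cast fun h => hbc (by rw [h])
    set S : ℝ := ((w : ℝ) - x) * (w - y) with hS
    have hS0 : S ≠ 0 := mul_ne_zero hxw hyw
    set D : ℝ := -(((x : ℝ) - r) * (y - r)) with hD
    have hD0 : 0 < D := by linarith
    -- With squared height `D + t S` the form of the separating side is `t S`, which has the sign of
    -- `S`. The other two conditions hold at `t = 0`, hence for small `t`.
    have hex : ∀ᶠ t : ℝ in 𝓝[>] 0, 0 < D + t * S ∧
        0 < ((r - x) - t * (w - x)) * ((y : ℝ) - x) ∧
        0 < ((r - y) - t * (w - y)) * ((x : ℝ) - y) := by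
      refine Filter.Eventually.filter_mono nhdsWithin_le_nhds ?_
      refine Filter.Eventually.and ?_ (Filter.Eventually.and ?_ ?_)
      · have : Continuous fun t : ℝ => D + t * S := by fun_prop
        exact this.tendsto 0 |>.eventually (lt_mem_nhds (by simpa using hD0))
      · have : Continuous fun t : ℝ => ((r - x) - t * (w - x)) * ((y : ℝ) - x) := by fun_prop
        refine this.tendsto 0 |>.eventually (lt_mem_nhds ?_)
        nlinarith [sq_nonneg ((x : ℝ) - r)]
      · have : Continuous fun t : ℝ => ((r - y) - t * (w - y)) * ((x : ℝ) - y) := by fun_prop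
        refine this.tendsto 0 |>.eventually (lt_mem_nhds ?_)
        nlinarith [sq_nonneg ((y : ℝ) - r)]
    obtain ⟨t, ⟨ht1, ht2, ht3⟩, ht0⟩ := (hex.and self_mem_nhdsWithin).exists
    have ht0 : 0 < t := ht0
    obtain ⟨z, hz, hY⟩ := mk _ ht1
    refine ⟨z, hz, ?_, ?_, ?_⟩
    · refine (mul_pos_side_coe x y w z).2 ?_
      rw [hz, hY, ← hS, hD, show ((r : ℝ) - x) * (r - y) + (-((x - r) * (y - r)) + t * S) = t * S
        by ring]
      have := mul_pos ht0 (mul_self_pos.2 hS0)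
      linarith
    · refine (mul_pos_side_coe x w y z).2 ?_
      rw [hz, hY, hD, hS]
      have := mul_pos (mul_self_pos.2 hyw) ht2
      nlinarith
    · refine (mul_pos_side_coe y w x z).2 ?_
      rw [hz, hY, hD, hS]
      have := mul_pos (mul_self_pos.2 hxw) ht3
      nlinarith

theorem SepEdge.adj {r : ℚ} {u w : OnePoint ℚ} (h : SepEdge r u w) : fareyGraph.Adj u w := by
  obtain ⟨x, y, hx, hy, ha, hs⟩ := h
  exact ha

theorem exists_third {Δ : Finset (OnePoint ℚ)} (h : IsFareyTriangle Δ) {u w : OnePoint ℚ}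
    (hu : u ∈ Δ) (hw : w ∈ Δ) (huw : u ≠ w) :
    ∃ v, fareyGraph.Adj u w ∧ fareyGraph.Adj u v ∧ fareyGraph.Adj w v ∧ Δ = {u, w, v} := by
  obtain ⟨a, b, c, hab, hac, hbc, rfl⟩ := SimpleGraph.is3Clique_iff.1 h
  simp only [Finset.mem_insert, Finset.mem_singleton] at hu hw
  rcases hu with rfl | rfl | rfl <;> rcases hw with rfl | rfl | rfl
  · exact absurd rfl huw
  · exact ⟨c, hab, hac, hbc, rfl⟩
  · exact ⟨b, hac, hab, hbc.symm, by ext; simp; tauto⟩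
  · exact ⟨c, hab.symm, hbc, hac, by ext; simp; tauto⟩
  · exact absurd rfl huw
  · exact ⟨a, hbc, hab.symm, hac.symm, by ext; simp; tauto⟩
  · exact ⟨b, hac.symm, hbc.symm, hab, by ext; simp; tauto⟩
  · exact ⟨a, hbc.symm, hac.symm, hab.symm, by ext; simp; tauto⟩
  · exact absurd rfl huw

theorem mem_ladder_infty {r : ℚ} {Δ : Finset (OnePoint ℚ)} :
    Δ ∈ ladder ∞ (r : OnePoint ℚ) ↔ SepTriangle r Δ := by
  constructor
  · rintro ⟨hΔ, z, hz, hzr⟩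
    rw [mem_hypGeodesic_infty] at hzr
    refine ⟨hΔ, ?_⟩
    obtain ⟨a, b, c, hab, hac, hbc, rfl⟩ := SimpleGraph.is3Clique_iff.1 hΔ
    obtain ⟨h1, h2, h3⟩ := (mem_idealTriangleInterior hab.ne hac.ne hbc.ne).1 hz
    rcases exists_sepEdge_of_sideCond hzr hab hac hbc h1 h2 h3 with h | h | h
    · exact ⟨a, by simp, b, by simp, h⟩
    · exact ⟨a, by simp, c, by simp, h⟩
    · exact ⟨b, by simp, c, by simp, h⟩
  · rintro ⟨hΔ, u, hu, w, hw, h⟩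
    obtain ⟨v, huw, huv, hwv, rfl⟩ := exists_third hΔ hu hw h.adj.ne
    obtain ⟨z, hz, hc⟩ := exists_sideCond_of_sepEdge huv.ne hwv.ne h
    exact ⟨hΔ, z, (mem_idealTriangleInterior huw.ne huv.ne hwv.ne).2 hc,
      (mem_hypGeodesic_infty r z).2 hz⟩

theorem SepEdge.nonempty_inter {r : ℚ} {u w : OnePoint ℚ} (h : SepEdge r u w) :
    (hypGeodesic u w ∩ hypGeodesic ∞ r).Nonempty := by
  obtain ⟨x, y, rfl, rfl, -, hs⟩ := h
  have hsR : 0 < -(((x : ℝ) - r) * (y - r)) := by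
    have : ((x : ℝ) - r) * (y - r) < 0 := by exact_mod_cast hs
    linarith
  refine ⟨⟨⟨r, √(-(((x : ℝ) - r) * (y - r)))⟩, Real.sqrt_pos.2 hsR⟩, ?_,
    (mem_hypGeodesic_infty r _).2 rfl⟩
  rw [hypGeodesic, Set.mem_ofPred_eq, sideForm_coe_coe]
  have : (√(-(((x : ℝ) - r) * (y - r)))) ^ 2 = _ := Real.sq_sqrt hsR.le
  change (x.den : ℝ) * y.den * (((r : ℝ) - x) * (r - y) + (√(-(((x : ℝ) - r) * (y - r)))) ^ 2) = 0
  rw [this]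
  ring

/-! ### Pivots and spines -/

/-- An edge from a negative to a positive rational would cross the edge from `0` to `∞`; its
determinant is at most `-2`. -/
theorem SepEdge.nonneg {r : ℚ} (hr : 0 ≤ r) {x y : ℚ}
    (h : SepEdge r (x : OnePoint ℚ) (y : OnePoint ℚ)) : 0 ≤ x := by
  by_contra! hx
  obtain ⟨x', y', hx', hy', ha, hs⟩ := h
  obtain rfl := OnePoint.coe_injective hx'
  obtain rfl := OnePoint.coe_injective hy'
  have hy : 0 < y := by nlinarith
  rw [fareyGraph_adj_coe] at ha
  have h1 : x.num ≤ -1 := by have := Rat.num_neg.2 hx; omega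
  have h2 : 1 ≤ y.num := by have := Rat.num_pos.2 hy; omega
  have h3 : (1 : ℤ) ≤ x.den := by exact_mod_cast x.den_pos
  have h4 : (1 : ℤ) ≤ y.den := by exact_mod_cast y.den_pos
  have h5 : x.num * y.den ≤ -1 := by nlinarith
  have h6 : 1 ≤ x.den * y.num := by nlinarith
  rw [abs_of_neg (by linarith)] at ha
  linarith

theorem SepEdge.not_contFrac_nil {u w : OnePoint ℚ} : ¬ SepEdge (contFrac []) u w := by
  intro h
  obtain ⟨x, y, rfl, rfl, ha, hs⟩ := id h
  have h1 := h.nonneg (contFrac_nonneg [])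
  have h2 := h.symm.nonneg (contFrac_nonneg [])
  simp only [contFrac, sub_zero] at hs
  nlinarith [mul_nonneg h1 h2]

/-- On the non-negative rationals `x ↦ 1 / (a + x)` has no pole and reverses the order, so it
preserves the property of lying on opposite sides. -/
theorem SepEdge.fareyStep {a : ℕ} (ha : 3 ≤ a) {l : List ℕ} {u w : OnePoint ℚ}
    (h : SepEdge (contFrac l) u w) :
    SepEdge (contFrac (a :: l)) (fareyStep a u) (fareyStep a w) := by
  have hr := contFrac_nonneg l
  obtain ⟨x, y, rfl, rfl, hadj, hs⟩ := id h
  have hx := h.nonneg hr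
  have hy := h.symm.nonneg hr
  have haQ : (3 : ℚ) ≤ a := by exact_mod_cast ha
  have hax : (a : ℚ) + x ≠ 0 := by positivity
  have hay : (a : ℚ) + y ≠ 0 := by positivity
  have har : (a : ℚ) + contFrac l ≠ 0 := by positivity
  refine ⟨1 / (a + x), 1 / (a + y), fareyStep_coe a x hax, fareyStep_coe a y hay,
    (fareyIso a).map_rel_iff.2 hadj, ?_⟩
  simp only [contFrac]
  rw [div_sub_div _ _ hax har, div_sub_div _ _ hay har, div_mul_div_comm]
  apply div_neg_of_neg_of_pos
  · nlinarith
  · positivity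

theorem fareyUnstep_coe (a : ℕ) {x : ℚ} (hx : x ≠ 0) :
    fareyUnstep a (x : OnePoint ℚ) = ((1 / x - a : ℚ) : OnePoint ℚ) := by
  have h : fareyStep a ((1 / x - a : ℚ) : OnePoint ℚ) = x := by
    rw [fareyStep_coe] <;> simp [hx]
  rw [← h, fareyUnstep_fareyStep]

/-- The inverse map has its pole at `0`. Endpoints of a separating edge are non-negative, so once
`0` is excluded both lie on the same side of the pole. -/
theorem SepEdge.fareyUnstep {a : ℕ} {l : List ℕ} {u w : OnePoint ℚ}
    (h : SepEdge (contFrac (a :: l)) u w) (hu : u ≠ ((0 : ℚ) : OnePoint ℚ))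
    (hw : w ≠ ((0 : ℚ) : OnePoint ℚ)) :
    SepEdge (contFrac l) (fareyUnstep a u) (fareyUnstep a w) := by
  have hr := contFrac_nonneg l
  obtain ⟨x, y, rfl, rfl, hadj, hs⟩ := id h
  have hx := h.nonneg (contFrac_nonneg _)
  have hy := h.symm.nonneg (contFrac_nonneg _)
  have hx0 : 0 < x := lt_of_le_of_ne hx fun h => hu (by rw [h])
  have hy0 : 0 < y := lt_of_le_of_ne hy fun h => hw (by rw [h])
  refine ⟨1 / x - a, 1 / y - a, fareyUnstep_coe a hx0.ne', fareyUnstep_coe a hy0.ne',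
    (fareyIso a).symm.map_rel_iff.2 hadj, ?_⟩
  simp only [contFrac] at hs
  have hpos : 0 < (a : ℚ) + contFrac l := by
    by_contra! hc
    have : (a : ℚ) + contFrac l = 0 := by
      have : (0 : ℚ) ≤ a := by positivity
      linarith
    rw [this] at hs
    simp at hs
    nlinarith
  set s := (a : ℚ) + contFrac l with hsdef
  have e1 : (1 / x - a - contFrac l) * (1 / y - a - contFrac l) =
      (x - 1 / s) * (y - 1 / s) * (s ^ 2 / (x * y)) := by
    rw [show 1 / x - a - contFrac l = 1 / x - s by rw [hsdef]; ring,
      show 1 / y - a - contFrac l = 1 / y - s by rw [hsdef]; ring]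
    field_simp
    ring
  rw [e1]
  exact mul_neg_of_neg_of_pos hs (by positivity)

/-- Both edges are pulled back by the first Möbius step, as long as `0` is not an endpoint. The
vertex `0` is itself a convergent. If one edge joins `v` to `0`, then `v` is a unit fraction, and
the other edge squeezes its denominator into `[a, a + 1)`; so `v = 1 / a`, the image of the first
convergent of the tail. -/
theorem mem_convergents_of_sepEdge {l : List ℕ} (hl : ∀ i ∈ l, 3 ≤ i) {v m₁ m₂ : OnePoint ℚ}
    (h₁ : SepEdge (contFrac l) v m₁) (h₂ : SepEdge (contFrac l) v m₂) (hm : m₁ ≠ m₂) :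
    v ∈ convergents l := by
  induction l generalizing v m₁ m₂ with
  | nil => exact absurd h₁ SepEdge.not_contFrac_nil
  | cons a l ih =>
    have ha := hl a (by simp)
    have hl' : ∀ i ∈ l, 3 ≤ i := fun i hi => hl i (by simp [hi])
    have ih := @ih hl'
    by_cases hv : v = ((0 : ℚ) : OnePoint ℚ)
    · simp [convergents, hv]
    suffices h : fareyUnstep a v ∈ convergents l by
      rw [convergents, List.mem_cons, List.mem_map]
      exact Or.inr ⟨_, h, fareyStep_fareyUnstep a v⟩
    have key : ∀ {m}, SepEdge (contFrac (a :: l)) v ((0 : ℚ) : OnePoint ℚ) →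
        m ≠ ((0 : ℚ) : OnePoint ℚ) → SepEdge (contFrac (a :: l)) v m →
        fareyUnstep a v ∈ convergents l := by
      intro m h0 hm0 hvm
      have h' := hvm.fareyUnstep hv hm0
      have hr := contFrac_nonneg l
      have hr1 := contFrac_lt_half hl'
      have hR0 := contFrac_pos ha l
      obtain ⟨x, y, rfl, hy0, hadj, hs⟩ := id h0
      obtain rfl := OnePoint.coe_injective hy0
      have hx := h0.nonneg hR0.le
      have hx0 : 0 < x := lt_of_le_of_ne hx fun h => hv (by rw [h])
      rw [fareyUnstep_coe a hx0.ne'] at h' ⊢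
      rw [fareyGraph_adj_coe] at hadj
      have hnum : x.num = 1 := by
        have := Rat.num_pos.2 hx0
        simp only [Rat.den_zero, Rat.num_zero, mul_zero, sub_zero, Nat.cast_one, mul_one] at hadj
        rwa [abs_of_pos this] at hadj
      have hxd : 1 / x = x.den := by
        have := Rat.num_div_den x
        rw [hnum] at this
        conv_lhs => rw [← this]
        simp
      -- The pulled back second edge still separates, so its endpoints are non-negative.
      have hge : (0 : ℚ) ≤ 1 / x - a := by
        obtain ⟨x', y', e1, e2, -, -⟩ := id h'
        rw [e2] at h'
        exact h'.nonneg hr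
      have hlt : 1 / x < a + 1 := by
        have h1 : contFrac (a :: l) < x := by nlinarith
        simp only [contFrac] at h1
        rw [one_div_lt (by positivity) hx0] at h1
        linarith
      rw [hxd] at hge hlt ⊢
      have e1 : (a : ℚ) ≤ x.den := by linarith
      have e2 : (a : ℕ) ≤ x.den := by exact_mod_cast e1
      have e3 : x.den < a + 1 := by exact_mod_cast hlt
      have : x.den = a := by omega
      rw [this, sub_self]
      cases l with
      | nil => exact absurd h' SepEdge.not_contFrac_nil
      | cons b l => simp [convergents]
    by_cases h10 : m₁ = ((0 : ℚ) : OnePoint ℚ)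
    · subst h10
      exact key h₁ hm.symm h₂
    by_cases h20 : m₂ = ((0 : ℚ) : OnePoint ℚ)
    · subst h20
      exact key h₂ h10 h₁
    exact ih (h₁.fareyUnstep hv h10) (h₂.fareyUnstep hv h20)
      fun h => hm (by rw [← fareyStep_fareyUnstep a m₁, h, fareyStep_fareyUnstep])

theorem SepTriangle.map_fareyIso {a : ℕ} (ha : 3 ≤ a) {l : List ℕ} {Δ : Finset (OnePoint ℚ)}
    (h : SepTriangle (contFrac l) Δ) :
    SepTriangle (contFrac (a :: l)) (Δ.map (fareyIso a).toEquiv.toEmbedding) := by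
  obtain ⟨hΔ, u, hu, w, hw, huw⟩ := h
  refine ⟨?_, _, Finset.mem_map_of_mem _ hu, _, Finset.mem_map_of_mem _ hw, huw.fareyStep ha⟩
  obtain ⟨p, q, s, hpq, hps, hqs, rfl⟩ := SimpleGraph.is3Clique_iff.1 hΔ
  exact SimpleGraph.is3Clique_iff.2 ⟨_, _, _, (fareyIso a).map_rel_iff.2 hpq,
    (fareyIso a).map_rel_iff.2 hps, (fareyIso a).map_rel_iff.2 hqs, by simp⟩

theorem sepEdge_zero_unitFraction {r : ℚ} (hr : 0 < r) {j : ℕ} (hj : j ≠ 0) (h : r * j < 1) :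
    SepEdge r ((0 : ℚ) : OnePoint ℚ) ((1 / j : ℚ) : OnePoint ℚ) := by
  refine ⟨0, 1 / j, rfl, rfl, ?_, ?_⟩
  · rw [fareyGraph_adj_coe, one_div, Rat.inv_natCast_num, Rat.inv_natCast_den,
      Int.sign_eq_one_of_pos (by omega)]
    simp
  · have : (0 : ℚ) < j := by positivity
    have : r < 1 / j := by rwa [lt_div_iff₀ this]
    nlinarith

theorem adj_unitFraction (j : ℕ) (hj : j ≠ 0) :
    fareyGraph.Adj ((1 / j : ℚ) : OnePoint ℚ) ((1 / (j + 1 : ℕ) : ℚ) : OnePoint ℚ) := by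
  rw [fareyGraph_adj_coe, one_div, one_div, Rat.inv_natCast_num, Rat.inv_natCast_num,
    Rat.inv_natCast_den, Rat.inv_natCast_den]
  rw [Int.sign_eq_one_of_pos (by omega), Int.sign_eq_one_of_pos (by omega)]
  simp [hj]

theorem sepTriangle_fan {r : ℚ} (hr : 0 < r) {j : ℕ} (hj : j ≠ 0) (h : r * j < 1) :
    SepTriangle r {((0 : ℚ) : OnePoint ℚ), ((1 / j : ℚ) : OnePoint ℚ),
      ((1 / (j + 1 : ℕ) : ℚ) : OnePoint ℚ)} := by
  refine ⟨SimpleGraph.is3Clique_iff.2 ⟨_, _, _, ?_, ?_, adj_unitFraction j hj, rfl⟩,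
    _, by simp, _, by simp, sepEdge_zero_unitFraction hr hj h⟩
  all_goals
    rw [fareyGraph_adj_coe, one_div, Rat.inv_natCast_num, Rat.inv_natCast_den,
      Int.sign_eq_one_of_pos (by omega)]
    simp

theorem sepTriangle_infty {r : ℚ} (hr : 0 < r) (h : r < 1) :
    SepTriangle r {∞, ((0 : ℚ) : OnePoint ℚ), ((1 / (1 : ℕ) : ℚ) : OnePoint ℚ)} := by
  refine ⟨SimpleGraph.is3Clique_iff.2 ⟨_, _, _, ?_, ?_, ?_, rfl⟩,
    _, ?_, _, ?_, sepEdge_zero_unitFraction hr one_ne_zero (by simpa using h)⟩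
  · rw [fareyGraph_adj_infty_coe]; simp
  · rw [fareyGraph_adj_infty_coe]; simp
  · rw [fareyGraph_adj_coe]; simp
  · simp
  · simp

/-- For the convergent `0` the triangles `∞, 0, 1` and `0, 1/2, 1/3` serve; the second needs the
target to be below `1/2`, which holds because all partial quotients are at least `3`. The other
convergents are images under the Möbius steps. -/
theorem exists_triangles_of_mem_convergents {l : List ℕ} (hl : ∀ i ∈ l, 3 ≤ i)
    {v : OnePoint ℚ} (hv : v ∈ convergents l) :
    ∃ Δ₁ Δ₂, SepTriangle (contFrac l) Δ₁ ∧ SepTriangle (contFrac l) Δ₂ ∧ Δ₁ ∩ Δ₂ = {v} := by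
  induction l generalizing v with
  | nil => simp [convergents] at hv
  | cons a l ih =>
    have ha := hl a (by simp)
    have hpos := contFrac_pos ha l
    have hlt := contFrac_lt_half hl
    rw [convergents, List.mem_cons, List.mem_map] at hv
    rcases hv with rfl | ⟨w, hw, rfl⟩
    · refine ⟨_, _, sepTriangle_infty hpos (by linarith), sepTriangle_fan hpos two_ne_zero
        (by push_cast; linarith), ?_⟩
      ext x
      simp only [Finset.mem_inter, Finset.mem_insert, Finset.mem_singleton]
      constructor
      · rintro ⟨rfl | rfl | rfl, h⟩
        · simp at h
        · rfl
        · simp only [OnePoint.coe_eq_coe] at h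
          norm_num at h
      · rintro rfl
        simp
    · obtain ⟨T₁, T₂, h1, h2, h⟩ := ih (fun i hi => hl i (by simp [hi])) hw
      refine ⟨_, _, h1.map_fareyIso ha, h2.map_fareyIso ha, ?_⟩
      rw [← Finset.map_inter, h]
      rfl

/-- The ends of the separating side lie on opposite sides of `r`, so a third vertex other than `∞`
and `r` is separated from one of them. -/
theorem SepTriangle.exists_sepEdge {r : ℚ} {Δ : Finset (OnePoint ℚ)} (h : SepTriangle r Δ)
    {v : OnePoint ℚ} (hv : v ∈ Δ) : (∃ m ∈ Δ, SepEdge r v m) ∨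
      ((v = ∞ ∨ v = r) ∧ ∃ b ∈ Δ, ∃ c ∈ Δ, fareyGraph.Adj b v ∧ fareyGraph.Adj c v ∧
        SepEdge r b c) := by
  obtain ⟨hΔ, u, hu, w, hw, huw⟩ := h
  by_cases hvu : v = u
  · subst hvu; exact Or.inl ⟨w, hw, huw⟩
  by_cases hvw : v = w
  · subst hvw; exact Or.inl ⟨u, hu, huw.symm⟩
  have hclique := hΔ.isClique
  have h1 : fareyGraph.Adj u v := hclique hu hv (Ne.symm hvu)
  have h2 : fareyGraph.Adj w v := hclique hw hv (Ne.symm hvw)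
  induction v using OnePoint.rec with
  | infty => exact Or.inr ⟨Or.inl rfl, u, hu, w, hw, h1, h2, huw⟩
  | coe y =>
    by_cases hy : y = r
    · subst hy; exact Or.inr ⟨Or.inr rfl, u, hu, w, hw, h1, h2, huw⟩
    left
    obtain ⟨x, x', rfl, rfl, -, hs⟩ := huw
    by_cases hc : (y - r) * (x - r) < 0
    · exact ⟨x, hu, y, x, rfl, rfl, h1.symm, hc⟩
    · refine ⟨x', hw, y, x', rfl, rfl, h2.symm, ?_⟩
      have hy' : y - r ≠ 0 := sub_ne_zero.2 hy
      by_contra! hc2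
      have := mul_self_pos.2 hy'
      nlinarith [mul_nonneg (not_lt.1 hc) hc2]

/-- Neighbours of `∞` are integers, and `0` is the only non-negative integer below `r`. -/
theorem zero_mem_of_sepEdge_adj_infty {r : ℚ} (hr : 0 ≤ r) (hr1 : r < 1) {b c : OnePoint ℚ}
    (h : SepEdge r b c) (hb : fareyGraph.Adj b ∞) (hc : fareyGraph.Adj c ∞) :
    b = ((0 : ℚ) : OnePoint ℚ) ∨ c = ((0 : ℚ) : OnePoint ℚ) := by
  obtain ⟨x, y, rfl, rfl, -, hs⟩ := id h
  have hx := h.nonneg hr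
  have hy := h.symm.nonneg hr
  have key : ∀ x : ℚ, 0 ≤ x → x < r → fareyGraph.Adj (x : OnePoint ℚ) ∞ → x = 0 := by
    intro x hx hxr hax
    have hd := fareyGraph_adj_infty_coe.1 hax.symm
    have hn := Rat.coe_int_num_of_den_eq_one hd
    have h1 : x.num < 1 := by
      have : (x.num : ℚ) < 1 := by rw [hn]; linarith
      exact_mod_cast this
    have h2 : 0 ≤ x.num := Rat.num_nonneg.2 hx
    rw [← hn, show x.num = 0 by omega, Int.cast_zero]
  rcases lt_or_ge x r with h | h
  · left; rw [key x hx h hb]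
  · right; rw [key y hy (by nlinarith) hc]

/-- The lower parent of `r` is unique: `r` is the mediant of `x` and `y`, so `x` has a smaller
denominator than `r`, and the determinant condition fixes that denominator modulo the denominator of
`r`. -/
theorem eq_of_sepEdge_adj {r : ℚ} {x y x' y' : ℚ} (hxy : fareyGraph.Adj (x : OnePoint ℚ) y)
    (hx : fareyGraph.Adj (x : OnePoint ℚ) r) (hy : fareyGraph.Adj (y : OnePoint ℚ) r)
    (hxr : x < r) (hry : r < y) (hxy' : fareyGraph.Adj (x' : OnePoint ℚ) y')
    (hx' : fareyGraph.Adj (x' : OnePoint ℚ) r) (hy' : fareyGraph.Adj (y' : OnePoint ℚ) r)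
    (hxr' : x' < r) (hry' : r < y') : x = x' := by
  have det : ∀ {u w : ℚ}, u < w → fareyGraph.Adj (u : OnePoint ℚ) w →
      w.num * u.den - w.den * u.num = 1 := by
    intro u w h ha
    rw [fareyGraph_adj_coe] at ha
    rw [Rat.lt_iff] at h
    rw [abs_of_neg (by linarith)] at ha
    linarith
  have dens : ∀ {u w : ℚ}, u < r → r < w → fareyGraph.Adj (u : OnePoint ℚ) w →
      fareyGraph.Adj (u : OnePoint ℚ) r → fareyGraph.Adj (w : OnePoint ℚ) r →
      u.den < r.den := by
    intro u w h1 h2 h3 h4 h5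
    have e1 := det h1 h4
    have e2 := det h2 h5.symm
    have e3 := det (h1.trans h2) h3
    have hw : (0 : ℤ) < w.den := by exact_mod_cast w.den_pos
    have : (r.den : ℤ) = u.den + w.den := by
      linear_combination (-(r.den : ℤ)) * e3 + (u.den : ℤ) * e2 + (w.den : ℤ) * e1
    omega
  have d1 := dens hxr hry hxy hx hy
  have d2 := dens hxr' hry' hxy' hx' hy'
  have e1 := det hxr hx
  have e2 := det hxr' hx'
  have hco : IsCoprime (r.den : ℤ) r.num := (Rat.isCoprime_num_den r).symm
  have hdvd : (r.den : ℤ) ∣ (x.den : ℤ) - x'.den := by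
    refine hco.dvd_of_dvd_mul_left (z := (x.den : ℤ) - x'.den) ⟨x.num - x'.num, ?_⟩
    linear_combination e1 - e2
  have hz : (x.den : ℤ) - x'.den = 0 := by
    apply Int.eq_zero_of_abs_lt_dvd hdvd
    rw [abs_lt]
    have := x.den_pos
    have := x'.den_pos
    constructor <;> omega
  have hden : x.den = x'.den := by omega
  have hr0 : (r.den : ℤ) ≠ 0 := by exact_mod_cast r.den_nz
  have hnum : x.num = x'.num := by
    apply mul_left_cancel₀ hr0
    rw [hden] at e1
    linarith
  exact Rat.ext hnum hden

/-- A common vertex lies on a separating side of each triangle, and these sides differ when it is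
the only common vertex; this yields a convergent. The exceptions are `∞`, where both triangles also
contain `0`, and the target, where both contain its lower parent. -/
theorem ladderPivots_infty {l : List ℕ} (hl : ∀ i ∈ l, 3 ≤ i) :
    ladderPivots ∞ (contFrac l : OnePoint ℚ) = {v | v ∈ convergents l} := by
  ext v
  simp only [ladderPivots, mem_ladder_infty, Set.mem_ofPred_eq]
  constructor
  · rintro ⟨T₁, h1, T₂, h2, h⟩
    have hv : ∀ x, x ∈ T₁ → x ∈ T₂ → x = v := fun x hx1 hx2 =>
      (Set.ext_iff.1 h x).1 ⟨hx1, hx2⟩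
    obtain ⟨hv1, hv2⟩ := (Set.ext_iff.1 h v).2 rfl
    have hr := contFrac_nonneg l
    have hr1 := contFrac_lt_half hl
    rcases h1.exists_sepEdge hv1 with ⟨m₁, hm1, hs1⟩ | ⟨hc, b, hb, c, hc', hbv, hcv, hbc⟩
    · rcases h2.exists_sepEdge hv2 with ⟨m₂, hm2, hs2⟩ | ⟨hc, -⟩
      · refine mem_convergents_of_sepEdge hl hs1 hs2 ?_
        rintro rfl
        exact hs1.adj.ne (hv _ hm1 hm2).symm
      · exfalso
        obtain ⟨x, y, rfl, rfl, -, hs⟩ := hs1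
        rcases hc with hc | hc
        · simp at hc
        · obtain rfl := OnePoint.coe_injective hc
          simp at hs
    · exfalso
      rcases h2.exists_sepEdge hv2 with ⟨m₂, hm2, hs2⟩ | ⟨-, b', hb', c', hc2, hbv', hcv', hbc'⟩
      · obtain ⟨x, y, rfl, rfl, -, hs⟩ := hs2
        rcases hc with hc | hc
        · simp at hc
        · obtain rfl := OnePoint.coe_injective hc
          simp at hs
      rcases hc with rfl | rfl
      · have z1 : ((0 : ℚ) : OnePoint ℚ) ∈ T₁ := by
          rcases zero_mem_of_sepEdge_adj_infty hr (by linarith) hbc hbv hcv with h | h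
          · rwa [← h]
          · rwa [← h]
        have z2 : ((0 : ℚ) : OnePoint ℚ) ∈ T₂ := by
          rcases zero_mem_of_sepEdge_adj_infty hr (by linarith) hbc' hbv' hcv' with h | h
          · rwa [← h]
          · rwa [← h]
        simpa using hv _ z1 z2
      · have order : ∀ {T : Finset (OnePoint ℚ)} {b c : OnePoint ℚ}, b ∈ T → c ∈ T →
            fareyGraph.Adj b (contFrac l : OnePoint ℚ) →
            fareyGraph.Adj c (contFrac l : OnePoint ℚ) → SepEdge (contFrac l) b c →
            ∃ x y : ℚ, (x : OnePoint ℚ) ∈ T ∧ x < contFrac l ∧ contFrac l < y ∧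
              fareyGraph.Adj (x : OnePoint ℚ) y ∧
              fareyGraph.Adj (x : OnePoint ℚ) (contFrac l : OnePoint ℚ) ∧
              fareyGraph.Adj (y : OnePoint ℚ) (contFrac l : OnePoint ℚ) := by
          intro T b c hb hc hbr hcr hbc
          obtain ⟨x, y, rfl, rfl, ha, hs⟩ := id hbc
          rcases lt_or_ge x (contFrac l) with h | h
          · exact ⟨x, y, hb, h, by nlinarith, ha, hbr, hcr⟩
          · exact ⟨y, x, hc, by nlinarith, by
              rcases h.eq_or_lt with h | h
              · rw [h] at hs; simp at hs
              · exact h, ha.symm, hcr, hbr⟩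
        obtain ⟨x, y, hxT, hxr, hry, q1, q2, q3⟩ := order hb hc' hbv hcv hbc
        obtain ⟨x', y', hxT', hxr', hry', q1', q2', q3'⟩ := order hb' hc2 hbv' hcv' hbc'
        have := eq_of_sepEdge_adj q1 q2 q3 hxr hry q1' q2' q3' hxr' hry'
        rw [← this] at hxT'
        have := OnePoint.coe_injective (hv _ hxT hxT')
        exact hxr.ne this
  · intro hv
    obtain ⟨T₁, T₂, h1, h2, h⟩ := exists_triangles_of_mem_convergents hl hv
    refine ⟨T₁, h1, T₂, h2, ?_⟩
    rw [← Finset.coe_inter, h, Finset.coe_singleton]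

theorem sepEdge_spineList {l : List ℕ} (hl : ∀ i ∈ l, 3 ≤ i) {i : ℕ} {u w : OnePoint ℚ}
    (hi : 0 < i) (hu : (spineList l)[i]? = some u) (hw : (spineList l)[i + 1]? = some w)
    (hi' : i + 2 < (spineList l).length) : SepEdge (contFrac l) u w := by
  induction l generalizing i u w with
  | nil => simp [spineList] at hi'
  | cons a l ih =>
    have ha := hl a (by simp)
    have hl' : ∀ i ∈ l, 3 ≤ i := fun i hi => hl i (by simp [hi])
    obtain ⟨k, rfl⟩ := Nat.exists_eq_add_of_lt hi
    simp only [spineList, zero_add, List.getElem?_cons_succ, List.getElem?_map,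
      Option.map_eq_some_iff, List.length_cons, List.length_map] at hu hw hi'
    obtain ⟨u', hu', rfl⟩ := hu
    obtain ⟨w', hw', rfl⟩ := hw
    rcases Nat.eq_zero_or_pos k with rfl | hk
    · cases l with
      | nil => simp [spineList] at hi'
      | cons b l =>
        simp only [spineList, List.getElem?_cons_succ, List.getElem?_map,
          Option.map_eq_some_iff, List.getElem?_cons_zero, Option.some.injEq, zero_add] at hu' hw'
        obtain ⟨w'', hw'', rfl⟩ := hw'
        have hwinf : w'' = ∞ := by
          cases l <;> simpa [spineList, eq_comm] using hw''
        subst hu' hwinf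
        rw [fareyStep_infty, fareyStep_infty, fareyStep_zero a (by omega)]
        apply sepEdge_zero_unitFraction (contFrac_pos ha _) (by omega)
        have h0 := contFrac_pos (hl' b (by simp)) l
        rw [contFrac, one_div, inv_mul_lt_iff₀ (by positivity)]
        linarith
    · exact (ih hl' hk hu' hw' (by omega)).fareyStep ha

theorem exists_sepTriangle_spineList {l : List ℕ} (hl : ∀ i ∈ l, 3 ≤ i) (hne : l ≠ []) {i : ℕ}
    {u w : OnePoint ℚ} (hu : (spineList l)[i]? = some u) (hw : (spineList l)[i + 1]? = some w) :
    ∃ Δ, SepTriangle (contFrac l) Δ ∧ u ∈ Δ ∧ w ∈ Δ := by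
  induction l generalizing i u w with
  | nil => exact absurd rfl hne
  | cons a l ih =>
    have ha := hl a (by simp)
    have hl' : ∀ i ∈ l, 3 ≤ i := fun i hi => hl i (by simp [hi])
    have hpos := contFrac_pos ha l
    have hlt := contFrac_lt_half hl
    rcases Nat.eq_zero_or_pos i with rfl | hi
    · simp only [spineList, List.getElem?_cons_zero, Option.some.injEq, zero_add,
        List.getElem?_cons_succ, List.getElem?_map, Option.map_eq_some_iff] at hu hw
      obtain ⟨w', hw', rfl⟩ := hw
      have hwinf : w' = ∞ := by
        cases l <;> simpa [spineList, eq_comm] using hw'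
      subst hu hwinf
      rw [fareyStep_infty]
      exact ⟨_, sepTriangle_infty hpos (by linarith), by simp, by simp⟩
    · obtain ⟨k, rfl⟩ := Nat.exists_eq_add_of_lt hi
      simp only [spineList, zero_add, List.getElem?_cons_succ, List.getElem?_map,
        Option.map_eq_some_iff] at hu hw
      obtain ⟨u', hu', rfl⟩ := hu
      obtain ⟨w', hw', rfl⟩ := hw
      by_cases hl0 : l = []
      · subst hl0
        have hk : k = 0 := by
          by_contra hk
          obtain ⟨k', rfl⟩ := Nat.exists_eq_succ_of_ne_zero hk
          simp [spineList] at hw'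
        subst hk
        simp only [spineList, List.getElem?_cons_zero, Option.some.injEq, zero_add,
          List.getElem?_cons_succ] at hu' hw'
        subst hu' hw'
        rw [fareyStep_infty, fareyStep_zero a (by omega)]
        -- The last edge runs from `0` to the target `1 / a` itself, so it does not separate. It
        -- lies in the triangle `0, 1/(a-1), 1/a`, whose side from `0` to `1/(a-1)` does.
        obtain ⟨b, rfl⟩ : ∃ b, a = b + 1 := ⟨a - 1, by omega⟩
        refine ⟨_, sepTriangle_fan hpos (j := b) (by omega) ?_, by simp, by simp⟩
        simp only [contFrac]
        push_cast
        rw [add_zero, one_div, inv_mul_lt_iff₀ (by positivity)]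
        linarith
      · obtain ⟨T, hT, h1, h2⟩ := ih hl' hl0 hu' hw'
        exact ⟨_, hT.map_fareyIso ha, Finset.mem_map_of_mem _ h1, Finset.mem_map_of_mem _ h2⟩

/-! ### Spines coincide with geodesics. -/

theorem SimpleGraph.Walk.exists_getVert_of_mem_edges {V : Type*} {G : SimpleGraph V} {x y : V}
    (P : G.Walk x y) {e : Sym2 V} (he : e ∈ P.edges) :
    ∃ i < P.length, e = s(P.getVert i, P.getVert (i + 1)) := by
  induction P with
  | nil => simp at he
  | cons h P ih =>
    rw [SimpleGraph.Walk.edges_cons, List.mem_cons] at he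
    rcases he with rfl | he
    · exact ⟨0, by simp, by simp⟩
    · obtain ⟨i, hi, rfl⟩ := ih he
      exact ⟨i + 1, by simpa using hi, by simp⟩

/-- A spine is a path, and its vertices are the endpoints and the convergents. This already
determines its length, which equals the distance, so it is the unique geodesic; the edge conditions
are needed only in the converse direction, where they are verified for the walk through the
convergents. -/
theorem isSpine_iff {l : List ℕ} (hl : ∀ i ∈ l, 3 ≤ i) (hne : l ≠ [])
    (K : fareyGraph.Walk ∞ (contFrac l : OnePoint ℚ)) :
    IsSpine K ↔ K.support = spineList l := by
  have hnodup : (spineList l).Nodup := by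
    obtain ⟨P, hP⟩ := exists_walk_spineList hl
    rw [← hP]
    exact (P.isPath_of_length_eq_dist ((isGeodesicWalk_iff hl P).2 hP)).support_nodup
  have hnodup' := hnodup
  rw [spineList_eq hl, List.nodup_cons, List.nodup_append] at hnodup'
  obtain ⟨hinf, hcn, -, hdis⟩ := hnodup'
  constructor
  · intro h
    refine (isGeodesicWalk_iff hl K).1 ?_
    rw [IsGeodesicWalk, dist_infty_contFrac hl]
    have hset : K.support.toFinset = insert ∞ (insert (contFrac l : OnePoint ℚ)
        (convergents l).toFinset) := by
      ext v
      have hv := Set.ext_iff.1 (h.inner_vertices.trans (ladderPivots_infty hl)) v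
      simp only [Set.mem_ofPred_eq] at hv
      simp only [List.mem_toFinset, Finset.mem_insert]
      rw [← hv]
      by_cases h1 : v = ∞
      · simp [h1]
      by_cases h2 : v = (contFrac l : OnePoint ℚ)
      · simp [h2]
      simp [h1, h2]
    have hcard := congrArg Finset.card hset
    rw [List.toFinset_card_of_nodup h.isPath.support_nodup, Finset.card_insert_of_notMem,
      Finset.card_insert_of_notMem, List.toFinset_card_of_nodup hcn, length_convergents,
      SimpleGraph.Walk.length_support] at hcard
    · omega
    · rw [List.mem_toFinset]
      intro hm
      exact hdis _ hm _ (by simp) rfl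
    · simp only [List.mem_append, List.mem_singleton, not_or] at hinf
      simp only [Finset.mem_insert, List.mem_toFinset, not_or]
      exact ⟨hinf.2, hinf.1⟩
  · intro h
    obtain ⟨a, l', rfl⟩ := List.exists_cons_of_ne_nil hne
    have ha := hl a (by simp)
    have hpos := contFrac_pos ha l'
    have hlt := contFrac_lt_half hl
    have hget : ∀ i, i ≤ K.length → (spineList (a :: l'))[i]? = some (K.getVert i) := by
      intro i hi
      rw [← h, K.getVert_eq_support_getElem hi]
      exact List.getElem?_eq_getElem _
    have hlen : K.length + 1 = (spineList (a :: l')).length := by rw [← h, K.length_support]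
    refine ⟨?_, ?_, ?_, ?_, ?_⟩
    · have h1 := mem_ladder_infty.2 (sepTriangle_infty hpos (by linarith))
      have h2 := mem_ladder_infty.2 (sepTriangle_fan hpos one_ne_zero (by push_cast; linarith))
      have h3 := mem_ladder_infty.2 (sepTriangle_fan hpos two_ne_zero (by push_cast; linarith))
      have hd : ∀ i j : ℕ, i ≠ j → ((1 / (i + 1 : ℕ) : ℚ) : OnePoint ℚ) ≠
          ((1 / (j + 1 : ℕ) : ℚ) : OnePoint ℚ) := by
        intro i j hij h
        have := OnePoint.coe_injective h
        rw [one_div, one_div, inv_inj] at this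
        have : i + 1 = j + 1 := by exact_mod_cast this
        omega
      have hd1 := hd 0 1 (by norm_num)
      have hd2 := hd 0 2 (by norm_num)
      have hd0 : ∀ i : ℕ, ((1 / (i + 1 : ℕ) : ℚ) : OnePoint ℚ) ≠ ((0 : ℚ) : OnePoint ℚ) := by
        intro i h
        have := OnePoint.coe_injective h
        rw [one_div, inv_eq_zero] at this
        have : i + 1 = 0 := by exact_mod_cast this
        omega
      refine le_trans (Set.encard_eq_three.2 ⟨_, _, _, ?_, ?_, ?_, rfl⟩).ge
        (Set.encard_le_encard (Set.insert_subset h1 (Set.insert_subset h2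
          (Set.singleton_subset_iff.2 h3))))
      · intro he
        have := (Finset.ext_iff.1 he ∞).1 (by simp)
        simp at this
      · intro he
        have := (Finset.ext_iff.1 he ∞).1 (by simp)
        simp at this
      · intro he
        have := (Finset.ext_iff.1 he ((1 / (0 + 1 : ℕ) : ℚ) : OnePoint ℚ)).1 (by simp)
        simp only [Finset.mem_insert, Finset.mem_singleton] at this
        rcases this with h | h | h
        · exact hd0 0 h
        · exact hd1 h
        · exact hd2 h
    · rw [SimpleGraph.Walk.isPath_def, h]
      exact hnodup
    · intro e he
      obtain ⟨i, hi, rfl⟩ := K.exists_getVert_of_mem_edges he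
      obtain ⟨T, hT, h1, h2⟩ := exists_sepTriangle_spineList hl hne (hget i hi.le)
        (hget (i + 1) hi)
      refine ⟨T, mem_ladder_infty.2 hT, fun v hv => ?_⟩
      rcases Sym2.mem_iff.1 hv with rfl | rfl
      · exact h1
      · exact h2
    · rw [ladderPivots_infty hl]
      ext v
      rw [Set.mem_ofPred_eq, h, spineList_eq hl]
      simp only [List.mem_cons, List.mem_append, List.not_mem_nil, or_false, Set.mem_ofPred_eq]
      simp only [List.mem_append, List.mem_singleton, not_or] at hinf
      constructor
      · rintro ⟨h1 | h1 | h1, h2, h3⟩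
        · exact absurd h1 h2
        · exact h1
        · exact absurd h1 h3
      · intro hv
        refine ⟨Or.inr (Or.inl hv), ?_, ?_⟩
        · rintro rfl; exact hinf.1 hv
        · rintro rfl; exact hdis _ hv _ (by simp) rfl
    · intro i hi hi'
      exact (sepEdge_spineList hl hi (hget i (by omega)) (hget (i + 1) (by omega))
        (by omega)).nonempty_inter

theorem exists_unique_spine {l : List ℕ} (hl : ∀ i ∈ l, 3 ≤ i) (hne : l ≠ []) :
    ∃ K : fareyGraph.Walk ∞ (contFrac l : OnePoint ℚ),
      (∀ K' : fareyGraph.Walk ∞ (contFrac l : OnePoint ℚ), IsSpine K' ↔ K' = K) ∧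
      K.length = l.length + 1 ∧
      ∀ P : fareyGraph.Walk ∞ (contFrac l : OnePoint ℚ), IsGeodesicWalk P ↔ P = K := by
  obtain ⟨K, hK⟩ := exists_walk_spineList hl
  have hext : ∀ P : fareyGraph.Walk ∞ (contFrac l : OnePoint ℚ),
      P.support = spineList l ↔ P = K := by
    intro P
    rw [← hK]
    exact ⟨SimpleGraph.Walk.ext_support, fun h => by rw [h]⟩
  refine ⟨K, fun K' => (isSpine_iff hl hne K').trans (hext K'), ?_,
    fun P => (isGeodesicWalk_iff hl P).trans (hext P)⟩
  have := K.length_support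
  rw [hK, length_spineList] at this
  omega

/-- The distance of the convergents of `[3, 3, 3, …]` is unbounded. -/
theorem le_length_of_walk_zero {n : ℕ}
    (P : fareyGraph.Walk ((0 : ℚ) : OnePoint ℚ) (contFrac (List.replicate n 3) : OnePoint ℚ)) :
    n ≤ P.length := by
  have hadj : fareyGraph.Adj ∞ ((0 : ℚ) : OnePoint ℚ) := by
    simp [fareyGraph_adj_infty_coe]
  have := (length_walk_ge (l := List.replicate n 3)
    (fun i hi => (List.eq_of_mem_replicate hi).ge) (.cons hadj P)).1
  simpa using this

/-! ### Lifting maps to the circle -/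

theorem exists_lift_unitAddCircle {A : Type*} [TopologicalSpace A] [SimplyConnectedSpace A]
    [LocallyPathConnectedSpace A] {c : A → UnitAddCircle} (hc : Continuous c) :
    ∃ g : A → ℝ, Continuous g ∧ ∀ y, (g y : UnitAddCircle) = c y := by
  obtain ⟨a₀⟩ := (inferInstance : Nonempty A)
  obtain ⟨e₀, he⟩ := QuotientAddGroup.mk_surjective (c a₀)
  obtain ⟨F, hF, -⟩ := (AddCircle.isCoveringMap_coe (1 : ℝ)).existsUnique_continuousMap_lifts
    ⟨c, hc⟩ a₀ e₀ he
  exact ⟨F, F.continuous, fun y => congrFun hF.2 y⟩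

theorem exists_const_of_int_valued {A : Type*} [TopologicalSpace A] [PreconnectedSpace A]
    {f : A → ℝ} (hf : Continuous f) (h : ∀ y, ∃ k : ℤ, f y = k) :
    ∃ k : ℤ, ∀ y, f y = k := by
  choose g hg using h
  have hgc : Continuous g := by
    rw [Int.isClosedEmbedding_coe_real.isEmbedding.continuous_iff]
    convert hf using 1
    funext y
    exact (hg y).symm
  rcases isEmpty_or_nonempty A with hA | ⟨⟨a⟩⟩
  · exact ⟨0, fun y => hA.elim y⟩
  · exact ⟨g a, fun y => by rw [hg, PreconnectedSpace.constant ‹_› hgc (y := a)]⟩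

theorem coe_eq_coe_unitAddCircle {x y : ℝ} :
    (x : UnitAddCircle) = (y : UnitAddCircle) ↔ ∃ k : ℤ, y = x + k := by
  rw [eq_comm, QuotientAddGroup.eq_iff_sub_mem, AddSubgroup.mem_zmultiples_iff]
  simp only [zsmul_eq_mul, mul_one]
  exact exists_congr fun k => ⟨fun h => by linarith, fun h => by linarith⟩

/-! ### Flat covers -/

/-- The point of the integer lattice with coordinates `n`. -/
def latticePt (n : ℤ × ℤ) : ℝ × ℝ := ((n.1 : ℝ), (n.2 : ℝ))

@[simp] theorem latticePt_fst (n : ℤ × ℤ) : (latticePt n).1 = n.1 := rfl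
@[simp] theorem latticePt_snd (n : ℤ × ℤ) : (latticePt n).2 = n.2 := rfl
@[simp] theorem latticePt_zero : latticePt 0 = 0 := by ext <;> simp
theorem latticePt_add (m n : ℤ × ℤ) : latticePt (m + n) = latticePt m + latticePt n := by
  ext <;> simp
theorem latticePt_zsmul (k : ℤ) (n : ℤ × ℤ) : latticePt (k • n) = (k : ℝ) • latticePt n := by
  ext <;> simp
theorem latticePt_neg (n : ℤ × ℤ) : latticePt (-n) = -latticePt n := by
  ext <;> simp
theorem latticePt_sub (m n : ℤ × ℤ) : latticePt (m - n) = latticePt m - latticePt n := by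
  ext <;> simp
theorem latticePt_injective : Function.Injective latticePt := by
  intro m n h
  have h1 := congrArg Prod.fst h
  have h2 := congrArg Prod.snd h
  simp only [latticePt_fst, latticePt_snd, Int.cast_inj] at h1 h2
  exact Prod.ext h1 h2

/-- A continuous odd function with `bump (t + 1) = bump t + 1` that vanishes on
`[-1/4, 1/4]`. -/
noncomputable def bump (t : ℝ) : ℝ :=
  t - Real.arcsin (Real.sin (2 * Real.pi * t)) / (2 * Real.pi)

/-- A homeomorphism of the plane that normalizes the integer lattice. -/
noncomputable def twist (x : ℝ × ℝ) : ℝ × ℝ := (x.2, x.1 + 3 * bump x.2)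

/-- `p` maps the plane onto a quotient of the torus, and is a covering over the subsurface `S`. -/
structure FlatCover {S X : Type*} [TopologicalSpace S] [TopologicalSpace X]
    (ι : S → X) (p : ℝ × ℝ → X) : Prop where
  t2 : T2Space X
  emb : IsEmbedding ι
  cont : Continuous p
  isOpenMap : IsOpenMap p
  surj : Function.Surjective p
  periodic : ∀ x n, p (x + latticePt n) = p x
  fiber : ∀ x y, p x = p y → (∃ n, y = x + latticePt n) ∨
    ((∀ z, p (-z) = p z) ∧ ∃ n, y = -x + latticePt n)
  locInj : ∀ x, p x ∈ Set.range ι → ∃ V ∈ 𝓝 x, Set.InjOn p V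
  lift : ∀ c : ℝ × ℝ → S, Continuous c → ∃ c' : ℝ × ℝ → ℝ × ℝ, Continuous c' ∧
    ∀ y, p (c' y) = ι (c y)
  annulus_isOpenMap : ∀ f : Circle × ℝ → S, IsOpenEmbedding f → IsOpenMap (ι ∘ f)
  range_mem_nhds : ∀ x : ℝ × ℝ, ((∃ m : ℤ, |x.1 - m - 3 / 8| < 1 / 8) ∨
    ∃ m : ℤ, |x.2 - m - 3 / 8| < 1 / 8) → Set.range ι ∈ 𝓝 (p x)
  twist_mem : ∀ x, p (twist x) ∈ Set.range ι ↔ p x ∈ Set.range ι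

namespace FlatCover

variable {S X : Type*} [TopologicalSpace S] [TopologicalSpace X] {ι : S → X} {p : ℝ × ℝ → X}

theorem t2Space (hp : FlatCover ι p) : T2Space S :=
  have := hp.t2
  hp.emb.t2Space

/-- Local injectivity of `p` over the surface makes the coincidence set of two lifts open; it is
closed and non-empty. Over the cone points of the sphere `p` is not locally injective, hence the
hypothesis on the range. -/
theorem lift_unique (hp : FlatCover ι p) {A : Type*} [TopologicalSpace A] [PreconnectedSpace A]
    {c c' : A → ℝ × ℝ} (hc : Continuous c) (hc' : Continuous c') (h : ∀ a, p (c a) = p (c' a))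
    (hr : ∀ a, p (c a) ∈ Set.range ι) {a₀ : A} (h₀ : c a₀ = c' a₀) : c = c' := by
  have hclosed : IsClosed {a | c a = c' a} := isClosed_eq hc hc'
  have hopen : IsOpen {a | c a = c' a} := by
    rw [isOpen_iff_mem_nhds]
    intro a ha
    obtain ⟨V, hV, hinj⟩ := hp.locInj (c a) (hr a)
    have h1 := hc.continuousAt.preimage_mem_nhds hV
    have h2 := hc'.continuousAt.preimage_mem_nhds (ha ▸ hV)
    filter_upwards [h1, h2] with b hb1 hb2
    exact hinj hb1 hb2 (h b)
  have huniv := IsClopen.eq_univ ⟨hclosed, hopen⟩ ⟨a₀, h₀⟩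
  funext a
  exact (Set.ext_iff.1 huniv a).2 trivial

/-- Points of a fibre differ by a lattice translation, possibly composed with a half-turn. The sign
`e` lets the torus and the sphere share the later arguments. -/
theorem exists_deck (hp : FlatCover ι p) {x y : ℝ × ℝ} (h : p x = p y) :
    ∃ (e : ℤ) (n : ℤ × ℤ), (e = 1 ∨ e = -1) ∧ y = (e : ℝ) • x + latticePt n ∧
      ∀ z, p ((e : ℝ) • z + latticePt n) = p z := by
  rcases hp.fiber x y h with ⟨n, rfl⟩ | ⟨he, n, rfl⟩
  · exact ⟨1, n, Or.inl rfl, by simp, fun z => by simpa using hp.periodic z n⟩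
  · exact ⟨-1, n, Or.inr rfl, by simp, fun z => by simpa using (hp.periodic (-z) n).trans (he z)⟩

theorem exists_lift_from (hp : FlatCover ι p) {c : ℝ × ℝ → S} (hc : Continuous c)
    {y₀ x₀ : ℝ × ℝ} (h₀ : p x₀ = ι (c y₀)) :
    ∃ c' : ℝ × ℝ → ℝ × ℝ, Continuous c' ∧ (∀ y, p (c' y) = ι (c y)) ∧ c' y₀ = x₀ := by
  obtain ⟨c₁, h1, h2⟩ := hp.lift c hc
  obtain ⟨e, n, -, hy, hz⟩ := hp.exists_deck ((h2 y₀).trans h₀.symm)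
  exact ⟨fun y => (e : ℝ) • c₁ y + latticePt n, by fun_prop, fun y => by rw [hz, h2], hy.symm⟩

theorem lift_period (hp : FlatCover ι p) {A : Type*} [TopologicalSpace A] [PreconnectedSpace A]
    {c : A → S} {c' : A → ℝ × ℝ} (hc' : Continuous c') (hcc : ∀ a, p (c' a) = ι (c a))
    {σ : A → A} (hσ : Continuous σ) (hcσ : ∀ a, c (σ a) = c a) {a₀ : A} {v : ℤ × ℤ}
    (h₀ : c' (σ a₀) = c' a₀ + latticePt v) : ∀ a, c' (σ a) = c' a + latticePt v := by
  have := hp.lift_unique (c := fun a => c' (σ a)) (c' := fun a => c' a + latticePt v)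
    (hc'.comp hσ) (by fun_prop) (fun a => by rw [hp.periodic, hcc, hcc, hcσ])
    (fun a => ⟨_, (hcc _).symm⟩) h₀
  exact congrFun this

end FlatCover

theorem add_int_of_add_one {f : ℝ → ℝ × ℝ} {v : ℤ × ℤ}
    (h : ∀ t, f (t + 1) = f t + latticePt v) (t : ℝ) (k : ℤ) :
    f (t + k) = f t + latticePt (k • v) := by
  induction k using Int.induction_on with
  | zero => simp
  | succ k ih =>
    push_cast at *
    rw [← add_assoc, h, ih, add_smul, one_smul, latticePt_add, add_assoc]
  | pred k ih =>
    have := h (t + ((-(k : ℤ) - 1 : ℤ) : ℝ))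
    rw [show t + ((-(k : ℤ) - 1 : ℤ) : ℝ) + 1 = t + ((-(k : ℤ) : ℤ) : ℝ) by push_cast; ring, ih]
      at this
    rw [sub_smul, one_smul, latticePt_sub, add_sub, this, add_sub_cancel_right]

/-- The closed curve `α` has a parametrization that lifts to a path in the plane with period `v`. -/
def HasClass {S X : Type*} [TopologicalSpace S] (ι : S → X) (p : ℝ × ℝ → X) (α : Set S)
    (v : ℤ × ℤ) : Prop :=
  ∃ (g : ℝ → S) (g' : ℝ → ℝ × ℝ), Continuous g ∧ Continuous g' ∧ (∀ t, g (t + 1) = g t) ∧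
    (∀ t t', g t = g t' → ∃ k : ℤ, t' = t + k) ∧ Set.range g = α ∧
    (∀ t, p (g' t) = ι (g t)) ∧ ∀ t, g' (t + 1) = g' t + latticePt v

/-- The injective curve is an embedding of the circle, so the other closed curve becomes a
continuous map to the circle. It lifts to the line, and `d` is its degree. -/
theorem exists_reparam {S : Type*} [TopologicalSpace S] [T2Space S] {g h : ℝ → S}
    (hg : Continuous g) (hh : Continuous h) (hg1 : ∀ t, g (t + 1) = g t)
    (hh1 : ∀ t, h (t + 1) = h t) (hinj : ∀ t t', g t = g t' → ∃ k : ℤ, t' = t + k)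
    (hr : ∀ t, h t ∈ Set.range g) :
    ∃ (φ : ℝ → ℝ) (d : ℤ), Continuous φ ∧ (∀ t, h t = g (φ t)) ∧ ∀ t, φ (t + 1) = φ t + d := by
  have hper : Function.Periodic g 1 := hg1
  have hbc : Continuous (hper.lift : UnitAddCircle → S) :=
    continuous_coinduced_dom.2 hg
  have hbi : Function.Injective (hper.lift : UnitAddCircle → S) := by
    intro a b hab
    induction a using QuotientAddGroup.induction_on with | H a => ?_
    induction b using QuotientAddGroup.induction_on with | H b => ?_
    exact coe_eq_coe_unitAddCircle.2 (hinj a b hab)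
  have hemb := (hbc.isClosedEmbedding hbi).isEmbedding
  choose τ hτ using hr
  have hτc : Continuous (fun t => (τ t : UnitAddCircle)) := by
    rw [hemb.continuous_iff]
    convert hh using 1
    funext t
    exact hτ t
  obtain ⟨φ, hφ, hφ'⟩ := exists_lift_unitAddCircle hτc
  have hgφ : ∀ t, h t = g (φ t) := by
    intro t
    rw [← hτ t]
    exact (congrArg hper.lift (hφ' t)).symm
  obtain ⟨d, hd⟩ := exists_const_of_int_valued (f := fun t => φ (t + 1) - φ t) (by fun_prop)
    (fun t => by
      obtain ⟨k, hk⟩ := hinj (φ t) (φ (t + 1)) (by rw [← hgφ, ← hgφ, hh1])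
      exact ⟨k, by rw [hk]; ring⟩)
  exact ⟨φ, d, hφ, hgφ, fun t => by linarith [hd t]⟩

namespace FlatCover

variable {S X : Type*} [TopologicalSpace S] [TopologicalSpace X] {ι : S → X} {p : ℝ × ℝ → X}

/-- A closed curve inside `α` is a reparametrization of degree `d`, and its lift differs from the
given lift of `α` by a deck transformation of sign `e`; the multiple is `e d`. -/
theorem lift_period_of_hasClass (hp : FlatCover ι p) {α : Set S} {v : ℤ × ℤ}
    (hα : HasClass ι p α v) {h : ℝ → S} {h' : ℝ → ℝ × ℝ} (hh : Continuous h)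
    (hh' : Continuous h') (hh1 : ∀ t, h (t + 1) = h t) (hr : ∀ t, h t ∈ α)
    (hl : ∀ t, p (h' t) = ι (h t)) :
    ∃ k : ℤ, ∀ t, h' (t + 1) = h' t + latticePt (k • v) := by
  have := hp.t2Space
  obtain ⟨g, g', hg, hg', hg1, hinj, rfl, hgl, hgv⟩ := hα
  obtain ⟨φ, d, hφ, hφ', hφd⟩ := exists_reparam hg hh hg1 hh1 hinj hr
  have hbase : p (g' (φ 0)) = p (h' 0) := by rw [hgl, hl, hφ']
  obtain ⟨e, n, -, hy, hz⟩ := hp.exists_deck hbase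
  have heq := hp.lift_unique (c := h') (c' := fun t => (e : ℝ) • g' (φ t) + latticePt n) hh'
    (by fun_prop) (fun t => by rw [hz, hl, hgl, hφ']) (fun t => ⟨_, (hl t).symm⟩) hy
  refine ⟨e * d, fun t => ?_⟩
  have e1 : h' (t + 1) = (e : ℝ) • g' (φ (t + 1)) + latticePt n := congrFun heq (t + 1)
  have e2 : h' t = (e : ℝ) • g' (φ t) + latticePt n := congrFun heq t
  rw [e1, e2, hφd, add_int_of_add_one hgv, smul_add, mul_smul, latticePt_zsmul e]
  abel

theorem hasClass_unique (hp : FlatCover ι p) {α : Set S} {v w : ℤ × ℤ}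
    (hv : HasClass ι p α v) (hw : HasClass ι p α w) : ∃ k : ℤ, w = k • v := by
  obtain ⟨g, g', hg, hg', hg1, hinj, rfl, hgl, hgv⟩ := hw
  obtain ⟨k, hk⟩ := hp.lift_period_of_hasClass hv hg hg' hg1 (fun t => ⟨t, rfl⟩) hgl
  refine ⟨k, latticePt_injective ?_⟩
  exact add_left_cancel ((hgv 0).symm.trans (hk 0))

/-- The isotopy is lifted as a map of the plane in the parameters of time and curve; the period is
the same at all times by unique lifting. -/
theorem hasClass_of_ambientIsotopic (hp : FlatCover ι p) {α β : Set S} {v : ℤ × ℤ}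
    (hα : HasClass ι p α v) (h : AmbientIsotopic α β) : HasClass ι p β v := by
  obtain ⟨g, g', hg, hg', hg1, hinj, rfl, hgl, hgv⟩ := hα
  obtain ⟨H, hc, hh, h0, rfl⟩ := h
  let c : ℝ × ℝ → S := fun y => H (Set.projIcc 0 1 zero_le_one y.1) (g y.2)
  have hcc : Continuous c := by
    refine hc.comp (f := fun y : ℝ × ℝ => (Set.projIcc (0 : ℝ) 1 zero_le_one y.1, g y.2)) ?_
    exact (continuous_projIcc.comp continuous_fst).prodMk (hg.comp continuous_snd)
  have hc0 : ∀ t, c (0, t) = g t := by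
    intro t
    simp only [c, Set.projIcc_left]
    exact congrFun h0 (g t)
  have hc1 : ∀ t, c (1, t) = H 1 (g t) := by
    intro t
    simp only [c, Set.projIcc_right]
    rfl
  obtain ⟨L, hL, hLc, hL0⟩ := hp.exists_lift_from hcc (y₀ := (0, 0)) (x₀ := g' 0)
    (by rw [hc0, hgl])
  have hLg : (fun t : ℝ => L (0, t)) = g' :=
    hp.lift_unique (by fun_prop) hg' (fun t => by rw [hLc, hc0, hgl])
      (fun t => ⟨_, (hLc _).symm⟩) hL0
  have hper := hp.lift_period (c := c) hL hLc (σ := fun y => (y.1, y.2 + 1)) (by fun_prop)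
    (fun y => by simp only [c, hg1]) (a₀ := (0, 0)) (v := v) (by
      have := congrFun hLg
      simp only [this, hgv])
  refine ⟨fun t => H 1 (g t), fun t => L (1, t), ?_, by fun_prop, fun t => congrArg (H 1) (hg1 t), ?_, ?_,
    fun t => by rw [hLc, hc1], fun t => hper (1, t)⟩
  · exact (hh 1).continuous.comp hg
  · exact fun t t' htt => hinj t t' ((hh 1).injective htt)
  · exact Set.range_comp (H 1) g

/-- The period of the lift is constant along the homotopy, so it is `0` at the end `r₁` as well.
That end is itself a parametrization of `α`, so the zero class is a class of `α`, and uniqueness up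
to multiples gives `v = 0`. -/
theorem eq_zero_of_homotopy (hp : FlatCover ι p) {α : Set S} {v : ℤ × ℤ}
    (hα : HasClass ι p α v) {c : ℝ × ℝ → S} (hc : Continuous c)
    (hper : ∀ r t, c (r, t + 1) = c (r, t)) {r₀ r₁ : ℝ}
    (hinj : ∀ t t', c (r₁, t) = c (r₁, t') → ∃ k : ℤ, t' = t + k)
    (hr : Set.range (fun t => c (r₁, t)) = α)
    (h₀ : ∀ (l : ℝ → ℝ × ℝ) (w : ℤ × ℤ), Continuous l → (∀ t, p (l t) = ι (c (r₀, t))) →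
      (∀ t, l (t + 1) = l t + latticePt w) → w = 0) : v = 0 := by
  obtain ⟨L, hL, hLc⟩ := hp.lift c hc
  obtain ⟨k, hk⟩ := hp.lift_period_of_hasClass hα (h := fun t => c (r₁, t))
    (h' := fun t => L (r₁, t)) (by fun_prop) (by fun_prop) (hper r₁)
    (fun t => hr ▸ ⟨t, rfl⟩) (fun t => hLc _)
  have hLper := hp.lift_period (c := c) hL hLc (σ := fun y => (y.1, y.2 + 1)) (by fun_prop)
    (fun y => hper _ _) (a₀ := (r₁, 0)) (hk 0)
  have hw := h₀ (fun t => L (r₀, t)) (k • v) (by fun_prop) (fun t => hLc _)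
    (fun t => hLper (r₀, t))
  have hcl : HasClass ι p α (k • v) := ⟨fun t => c (r₁, t), fun t => L (r₁, t), by fun_prop,
    by fun_prop, hper r₁, hinj, hr, fun t => hLc _, hk⟩
  rw [hw] at hcl
  obtain ⟨j, hj⟩ := hp.hasClass_unique hcl hα
  simpa using hj

end FlatCover

/-! ### Annuli and their periodic parametrizations -/

/-- The parametrization of the circle with period one. -/
noncomputable def circlePar (t : ℝ) : Circle := Circle.exp (2 * Real.pi * t)

theorem continuous_circlePar : Continuous circlePar := by
  unfold circlePar
  fun_prop

theorem circlePar_eq_iff {t t' : ℝ} : circlePar t = circlePar t' ↔ ∃ k : ℤ, t' = t + k := by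
  unfold circlePar
  rw [eq_comm, Circle.exp_eq_exp]
  have := Real.pi_pos
  refine exists_congr fun k => ?_
  constructor
  · intro h
    have : 2 * Real.pi * (t' - (t + k)) = 0 := by linarith
    have := (mul_eq_zero.1 this).resolve_left (by positivity)
    linarith
  · rintro rfl
    ring

theorem circlePar_add_one (t : ℝ) : circlePar (t + 1) = circlePar t :=
  (circlePar_eq_iff.2 ⟨1, by simp⟩).symm

theorem circlePar_surjective : Function.Surjective circlePar := by
  intro z
  refine ⟨Complex.arg z / (2 * Real.pi), ?_⟩
  unfold circlePar
  rw [mul_div_cancel₀ _ (by have := Real.pi_pos; positivity)]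
  exact Circle.exp_arg z

theorem isOpenMap_circlePar : IsOpenMap circlePar := by
  have h1 : IsOpenMap (fun t : ℝ => 2 * Real.pi * t) :=
    (Homeomorph.mulLeft₀ (2 * Real.pi) (by have := Real.pi_pos; positivity)).isOpenMap
  exact isLocalHomeomorph_circleExp.isOpenMap.comp h1

theorem isOpenQuotientMap_circlePar_prod :
    IsOpenQuotientMap (fun y : ℝ × ℝ => (circlePar y.1, y.2)) where
  surjective := by
    rintro ⟨z, s⟩
    obtain ⟨t, rfl⟩ := circlePar_surjective z
    exact ⟨(t, s), rfl⟩
  continuous := (continuous_circlePar.comp continuous_fst).prodMk continuous_snd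
  isOpenMap := isOpenMap_circlePar.prodMap IsOpenMap.id

/-- `F` is a periodic parametrization of an open annulus embedded in `S`. -/
structure IsCollar {S : Type*} [TopologicalSpace S] (F : ℝ × ℝ → S) : Prop where
  cont : Continuous F
  isOpenMap : IsOpenMap F
  periodic : ∀ t s, F (t + 1, s) = F (t, s)
  inj : ∀ t s t' s', F (t, s) = F (t', s') → s' = s ∧ ∃ k : ℤ, t' = t + k

theorem IsCollar.of_isOpenEmbedding {S : Type*} [TopologicalSpace S] {f : Circle × ℝ → S}
    (hf : IsOpenEmbedding f) : IsCollar (fun y : ℝ × ℝ => f (circlePar y.1, y.2)) where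
  cont := hf.continuous.comp isOpenQuotientMap_circlePar_prod.continuous
  isOpenMap := hf.isOpenMap.comp isOpenQuotientMap_circlePar_prod.isOpenMap
  periodic t s := by simp only [circlePar_add_one]
  inj t s t' s' h := by
    have := Prod.ext_iff.1 (hf.injective h)
    exact ⟨this.2.symm, circlePar_eq_iff.1 this.1⟩

theorem IsCollar.isSimpleClosedCurve {S : Type*} [TopologicalSpace S] {F : ℝ × ℝ → S}
    (hF : IsCollar F) : IsSimpleClosedCurve (Set.range fun t => F (t, 0)) := by
  choose τ hτ using circlePar_surjective
  have hper : ∀ t s (k : ℤ), F (t + k, s) = F (t, s) := by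
    intro t s k
    have : Function.Periodic (fun t => F (t, s)) 1 := fun t => hF.periodic t s
    simpa using this.int_mul k t
  let f : Circle × ℝ → S := fun z => F (τ z.1, z.2)
  have hfE : ∀ t s, f (circlePar t, s) = F (t, s) := by
    intro t s
    obtain ⟨k, hk⟩ := circlePar_eq_iff.1 (hτ (circlePar t))
    simp only [f]
    conv_rhs => rw [hk, hper]
  have hfF : f ∘ (fun y : ℝ × ℝ => (circlePar y.1, y.2)) = F := by
    funext ⟨t, s⟩
    exact hfE t s
  have hcont : Continuous f := by
    rw [isOpenQuotientMap_circlePar_prod.isQuotientMap.continuous_iff, hfF]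
    exact hF.cont
  have hinj : Function.Injective f := by
    rintro ⟨z, s⟩ ⟨z', s'⟩ h
    obtain ⟨t, rfl⟩ := circlePar_surjective z
    obtain ⟨t', rfl⟩ := circlePar_surjective z'
    rw [hfE, hfE] at h
    obtain ⟨rfl, h'⟩ := hF.inj _ _ _ _ h
    rw [circlePar_eq_iff.2 h']
  have hopen : IsOpenMap f := by
    intro U hU
    have : f '' U = F '' ((fun y : ℝ × ℝ => (circlePar y.1, y.2)) ⁻¹' U) := by
      rw [← hfF, Set.image_comp, Set.image_preimage_eq _
        isOpenQuotientMap_circlePar_prod.surjective]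
    rw [this]
    exact hF.isOpenMap _ (hU.preimage isOpenQuotientMap_circlePar_prod.continuous)
  refine ⟨f, .of_continuous_injective_isOpenMap hcont hinj hopen, ?_⟩
  ext x
  constructor
  · rintro ⟨⟨z, s⟩, ⟨-, hs⟩, rfl⟩
    obtain rfl : s = 0 := hs
    obtain ⟨t, rfl⟩ := circlePar_surjective z
    exact ⟨t, (hfE t 0).symm⟩
  · rintro ⟨t, rfl⟩
    exact ⟨(circlePar t, 0), ⟨trivial, rfl⟩, hfE t 0⟩

/-! ### Essential curves -/

/-- `x` lies on none of the lines on which a coordinate is congruent to `3 / 8`. -/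
def OffGrid (x : ℝ × ℝ) : Prop := ∀ m : ℤ, x.1 ≠ m + 3 / 8 ∧ x.2 ≠ m + 3 / 8

theorem exists_eq_int_add_of_period {f : ℝ → ℝ} (hf : Continuous f) {k : ℤ} (hk : k ≠ 0)
    (h : ∀ t, f (t + 1) = f t + k) (a : ℝ) : ∃ t, ∃ m : ℤ, f t = m + a := by
  have h1 := h 0
  rw [zero_add] at h1
  have hivt := intermediate_value_uIcc (a := 0) (b := 1) hf.continuousOn
  have hint : ∃ m : ℤ, (m + a : ℝ) ∈ Set.uIcc (f 0) (f 1) := by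
    rcases lt_or_gt_of_ne hk with hk | hk
    · have hk : (k : ℝ) ≤ -1 := by exact_mod_cast Int.le_sub_one_of_lt hk
      refine ⟨⌈f 1 - a⌉, ?_⟩
      have e1 := Int.le_ceil (f 1 - a)
      have e2 := Int.ceil_lt_add_one (f 1 - a)
      rw [Set.mem_uIcc]
      right
      constructor <;> linarith
    · have hk : (1 : ℝ) ≤ k := by exact_mod_cast hk
      refine ⟨⌈f 0 - a⌉, ?_⟩
      have e1 := Int.le_ceil (f 0 - a)
      have e2 := Int.ceil_lt_add_one (f 0 - a)
      rw [Set.mem_uIcc]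
      left
      constructor <;> linarith
  obtain ⟨m, hm⟩ := hint
  obtain ⟨t, -, ht⟩ := hivt hm
  exact ⟨t, m, ht⟩

/-- A coordinate with a non-zero integral period takes values in every residue class modulo `1`,
among them that of `3 / 8`. -/
theorem eq_zero_of_offGrid {l : ℝ → ℝ × ℝ} {w : ℤ × ℤ} (hl : Continuous l)
    (hw : ∀ t, l (t + 1) = l t + latticePt w) (h : ∀ t, OffGrid (l t)) : w = 0 := by
  by_contra hw0
  have : w.1 ≠ 0 ∨ w.2 ≠ 0 := by
    by_contra! hc
    exact hw0 (Prod.ext hc.1 hc.2)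
  rcases this with hk | hk
  · obtain ⟨t, m, htm⟩ := exists_eq_int_add_of_period (f := fun t => (l t).1) (by fun_prop) hk
      (fun t => by simp [hw]) (3 / 8)
    exact (h t m).1 htm
  · obtain ⟨t, m, htm⟩ := exists_eq_int_add_of_period (f := fun t => (l t).2) (by fun_prop) hk
      (fun t => by simp [hw]) (3 / 8)
    exact (h t m).2 htm

namespace FlatCover

variable {S X : Type*} [TopologicalSpace S] [TopologicalSpace X] {ι : S → X} {p : ℝ × ℝ → X}

/-- At an interior point `p` is injective and open on a small open set that lands in the surface, so
it can be inverted there. -/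
theorem exists_chart (hp : FlatCover ι p) {x : ℝ × ℝ} {s : S} (hxs : p x = ι s)
    (hx : Set.range ι ∈ 𝓝 (p x)) {W : Set (ℝ × ℝ)} (hW : W ∈ 𝓝 x) :
    ∃ e : OpenPartialHomeomorph S (ℝ × ℝ), s ∈ e.source ∧ e s = x ∧
      (∀ y ∈ e.source, p (e y) = ι y) ∧ e.target ⊆ W := by
  have : Nonempty S := ⟨s⟩
  obtain ⟨V₀, hV₀, hinj⟩ := hp.locInj x (hxs ▸ ⟨s, rfl⟩)
  obtain ⟨V, hVsub, hVo, hxV⟩ := mem_nhds_iff.1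
    (Filter.inter_mem (Filter.inter_mem hV₀ hW) (hp.cont.continuousAt.preimage_mem_nhds hx))
  let j : ℝ × ℝ → S := fun z => Function.invFun ι (p z)
  have hj : ∀ z ∈ V, ι (j z) = p z := fun z hz => Function.invFun_eq (hVsub hz).2
  have hjinj : Set.InjOn j V := by
    intro a ha b hb hab
    refine hinj (hVsub ha).1.1 (hVsub hb).1.1 ?_
    rw [← hj a ha, ← hj b hb, hab]
  have hjc : ContinuousOn j V := by
    rw [hp.emb.continuousOn_iff]
    exact hp.cont.continuousOn.congr hj
  have hjo : IsOpenMap (V.domRestrict j) := by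
    intro U hU
    obtain ⟨U', hU', rfl⟩ := isOpen_induced_iff.1 hU
    have : V.domRestrict j '' (Subtype.val ⁻¹' U') = ι ⁻¹' (p '' (V ∩ U')) := by
      ext y
      constructor
      · rintro ⟨⟨z, hz⟩, hzU, rfl⟩
        exact ⟨z, ⟨hz, hzU⟩, (hj z hz).symm⟩
      · rintro ⟨z, ⟨hz, hzU⟩, hzy⟩
        exact ⟨⟨z, hz⟩, hzU, hp.emb.injective ((hj z hz).trans hzy)⟩
    rw [this]
    exact (hp.isOpenMap _ (hVo.inter hU')).preimage hp.emb.continuous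
  let pe := hjinj.toPartialEquiv
  let e := OpenPartialHomeomorph.ofContinuousOpenRestrict pe hjc hjo hVo
  have hjs : j x = s := hp.emb.injective ((hj x hxV).trans hxs)
  have hsrc : ∀ y ∈ e.symm.source, e.symm y ∈ V ∧ j (e.symm y) = y := by
    intro y hy
    have h1 : e.symm y ∈ e.source := e.map_target hy
    exact ⟨h1, e.right_inv hy⟩
  have hxe : x ∈ e.source := hxV
  refine ⟨e.symm, ?_, ?_, ?_, ?_⟩
  · rw [← hjs]; exact e.map_source hxe
  · have := e.left_inv hxe
    change e.symm (j x) = x at this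
    rwa [hjs] at this
  · intro y hy
    obtain ⟨h1, h2⟩ := hsrc y hy
    rw [← hj _ h1, h2]
  · intro z hz
    exact (hVsub hz).1.2

theorem range_mem_nhds_of_not_offGrid (hp : FlatCover ι p) {x : ℝ × ℝ} (hx : ¬ OffGrid x) :
    Set.range ι ∈ 𝓝 (p x) := by
  unfold OffGrid at hx
  push Not at hx
  obtain ⟨m, hm⟩ := hx
  apply hp.range_mem_nhds
  by_cases h : x.1 = m + 3 / 8
  · left; exact ⟨m, by rw [h]; norm_num⟩
  · right; exact ⟨m, by rw [hm h]; norm_num⟩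

/-- Points over the grid have planar charts, so they are not boundary points. -/
theorem offGrid_of_mem_surfaceBoundary (hp : FlatCover ι p) {s : S} (hs : s ∈ surfaceBoundary S)
    {x : ℝ × ℝ} (hx : p x = ι s) : OffGrid x := by
  by_contra h
  obtain ⟨e, he, -⟩ := hp.exists_chart hx (hp.range_mem_nhds_of_not_offGrid h) Filter.univ_mem
  exact hs ⟨e, he⟩

/-- The image of the grid is compact. -/
theorem exists_compact_grid (hp : FlatCover ι p) :
    ∃ K : Set S, IsCompact K ∧ ∀ s ∉ K, ∀ x, p x = ι s → OffGrid x := by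
  let G : Set (ℝ × ℝ) := {3 / 8} ×ˢ Set.Icc 0 1 ∪ Set.Icc 0 1 ×ˢ {3 / 8}
  have hG : IsCompact G :=
    (isCompact_singleton.prod isCompact_Icc).union (isCompact_Icc.prod isCompact_singleton)
  have hC := hG.image hp.cont
  refine ⟨ι ⁻¹' (p '' G), hp.emb.isInducing.isCompact_preimage' hC ?_, ?_⟩
  · rintro _ ⟨x, hx, rfl⟩
    refine mem_of_mem_nhds (hp.range_mem_nhds_of_not_offGrid fun h => ?_)
    have := h 0
    rcases hx with ⟨h1, -⟩ | ⟨-, h1⟩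
    · exact this.1 (by simpa using h1)
    · exact this.2 (by simpa using h1)
  · intro s hs x hx
    by_contra h
    apply hs
    rw [Set.mem_preimage, ← hx]
    unfold OffGrid at h
    push Not at h
    obtain ⟨m, hm⟩ := h
    by_cases h1 : x.1 = m + 3 / 8
    · refine ⟨x + latticePt (-m, -⌊x.2⌋), Or.inl ⟨?_, ?_⟩, hp.periodic _ _⟩
      · simp [h1]
      · have := Int.fract_nonneg x.2
        have := Int.fract_lt_one x.2
        unfold Int.fract at *
        simp only [Prod.snd_add, latticePt_snd, Int.cast_neg, Set.mem_Icc]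
        constructor <;> linarith
    · have h2 := hm h1
      refine ⟨x + latticePt (-⌊x.1⌋, -m), Or.inr ⟨?_, ?_⟩, hp.periodic _ _⟩
      · have := Int.fract_nonneg x.1
        have := Int.fract_lt_one x.1
        unfold Int.fract at *
        simp only [Prod.fst_add, latticePt_fst, Int.cast_neg, Set.mem_Icc]
        constructor <;> linarith
      · simp [h2]

/-- The concentric circles of the disk contract the curve to a point, and every lift of a constant
path is constant. -/
theorem not_boundsDisk (hp : FlatCover ι p) {α : Set S} {v : ℤ × ℤ} (hα : HasClass ι p α v)
    (hv : v ≠ 0) : ¬ BoundsDisk α := by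
  rintro ⟨d, hd, rfl⟩
  let w : ℝ × ℝ → {z : ℂ // ‖z‖ ≤ 1} := fun y =>
    ⟨((Set.projIcc (0 : ℝ) 1 zero_le_one y.1 : ℝ) : ℂ) * circlePar y.2, by
      have := (Set.projIcc (0 : ℝ) 1 zero_le_one y.1).2
      rw [norm_mul, Circle.norm_coe, mul_one, Complex.norm_real, Real.norm_of_nonneg this.1]
      exact this.2⟩
  have hw : Continuous w := by
    refine Continuous.subtype_mk ?_ _
    refine (Complex.continuous_ofReal.comp (continuous_subtype_val.comp
      (continuous_projIcc.comp continuous_fst))).mul ?_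
    exact continuous_subtype_val.comp (continuous_circlePar.comp continuous_snd)
  have hw1 : ∀ t, (w (1, t) : ℂ) = circlePar t := by intro t; simp [w]
  have hw0 : ∀ t, w (0, t) = w (0, 0) := by intro t; ext; simp [w]
  apply hv
  refine hp.eq_zero_of_homotopy hα (hd.continuous.comp hw) (r₀ := 0) (r₁ := 1) ?_ ?_ ?_ ?_
  · intro r t
    simp only [Function.comp_apply, w, circlePar_add_one]
  · intro t t' h
    have h1 := congrArg Subtype.val (hd.injective h)
    rw [hw1, hw1] at h1
    exact circlePar_eq_iff.1 (Circle.ext h1)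
  · ext x
    constructor
    · rintro ⟨t, rfl⟩
      exact ⟨w (1, t), by
        rw [Set.mem_ofPred_eq, hw1, Circle.norm_coe], rfl⟩
    · rintro ⟨z, hz, rfl⟩
      obtain ⟨t, ht⟩ := circlePar_surjective ⟨z, by simpa [Submonoid.unitSphere] using hz⟩
      refine ⟨t, congrArg d (Subtype.ext ?_)⟩
      rw [hw1, ht]
  · intro l u hl hlp hlu
    have hconst := hp.lift_unique (c := l) (c' := fun _ => l 0) hl continuous_const
      (fun t => by rw [hlp, hlp]; simp only [Function.comp_apply, hw0 t])
      (fun t => ⟨_, (hlp t).symm⟩) (a₀ := 0) rfl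
    have h1 := hlu 0
    rw [congrFun hconst (0 + 1), left_eq_add] at h1
    exact latticePt_injective (h1.trans latticePt_zero.symm)

/-- The disk is a closed subset, so the compact image of the grid meets it in a compact set, which
stays away from the puncture. Hence small circles around the puncture avoid the grid and have zero
period. -/
theorem not_boundsPuncturedDisk (hp : FlatCover ι p) {α : Set S} {v : ℤ × ℤ}
    (hα : HasClass ι p α v) (hv : v ≠ 0) : ¬ BoundsPuncturedDisk α := by
  rintro ⟨d, hd, rfl⟩
  -- The exponential keeps the radius positive; the parameter `0` gives the boundary circle and `log
  -- (δ / 2)` a circle inside the `δ`-disk.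
  let w : ℝ × ℝ → {z : ℂ // 0 < ‖z‖ ∧ ‖z‖ ≤ 1} := fun y =>
    ⟨((min 1 (Real.exp y.1) : ℝ) : ℂ) * circlePar y.2, by
      have h : 0 < min 1 (Real.exp y.1) := lt_min one_pos (Real.exp_pos _)
      rw [norm_mul, Circle.norm_coe, mul_one, Complex.norm_real, Real.norm_of_nonneg h.le]
      exact ⟨h, min_le_left _ _⟩⟩
  have hwn : ∀ y, ‖(w y : ℂ)‖ = min 1 (Real.exp y.1) := by
    intro y
    have h : 0 < min 1 (Real.exp y.1) := lt_min one_pos (Real.exp_pos _)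
    change ‖((min 1 (Real.exp y.1) : ℝ) : ℂ) * circlePar y.2‖ = _
    rw [norm_mul, Circle.norm_coe, mul_one, Complex.norm_real, Real.norm_of_nonneg h.le]
  have hw : Continuous w := by
    refine Continuous.subtype_mk ?_ _
    refine (Complex.continuous_ofReal.comp (by fun_prop)).mul ?_
    exact continuous_subtype_val.comp (continuous_circlePar.comp continuous_snd)
  have hw1 : ∀ t, (w (0, t) : ℂ) = circlePar t := by intro t; simp [w]
  obtain ⟨K, hK, hKg⟩ := hp.exists_compact_grid
  have hKd := hd.isCompact_preimage hK
  have hN : IsCompact ((fun z : {z : ℂ // 0 < ‖z‖ ∧ ‖z‖ ≤ 1} => ‖(z : ℂ)‖) '' (d ⁻¹' K)) :=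
    hKd.image (by fun_prop)
  have h0 : (0 : ℝ) ∉ (fun z : {z : ℂ // 0 < ‖z‖ ∧ ‖z‖ ≤ 1} => ‖(z : ℂ)‖) '' (d ⁻¹' K) := by
    rintro ⟨z, -, hz⟩
    exact z.2.1.ne' hz
  obtain ⟨δ, hδ, hδN⟩ := Metric.isOpen_iff.1 hN.isClosed.isOpen_compl 0 h0
  apply hv
  refine hp.eq_zero_of_homotopy hα (hd.continuous.comp hw) (r₀ := Real.log (δ / 2)) (r₁ := 0)
    ?_ ?_ ?_ ?_
  · intro r t
    simp only [Function.comp_apply, w, circlePar_add_one]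
  · intro t t' h
    have h1 := congrArg Subtype.val (hd.injective h)
    rw [hw1, hw1] at h1
    exact circlePar_eq_iff.1 (Circle.ext h1)
  · ext x
    constructor
    · rintro ⟨t, rfl⟩
      exact ⟨w (0, t), by
        rw [Set.mem_ofPred_eq, hw1, Circle.norm_coe], rfl⟩
    · rintro ⟨z, hz, rfl⟩
      obtain ⟨t, ht⟩ := circlePar_surjective ⟨z, by simpa [Submonoid.unitSphere] using hz⟩
      refine ⟨t, congrArg d (Subtype.ext ?_)⟩
      rw [hw1, ht]
  · intro l u hl hlp hlu
    refine eq_zero_of_offGrid hl hlu fun t => hKg _ ?_ _ (hlp t)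
    intro hmem
    have h2 : min 1 (δ / 2) ∈ Metric.ball (0 : ℝ) δ := by
      rw [Metric.mem_ball, dist_zero_right, Real.norm_of_nonneg (by positivity)]
      exact (min_le_right _ _).trans_lt (by linarith)
    refine hδN h2 ⟨w (Real.log (δ / 2), t), hmem, ?_⟩
    simp only [hwn]
    rw [Real.exp_log (by positivity)]

/-- The annulus moves the curve into the boundary, whose lifts avoid the grid. -/
theorem not_isBoundaryParallel (hp : FlatCover ι p) {α : Set S} {v : ℤ × ℤ}
    (hα : HasClass ι p α v) (hv : v ≠ 0) : ¬ IsBoundaryParallel α := by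
  rintro ⟨h, hh, rfl, x, -, hx⟩
  let w : ℝ × ℝ → Circle × unitInterval := fun y =>
    (circlePar y.2, Set.projIcc (0 : ℝ) 1 zero_le_one y.1)
  have hw : Continuous w :=
    (continuous_circlePar.comp continuous_snd).prodMk (continuous_projIcc.comp continuous_fst)
  apply hv
  refine hp.eq_zero_of_homotopy hα (hh.continuous.comp hw) (r₀ := 1) (r₁ := 0) ?_ ?_ ?_ ?_
  · intro r t
    simp only [Function.comp_apply, w, circlePar_add_one]
  · intro t t' htt
    exact circlePar_eq_iff.1 (Prod.ext_iff.1 (hh.injective htt)).1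
  · ext y
    constructor
    · rintro ⟨t, rfl⟩
      refine ⟨w (0, t), ⟨trivial, ?_⟩, rfl⟩
      simp [w]
    · rintro ⟨⟨z, r⟩, ⟨-, hr⟩, rfl⟩
      obtain rfl : r = 0 := hr
      obtain ⟨t, rfl⟩ := circlePar_surjective z
      exact ⟨t, by simp [w]⟩
  · intro l u hl hlp hlu
    refine eq_zero_of_offGrid hl hlu fun t =>
      hp.offGrid_of_mem_surfaceBoundary ?_ (hlp t)
    apply connectedComponentIn_subset (surfaceBoundary S) x
    rw [← hx]
    refine ⟨w (1, t), ⟨trivial, ?_⟩, rfl⟩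
    simp [w]

theorem isEssentialCurve (hp : FlatCover ι p) {α : Set S} {v : ℤ × ℤ}
    (hs : IsSimpleClosedCurve α) (hα : HasClass ι p α v) (hv : v ≠ 0) : IsEssentialCurve α where
  isSimpleClosedCurve := hs
  not_boundsDisk := hp.not_boundsDisk hα hv
  not_boundsPuncturedDisk := hp.not_boundsPuncturedDisk hα hv
  not_isBoundaryParallel := hp.not_isBoundaryParallel hα hv

end FlatCover

/-! ### The twist homeomorphism -/

theorem continuous_bump : Continuous bump := by
  unfold bump
  fun_prop

theorem bump_neg (t : ℝ) : bump (-t) = -bump t := by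
  unfold bump
  rw [mul_neg, Real.sin_neg, Real.arcsin_neg]
  ring

theorem bump_add_int (t : ℝ) (k : ℤ) : bump (t + k) = bump t + k := by
  unfold bump
  rw [show 2 * Real.pi * (t + k) = 2 * Real.pi * t + k * (2 * Real.pi) by ring,
    Real.sin_add_int_mul_two_pi]
  ring

/-- This makes `twist` a mere exchange of coordinates on the torus near the origin, so that it
preserves the square hole. -/
theorem bump_of_abs_le {t : ℝ} (ht : |t| ≤ 1 / 4) : bump t = 0 := by
  have hpi := Real.pi_pos
  have := abs_le.1 ht
  unfold bump
  rw [Real.arcsin_sin (by nlinarith) (by nlinarith)]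
  field_simp
  ring

/-- This value locates the intersection of the base curve with its image: the condition `t - 3/4 ≡ ±
3/8` modulo `1` reads `t ≡ 1/8` or `t ≡ 3/8`. -/
theorem bump_three_eighths : bump (3 / 8) = 1 / 4 := by
  have hpi := Real.pi_pos
  unfold bump
  rw [← Real.sin_pi_sub, Real.arcsin_sin (by nlinarith) (by nlinarith)]
  field_simp
  ring

/-- On the half-lattice `twist` is therefore linear and integral, so it permutes the punctures of
the sphere. -/
theorem bump_half (k : ℤ) : bump (k / 2) = k / 2 := by
  unfold bump
  rw [show 2 * Real.pi * ((k : ℝ) / 2) = k * Real.pi by ring, Real.sin_int_mul_pi]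
  simp

/-- `twist` as a homeomorphism. -/
noncomputable def twistHomeo : (ℝ × ℝ) ≃ₜ (ℝ × ℝ) where
  toFun := twist
  invFun y := (y.2 - 3 * bump y.1, y.1)
  left_inv x := by simp [twist]
  right_inv x := by simp [twist]
  continuous_toFun := by
    have := continuous_bump
    unfold twist
    fun_prop
  continuous_invFun := by
    have := continuous_bump
    fun_prop

/-- The action of `twist` on the integer lattice. -/
def twistLattice (n : ℤ × ℤ) : ℤ × ℤ := (n.2, n.1 + 3 * n.2)

theorem twist_add (x : ℝ × ℝ) (n : ℤ × ℤ) :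
    twist (x + latticePt n) = twist x + latticePt (twistLattice n) := by
  ext
  · simp [twist, twistLattice]
  · simp [twist, twistLattice, bump_add_int]
    ring

theorem twist_neg (x : ℝ × ℝ) : twist (-x) = -twist x := by
  ext
  · simp [twist]
  · simp [twist, bump_neg]
    ring

theorem exists_twistLattice_eq (n : ℤ × ℤ) : ∃ m, twistLattice m = n :=
  ⟨(n.2 - 3 * n.1, n.1), by simp [twistLattice]⟩

theorem IsSimpleClosedCurve.image {S S' : Type*} [TopologicalSpace S] [TopologicalSpace S']
    {α : Set S} (h : IsSimpleClosedCurve α) (T : S ≃ₜ S') : IsSimpleClosedCurve (T '' α) := by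
  obtain ⟨f, hf, rfl⟩ := h
  exact ⟨T ∘ f, T.isOpenEmbedding.comp hf, Set.image_comp _ _ _⟩

theorem CrossAt.symm {S : Type*} [TopologicalSpace S] {α β : Set S} {x : S}
    (h : CrossAt α β x) : CrossAt β α x := by
  obtain ⟨e, hx, h0, h⟩ := h
  refine ⟨e.transHomeomorph (Homeomorph.prodComm ℝ ℝ), hx, ?_, fun y hy => ?_⟩
  · simp [h0]
  · exact (h y hy).symm

theorem MeetTransversely.symm {S : Type*} [TopologicalSpace S] {k : ℕ} {α β : Set S}
    (h : MeetTransversely k α β) : MeetTransversely k β α := by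
  rw [MeetTransversely, Set.inter_comm]
  exact ⟨h.1, fun x hx => (h.2 x hx).symm⟩

theorem CrossAt.image {S S' : Type*} [TopologicalSpace S] [TopologicalSpace S'] {α β : Set S}
    {x : S} (h : CrossAt α β x) (T : S ≃ₜ S') : CrossAt (T '' α) (T '' β) (T x) := by
  obtain ⟨e, hx, h0, h⟩ := h
  refine ⟨T.symm.transOpenPartialHomeomorph e, by simpa using hx, by simpa using h0,
    fun y hy => ?_⟩
  have := h (T.symm y) (by simpa using hy)
  have hmem : ∀ γ : Set S, y ∈ T '' γ ↔ T.symm y ∈ γ := fun γ => by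
    rw [T.image_eq_preimage_symm]; rfl
  rw [hmem, hmem]
  exact this

theorem MeetTransversely.image {S S' : Type*} [TopologicalSpace S] [TopologicalSpace S'] {k : ℕ}
    {α β : Set S} (h : MeetTransversely k α β) (T : S ≃ₜ S') :
    MeetTransversely k (T '' α) (T '' β) := by
  rw [MeetTransversely, ← Set.image_inter T.injective, T.injective.encard_image]
  refine ⟨h.1, ?_⟩
  rintro _ ⟨x, hx, rfl⟩
  exact (h.2 x hx).image T

/-- A homeomorphism from the line onto the interval `(-1/8, 1/8)`. -/
noncomputable def squeeze (s : ℝ) : ℝ := Real.arctan s / (4 * Real.pi)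

theorem squeeze_at_zero : squeeze 0 = 0 := by simp [squeeze]

theorem abs_squeeze_lt (s : ℝ) : |squeeze s| < 1 / 8 := by
  have hpi := Real.pi_pos
  have h1 := Real.neg_pi_div_two_lt_arctan s
  have h2 := Real.arctan_lt_pi_div_two s
  rw [squeeze, abs_lt, lt_div_iff₀ (by positivity), div_lt_iff₀ (by positivity)]
  constructor <;> linarith

theorem isOpenEmbedding_squeeze : IsOpenEmbedding squeeze := by
  have hpi := Real.pi_pos
  have h1 : IsOpenEmbedding Real.arctan := by
    have := Real.tanPartialHomeomorph.symm.isOpenEmbedding rfl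
    exact this
  have h2 := (Homeomorph.mulRight₀ (1 / (4 * Real.pi)) (by positivity)).isOpenEmbedding.comp h1
  convert h2 using 1
  funext s
  simp [squeeze, div_eq_mul_inv]

namespace FlatCover

variable {S X : Type*} [TopologicalSpace S] [TopologicalSpace X] {ι : S → X} {p : ℝ × ℝ → X}

theorem twist_eq_iff (hp : FlatCover ι p) {x y : ℝ × ℝ} : p (twist x) = p (twist y) ↔ p x = p y := by
  constructor
  · intro h
    rcases hp.fiber _ _ h with ⟨n, hn⟩ | ⟨he, n, hn⟩
    · obtain ⟨m, rfl⟩ := exists_twistLattice_eq n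
      rw [← twist_add] at hn
      rw [twistHomeo.injective hn, hp.periodic]
    · obtain ⟨m, rfl⟩ := exists_twistLattice_eq n
      rw [← twist_neg, ← twist_add] at hn
      rw [twistHomeo.injective hn, hp.periodic, he]
  · intro h
    rcases hp.fiber _ _ h with ⟨n, rfl⟩ | ⟨he, n, rfl⟩
    · rw [twist_add, hp.periodic]
    · rw [twist_add, hp.periodic, twist_neg, he]

/-- Since `twist` normalizes the deck group, it and its inverse descend to the quotient, and both
preserve the subsurface. -/
theorem exists_twist (hp : FlatCover ι p) :
    ∃ T : S ≃ₜ S, ∀ s x, p x = ι s → p (twist x) = ι (T s) := by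
  have hq : IsOpenQuotientMap p := ⟨hp.surj, hp.cont, hp.isOpenMap⟩
  choose r hr using hp.surj
  let TX : X → X := fun z => p (twist (r z))
  have hTX : ∀ x, TX (p x) = p (twist x) := fun x => hp.twist_eq_iff.2 (hr _)
  let TX' : X → X := fun z => p (twistHomeo.symm (r z))
  have hTX' : ∀ x, TX' (p x) = p (twistHomeo.symm x) := by
    intro x
    refine hp.twist_eq_iff.1 ?_
    change p (twistHomeo (twistHomeo.symm _)) = p (twistHomeo (twistHomeo.symm _))
    rw [Homeomorph.apply_symm_apply, Homeomorph.apply_symm_apply, hr]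
  have hc : Continuous TX := by
    rw [hq.isQuotientMap.continuous_iff]
    have : TX ∘ p = p ∘ twistHomeo := funext hTX
    rw [this]
    exact hp.cont.comp twistHomeo.continuous
  have hc' : Continuous TX' := by
    rw [hq.isQuotientMap.continuous_iff]
    have : TX' ∘ p = p ∘ twistHomeo.symm := funext hTX'
    rw [this]
    exact hp.cont.comp twistHomeo.symm.continuous
  have hinv : ∀ z, TX (TX' z) = z := by
    intro z
    obtain ⟨x, rfl⟩ := hp.surj z
    rw [hTX', hTX]
    exact congrArg p (twistHomeo.apply_symm_apply x)
  have hinv' : ∀ z, TX' (TX z) = z := by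
    intro z
    obtain ⟨x, rfl⟩ := hp.surj z
    rw [hTX, hTX']
    exact congrArg p (twistHomeo.symm_apply_apply x)
  have hr1 : ∀ s, TX (ι s) ∈ Set.range ι := by
    intro s
    obtain ⟨x, hx⟩ := hp.surj (ι s)
    rw [← hx, hTX, hp.twist_mem, hx]
    exact ⟨s, rfl⟩
  have hr2 : ∀ s, TX' (ι s) ∈ Set.range ι := by
    intro s
    obtain ⟨x, hx⟩ := hp.surj (ι s)
    rw [← hx, hTX', ← hp.twist_mem]
    change p (twistHomeo (twistHomeo.symm x)) ∈ _
    rw [Homeomorph.apply_symm_apply, hx]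
    exact ⟨s, rfl⟩
  choose T hT using hr1
  choose T' hT' using hr2
  refine ⟨⟨⟨T, T', fun s => hp.emb.injective ?_, fun s => hp.emb.injective ?_⟩, ?_, ?_⟩, ?_⟩
  · rw [hT', hT, hinv']
  · rw [hT, hT', hinv]
  · refine hp.emb.continuous_iff.2 ?_
    exact (hc.comp hp.emb.continuous).congr fun s => (hT s).symm
  · refine hp.emb.continuous_iff.2 ?_
    exact (hc'.comp hp.emb.continuous).congr fun s => (hT' s).symm
  · intro s x hx
    change _ = ι (T s)
    rw [hT, ← hx, hTX]

/-- The collar is the vertical strip over `(1/4, 1/2)`. It misses the hole and the half-lattice, and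
modulo the lattice it is disjoint from its negative, so it embeds in both quotients. -/
theorem exists_base_collar (hp : FlatCover ι p) :
    ∃ F : ℝ × ℝ → S, IsCollar F ∧ ∀ t s, ι (F (t, s)) = p (3 / 8 + squeeze s, t) := by
  have hr : ∀ y : ℝ × ℝ, p (3 / 8 + squeeze y.2, y.1) ∈ Set.range ι := by
    intro y
    refine mem_of_mem_nhds (hp.range_mem_nhds _ (Or.inl ⟨0, ?_⟩))
    simpa using abs_squeeze_lt y.2
  choose F hF using hr
  have hsq := isOpenEmbedding_squeeze
  have hsqc := hsq.continuous
  refine ⟨F, ⟨?_, ?_, ?_, ?_⟩, fun t s => hF _⟩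
  · refine hp.emb.continuous_iff.2 ?_
    refine Continuous.congr ?_ fun y => (hF y).symm
    exact hp.cont.comp (by fun_prop)
  · have hm : IsOpenMap (fun y : ℝ × ℝ => (3 / 8 + squeeze y.2, y.1)) := by
      have h1 : IsOpenMap (fun s => 3 / 8 + squeeze s) :=
        (Homeomorph.addLeft (3 / 8 : ℝ)).isOpenMap.comp hsq.isOpenMap
      exact (h1.prodMap IsOpenMap.id).comp (Homeomorph.prodComm ℝ ℝ).isOpenMap
    intro U hU
    have : F '' U = ι ⁻¹' (p '' ((fun y : ℝ × ℝ => (3 / 8 + squeeze y.2, y.1)) '' U)) := by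
      ext s
      constructor
      · rintro ⟨y, hy, rfl⟩
        exact ⟨_, ⟨y, hy, rfl⟩, (hF y).symm⟩
      · rintro ⟨_, ⟨y, hy, rfl⟩, h⟩
        exact ⟨y, hy, hp.emb.injective ((hF y).trans h)⟩
    rw [this]
    exact (hp.isOpenMap _ (hm _ hU)).preimage hp.emb.continuous
  · intro t s
    apply hp.emb.injective
    rw [hF, hF]
    conv_rhs => rw [← hp.periodic _ (0, 1)]
    congr 1
    ext <;> simp
  · intro t s t' s' h
    have h := congrArg ι h
    rw [hF, hF] at h
    have b1 := abs_lt.1 (abs_squeeze_lt s)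
    have b2 := abs_lt.1 (abs_squeeze_lt s')
    rcases hp.fiber _ _ h with ⟨n, hn⟩ | ⟨he, n, hn⟩
    · have e1 := congrArg Prod.fst hn
      have e2 := congrArg Prod.snd hn
      simp only [Prod.fst_add, Prod.snd_add, latticePt_fst, latticePt_snd] at e1 e2
      have hn1 : n.1 = 0 := by
        have h1 : (n.1 : ℝ) < 1 := by linarith
        have h2 : (-1 : ℝ) < n.1 := by linarith
        have h1 : n.1 < 1 := by exact_mod_cast h1
        have h2 : -1 < n.1 := by exact_mod_cast h2
        omega
      rw [hn1, Int.cast_zero, add_zero, add_right_inj] at e1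
      exact ⟨hsq.injective e1, n.2, e2⟩
    -- The sum of two numbers in `(1/4, 1/2)` lies strictly between `0` and `1`.
    · exfalso
      have e1 := congrArg Prod.fst hn
      simp only [Prod.fst_add, Prod.fst_neg, latticePt_fst] at e1
      have h1 : (n.1 : ℝ) < 1 := by linarith
      have h2 : (0 : ℝ) < n.1 := by linarith
      have h1 : n.1 < 1 := by exact_mod_cast h1
      have h2 : 0 < n.1 := by exact_mod_cast h2
      omega

/-- The vertical base curve. -/
def baseCurve (ι : S → X) (p : ℝ × ℝ → X) : Set S := {s | ∃ t : ℝ, ι s = p (3 / 8, t)}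

theorem range_base_collar (hp : FlatCover ι p) {F : ℝ × ℝ → S}
    (hF : ∀ t s, ι (F (t, s)) = p (3 / 8 + squeeze s, t)) :
    (Set.range fun t => F (t, 0)) = baseCurve ι p := by
  ext s
  constructor
  · rintro ⟨t, rfl⟩
    exact ⟨t, by rw [hF, squeeze_at_zero, add_zero]⟩
  · rintro ⟨t, ht⟩
    exact ⟨t, hp.emb.injective (by rw [hF, squeeze_at_zero, add_zero, ht])⟩

theorem hasClass_baseCurve (hp : FlatCover ι p) : HasClass ι p (baseCurve ι p) (0, 1) := by
  obtain ⟨F, hF, hFι⟩ := hp.exists_base_collar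
  have hFc := hF.cont
  refine ⟨fun t => F (t, 0), fun t => (3 / 8, t), by fun_prop, by fun_prop,
    fun t => hF.periodic t 0, fun t t' h => (hF.inj _ _ _ _ h).2, hp.range_base_collar hFι,
    fun t => by rw [hFι, squeeze_at_zero, add_zero], fun t => by ext <;> simp⟩

theorem hasClass_image_twist (_hp : FlatCover ι p) {T : S ≃ₜ S}
    (hT : ∀ s x, p x = ι s → p (twist x) = ι (T s)) {α : Set S} {v : ℤ × ℤ}
    (hα : HasClass ι p α v) : HasClass ι p (T '' α) (twistLattice v) := by
  obtain ⟨g, g', hg, hg', hg1, hinj, rfl, hgl, hgv⟩ := hα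
  refine ⟨fun t => T (g t), fun t => twist (g' t), by fun_prop,
    twistHomeo.continuous.comp hg', fun t => congrArg T (hg1 t),
    fun t t' h => hinj t t' (T.injective h), Set.range_comp T g, fun t => hT _ _ (hgl t),
    fun t => by simp only [hgv, twist_add]⟩

theorem mem_baseCurve_iff (hp : FlatCover ι p) {z : ℝ × ℝ} {y : S} (hz : p z = ι y) :
    y ∈ baseCurve ι p ↔ (∃ m : ℤ, z.1 = m + 3 / 8) ∨
      ((∀ x, p (-x) = p x) ∧ ∃ m : ℤ, z.1 = m - 3 / 8) := by
  constructor
  · rintro ⟨t, ht⟩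
    rcases hp.fiber (3 / 8, t) z (by rw [hz, ht]) with ⟨n, rfl⟩ | ⟨he, n, rfl⟩
    · left; exact ⟨n.1, by simp; ring⟩
    · right; exact ⟨he, n.1, by simp; ring⟩
  · rintro (⟨m, hm⟩ | ⟨he, m, hm⟩)
    · refine ⟨z.2, ?_⟩
      rw [← hz, ← hp.periodic (3 / 8, z.2) (m, 0)]
      congr 1
      ext
      · simp [hm]; ring
      · simp
    · refine ⟨-z.2, ?_⟩
      rw [← hz, ← he, ← hp.periodic (3 / 8, -z.2) (-m, 0)]
      congr 1
      ext
      · simp [hm]; ring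
      · simp

theorem mem_image_twist_iff (hp : FlatCover ι p) {T : S ≃ₜ S}
    (hT : ∀ s x, p x = ι s → p (twist x) = ι (T s)) {z : ℝ × ℝ} {y : S} (hz : p z = ι y) :
    y ∈ T '' baseCurve ι p ↔ (∃ m : ℤ, z.2 - 3 * bump z.1 = m + 3 / 8) ∨
      ((∀ x, p (-x) = p x) ∧ ∃ m : ℤ, z.2 - 3 * bump z.1 = m - 3 / 8) := by
  rw [T.image_eq_preimage_symm]
  have h : p (twistHomeo.symm z) = ι (T.symm y) := by
    obtain ⟨x, hx⟩ := hp.surj (ι (T.symm y))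
    have h1 := hT _ _ hx
    rw [T.apply_symm_apply, ← hz] at h1
    rw [← hx]
    refine hp.twist_eq_iff.1 ?_
    rw [h1]
    exact congrArg p (twistHomeo.apply_symm_apply z)
  exact hp.mem_baseCurve_iff h

/-- The functions `z.1` and `z.2 - 3 * bump z.1` are coordinates of the plane in which all lifts of
the two curves are coordinate lines. -/
theorem crossAt_baseCurve (hp : FlatCover ι p) {T : S ≃ₜ S}
    (hT : ∀ s x, p x = ι s → p (twist x) = ι (T s)) {s : S} (h1 : s ∈ baseCurve ι p)
    (h2 : s ∈ T '' baseCurve ι p) : CrossAt (baseCurve ι p) (T '' baseCurve ι p) s := by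
  obtain ⟨t, ht⟩ := h1
  set x : ℝ × ℝ := (3 / 8, t) with hx
  have hx2 := (hp.mem_image_twist_iff hT ht.symm).1 h2
  let q : ℝ × ℝ → ℝ := fun z => z.2 - 3 * bump z.1
  have hq : Continuous q := by
    have := continuous_bump
    fun_prop
  -- Lifts of one curve have levels differing by an integer or by an integer plus `± 3/4`, so within
  -- `1/8` only one lift of each curve is seen.
  have hW : {z : ℝ × ℝ | |z.1 - 3 / 8| < 1 / 8 ∧ |q z - q x| < 1 / 8} ∈ 𝓝 x := by
    apply IsOpen.mem_nhds
    · have h1 : Continuous fun z : ℝ × ℝ => |z.1 - 3 / 8| := by fun_prop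
      have h2 : Continuous fun z : ℝ × ℝ => |q z - q x| := (hq.sub continuous_const).abs
      exact (isOpen_lt h1 continuous_const).inter (isOpen_lt h2 continuous_const)
    · simp [hx]
  obtain ⟨e, hes, hex, hep, het⟩ := hp.exists_chart ht.symm
    (hp.range_mem_nhds x (Or.inl ⟨0, by simp [hx]⟩)) hW
  let C : (ℝ × ℝ) ≃ₜ (ℝ × ℝ) :=
    { toFun := fun z => (q z - q x, z.1 - 3 / 8)
      invFun := fun z => (z.2 + 3 / 8, z.1 + q x + 3 * bump (z.2 + 3 / 8))
      left_inv := fun z => by simp [q]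
      right_inv := fun z => by simp [q]
      continuous_toFun := by fun_prop
      continuous_invFun := by
        have := continuous_bump
        fun_prop }
  refine ⟨e.transHomeomorph C, hes, ?_, ?_⟩
  · change C (e s) = _
    rw [hex]
    simp [C, hx]
  · intro y hy
    have hy : y ∈ e.source := hy
    obtain ⟨hy1, hy2⟩ := het (e.map_source hy)
    have hyp := hep y hy
    set z := e y with hz
    have int_abs : ∀ m : ℤ, |(m : ℝ)| < 1 → m = 0 := by
      intro m hm
      have : |m| < 1 := by exact_mod_cast hm
      exact Int.abs_lt_one_iff.1 this
    have no_int : ∀ m : ℤ, ¬ |(m : ℝ) - 3 / 4| < 1 / 8 := by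
      intro m hm
      rw [abs_lt] at hm
      have h1 : (m : ℝ) < 1 := by linarith
      have h2 : (0 : ℝ) < m := by linarith
      have h1 : m < 1 := by exact_mod_cast h1
      have h2 : 0 < m := by exact_mod_cast h2
      omega
    constructor
    · rw [hp.mem_baseCurve_iff hyp]
      change _ ↔ z.1 - 3 / 8 = 0
      constructor
      · rintro (⟨m, hm⟩ | ⟨-, m, hm⟩)
        · rw [hm] at hy1 ⊢
          have := int_abs m (by rw [add_sub_cancel_right] at hy1; linarith)
          simp [this]
        · rw [hm] at hy1
          exact absurd (by convert hy1 using 2; ring) (no_int m)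
      · intro h
        left
        exact ⟨0, by simp; linarith⟩
    · rw [hp.mem_image_twist_iff hT hyp]
      change _ ↔ q z - q x = 0
      constructor
      · intro hz2
        have key : ∃ m : ℤ, q z - q x = m := by
          rcases hz2 with ⟨m, hm⟩ | ⟨-, m, hm⟩ <;> rcases hx2 with ⟨m', hm'⟩ | ⟨-, m', hm'⟩ <;>
            change q z = _ at hm <;> change q x = _ at hm'
          · exact ⟨m - m', by rw [hm, hm']; push_cast; ring⟩
          · rw [hm, hm', abs_sub_comm] at hy2
            exact absurd (by convert hy2 using 2; push_cast; ring) (no_int (m' - m))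
          · rw [hm, hm'] at hy2
            exact absurd (by convert hy2 using 2; push_cast; ring) (no_int (m - m'))
          · exact ⟨m - m', by rw [hm, hm']; push_cast; ring⟩
        obtain ⟨m, hm⟩ := key
        rw [hm] at hy2 ⊢
        rw [int_abs m (by linarith), Int.cast_zero]
      · intro h
        have : q z = q x := by linarith
        change (∃ m : ℤ, q z = _) ∨ (_ ∧ ∃ m : ℤ, q z = _)
        rw [this]
        exact hx2

theorem mem_inter_iff (hp : FlatCover ι p) {T : S ≃ₜ S}
    (hT : ∀ s x, p x = ι s → p (twist x) = ι (T s)) {F : ℝ × ℝ → S} (hFc : IsCollar F)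
    (hF : ∀ t s, ι (F (t, s)) = p (3 / 8 + squeeze s, t)) (s : S) :
    s ∈ baseCurve ι p ∩ T '' baseCurve ι p ↔
      s = F (1 / 8, 0) ∨ ((∀ x, p (-x) = p x) ∧ s = F (3 / 8, 0)) := by
  have hper : ∀ t s (k : ℤ), F (t + k, s) = F (t, s) := by
    intro t s k
    have : Function.Periodic (fun t => F (t, s)) 1 := fun t => hFc.periodic t s
    simpa using this.int_mul k t
  have key : ∀ t, F (t, 0) ∈ T '' baseCurve ι p ↔ (∃ m : ℤ, t = 1 / 8 + m) ∨
      ((∀ x, p (-x) = p x) ∧ ∃ m : ℤ, t = 3 / 8 + m) := by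
    intro t
    rw [hp.mem_image_twist_iff hT (z := (3 / 8, t))
      (by rw [hF, squeeze_at_zero, add_zero])]
    simp only [bump_three_eighths]
    refine or_congr ?_ (and_congr_right fun _ => ?_)
    · constructor
      · rintro ⟨m, hm⟩
        exact ⟨m + 1, by push_cast; linarith⟩
      · rintro ⟨m, hm⟩
        exact ⟨m - 1, by push_cast; linarith⟩
    · constructor
      · rintro ⟨m, hm⟩
        exact ⟨m, by linarith⟩
      · rintro ⟨m, hm⟩
        exact ⟨m, by linarith⟩
  rw [← hp.range_base_collar hF]
  rw [← hp.range_base_collar hF] at key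
  constructor
  · rintro ⟨⟨t, rfl⟩, h⟩
    rcases (key t).1 h with ⟨m, rfl⟩ | ⟨he, m, rfl⟩
    · left; exact hper _ _ _
    · right; exact ⟨he, hper _ _ _⟩
  · rintro (rfl | ⟨he, rfl⟩)
    · exact ⟨⟨_, rfl⟩, (key _).2 (Or.inl ⟨0, by simp⟩)⟩
    · exact ⟨⟨_, rfl⟩, (key _).2 (Or.inr ⟨he, 0, by simp⟩)⟩

theorem meetTransversely_one (hp : FlatCover ι p) {T : S ≃ₜ S}
    (hT : ∀ s x, p x = ι s → p (twist x) = ι (T s)) (hodd : ¬ ∀ x, p (-x) = p x) :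
    MeetTransversely 1 (baseCurve ι p) (T '' baseCurve ι p) := by
  obtain ⟨F, hFc, hF⟩ := hp.exists_base_collar
  refine ⟨?_, fun x hx => hp.crossAt_baseCurve hT hx.1 hx.2⟩
  have : baseCurve ι p ∩ T '' baseCurve ι p = {F (1 / 8, 0)} := by
    ext s
    rw [hp.mem_inter_iff hT hFc hF]
    simp only [hodd, false_and, or_false, Set.mem_singleton_iff]
  rw [this, Set.encard_singleton]
  rfl

theorem meetTransversely_two (hp : FlatCover ι p) {T : S ≃ₜ S}
    (hT : ∀ s x, p x = ι s → p (twist x) = ι (T s)) (heven : ∀ x, p (-x) = p x) :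
    MeetTransversely 2 (baseCurve ι p) (T '' baseCurve ι p) := by
  obtain ⟨F, hFc, hF⟩ := hp.exists_base_collar
  refine ⟨?_, fun x hx => hp.crossAt_baseCurve hT hx.1 hx.2⟩
  have : baseCurve ι p ∩ T '' baseCurve ι p = {F (1 / 8, 0), F (3 / 8, 0)} := by
    ext s
    rw [hp.mem_inter_iff hT hFc hF]
    simp only [implies_true, heven, true_and, Set.mem_insert_iff, Set.mem_singleton_iff]
  rw [this, Set.encard_pair]
  · rfl
  · intro h
    obtain ⟨-, k, hk⟩ := hFc.inj _ _ _ _ h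
    have h1 : (k : ℝ) < 1 := by linarith
    have h2 : (0 : ℝ) < k := by linarith
    have h1 : k < 1 := by exact_mod_cast h1
    have h2 : 0 < k := by exact_mod_cast h2
    omega

end FlatCover

/-! ### Slopes of curve classes and the comparison of distances. -/

/-! ### The latticeSlope map to the Farey graph -/

/-- The latticeSlope of a lattice vector. -/
def latticeSlope (v : ℤ × ℤ) : OnePoint ℚ := mkExt v.1 v.2

theorem latticeSlope_smul {k : ℤ} (hk : k ≠ 0) (v : ℤ × ℤ) : latticeSlope (k • v) = latticeSlope v := by
  simp [latticeSlope, mkExt_mul hk]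

theorem latticeSlope_twistLattice {v : ℤ × ℤ} (hv : v ≠ 0) :
    latticeSlope (twistLattice v) = fareyStep 3 (latticeSlope v) := by
  have h0 : v.1 ≠ 0 ∨ v.2 ≠ 0 := by
    by_contra! hc
    exact hv (Prod.ext hc.1 hc.2)
  obtain ⟨k, hk, h1, h2⟩ := exists_extNum_mkExt h0
  unfold latticeSlope fareyStep twistLattice
  rw [← mkExt_mul hk (extDen _)]
  congr 1
  simp only
  rw [mul_add, ← h1, mul_left_comm, ← h2]
  rfl

theorem twistLattice_ne_zero {v : ℤ × ℤ} (hv : v ≠ 0) : twistLattice v ≠ 0 := by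
  intro h
  have h1 := congrArg Prod.fst h
  have h2 := congrArg Prod.snd h
  simp only [twistLattice, Prod.fst_zero, Prod.snd_zero] at h1 h2
  exact hv (Prod.ext (by simp; omega) h1)

/-- As `u` is orthogonal to `v`, it is a non-zero multiple of the primitive direction of `v` turned
by a right angle. So `u · w` is a non-zero multiple of the Farey determinant of the two slopes, and
the bound forces that determinant into `{-1, 0, 1}`. -/
theorem latticeSlope_eq_or_adj {u v w : ℤ × ℤ} (hu : u ≠ 0) (hv : v ≠ 0) (hw : w ≠ 0)
    (huv : u.1 * v.1 + u.2 * v.2 = 0) (huw : |u.1 * w.1 + u.2 * w.2| ≤ 1) :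
    latticeSlope v = latticeSlope w ∨ fareyGraph.Adj (latticeSlope v) (latticeSlope w) := by
  have hne : ∀ {v : ℤ × ℤ}, v ≠ 0 → v.1 ≠ 0 ∨ v.2 ≠ 0 := by
    intro v hv
    by_contra! hc
    exact hv (Prod.ext hc.1 hc.2)
  obtain ⟨k, hk, k1, k2⟩ := exists_extNum_mkExt (hne hv)
  obtain ⟨l, hl, l1, l2⟩ := exists_extNum_mkExt (hne hw)
  change v.1 = k * extNum (latticeSlope v) at k1
  change v.2 = k * extDen (latticeSlope v) at k2
  change w.1 = l * extNum (latticeSlope w) at l1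
  change w.2 = l * extDen (latticeSlope w) at l2
  obtain ⟨a, b, hab⟩ := isCoprime_extNum_extDen (latticeSlope v)
  have h0 : u.1 * extNum (latticeSlope v) + u.2 * extDen (latticeSlope v) = 0 := by
    apply (mul_eq_zero.1 _).resolve_left hk
    rw [← huv, k1, k2]; ring
  have hu1 : u.1 = (b * u.1 - a * u.2) * extDen (latticeSlope v) := by
    linear_combination (-u.1) * hab + a * h0
  have hu2 : u.2 = -((b * u.1 - a * u.2) * extNum (latticeSlope v)) := by
    linear_combination (-u.2) * hab + b * h0
  set m := b * u.1 - a * u.2 with hm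
  have hm0 : m ≠ 0 := by
    intro h
    rw [h] at hu1 hu2
    exact hu (Prod.ext (by simpa using hu1) (by simpa using hu2))
  have hdet : u.1 * w.1 + u.2 * w.2 = (-(m * l)) * (extNum (latticeSlope v) * extDen (latticeSlope w) -
      extDen (latticeSlope v) * extNum (latticeSlope w)) := by
    rw [hu1, hu2, l1, l2]; ring
  rw [hdet, abs_mul, abs_neg] at huw
  have hml : 1 ≤ |m * l| := Int.one_le_abs (mul_ne_zero hm0 hl)
  have hle : |extNum (latticeSlope v) * extDen (latticeSlope w) - extDen (latticeSlope v) * extNum (latticeSlope w)| ≤ 1 := by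
    nlinarith [abs_nonneg (extNum (latticeSlope v) * extDen (latticeSlope w) -
      extDen (latticeSlope v) * extNum (latticeSlope w))]
  rcases hle.eq_or_lt with h | h
  · right; exact h
  · left
    have := Int.abs_lt_one_iff.1 h
    rw [eq_mkExt_of (x := latticeSlope v) (p := extNum (latticeSlope w)) (q := extDen (latticeSlope w))
      (by linarith) ?_, mkExt_extNum_extDen]
    by_contra! hc
    obtain ⟨c, d, hcd⟩ := isCoprime_extNum_extDen (latticeSlope w)
    rw [hc.1, hc.2] at hcd
    simp at hcd

namespace FlatCover

variable {S X : Type*} [TopologicalSpace S] [TopologicalSpace X] {ι : S → X} {p : ℝ × ℝ → X}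

open Classical in
/-- The latticeSlope of an isotopy class of curves. -/
noncomputable def classSlope (ι : S → X) (p : ℝ × ℝ → X) (V : CurveClass S) : OnePoint ℚ :=
  if h : ∃ v : ℤ × ℤ, v ≠ 0 ∧ HasClass ι p (Quotient.out V).1 v then latticeSlope h.choose else ∞

theorem classSlope_mk (hp : FlatCover ι p) (α : EssentialCurve S) {v : ℤ × ℤ} (hv : v ≠ 0)
    (hα : HasClass ι p α.1 v) :
    classSlope ι p (Quotient.mk (curveSetoid S) α) = latticeSlope v := by
  have hiso : AmbientIsotopic α.1 (Quotient.out (Quotient.mk (curveSetoid S) α)).1 :=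
    (curveSetoid S).symm (Quotient.mk_out (s := curveSetoid S) α)
  have hex : ∃ v : ℤ × ℤ, v ≠ 0 ∧
      HasClass ι p (Quotient.out (Quotient.mk (curveSetoid S) α)).1 v :=
    ⟨v, hv, hp.hasClass_of_ambientIsotopic hα hiso⟩
  refine (dif_pos hex).trans ?_
  obtain ⟨h1, h2⟩ := hex.choose_spec
  obtain ⟨k, hk⟩ := hp.hasClass_unique (hp.hasClass_of_ambientIsotopic hα hiso) h2
  rw [hk] at h1 ⊢
  refine latticeSlope_smul ?_ v
  rintro rfl
  simp at h1

/-- The iterated images of the base curve have slopes `[3, …, 3]` and successive ones meet as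
required, so they are joined by paths. A path in the curve complex projects to a walk in the Farey
graph that is not longer, whose length is bounded below by the continued fraction estimate. -/
theorem hasInfiniteDiameter (hp : FlatCover ι p) (k : ℕ)
    (hbase : ∀ T : S ≃ₜ S, (∀ s x, p x = ι s → p (twist x) = ι (T s)) →
      MeetTransversely k (baseCurve ι p) (T '' baseCurve ι p))
    (hadj : ∀ α β : Set S, IsEssentialCurve α → IsEssentialCurve β → MeetTransversely k α β →
      ∃ u v w : ℤ × ℤ, u ≠ 0 ∧ v ≠ 0 ∧ w ≠ 0 ∧ HasClass ι p α v ∧ HasClass ι p β w ∧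
        u.1 * v.1 + u.2 * v.2 = 0 ∧ |u.1 * w.1 + u.2 * w.2| ≤ 1) :
    HasInfiniteDiameter (sporadicCurveComplex k S) := by
  obtain ⟨T, hT⟩ := hp.exists_twist
  have hF := hp.exists_base_collar
  obtain ⟨F, hFc, hFι⟩ := hF
  let c : ℕ → Set S := fun n => (fun α => T '' α)^[n] (baseCurve ι p)
  let v : ℕ → ℤ × ℤ := fun n => twistLattice^[n] (0, 1)
  have hcs : ∀ n, c (n + 1) = T '' c n := fun n => Function.iterate_succ_apply' _ _ _
  have hvs : ∀ n, v (n + 1) = twistLattice (v n) := fun n => Function.iterate_succ_apply' _ _ _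
  have hv0 : ∀ n, v n ≠ 0 := by
    intro n
    induction n with
    | zero => simp [v]
    | succ n ih => rw [hvs]; exact twistLattice_ne_zero ih
  have hcl : ∀ n, HasClass ι p (c n) (v n) := by
    intro n
    induction n with
    | zero => exact hp.hasClass_baseCurve
    | succ n ih => rw [hvs, hcs]; exact hp.hasClass_image_twist hT ih
  have hsc : ∀ n, IsSimpleClosedCurve (c n) := by
    intro n
    induction n with
    | zero =>
      change IsSimpleClosedCurve (baseCurve ι p)
      rw [← hp.range_base_collar hFι]; exact hFc.isSimpleClosedCurve
    | succ n ih => rw [hcs]; exact ih.image T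
  have hmeet : ∀ n, MeetTransversely k (c n) (c (n + 1)) := by
    intro n
    induction n with
    | zero => exact hbase T hT
    | succ n ih =>
      have := ih.image T
      rwa [← hcs n, ← hcs (n + 1)] at this
  have hsl : ∀ n, latticeSlope (v n) = (contFrac (List.replicate n 3) : OnePoint ℚ) := by
    intro n
    induction n with
    | zero => simp [v, latticeSlope, mkExt, contFrac]
    | succ n ih =>
      rw [hvs, latticeSlope_twistLattice (hv0 n), ih, fareyStep_contFrac le_rfl, List.replicate_succ]
  let E : ℕ → EssentialCurve S := fun n => ⟨c n, hp.isEssentialCurve (hsc n) (hcl n) (hv0 n)⟩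
  let V : ℕ → CurveClass S := fun n => Quotient.mk (curveSetoid S) (E n)
  have hVs : ∀ n, classSlope ι p (V n) = (contFrac (List.replicate n 3) : OnePoint ℚ) :=
    fun n => (hp.classSlope_mk (E n) (hv0 n) (hcl n)).trans (hsl n)
  have hreach : ∀ n, (oneSkeleton (sporadicCurveComplex k S)).Reachable (V 0) (V n) := by
    intro n
    induction n with
    | zero => rfl
    | succ n ih =>
      refine ih.trans ?_
      -- Equality of successive classes need not be ruled out: it only shortens the path.
      by_cases hne : V n = V (n + 1)
      · rw [hne]
      refine SimpleGraph.Adj.reachable ⟨hne, ?_⟩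
      classical
      let f : CurveClass S → EssentialCurve S := fun u => if u = V n then E n else E (n + 1)
      have hf1 : f (V n) = E n := if_pos rfl
      have hf2 : f (V (n + 1)) = E (n + 1) := if_neg (Ne.symm hne)
      refine ⟨{V n, V (n + 1)}, ⟨by simp, f, ?_, ?_⟩, by simp⟩
      · intro u hu
        simp only [Finset.mem_insert, Finset.mem_singleton] at hu
        rcases hu with rfl | rfl
        · rw [hf1]
        · rw [hf2]
      · intro a ha b hb hab
        simp only [Finset.mem_insert, Finset.mem_singleton] at ha hb
        rcases ha with rfl | rfl <;> rcases hb with rfl | rfl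
        · exact absurd rfl hab
        · rw [hf1, hf2]
          exact hmeet n
        · rw [hf1, hf2]
          exact (hmeet n).symm
        · exact absurd rfl hab
  have hlip : ∀ {A B : CurveClass S}, (oneSkeleton (sporadicCurveComplex k S)).Adj A B →
      classSlope ι p A = classSlope ι p B ∨
        fareyGraph.Adj (classSlope ι p A) (classSlope ι p B) := by
    rintro A B ⟨hAB, σ, ⟨-, f, hf1, hf2⟩, hσ⟩
    have hA : A ∈ σ := by rw [← Finset.mem_coe, hσ]; simp
    have hB : B ∈ σ := by rw [← Finset.mem_coe, hσ]; simp
    obtain ⟨u, v, w, hu, hv, hw, h1, h2, h3, h4⟩ := hadj _ _ (f A).2 (f B).2 (hf2 A hA B hB hAB)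
    have e1 := hp.classSlope_mk (f A) hv h1
    have e2 := hp.classSlope_mk (f B) hw h2
    rw [hf1 A hA] at e1
    rw [hf1 B hB] at e2
    rw [e1, e2]
    exact latticeSlope_eq_or_adj hu hv hw h3 h4
  have hwalk : ∀ {A B : CurveClass S} (P : (oneSkeleton (sporadicCurveComplex k S)).Walk A B),
      ∃ Q : fareyGraph.Walk (classSlope ι p A) (classSlope ι p B), Q.length ≤ P.length := by
    intro A B P
    induction P with
    | nil => exact ⟨.nil, le_rfl⟩
    | cons h P ih =>
      obtain ⟨Q, hQ⟩ := ih
      rcases hlip h with h' | h'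
      · exact ⟨Q.copy h'.symm rfl, by simp; omega⟩
      · exact ⟨.cons h' Q, by simp; omega⟩
  intro N
  refine ⟨V 0, V N, hreach N, ?_⟩
  obtain ⟨P, hP⟩ := (hreach N).exists_walk_length_eq_dist
  obtain ⟨Q, hQ⟩ := hwalk P
  have h0 : classSlope ι p (V 0) = ((0 : ℚ) : OnePoint ℚ) := hVs 0
  have := le_length_of_walk_zero (Q.copy h0 (hVs N))
  rw [SimpleGraph.Walk.length_copy] at this
  omega

end FlatCover

/-! ### Functions dual to a collared curve -/

/-- The piecewise linear function rising from `0` to `1` on `[-1, 1]`. -/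
noncomputable def ramp (s : ℝ) : ℝ := max 0 (min 1 ((s + 1) / 2))

theorem continuous_ramp : Continuous ramp := by
  unfold ramp
  fun_prop

theorem ramp_mem (s : ℝ) : 0 ≤ ramp s ∧ ramp s ≤ 1 :=
  ⟨le_max_left _ _, max_le zero_le_one (min_le_left _ _)⟩

theorem ramp_of_abs_le {s : ℝ} (hs : |s| ≤ 1) : ramp s = (s + 1) / 2 := by
  have := abs_le.1 hs
  unfold ramp
  rw [min_eq_right (by linarith), max_eq_right (by linarith)]

theorem ramp_of_one_le {s : ℝ} (hs : 1 ≤ s) : ramp s = 1 := by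
  unfold ramp
  rw [min_eq_left (by linarith), max_eq_right zero_le_one]

theorem ramp_of_le_neg_one {s : ℝ} (hs : s ≤ -1) : ramp s = 0 := by
  unfold ramp
  rw [max_eq_left]
  exact (min_le_right _ _).trans (by linarith)

theorem coe_ramp_of_one_le_abs {s : ℝ} (hs : 1 ≤ |s|) : ((ramp s : ℝ) : UnitAddCircle) = 0 := by
  rcases le_abs'.1 hs with h | h
  · rw [ramp_of_le_neg_one h]; rfl
  · rw [ramp_of_one_le h]; exact AddCircle.coe_period 1

theorem coe_unitAddCircle_eq_zero {x : ℝ} : (x : UnitAddCircle) = 0 ↔ ∃ k : ℤ, x = k := by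
  rw [show (0 : UnitAddCircle) = ((0 : ℝ) : UnitAddCircle) from rfl, eq_comm,
    coe_eq_coe_unitAddCircle]
  simp

/-- With values in the circle, the jump of `ramp` from `0` to `1` between the two sides disappears,
so extending by `0` is continuous even when the curve does not separate. -/
theorem exists_collar_function {Z : Type*} [TopologicalSpace Z] {F : ℝ × ℝ → Z}
    (ho : IsOpenMap F) (hs : ∀ y y', F y = F y' → y.2 = y'.2)
    (hcl : IsClosed (F '' {y | |y.2| ≤ 1})) :
    ∃ Φ : Z → UnitAddCircle, Continuous Φ ∧ (∀ y, Φ (F y) = (ramp y.2 : ℝ)) ∧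
      ∀ z, z ∉ F '' {y | |y.2| < 1} → Φ z = 0 := by
  classical
  let Φ : Z → UnitAddCircle := fun z =>
    if h : z ∈ F '' {y | |y.2| < 1} then ((ramp h.choose.2 : ℝ) : UnitAddCircle) else 0
  have hΦF : ∀ y, Φ (F y) = (ramp y.2 : ℝ) := by
    intro y
    by_cases h : F y ∈ F '' {y | |y.2| < 1}
    · simp only [Φ, dif_pos h]
      rw [hs _ _ h.choose_spec.2]
    · simp only [Φ, dif_neg h]
      rw [coe_ramp_of_one_le_abs]
      by_contra! hlt
      exact h ⟨y, hlt, rfl⟩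
  have hΦ0 : ∀ z, z ∉ F '' {y | |y.2| < 1} → Φ z = 0 := fun z hz => dif_neg hz
  refine ⟨Φ, ?_, hΦF, hΦ0⟩
  rw [continuous_iff_continuousAt]
  intro z
  by_cases hz : z ∈ F '' {y | |y.2| ≤ 1}
  · obtain ⟨y, -, rfl⟩ := hz
    have hcomp : ContinuousAt (Φ ∘ F) y := by
      have : Φ ∘ F = fun y => ((ramp y.2 : ℝ) : UnitAddCircle) := funext hΦF
      rw [this]
      exact ((AddCircle.continuous_mk' 1).comp (continuous_ramp.comp continuous_snd)).continuousAt
    exact Filter.Tendsto.mono_left (Filter.tendsto_map'_iff.2 hcomp) (ho.nhds_le y)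
  · have : Φ =ᶠ[𝓝 z] fun _ => 0 := by
      filter_upwards [hcl.isOpen_compl.mem_nhds hz] with z' hz'
      exact hΦ0 z' fun ⟨y, hy, h⟩ => hz' ⟨y, LT.lt.le (a := |y.2|) hy, h⟩
    exact continuousAt_const.congr this.symm

/-- The increments of a lift under translations are continuous and integral, hence constant, and
they depend additively on the lattice vector. -/
theorem exists_equivariant_lift {c : ℝ × ℝ → UnitAddCircle} (hc : Continuous c)
    (hper : ∀ x n, c (x + latticePt n) = c x) :
    ∃ (G : ℝ × ℝ → ℝ) (u : ℤ × ℤ), Continuous G ∧ (∀ x, (G x : UnitAddCircle) = c x) ∧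
      ∀ x n, G (x + latticePt n) = G x + ((u.1 * n.1 + u.2 * n.2 : ℤ) : ℝ) := by
  obtain ⟨G, hG, hGc⟩ := exists_lift_unitAddCircle hc
  have hk : ∀ n, ∃ k : ℤ, ∀ x, G (x + latticePt n) - G x = k := by
    intro n
    refine exists_const_of_int_valued (by fun_prop) fun x => ?_
    obtain ⟨k, hk⟩ := coe_eq_coe_unitAddCircle.1
      ((hGc x).trans ((hper x n).symm.trans (hGc _).symm))
    exact ⟨k, by rw [hk]; ring⟩
  choose k hk using hk
  let κ : ℤ × ℤ →+ ℤ := AddMonoidHom.mk' k fun m n => by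
    have h1 := hk (m + n) 0
    have h2 := hk m (0 + latticePt n)
    have h3 := hk n 0
    rw [latticePt_add, ← add_assoc, add_right_comm] at h1
    have : ((k (m + n) : ℤ) : ℝ) = ((k m + k n : ℤ) : ℝ) := by push_cast; linarith
    exact_mod_cast this
  refine ⟨G, (κ (1, 0), κ (0, 1)), hG, hGc, fun x n => ?_⟩
  have h1 : κ n = n.1 • κ (1, 0) + n.2 • κ (0, 1) := by
    rw [← map_zsmul, ← map_zsmul, ← map_add]
    congr 1
    ext <;> simp
  have h2 := hk n x
  have h3 : k n = κ n := rfl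
  rw [h3, h1] at h2
  have h4 : n.1 • κ (1, 0) + n.2 • κ (0, 1) = κ (1, 0) * n.1 + κ (0, 1) * n.2 := by
    simp only [smul_eq_mul]; ring
  rw [h4] at h2
  linarith

/-- A lift to the plane of the function that is `ramp` across a collar. -/
theorem exists_normalized_lift {F : ℝ × ℝ → ℝ × ℝ} (hF : Continuous F) {G : ℝ × ℝ → ℝ}
    (hG : Continuous G) (h : ∀ y, (G (F y) : UnitAddCircle) = (ramp y.2 : ℝ)) :
    ∃ k : ℤ, ∀ y, G (F y) - k = ramp y.2 := by
  have hr := continuous_ramp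
  obtain ⟨k, hk⟩ := exists_const_of_int_valued (f := fun y => G (F y) - ramp y.2) (by fun_prop)
    (fun y => by
      obtain ⟨k, hk⟩ := coe_eq_coe_unitAddCircle.1 (h y)
      exact ⟨-k, by rw [hk]; push_cast; ring⟩)
  exact ⟨k, fun y => by linarith [hk y]⟩

/-- The circle-valued collar function of the projected annulus on the torus is lifted to the plane.
Its periods `u` count signed crossings of the curve; along the core the lift is constant, so `u`
annihilates `v`. -/
theorem exists_dual_function {F : ℝ × ℝ → ℝ × ℝ} (hF : Continuous F) (ho : IsOpenMap F)
    (hs : ∀ y y' n, F y' = F y + latticePt n → y'.2 = y.2) {v : ℤ × ℤ}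
    (hv : ∀ t s, F (t + 1, s) = F (t, s) + latticePt v) :
    ∃ (G : ℝ × ℝ → ℝ) (u : ℤ × ℤ), Continuous G ∧
      (∀ x n, G (x + latticePt n) = G x + ((u.1 * n.1 + u.2 * n.2 : ℤ) : ℝ)) ∧
      (∀ y, G (F y) = ramp y.2) ∧
      (∀ x, (∀ y n, |y.2| < 1 → x ≠ F y + latticePt n) → ∃ k : ℤ, G x = k) ∧
      u.1 * v.1 + u.2 * v.2 = 0 := by
  let q : ℝ × ℝ → UnitAddCircle × UnitAddCircle := fun x => (x.1, x.2)
  have hq : Continuous q :=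
    ((AddCircle.continuous_mk' 1).comp continuous_fst).prodMk
      ((AddCircle.continuous_mk' 1).comp continuous_snd)
  have hqo : IsOpenMap q :=
    QuotientAddGroup.isOpenMap_coe.prodMap QuotientAddGroup.isOpenMap_coe
  have hqe : ∀ x y, q x = q y ↔ ∃ n, y = x + latticePt n := by
    intro x y
    rw [Prod.ext_iff]
    change (x.1 : UnitAddCircle) = y.1 ∧ (x.2 : UnitAddCircle) = y.2 ↔ _
    rw [coe_eq_coe_unitAddCircle, coe_eq_coe_unitAddCircle]
    constructor
    · rintro ⟨⟨a, ha⟩, b, hb⟩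
      exact ⟨(a, b), Prod.ext ha hb⟩
    · rintro ⟨n, rfl⟩
      exact ⟨⟨n.1, rfl⟩, n.2, rfl⟩
  have hcompact : IsCompact ((q ∘ F) '' {y | |y.2| ≤ 1}) := by
    have : (q ∘ F) '' {y | |y.2| ≤ 1} = (q ∘ F) '' (Set.Icc 0 1 ×ˢ Set.Icc (-1) 1) := by
      refine Set.Subset.antisymm ?_ (Set.image_mono fun y hy => abs_le.2 hy.2)
      rintro _ ⟨⟨t, s⟩, hs1, rfl⟩
      refine ⟨(Int.fract t, s), ⟨⟨Int.fract_nonneg t, (Int.fract_lt_one t).le⟩, abs_le.1 hs1⟩, ?_⟩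
      refine (hqe _ _).2 ⟨⌊t⌋ • v, ?_⟩
      have := add_int_of_add_one (f := fun t => F (t, s)) (fun t => hv t s) (Int.fract t) ⌊t⌋
      rwa [Int.fract_add_floor] at this
    rw [this]
    exact (isCompact_Icc.prod isCompact_Icc).image (hq.comp hF)
  obtain ⟨Φ, hΦ, hΦF, hΦ0⟩ := exists_collar_function (hqo.comp ho)
    (fun y y' h => by
      obtain ⟨n, hn⟩ := (hqe _ _).1 h
      exact (hs _ _ _ hn).symm) hcompact.isClosed
  obtain ⟨G, u, hG, hGc, hGu⟩ := exists_equivariant_lift (hΦ.comp hq)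
    (fun x n => congrArg Φ ((hqe _ _).2 ⟨n, rfl⟩).symm)
  obtain ⟨k, hk⟩ := exists_normalized_lift hF hG fun y => (hGc _).trans (hΦF y)
  refine ⟨fun x => G x - k, u, by fun_prop, fun x n => by simp only [hGu]; ring, hk, ?_, ?_⟩
  · intro x hx
    have h0 : Φ (q x) = 0 := by
      refine hΦ0 _ ?_
      rintro ⟨y, hy, hyx⟩
      obtain ⟨n, hn⟩ := (hqe _ _).1 hyx
      exact hx y n hy hn
    obtain ⟨j, hj⟩ := coe_unitAddCircle_eq_zero.1 ((hGc x).trans h0)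
    exact ⟨j - k, by simp only [hj]; push_cast; ring⟩
  · have h1 := hk (0 + 1, 0)
    rw [hv, hGu] at h1
    have h2 := hk (0, 0)
    have : ((u.1 * v.1 + u.2 * v.2 : ℤ) : ℝ) = 0 := by linarith
    exact_mod_cast this

/-- The variant for an annulus whose lift closes up in the plane, where no torus is needed. It will
serve to show that this case does not occur for essential curves. -/
theorem exists_dual_function_of_periodic {F : ℝ × ℝ → ℝ × ℝ} (hF : Continuous F)
    (ho : IsOpenMap F) (hs : ∀ y y', F y' = F y → y'.2 = y.2) {k : ℕ} (hk : 0 < k)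
    (hper : ∀ t s, F (t + k, s) = F (t, s)) :
    IsCompact (F '' {y | |y.2| ≤ 1}) ∧ ∃ G : ℝ × ℝ → ℝ, Continuous G ∧
      (∀ y, G (F y) = ramp y.2) ∧ ∀ x, x ∉ F '' {y | |y.2| < 1} → ∃ k : ℤ, G x = k := by
  have hk' : (0 : ℝ) < k := by exact_mod_cast hk
  have hcompact : IsCompact (F '' {y | |y.2| ≤ 1}) := by
    have : F '' {y | |y.2| ≤ 1} = F '' (Set.Icc 0 (k : ℝ) ×ˢ Set.Icc (-1) 1) := by
      refine Set.Subset.antisymm ?_ (Set.image_mono fun y hy => abs_le.2 hy.2)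
      rintro _ ⟨⟨t, s⟩, hs1, rfl⟩
      have hp : Function.Periodic (fun t => F (t, s)) k := fun t => hper t s
      obtain ⟨t', ht', he⟩ := hp.exists_mem_Ico₀ hk' t
      exact ⟨(t', s), ⟨⟨ht'.1, ht'.2.le⟩, abs_le.1 hs1⟩, he.symm⟩
    rw [this]
    exact (isCompact_Icc.prod isCompact_Icc).image hF
  refine ⟨hcompact, ?_⟩
  obtain ⟨Φ, hΦ, hΦF, hΦ0⟩ := exists_collar_function ho (fun y y' h => hs _ _ h)
    hcompact.isClosed
  obtain ⟨G, hG, hGc⟩ := exists_lift_unitAddCircle hΦ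
  obtain ⟨j, hj⟩ := exists_normalized_lift hF hG fun y => (hGc _).trans (hΦF y)
  refine ⟨fun x => G x - j, by fun_prop, hj, fun x hx => ?_⟩
  obtain ⟨i, hi⟩ := coe_unitAddCircle_eq_zero.1 ((hGc x).trans (hΦ0 x hx))
  exact ⟨i - j, by simp only [hi]; push_cast; ring⟩

/-- Off the translates of the collar the function is integral; on them it is an integer plus `ramp`,
which equals `1/2` only on the core. -/
theorem exists_half_of_eq_int_add_half {F : ℝ × ℝ → ℝ × ℝ} {G : ℝ × ℝ → ℝ} {u : ℤ × ℤ}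
    (hGu : ∀ x n, G (x + latticePt n) = G x + ((u.1 * n.1 + u.2 * n.2 : ℤ) : ℝ))
    (hGF : ∀ y, G (F y) = ramp y.2)
    (hG0 : ∀ x, (∀ y n, |y.2| < 1 → x ≠ F y + latticePt n) → ∃ k : ℤ, G x = k)
    {x : ℝ × ℝ} {m : ℤ} (hx : G x = m + 1 / 2) : ∃ t n, x = F (t, 0) + latticePt n := by
  have no_half : ∀ k : ℤ, (k : ℝ) ≠ 1 / 2 := by
    intro k hk
    have : (2 * k : ℤ) = 1 := by
      have : (2 : ℝ) * k = 1 := by rw [hk]; norm_num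
      exact_mod_cast this
    omega
  by_cases h : ∀ y n, |y.2| < 1 → x ≠ F y + latticePt n
  · obtain ⟨k, hk⟩ := hG0 x h
    exact absurd (by push_cast; linarith) (no_half (k - m))
  · push Not at h
    obtain ⟨⟨t, s⟩, n, hy, rfl⟩ := h
    refine ⟨t, n, ?_⟩
    rw [hGu, hGF, ramp_of_abs_le hy.le] at hx
    simp only at hx hy
    have hy := abs_lt.1 hy
    set k : ℤ := u.1 * n.1 + u.2 * n.2
    have hs : s = 2 * ((m - k : ℤ) : ℝ) := by push_cast; linarith
    have h1 : ((m - k : ℤ) : ℝ) < 1 := by linarith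
    have h2 : (-1 : ℝ) < ((m - k : ℤ) : ℝ) := by linarith
    have h1 : m - k < 1 := by exact_mod_cast h1
    have h2 : -1 < m - k := by exact_mod_cast h2
    rw [show m - k = 0 by omega] at hs
    rw [hs]
    simp

namespace FlatCover

variable {S X : Type*} [TopologicalSpace S] [TopologicalSpace X] {ι : S → X} {p : ℝ × ℝ → X}

/-- Openness passes from the annulus in the quotient to its lift, because `p` is continuous and
locally injective there. -/
theorem isOpenMap_lift (hp : FlatCover ι p) {F : ℝ × ℝ → S} {L : ℝ × ℝ → ℝ × ℝ}
    (hL : Continuous L) (ho : IsOpenMap (ι ∘ F)) (hLF : ∀ y, p (L y) = ι (F y)) :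
    IsOpenMap L := by
  rw [isOpenMap_iff_nhds_le]
  intro y A hA
  obtain ⟨V, hV, hinj⟩ := hp.locInj (L y) ⟨_, (hLF y).symm⟩
  have hU : L ⁻¹' A ∩ L ⁻¹' V ∈ 𝓝 y :=
    Filter.inter_mem hA (hL.continuousAt.preimage_mem_nhds hV)
  have h1 := ho.image_mem_nhds hU
  rw [Function.comp_apply, ← hLF] at h1
  filter_upwards [hp.cont.continuousAt.preimage_mem_nhds h1, hV] with x hx hxV
  obtain ⟨z, ⟨hz1, hz2⟩, hzx⟩ := hx
  have : L z = x := hinj hz2 hxV ((hLF z).trans hzx)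
  rw [← this]
  exact hz1

theorem isOpenMap_collar (hp : FlatCover ι p) {f : Circle × ℝ → S} (hf : IsOpenEmbedding f) :
    IsOpenMap (ι ∘ fun y : ℝ × ℝ => f (circlePar y.1, y.2)) :=
  (hp.annulus_isOpenMap f hf).comp isOpenQuotientMap_circlePar_prod.isOpenMap

end FlatCover

/-! ### Curves crossing once -/

theorem exists_mem_eq_of_between {h : ℝ → ℝ} (hh : Continuous h) {a b c : ℝ}
    (h1 : h a ≤ c) (h2 : c ≤ h b) : ∃ t ∈ Set.uIcc a b, h t = c := by
  have := intermediate_value_uIcc (a := a) (b := b) hh.continuousOn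
  exact this (Set.mem_uIcc.2 (Or.inl ⟨h1, h2⟩))

/-- Say that `h` passes `m + 1/2` upwards at `t₀`. It meets no half-integral level before `t₀ + 1`,
so it stays in `(m + 1/2, m + 3/2)`. Just before `t₀ + 1` its value is `d` plus a value in `(m -
1/2, m + 1/2)`, which leaves only `d = 1`. -/
theorem abs_period_eq_one_of_crossing {h : ℝ → ℝ} (hh : Continuous h) {d m : ℤ}
    (hd : ∀ t, h (t + 1) = h t + d) {t₀ : ℝ} (h₀ : h t₀ = m + 1 / 2)
    (huniq : ∀ (t : ℝ) (j : ℤ), h t = j + 1 / 2 → ∃ k : ℤ, t = t₀ + k) {t₁ t₂ : ℝ}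
    (ht₁ : t₁ ∈ Set.Ioo t₀ (t₀ + 1)) (ht₂ : t₂ ∈ Set.Ioo (t₀ - 1) t₀)
    (hs : (h t₁ - h t₀) * (h t₂ - h t₀) < 0) : |d| = 1 := by
  wlog hpos : 0 < h t₁ - h t₀ generalizing h d m
  · have := this (h := fun t => -h t) (d := -d) (m := -m - 1) (by fun_prop)
      (fun t => by simp only [hd]; push_cast; ring) (by simp only [h₀]; push_cast; ring)
      (fun t j htj => huniq t (-j - 1) (by push_cast; linarith)) (by nlinarith)
      (by
        rcases lt_trichotomy (h t₁ - h t₀) 0 with hc | hc | hc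
        · linarith
        · rw [hc] at hs; simp at hs
        · exact absurd hc hpos)
    rwa [abs_neg] at this
  have hneg : h t₂ - h t₀ < 0 := by
    by_contra! hc
    exact absurd hs (not_lt.2 (mul_nonneg hpos.le hc))
  have hno1 : ∀ t ∈ Set.Ioo t₀ (t₀ + 1), ∀ j : ℤ, h t ≠ j + 1 / 2 := by
    rintro t ⟨ht, ht'⟩ j htj
    obtain ⟨k, rfl⟩ := huniq t j htj
    have h1 : (k : ℝ) < 1 := by linarith
    have h2 : (0 : ℝ) < k := by linarith
    have h1 : k < 1 := by exact_mod_cast h1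
    have h2 : 0 < k := by exact_mod_cast h2
    omega
  have hno2 : ∀ t ∈ Set.Ioo (t₀ - 1) t₀, ∀ j : ℤ, h t ≠ j + 1 / 2 := by
    rintro t ⟨ht, ht'⟩ j htj
    obtain ⟨k, rfl⟩ := huniq t j htj
    have h1 : (k : ℝ) < 0 := by linarith
    have h2 : (-1 : ℝ) < k := by linarith
    have h1 : k < 0 := by exact_mod_cast h1
    have h2 : -1 < k := by exact_mod_cast h2
    omega
  have e1 : (m : ℝ) - 1 / 2 < h t₂ := by
    by_contra! hc
    obtain ⟨t, ht, htm⟩ := exists_mem_eq_of_between hh (b := t₀) hc (by linarith)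
    rw [Set.uIcc_of_le ht₂.2.le] at ht
    rcases ht.2.eq_or_lt with rfl | hlt
    · linarith
    · exact hno2 t ⟨ht₂.1.trans_le ht.1, hlt⟩ (m - 1) (by rw [htm]; push_cast; ring)
  -- The sample point just before `t₀` is moved by one period into the interval after `t₀`.
  have ht₃ : t₂ + 1 ∈ Set.Ioo t₀ (t₀ + 1) := ⟨by linarith [ht₂.1], by linarith [ht₂.2]⟩
  have e2 : (m : ℝ) + 1 / 2 < h (t₂ + 1) := by
    by_contra! hc
    obtain ⟨t, ht, htm⟩ := exists_mem_eq_of_between hh (b := t₁) hc (by linarith)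
    have : t ∈ Set.Ioo t₀ (t₀ + 1) :=
      (Set.ordConnected_Ioo.uIcc_subset ht₃ ht₁) ht
    exact hno1 t this m htm
  have e3 : h (t₂ + 1) < m + 3 / 2 := by
    by_contra! hc
    obtain ⟨t, ht, htm⟩ := exists_mem_eq_of_between hh (a := t₀) (by linarith) hc
    rw [Set.uIcc_of_le ht₃.1.le] at ht
    rcases ht.1.eq_or_lt with rfl | hlt
    · linarith
    · exact hno1 t ⟨hlt, ht.2.trans_lt ht₃.2⟩ (m + 1) (by rw [htm]; push_cast; ring)
  rw [hd] at e2 e3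
  have h1 : (d : ℝ) < 2 := by linarith
  have h2 : (0 : ℝ) < d := by linarith
  have h1 : d < 2 := by exact_mod_cast h1
  have h2 : 0 < d := by exact_mod_cast h2
  rw [show d = 1 by omega]
  rfl

theorem IsPreconnected.mul_pos_of_ne_zero {A : Type*} [TopologicalSpace A] {Q : Set A}
    (hQ : IsPreconnected Q) {f : A → ℝ} (hf : ContinuousOn f Q) (h0 : ∀ x ∈ Q, f x ≠ 0)
    {x y : A} (hx : x ∈ Q) (hy : y ∈ Q) : 0 < f x * f y := by
  have himg := (hQ.image f hf).ordConnected
  have hne : (0 : ℝ) ∉ f '' Q := by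
    rintro ⟨z, hz, hz0⟩
    exact h0 z hz hz0
  rcases lt_or_gt_of_ne (h0 x hx) with h1 | h1 <;> rcases lt_or_gt_of_ne (h0 y hy) with h2 | h2
  · exact mul_pos_of_neg_of_neg h1 h2
  · exact absurd (himg.out ⟨x, hx, rfl⟩ ⟨y, hy, rfl⟩ ⟨h1.le, h2.le⟩) hne
  · exact absurd (himg.out ⟨y, hy, rfl⟩ ⟨x, hx, rfl⟩ ⟨h2.le, h1.le⟩) hne
  · exact mul_pos h1 h2

/-- The transverse coordinate of a collar changes sign along a curve that crosses its core. -/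
theorem exists_sign_change {S : Type*} [TopologicalSpace S] {F : ℝ × ℝ → S} (hF : IsCollar F)
    {g : ℝ → S} (hg : Continuous g) (hinj : ∀ t t', g t = g t' → ∃ k : ℤ, t' = t + k)
    {t₀ : ℝ} (hcross : CrossAt (Set.range fun t => F (t, 0)) (Set.range g) (g t₀))
    (hmem : g t₀ ∈ Set.range fun t => F (t, 0)) {ε : ℝ} (hε : 0 < ε) :
    ∃ y₁ y₂ : ℝ × ℝ, ∃ t₁ ∈ Set.Ioo t₀ (t₀ + ε), ∃ t₂ ∈ Set.Ioo (t₀ - ε) t₀,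
      g t₁ = F y₁ ∧ g t₂ = F y₂ ∧ |y₁.2| < ε ∧ |y₂.2| < ε ∧ y₁.2 * y₂.2 < 0 := by
  classical
  obtain ⟨a, ha⟩ := hmem
  simp only at ha
  obtain ⟨e, hes, he0, hab⟩ := hcross
  choose! r hr using fun x (hx : x ∈ Set.range F) => hx
  have hsF : ∀ y, (r (F y)).2 = y.2 := fun y => by
    have h := hr (F y) ⟨y, rfl⟩
    exact ((hF.inj _ _ _ _ h).1).symm
  have hsc : ContinuousOn (fun x => (r x).2) (Set.range F) := by
    rintro _ ⟨y, rfl⟩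
    refine ContinuousAt.continuousWithinAt ?_
    refine Filter.Tendsto.mono_left (Filter.tendsto_map'_iff.2 ?_) (hF.isOpenMap.nhds_le y)
    have : (fun x => (r x).2) ∘ F = Prod.snd := funext hsF
    rw [this]
    simp only [hsF]
    exact continuous_snd.continuousAt
  have hN : F '' {y | |y.2| < ε} ∈ 𝓝 (g t₀) := by
    rw [← ha]
    refine hF.isOpenMap.image_mem_nhds (IsOpen.mem_nhds ?_ ?_)
    · exact isOpen_lt (by fun_prop) continuous_const
    · simpa using hε
  have hN' : e.symm ⁻¹' (F '' {y | |y.2| < ε}) ∩ e.target ∈ 𝓝 ((0, 0) : ℝ × ℝ) := by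
    rw [← he0]
    refine Filter.inter_mem ?_ (e.open_target.mem_nhds (e.map_source hes))
    apply (e.symm.continuousAt (e.map_source hes)).preimage_mem_nhds
    rwa [e.left_inv hes]
  obtain ⟨ρ, hρ, hball⟩ := Metric.mem_nhds_iff.1 hN'
  rw [← ball_prod_same, Real.ball_eq_Ioo, zero_sub, zero_add] at hball
  let φ : ℝ × ℝ → ℝ := fun z => (r (e.symm z)).2
  have hφc : ContinuousOn φ (Set.Ioo (-ρ) ρ ×ˢ Set.Ioo (-ρ) ρ) := by
    refine hsc.comp (e.continuousOn_symm.mono fun z hz => (hball hz).2) fun z hz => ?_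
    exact Set.image_subset_range _ _ (hball hz).1
  have hφ0 : ∀ z ∈ Set.Ioo (-ρ) ρ ×ˢ Set.Ioo (-ρ) ρ, z.2 ≠ 0 → φ z ≠ 0 := by
    intro z hz hz2 h0
    apply hz2
    obtain ⟨y, hy, hyz⟩ := (hball hz).1
    have h1 := (hab (e.symm z) (e.map_target (hball hz).2)).1.1
    rw [e.right_inv (hball hz).2] at h1
    refine h1 ⟨y.1, ?_⟩
    rw [← hyz]
    have : φ z = y.2 := by simp only [φ]; rw [← hyz, hsF]
    rw [← h0, this]
  -- the coordinate `φ` has opposite signs on the two half-squares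
  have hpos : ∀ z z' : ℝ × ℝ, z ∈ Set.Ioo (-ρ) ρ ×ˢ Set.Ioo 0 ρ →
      z' ∈ Set.Ioo (-ρ) ρ ×ˢ Set.Ioo 0 ρ → 0 < φ z * φ z' := by
    have hsub : Set.Ioo (-ρ) ρ ×ˢ Set.Ioo 0 ρ ⊆ Set.Ioo (-ρ) ρ ×ˢ Set.Ioo (-ρ) ρ :=
      Set.prod_mono_right (Set.Ioo_subset_Ioo_left (by linarith))
    intro z z' hz hz'
    exact (isPreconnected_Ioo.prod isPreconnected_Ioo).mul_pos_of_ne_zero (hφc.mono hsub)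
      (fun x hx => hφ0 x (hsub hx) hx.2.1.ne') hz hz'
  have hneg : ∀ z z' : ℝ × ℝ, z ∈ Set.Ioo (-ρ) ρ ×ˢ Set.Ioo (-ρ) 0 →
      z' ∈ Set.Ioo (-ρ) ρ ×ˢ Set.Ioo (-ρ) 0 → 0 < φ z * φ z' := by
    have hsub : Set.Ioo (-ρ) ρ ×ˢ Set.Ioo (-ρ) 0 ⊆ Set.Ioo (-ρ) ρ ×ˢ Set.Ioo (-ρ) ρ :=
      Set.prod_mono_right (Set.Ioo_subset_Ioo_right (by linarith))
    intro z z' hz hz'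
    exact (isPreconnected_Ioo.prod isPreconnected_Ioo).mul_pos_of_ne_zero (hφc.mono hsub)
      (fun x hx => hφ0 x (hsub hx) hx.2.2.ne) hz hz'
  have hsign : ∀ σ : ℝ, σ ≠ 0 → ∃ z ∈ Set.Ioo (-ρ) ρ ×ˢ Set.Ioo (-ρ) ρ, 0 < σ * φ z := by
    intro σ hσ
    have hU : (fun δ : ℝ => F (a, δ * σ)) ⁻¹' (e.source ∩ e ⁻¹' Metric.ball (0, 0) ρ)
        ∈ 𝓝 (0 : ℝ) := by
      have hFc := hF.cont
      have h1 : ContinuousAt (fun δ : ℝ => F (a, δ * σ)) 0 := by fun_prop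
      refine h1.preimage_mem_nhds ?_
      rw [zero_mul, ha]
      refine Filter.inter_mem (e.open_source.mem_nhds hes) ?_
      apply (e.continuousAt hes).preimage_mem_nhds
      rw [he0]
      exact Metric.ball_mem_nhds _ hρ
    obtain ⟨δ, hδ, hδU⟩ := Metric.mem_nhds_iff.1 hU
    have h2 := hδU (show δ / 2 ∈ Metric.ball (0 : ℝ) δ by
      rw [Metric.mem_ball, dist_zero_right, Real.norm_of_nonneg (by positivity)]; linarith)
    refine ⟨e (F (a, δ / 2 * σ)), ?_, ?_⟩
    · have := h2.2
      rwa [Set.mem_preimage, ← ball_prod_same, Real.ball_eq_Ioo, zero_sub, zero_add] at this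
    · simp only [φ]
      rw [e.left_inv h2.1, hsF]
      simp only
      rw [mul_left_comm]
      exact mul_pos (by positivity) (mul_self_pos.2 hσ)
  have hopp : ∀ z ∈ Set.Ioo (-ρ) ρ ×ˢ Set.Ioo 0 ρ, ∀ z' ∈ Set.Ioo (-ρ) ρ ×ˢ Set.Ioo (-ρ) 0,
      φ z * φ z' < 0 := by
    intro z hz z' hz'
    by_contra! hc
    have hz0 : φ z ≠ 0 := fun h => by have := hpos z z hz hz; rw [h] at this; simp at this
    have hz0' : φ z' ≠ 0 := fun h => by have := hneg z' z' hz' hz'; rw [h] at this; simp at this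
    obtain ⟨x, hx, hx0⟩ := hsign (-φ z) (neg_ne_zero.2 hz0)
    have hzz : 0 < φ z * φ z' := lt_of_le_of_ne hc (mul_ne_zero hz0 hz0').symm
    rcases lt_trichotomy x.2 0 with h | h | h
    · have := hneg z' x hz' ⟨hx.1, hx.2.1, h⟩
      nlinarith [mul_pos hzz this, mul_self_pos.2 hz0']
    · have : φ x = 0 := by
        have h1 := (hab (e.symm x) (e.map_target (hball hx).2)).1.2
        rw [e.right_inv (hball hx).2] at h1
        obtain ⟨t, ht⟩ := h1 h
        simp only [φ]
        rw [← ht, hsF]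
      rw [this] at hx0
      simp at hx0
    · have := hpos z x hz ⟨hx.1, h, hx.2.2⟩
      linarith
  -- the curve runs along the second axis
  have hgU : g ⁻¹' (e.source ∩ e ⁻¹' Metric.ball (0, 0) ρ) ∈ 𝓝 t₀ := by
    refine hg.continuousAt.preimage_mem_nhds ?_
    refine Filter.inter_mem (e.open_source.mem_nhds hes) ?_
    apply (e.continuousAt hes).preimage_mem_nhds
    rw [he0]
    exact Metric.ball_mem_nhds _ hρ
  obtain ⟨δ', hδ', hδU'⟩ := Metric.mem_nhds_iff.1 hgU
  set δ := min (δ' / 2) (min (ε / 2) (1 / 4)) with hδdef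
  have hδ : 0 < δ := lt_min (by linarith) (lt_min (by linarith) (by norm_num))
  have hδ1 : δ ≤ δ' / 2 := min_le_left _ _
  have hδ2 : δ ≤ ε / 2 := (min_le_right _ _).trans (min_le_left _ _)
  have hδ3 : δ ≤ 1 / 4 := (min_le_right _ _).trans (min_le_right _ _)
  have hgm : ∀ t ∈ Set.Icc (t₀ - δ) (t₀ + δ), g t ∈ e.source ∧
      e (g t) ∈ Set.Ioo (-ρ) ρ ×ˢ Set.Ioo (-ρ) ρ := by
    intro t ht
    have := hδU' (show t ∈ Metric.ball t₀ δ' by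
      rw [Real.ball_eq_Ioo]; exact ⟨by linarith [ht.1], by linarith [ht.2]⟩)
    refine ⟨this.1, ?_⟩
    have := this.2
    rwa [Set.mem_preimage, ← ball_prod_same, Real.ball_eq_Ioo, zero_sub, zero_add] at this
  have hg1 : ∀ t ∈ Set.Icc (t₀ - δ) (t₀ + δ), (e (g t)).1 = 0 := fun t ht =>
    ((hab (g t) (hgm t ht).1).2).1 ⟨t, rfl⟩
  let y : ℝ → ℝ := fun t => (e (g t)).2
  have hyc : ContinuousOn y (Set.Icc (t₀ - δ) (t₀ + δ)) :=
    continuous_snd.comp_continuousOn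
      (e.continuousOn.comp hg.continuousOn fun t ht => (hgm t ht).1)
  have hyi : Set.InjOn y (Set.Icc (t₀ - δ) (t₀ + δ)) := by
    intro t ht t' ht' htt
    have h1 : e (g t) = e (g t') := Prod.ext ((hg1 t ht).trans (hg1 t' ht').symm) htt
    have h2 := e.injOn (hgm t ht).1 (hgm t' ht').1 h1
    obtain ⟨k, hk⟩ := hinj t t' h2
    have e1 : (k : ℝ) < 1 := by linarith [ht.1, ht'.2]
    have e2 : (-1 : ℝ) < k := by linarith [ht.2, ht'.1]
    have e1 : k < 1 := by exact_mod_cast e1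
    have e2 : -1 < k := by exact_mod_cast e2
    rw [hk, show k = 0 by omega]
    simp
  have hy0 : y t₀ = 0 := by simp only [y, he0]
  have m0 : t₀ ∈ Set.Icc (t₀ - δ) (t₀ + δ) := ⟨by linarith, by linarith⟩
  have m1 : t₀ + δ ∈ Set.Icc (t₀ - δ) (t₀ + δ) := ⟨by linarith, by linarith⟩
  have m2 : t₀ - δ ∈ Set.Icc (t₀ - δ) (t₀ + δ) := ⟨by linarith, by linarith⟩
  have hprod : φ (e (g (t₀ + δ))) * φ (e (g (t₀ - δ))) < 0 := by
    have a1 := hgm _ m1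
    have a2 := hgm _ m2
    rcases hyc.strictMonoOn_of_injOn_Icc' (by linarith) hyi with hm | hm
    · have h1 : 0 < y (t₀ + δ) := hy0 ▸ hm m0 m1 (by linarith)
      have h2 : y (t₀ - δ) < 0 := hy0 ▸ hm m2 m0 (by linarith)
      exact hopp _ ⟨a1.2.1, h1, a1.2.2.2⟩ _ ⟨a2.2.1, a2.2.2.1, h2⟩
    · have h1 : y (t₀ + δ) < 0 := hy0 ▸ hm m0 m1 (by linarith)
      have h2 : 0 < y (t₀ - δ) := hy0 ▸ hm m2 m0 (by linarith)
      rw [mul_comm]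
      exact hopp _ ⟨a2.2.1, h2, a2.2.2.2⟩ _ ⟨a1.2.1, a1.2.2.1, h1⟩
  have hgF : ∀ t ∈ Set.Icc (t₀ - δ) (t₀ + δ), ∃ y, g t = F y ∧ |y.2| < ε ∧
      φ (e (g t)) = y.2 := by
    intro t ht
    obtain ⟨y, hy, hyt⟩ := (hball (hgm t ht).2).1
    rw [e.left_inv (hgm t ht).1] at hyt
    refine ⟨y, hyt.symm, hy, ?_⟩
    simp only [φ]
    rw [e.left_inv (hgm t ht).1, ← hyt, hsF]
  obtain ⟨y₁, b1, b2, b3⟩ := hgF _ m1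
  obtain ⟨y₂, c1, c2, c3⟩ := hgF _ m2
  rw [b3, c3] at hprod
  exact ⟨y₁, y₂, t₀ + δ, ⟨by linarith, by linarith⟩, t₀ - δ, ⟨by linarith, by linarith⟩,
    b1, c1, b2, c2, hprod⟩

theorem core_eq_range {S : Type*} (f : Circle × ℝ → S) :
    f '' (Set.univ ×ˢ {0}) = Set.range fun t => f (circlePar t, 0) := by
  ext x
  constructor
  · rintro ⟨⟨z, s⟩, ⟨-, hs⟩, rfl⟩
    obtain rfl : s = 0 := hs
    obtain ⟨t, rfl⟩ := circlePar_surjective z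
    exact ⟨t, rfl⟩
  · rintro ⟨t, rfl⟩
    exact ⟨(circlePar t, 0), ⟨trivial, rfl⟩, rfl⟩

theorem hasClass_of_collar {S X : Type*} [TopologicalSpace S] {ι : S → X} {p : ℝ × ℝ → X}
    {F : ℝ × ℝ → S} {L : ℝ × ℝ → ℝ × ℝ} {v : ℤ × ℤ} (hF : IsCollar F)
    (hL : Continuous L) (hLF : ∀ y, p (L y) = ι (F y))
    (hv : ∀ t s, L (t + 1, s) = L (t, s) + latticePt v) :
    HasClass ι p (Set.range fun t => F (t, 0)) v := by
  have hFc := hF.cont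
  exact ⟨fun t => F (t, 0), fun t => L (t, 0), by fun_prop, by fun_prop,
    fun t => hF.periodic t 0, fun t t' h => (hF.inj _ _ _ _ h).2, rfl, fun t => hLF _,
    fun t => hv t 0⟩

namespace FlatCover

variable {S X : Type*} [TopologicalSpace S] [TopologicalSpace X] {ι : S → X} {p : ℝ × ℝ → X}

theorem exists_lift_collar (hp : FlatCover ι p) (hodd : ¬ ∀ x, p (-x) = p x) {α : Set S}
    (hα : IsSimpleClosedCurve α) : ∃ (F : ℝ × ℝ → S) (L : ℝ × ℝ → ℝ × ℝ) (v : ℤ × ℤ),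
      IsCollar F ∧ (Set.range fun t => F (t, 0)) = α ∧ Continuous L ∧ IsOpenMap L ∧
      (∀ y, p (L y) = ι (F y)) ∧ ∀ t s, L (t + 1, s) = L (t, s) + latticePt v := by
  obtain ⟨f, hf, rfl⟩ := hα
  have hF := IsCollar.of_isOpenEmbedding hf
  obtain ⟨L, hL, hLF⟩ := hp.lift _ hF.cont
  have hb : p (L (0, 0)) = p (L (0 + 1, 0)) := by rw [hLF, hLF, hF.periodic]
  rcases hp.fiber _ _ hb with ⟨v, hv⟩ | ⟨he, -⟩
  · refine ⟨_, L, v, hF, (core_eq_range f).symm, hL,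
      hp.isOpenMap_lift hL (hp.isOpenMap_collar hf) hLF, hLF, fun t s => ?_⟩
    exact hp.lift_period hL hLF (σ := fun y => (y.1 + 1, y.2)) (by fun_prop)
      (fun y => hF.periodic _ _) (a₀ := (0, 0)) hv (t, s)
  · exact absurd he hodd

/-- Along a lift of `β` the dual function of `α` is half-integral exactly at intersection points.
There is one per period, and transversality makes the function change sides there, so its period `u
· w` is `± 1`. -/
theorem exists_classes_of_meet_once (hp : FlatCover ι p) (hodd : ¬ ∀ x, p (-x) = p x)
    {α β : Set S} (hα : IsSimpleClosedCurve α) (hβ : IsSimpleClosedCurve β)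
    (h : MeetTransversely 1 α β) : ∃ u v w : ℤ × ℤ, HasClass ι p α v ∧ HasClass ι p β w ∧
      u.1 * v.1 + u.2 * v.2 = 0 ∧ |u.1 * w.1 + u.2 * w.2| = 1 := by
  obtain ⟨F, L, v, hF, rfl, hL, hLo, hLF, hLv⟩ := hp.exists_lift_collar hodd hα
  obtain ⟨F', L', w, hF', rfl, hL', -, hLF', hLw⟩ := hp.exists_lift_collar hodd hβ
  have hFc' := hF'.cont
  have hfib : ∀ x y, p x = p y → ∃ n, y = x + latticePt n := fun x y hxy =>
    (hp.fiber x y hxy).resolve_right fun h => hodd h.1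
  obtain ⟨G, u, hG, hGu, hGL, hG0, huv⟩ := exists_dual_function hL hLo (fun y y' n hn => by
    have : ι (F y) = ι (F y') := by rw [← hLF, ← hLF, hn, hp.periodic]
    exact (hF.inj _ _ _ _ (hp.emb.injective this)).1) hLv
  refine ⟨u, v, w, hasClass_of_collar hF hL hLF hLv, hasClass_of_collar hF' hL' hLF' hLw, huv, ?_⟩
  obtain ⟨x₀, hx₀⟩ := Set.encard_eq_one.1 h.1
  have hx₀m : x₀ ∈ (Set.range fun t => F (t, 0)) ∩ Set.range fun t => F' (t, 0) := by
    rw [hx₀]; rfl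
  have hcross := h.2 x₀ hx₀m
  obtain ⟨h1, t₀, ht₀⟩ := hx₀m
  simp only at ht₀
  subst ht₀
  let h' : ℝ → ℝ := fun t => G (L' (t, 0))
  have hval : ∀ t y, F' (t, 0) = F y → ∃ k : ℤ, h' t = ramp y.2 + k := by
    intro t y hty
    obtain ⟨n, hn⟩ := hfib (L y) (L' (t, 0)) (by rw [hLF, hLF', hty])
    exact ⟨_, by simp only [h']; rw [hn, hGu, hGL]⟩
  have hcont : Continuous h' := by fun_prop
  obtain ⟨a, ha⟩ := h1
  obtain ⟨m, hm⟩ := hval t₀ (a, 0) ha.symm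
  have hm : h' t₀ = m + 1 / 2 := by
    rw [hm, ramp_of_abs_le (by simp)]
    simp only
    ring
  -- Keeping the variation below `1/4` pins the integer in `hval`, so near `t₀` the dual function is
  -- `1/2` of the collar coordinate up to a constant.
  obtain ⟨ε', hε', hnear⟩ := Metric.continuousAt_iff.1 (hcont.continuousAt (x := t₀)) (1 / 4)
    (by norm_num)
  set ε := min ε' (1 / 4) with hεdef
  have hε : 0 < ε := lt_min hε' (by norm_num)
  have hε1 : ε ≤ ε' := min_le_left _ _
  have hε2 : ε ≤ 1 / 4 := min_le_right _ _
  have hval' : ∀ t y, F' (t, 0) = F y → |t - t₀| < ε → |y.2| < ε → h' t - h' t₀ = y.2 / 2 := by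
    intro t y hty ht hy
    obtain ⟨k, hk⟩ := hval t y hty
    have h2 := hnear (x := t) (by rw [Real.dist_eq]; linarith)
    rw [ramp_of_abs_le (by linarith)] at hk
    rw [Real.dist_eq, hk, hm] at h2
    have h3 := abs_lt.1 h2
    have h4 := abs_lt.1 hy
    have e1 : ((k - m : ℤ) : ℝ) < 1 := by push_cast; linarith
    have e2 : (-1 : ℝ) < ((k - m : ℤ) : ℝ) := by push_cast; linarith
    have e1 : k - m < 1 := by exact_mod_cast e1
    have e2 : -1 < k - m := by exact_mod_cast e2
    rw [hk, hm, show k = m by omega]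
    ring
  obtain ⟨y₁, y₂, t₁, ht₁, t₂, ht₂, b1, b2, b3, b4, b5⟩ := exists_sign_change hF
    (g := fun t => F' (t, 0)) (by fun_prop) (fun t t' h => (hF'.inj _ _ _ _ h).2) hcross ⟨a, ha⟩ hε
  refine abs_period_eq_one_of_crossing hcont (fun t => ?_) hm ?_ (t₁ := t₁) (t₂ := t₂)
    ⟨ht₁.1, by linarith [ht₁.2]⟩ ⟨by linarith [ht₂.1], ht₂.2⟩ ?_
  · simp only [h']
    rw [hLw, hGu]
  · intro t j htj
    obtain ⟨b, n, hbn⟩ := exists_half_of_eq_int_add_half hGu hGL hG0 htj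
    have : F' (t, 0) = F (b, 0) := hp.emb.injective (by rw [← hLF, ← hLF', hbn, hp.periodic])
    have hmem : F' (t, 0) ∈ (Set.range fun t => F (t, 0)) ∩ Set.range fun t => F' (t, 0) :=
      ⟨⟨b, this.symm⟩, t, rfl⟩
    rw [hx₀] at hmem
    exact (hF'.inj _ _ _ _ hmem.symm).2
  · rw [hval' t₁ y₁ b1 (abs_lt.2 ⟨by linarith [ht₁.1], by linarith [ht₁.2]⟩) b3,
      hval' t₂ y₂ b2 (abs_lt.2 ⟨by linarith [ht₂.1], by linarith [ht₂.2]⟩) b4]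
    linarith

theorem hasInfiniteDiameter_one (hp : FlatCover ι p) (hodd : ¬ ∀ x, p (-x) = p x) :
    HasInfiniteDiameter (sporadicCurveComplex 1 S) := by
  refine hp.hasInfiniteDiameter 1 (fun T hT => hp.meetTransversely_one hT hodd) ?_
  intro α β hα hβ h
  obtain ⟨u, v, w, h1, h2, h3, h4⟩ :=
    hp.exists_classes_of_meet_once hodd hα.isSimpleClosedCurve hβ.isSimpleClosedCurve h
  -- Exchanging the curves provides a class of `α` that pairs non-trivially, which excludes `v = 0`.
  obtain ⟨u', w', v', h1', h2', h3', h4'⟩ :=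
    hp.exists_classes_of_meet_once hodd hβ.isSimpleClosedCurve hα.isSimpleClosedCurve h.symm
  refine ⟨u, v, w, ?_, ?_, ?_, h1, h2, h3, h4.le⟩
  · rintro rfl; simp at h4
  · rintro rfl
    obtain ⟨k, hk⟩ := hp.hasClass_unique h1 h2'
    rw [smul_zero] at hk
    subst hk
    simp at h4'
  · rintro rfl; simp at h4

end FlatCover

/-! ### Winding numbers -/

/-- The winding number about the origin is the same for all loops of the family: it is `0` for the
constant loop and `1` for a loop that never points away from the unit circle. -/
theorem false_of_winding {c : ℝ × ℝ → ℝ × ℝ} (hc : Continuous c) (h0 : ∀ y, c y ≠ 0)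
    (hper : ∀ r t, c (r, t + 1) = c (r, t)) (hconst : ∀ t, c (0, t) = c (0, 0))
    (hpos : ∀ t, 0 < (c (1, t)).1 * Real.cos (2 * Real.pi * t) +
      (c (1, t)).2 * Real.sin (2 * Real.pi * t)) : False := by
  have hpi := Real.pi_pos
  let w : ℝ × ℝ → ℂ := fun y => ⟨(c y).1, (c y).2⟩
  have hw : Continuous w := by
    have : w = fun y => ((c y).1 : ℂ) + (c y).2 * Complex.I := by
      funext y
      exact Complex.mk_eq_add_mul_I _ _
    rw [this]
    fun_prop
  have hw0 : ∀ y, w y ≠ 0 := by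
    intro y h
    apply h0 y
    exact Prod.ext (congrArg Complex.re h) (congrArg Complex.im h)
  have hwn : ∀ y, 0 < ‖w y‖ := fun y => norm_pos_iff.2 (hw0 y)
  let z : ℝ × ℝ → Circle := fun y => ⟨w y / ‖w y‖, by
    simp [Submonoid.unitSphere, (hwn y).ne']⟩
  have hz : Continuous z := by
    refine Continuous.subtype_mk ?_ _
    refine hw.div (Complex.continuous_ofReal.comp hw.norm) fun y => ?_
    exact_mod_cast (hwn y).ne'
  obtain ⟨θ₀, hθ₀⟩ : ∃ θ, Circle.exp θ = z (0, 0) := ⟨_, Circle.exp_arg _⟩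
  obtain ⟨Θ, ⟨-, hΘ⟩, -⟩ := Circle.isCoveringMap_exp.existsUnique_continuousMap_lifts
    ⟨z, hz⟩ (0, 0) θ₀ hθ₀
  have hΘ' : ∀ y, Circle.exp (Θ y) = z y := fun y => congrFun hΘ y
  have hlift : ∀ y y', z y = z y' → ∃ k : ℤ, (Θ y - Θ y') / (2 * Real.pi) = k := by
    intro y y' h
    rw [← hΘ', ← hΘ', Circle.exp_eq_exp] at h
    obtain ⟨k, hk⟩ := h
    exact ⟨k, by rw [hk]; field_simp; ring⟩
  have hzper : ∀ r t, z (r, t + 1) = z (r, t) := by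
    intro r t
    ext
    simp only [z, w, hper]
  have hΘc := Θ.continuous
  obtain ⟨k, hk⟩ := exists_const_of_int_valued
    (f := fun y : ℝ × ℝ => (Θ (y.1, y.2 + 1) - Θ y) / (2 * Real.pi)) (by fun_prop)
    (fun y => hlift _ _ (hzper y.1 y.2))
  obtain ⟨j, hj⟩ := exists_const_of_int_valued
    (f := fun t : ℝ => (Θ (0, t) - Θ (0, 0)) / (2 * Real.pi)) (by fun_prop)
    (fun t => hlift _ _ (by ext; simp only [z, w, hconst t]))
  have hk0 : (k : ℝ) = 0 := by
    have h1 := hk (0, 0)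
    have h2 := hj (0 + 1)
    have h3 := hj 0
    simp only at h1
    rw [← h1, h2, ← h3]
    simp
  have hcos : ∀ t, 0 < Real.cos (Θ (1, t) - 2 * Real.pi * t) := by
    intro t
    have h1 : (z (1, t) : ℂ) = w (1, t) / ‖w (1, t)‖ := rfl
    rw [← hΘ', Circle.coe_exp, Complex.exp_mul_I, ← Complex.ofReal_cos, ← Complex.ofReal_sin,
      eq_div_iff (by exact_mod_cast (hwn _).ne')] at h1
    have e1 := congrArg Complex.re h1
    have e2 := congrArg Complex.im h1
    simp only [Complex.mul_re, Complex.mul_im, Complex.add_re, Complex.add_im, Complex.ofReal_re,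
      Complex.ofReal_im, Complex.I_re, Complex.I_im, mul_zero, mul_one, add_zero, zero_add,
      sub_zero, sub_self] at e1 e2
    have e3 : (w (1, t)).re = (c (1, t)).1 := rfl
    have e4 : (w (1, t)).im = (c (1, t)).2 := rfl
    have := hpos t
    rw [← e3, ← e4, ← e1, ← e2] at this
    rw [Real.cos_sub]
    have hn := hwn (1, t)
    by_contra! hc
    nlinarith
  have hf : Continuous fun t : ℝ => Θ (1, t) - 2 * Real.pi * t := by fun_prop
  have h1 := hk (1, 0)
  simp only [hk0, div_eq_zero_iff] at h1
  have h1 := h1.resolve_right (by positivity)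
  have hc0 := hcos 0
  -- With winding number `0` the angle difference falls by `2π` over one period, so it passes a
  -- value at distance `π` from the initial one, where the cosine has the opposite sign.
  obtain ⟨t, -, ht⟩ := exists_mem_eq_of_between hf (a := 0 + 1) (b := 0)
    (c := Θ (1, 0) - Real.pi) (by linarith) (by linarith)
  have hct := hcos t
  rw [ht, Real.cos_sub_pi] at hct
  rw [mul_zero, sub_zero] at hc0
  linarith

/-! ### The torus -/

/-- The projection of the plane onto the torus. -/
def torusProj (x : ℝ × ℝ) : UnitAddCircle × UnitAddCircle := (x.1, x.2)

theorem continuous_torusProj : Continuous torusProj :=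
  ((AddCircle.continuous_mk' 1).comp continuous_fst).prodMk
    ((AddCircle.continuous_mk' 1).comp continuous_snd)

theorem isOpenMap_torusProj : IsOpenMap torusProj :=
  QuotientAddGroup.isOpenMap_coe.prodMap QuotientAddGroup.isOpenMap_coe

theorem torusProj_surjective : Function.Surjective torusProj := by
  rintro ⟨a, b⟩
  obtain ⟨a, rfl⟩ := QuotientAddGroup.mk_surjective a
  obtain ⟨b, rfl⟩ := QuotientAddGroup.mk_surjective b
  exact ⟨(a, b), rfl⟩

theorem torusProj_eq_iff {x y : ℝ × ℝ} : torusProj x = torusProj y ↔ ∃ n, y = x + latticePt n := by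
  rw [Prod.ext_iff]
  change (x.1 : UnitAddCircle) = y.1 ∧ (x.2 : UnitAddCircle) = y.2 ↔ _
  rw [coe_eq_coe_unitAddCircle, coe_eq_coe_unitAddCircle]
  constructor
  · rintro ⟨⟨a, ha⟩, b, hb⟩
    exact ⟨(a, b), Prod.ext ha hb⟩
  · rintro ⟨n, rfl⟩
    exact ⟨⟨n.1, rfl⟩, n.2, rfl⟩

theorem torusProj_add (x y : ℝ × ℝ) : torusProj (x + y) = torusProj x + torusProj y := rfl

theorem torusProj_sub (x y : ℝ × ℝ) : torusProj (x - y) = torusProj x - torusProj y := rfl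

theorem not_torusProj_even : ¬ ∀ x, torusProj (-x) = torusProj x := by
  intro h
  obtain ⟨n, hn⟩ := torusProj_eq_iff.1 (h (1 / 4, 0))
  have h1 := congrArg Prod.fst hn
  simp only [Prod.fst_add, Prod.fst_neg, latticePt_fst] at h1
  have h2 : (2 * n.1 : ℤ) = 1 := by
    have : (2 : ℝ) * n.1 = 1 := by linarith
    exact_mod_cast this
  omega

theorem flatCover_torusProj {S : Type*} [TopologicalSpace S]
    {ι : S → UnitAddCircle × UnitAddCircle} (hι : IsEmbedding ι)
    (hann : ∀ f : Circle × ℝ → S, IsOpenEmbedding f → IsOpenMap (ι ∘ f))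
    (hr : ∀ x : ℝ × ℝ, ((∃ m : ℤ, |x.1 - m - 3 / 8| < 1 / 8) ∨
      ∃ m : ℤ, |x.2 - m - 3 / 8| < 1 / 8) → Set.range ι ∈ 𝓝 (torusProj x))
    (htw : ∀ x, torusProj (twist x) ∈ Set.range ι ↔ torusProj x ∈ Set.range ι) :
    FlatCover ι torusProj where
  t2 := inferInstance
  emb := hι
  cont := continuous_torusProj
  isOpenMap := isOpenMap_torusProj
  surj := torusProj_surjective
  periodic x n := (torusProj_eq_iff.2 ⟨n, rfl⟩).symm
  fiber x y h := Or.inl (torusProj_eq_iff.1 h)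
  locInj x _ := by
    refine ⟨Metric.ball x (1 / 2), Metric.ball_mem_nhds _ (by norm_num), ?_⟩
    intro y hy y' hy' h
    obtain ⟨n, rfl⟩ := torusProj_eq_iff.1 h
    rw [Metric.mem_ball] at hy hy'
    have h1 : ‖latticePt n‖ < 1 := by
      have := dist_triangle_right (y + latticePt n) y x
      rw [dist_self_add_left] at this
      linarith
    have key : ∀ k : ℤ, |(k : ℝ)| ≤ ‖latticePt n‖ → k = 0 := by
      intro k hk
      have : |(k : ℝ)| < 1 := hk.trans_lt h1
      exact Int.abs_lt_one_iff.1 (by exact_mod_cast this)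
    have e1 := key n.1 (norm_fst_le (latticePt n))
    have e2 := key n.2 (norm_snd_le (latticePt n))
    have : n = 0 := Prod.ext e1 e2
    rw [this, latticePt_zero, add_zero]
  lift c hc := by
    have h := hι.continuous.comp hc
    obtain ⟨a, ha, ha'⟩ := exists_lift_unitAddCircle (continuous_fst.comp h)
    obtain ⟨b, hb, hb'⟩ := exists_lift_unitAddCircle (continuous_snd.comp h)
    exact ⟨fun y => (a y, b y), by fun_prop, fun y => Prod.ext (ha' y) (hb' y)⟩
  annulus_isOpenMap := hann
  range_mem_nhds := hr
  twist_mem := htw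

/-- A strip on which a coordinate is far from the integers misses the neighbourhood of the
lattice. -/
theorem norm_torusProj_of_strip {x : ℝ × ℝ} (hx : (∃ m : ℤ, |x.1 - m - 3 / 8| < 1 / 8) ∨
    ∃ m : ℤ, |x.2 - m - 3 / 8| < 1 / 8) : 1 / 4 < ‖torusProj x‖ := by
  have key : ∀ t : ℝ, (∃ m : ℤ, |t - m - 3 / 8| < 1 / 8) → 1 / 4 < ‖(t : UnitAddCircle)‖ := by
    rintro t ⟨m, hm⟩
    have h := abs_lt.1 hm
    have h1 : round t = m := by
      rw [round_eq, Int.floor_eq_iff]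
      constructor <;> linarith
    rw [UnitAddCircle.norm_eq, h1, lt_abs]
    left
    linarith
  rw [Prod.norm_def]
  rcases hx with hx | hx
  · exact lt_max_of_lt_left (key _ hx)
  · exact lt_max_of_lt_right (key _ hx)

/-- Once the second coordinate is within `1/4` of an integer, `bump` equals that integer and does
not change the first coordinate modulo `1`. -/
theorem norm_torusProj_twist (x : ℝ × ℝ) {r : ℝ} (hr : r ≤ 1 / 4) :
    ‖torusProj (twist x)‖ < r ↔ ‖torusProj x‖ < r := by
  rw [Prod.norm_def, Prod.norm_def, max_lt_iff, max_lt_iff, and_comm]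
  refine and_congr_left fun h => ?_
  change ‖((x.1 + 3 * bump x.2 : ℝ) : UnitAddCircle)‖ < r ↔ ‖(x.1 : UnitAddCircle)‖ < r
  change ‖(x.2 : UnitAddCircle)‖ < r at h
  rw [UnitAddCircle.norm_eq] at h
  have h1 : bump x.2 = round x.2 := by
    have h2 := bump_add_int (x.2 - round x.2) (round x.2)
    have h3 : bump (x.2 - round x.2) = 0 := bump_of_abs_le (h.le.trans hr)
    rwa [sub_add_cancel, h3, zero_add] at h2
  have h2 : ((x.1 + 3 * bump x.2 : ℝ) : UnitAddCircle) = (x.1 : UnitAddCircle) := by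
    rw [eq_comm, coe_eq_coe_unitAddCircle]
    exact ⟨3 * round x.2, by rw [h1]; push_cast; ring⟩
  rw [h2]

theorem torusProj_twist_eq_zero (x : ℝ × ℝ) : torusProj (twist x) = 0 ↔ torusProj x = 0 := by
  have h0 : ∀ y, torusProj y = 0 ↔ ∃ n, y = latticePt n := by
    intro y
    have : (0 : UnitAddCircle × UnitAddCircle) = torusProj 0 := rfl
    rw [this, eq_comm, torusProj_eq_iff]
    simp
  rw [h0, h0]
  constructor
  · rintro ⟨n, hn⟩
    obtain ⟨m, rfl⟩ := exists_twistLattice_eq n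
    refine ⟨m, twistHomeo.injective ?_⟩
    change twist x = twist _
    have h := twist_add 0 m
    rw [zero_add] at h
    rw [h, hn]
    simp [twist, bump_of_abs_le]
  · rintro ⟨n, rfl⟩
    refine ⟨twistLattice n, ?_⟩
    have h := twist_add 0 n
    rw [zero_add] at h
    rw [h]
    simp [twist, bump_of_abs_le]

/-! ### The torus with a hole -/

theorem norm_unitAddCircle_of_abs_le {a : ℝ} (ha : |a| ≤ 1 / 2) : ‖(a : UnitAddCircle)‖ = |a| :=
  (AddCircle.norm_coe_eq_abs_iff 1 one_ne_zero).2 (by simpa using ha)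

/-- Near a point of the boundary of the hole, pushing away from the centre preserves the surface. -/
theorem norm_add_push {x₀ d : ℝ × ℝ} (hx₀ : ‖x₀‖ = 1 / 4) (hd : ‖d‖ < 1 / 16)
    (h : 1 / 4 ≤ ‖torusProj (x₀ + d)‖) {τ : ℝ} (hτ : 0 ≤ τ) (hτ' : τ ≤ 1 / 4) :
    1 / 4 ≤ ‖torusProj (x₀ + d + τ • x₀)‖ := by
  have key : ∀ a b : ℝ, |a| ≤ 1 / 4 → |b| < 1 / 16 →
      ‖((a + b : ℝ) : UnitAddCircle)‖ = |a + b| ∧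
      ‖((a + b + τ * a : ℝ) : UnitAddCircle)‖ = |a + b + τ * a| ∧
      (1 / 4 ≤ |a + b| → 1 / 4 ≤ |a + b + τ * a|) := by
    intro a b ha hb
    have ha := abs_le.1 ha
    have hb := abs_lt.1 hb
    refine ⟨norm_unitAddCircle_of_abs_le (abs_le.2 ⟨by linarith, by linarith⟩),
      norm_unitAddCircle_of_abs_le (abs_le.2 ⟨by nlinarith, by nlinarith⟩), ?_⟩
    intro hab
    rcases le_abs'.1 hab with h1 | h1
    · rw [le_abs']; left; nlinarith
    · rw [le_abs']; right; nlinarith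
  have n1 := (norm_fst_le x₀).trans hx₀.le
  have n2 := (norm_snd_le x₀).trans hx₀.le
  have n3 := (norm_fst_le d).trans_lt hd
  have n4 := (norm_snd_le d).trans_lt hd
  obtain ⟨k1, k2, k3⟩ := key x₀.1 d.1 n1 n3
  obtain ⟨l1, l2, l3⟩ := key x₀.2 d.2 n2 n4
  rw [Prod.norm_def] at h ⊢
  change 1 / 4 ≤ max ‖((x₀.1 + d.1 : ℝ) : UnitAddCircle)‖ ‖((x₀.2 + d.2 : ℝ) : UnitAddCircle)‖ at h
  change 1 / 4 ≤ max ‖((x₀.1 + d.1 + τ * x₀.1 : ℝ) : UnitAddCircle)‖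
    ‖((x₀.2 + d.2 + τ * x₀.2 : ℝ) : UnitAddCircle)‖
  rw [k1, l1] at h
  rw [k2, l2]
  rcases le_max_iff.1 h with h | h
  · exact le_max_of_le_left (k3 h)
  · exact le_max_of_le_right (l3 h)

theorem norm_torusProj_smul {x₀ : ℝ × ℝ} (hx₀ : ‖x₀‖ = 1 / 4) {c : ℝ} (hc : |c| ≤ 1) :
    ‖torusProj (c • x₀)‖ = |c| / 4 := by
  have key : ∀ a : ℝ, |a| ≤ 1 / 4 → ‖((c * a : ℝ) : UnitAddCircle)‖ = |c * a| := by
    intro a ha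
    refine norm_unitAddCircle_of_abs_le ?_
    rw [abs_mul]
    nlinarith [abs_nonneg c, abs_nonneg a]
  have n1 := (norm_fst_le x₀).trans hx₀.le
  have n2 := (norm_snd_le x₀).trans hx₀.le
  have h1 : ‖torusProj (c • x₀)‖ = ‖c • x₀‖ := by
    rw [Prod.norm_def, Prod.norm_def]
    exact congrArg₂ max (key _ n1) (key _ n2)
  rw [h1, norm_smul, hx₀, Real.norm_eq_abs]
  ring

theorem exists_torusProj_near {x₀ : ℝ × ℝ} {z : UnitAddCircle × UnitAddCircle} {ε : ℝ}
    (hz : ‖z - torusProj x₀‖ < ε) : ∃ d, ‖d‖ < ε ∧ z = torusProj (x₀ + d) := by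
  obtain ⟨y, hy⟩ := torusProj_surjective (z - torusProj x₀)
  let d : ℝ × ℝ := (y.1 - round y.1, y.2 - round y.2)
  have h1 : torusProj y = torusProj d :=
    torusProj_eq_iff.2 ⟨(-round y.1, -round y.2), by
      ext <;> simp [d, sub_eq_add_neg]⟩
  refine ⟨d, ?_, ?_⟩
  · rw [← hy, Prod.norm_def] at hz
    change max ‖(y.1 : UnitAddCircle)‖ ‖(y.2 : UnitAddCircle)‖ < ε at hz
    rw [UnitAddCircle.norm_eq, UnitAddCircle.norm_eq] at hz
    exact hz
  · rw [torusProj_add, ← h1, hy, add_sub_cancel]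

/-- An open annulus in the torus with a hole does not meet the boundary. -/
theorem norm_ne_of_isCollar {F : ℝ × ℝ → {x : UnitAddCircle × UnitAddCircle // 1 / 4 ≤ ‖x‖}}
    (hF : IsCollar F) (y₀ : ℝ × ℝ) : ‖(F y₀ : UnitAddCircle × UnitAddCircle)‖ ≠ 1 / 4 := by
  intro hbd
  have hpi := Real.pi_pos
  let J : ℝ × ℝ → UnitAddCircle × UnitAddCircle := fun y => F y
  have hJ : Continuous J := continuous_subtype_val.comp hF.cont
  obtain ⟨x₀, hx₀, hx₀J⟩ : ∃ x₀, ‖x₀‖ = 1 / 4 ∧ J y₀ = torusProj x₀ := by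
    obtain ⟨y, hy⟩ := torusProj_surjective (J y₀)
    let d : ℝ × ℝ := (y.1 - round y.1, y.2 - round y.2)
    have h1 : torusProj y = torusProj d :=
      torusProj_eq_iff.2 ⟨(-round y.1, -round y.2), by ext <;> simp [d, sub_eq_add_neg]⟩
    refine ⟨d, ?_, by rw [← h1, hy]⟩
    have h2 : ‖J y₀‖ = 1 / 4 := hbd
    rw [← hy, Prod.norm_def] at h2
    change max ‖(y.1 : UnitAddCircle)‖ ‖(y.2 : UnitAddCircle)‖ = 1 / 4 at h2
    rw [UnitAddCircle.norm_eq, UnitAddCircle.norm_eq] at h2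
    exact h2
  -- a local inverse of the collar
  let B : Set (ℝ × ℝ) := Metric.ball y₀ (1 / 2)
  have hB : IsOpen B := Metric.isOpen_ball
  have hinj : Set.InjOn J B := by
    rintro ⟨t, s⟩ h1 ⟨t', s'⟩ h2 h
    obtain ⟨rfl, k, rfl⟩ := hF.inj t s t' s' (Subtype.ext h)
    have e1 := (norm_fst_le ((t, s') - y₀)).trans_lt (mem_ball_iff_norm.1 h1)
    have e2 := (norm_fst_le ((t + k, s') - y₀)).trans_lt (mem_ball_iff_norm.1 h2)
    have e1 := abs_lt.1 e1
    have e2 := abs_lt.1 e2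
    simp only [Prod.fst_sub] at e1 e2
    have h1 : (k : ℝ) < 1 := by linarith
    have h2 : (-1 : ℝ) < k := by linarith
    have h1 : k < 1 := by exact_mod_cast h1
    have h2 : -1 < k := by exact_mod_cast h2
    rw [show k = 0 by omega]
    simp
  let R := Function.invFunOn J B
  have hRJ : ∀ y ∈ B, R (J y) = y := fun y hy => hinj.leftInvOn_invFunOn hy
  obtain ⟨W, hW, hWB⟩ := isOpen_induced_iff.1 (hF.isOpenMap B hB)
  have hJB : ∀ x, x ∈ J '' B ↔ 1 / 4 ≤ ‖x‖ ∧ x ∈ W := by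
    intro x
    constructor
    · rintro ⟨y, hy, rfl⟩
      exact ⟨(F y).2, (Set.ext_iff.1 hWB (F y)).2 ⟨y, hy, rfl⟩⟩
    · rintro ⟨h1, h2⟩
      obtain ⟨y, hy, hyx⟩ := (Set.ext_iff.1 hWB ⟨x, h1⟩).1 h2
      exact ⟨y, hy, congrArg Subtype.val hyx⟩
  have hR : ContinuousOn R (J '' B) := by
    rintro _ ⟨y, hy, rfl⟩
    intro A hA
    rw [hRJ y hy] at hA
    have h1 := hF.isOpenMap.image_mem_nhds (Filter.inter_mem hA (hB.mem_nhds hy))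
    rw [nhds_induced, Filter.mem_comap] at h1
    obtain ⟨V, hV, hVs⟩ := h1
    refine mem_nhdsWithin_iff_exists_mem_nhds_inter.2 ⟨V, hV, ?_⟩
    rintro _ ⟨hz, ⟨z, hz', rfl⟩⟩
    obtain ⟨z', ⟨h1, h2⟩, h3⟩ := hVs (show F z ∈ Subtype.val ⁻¹' V from hz)
    have : z' = z := hinj h2 hz' (congrArg Subtype.val h3)
    subst this
    rw [Set.mem_preimage, hRJ _ h2]
    exact h1
  have hy₀B : y₀ ∈ B := Metric.mem_ball_self (by norm_num)
  obtain ⟨ρ, hρ, hρs⟩ : ∃ ρ > 0, ∀ y ∈ Metric.closedBall y₀ ρ, y ∈ B ∧ ‖J y - J y₀‖ < 1 / 16 := by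
    have h1 : ∀ᶠ y in 𝓝 y₀, y ∈ B ∧ ‖J y - J y₀‖ < 1 / 16 := by
      refine Filter.Eventually.and (hB.mem_nhds hy₀B) ?_
      have : IsOpen {y | ‖J y - J y₀‖ < 1 / 16} :=
        isOpen_lt (hJ.sub continuous_const).norm continuous_const
      exact this.mem_nhds (by simp)
    exact Metric.nhds_basis_closedBall.mem_iff.1 h1
  -- A small push by `τ • x₀` keeps the image of the disk in the surface and in the annulus, and
  -- moves annulus coordinates by less than half the radius, uniformly by compactness.
  have hev : ∀ᶠ τ in 𝓝 (0 : ℝ), ∀ y ∈ Metric.closedBall y₀ ρ, 0 ≤ τ → τ ≤ 1 / 4 →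
      J y + torusProj (τ • x₀) ∈ J '' B ∧ ‖R (J y + torusProj (τ • x₀)) - y‖ < ρ / 2 := by
    apply (isCompact_closedBall y₀ ρ).eventually_forall_of_forall_eventually
    intro y hy
    have hyB := (hρs y hy).1
    have hcm : Continuous fun z : ℝ × (ℝ × ℝ) => J z.2 + torusProj (z.1 • x₀) :=
      (hJ.comp continuous_snd).add (continuous_torusProj.comp (by fun_prop))
    have hc0 : J y + torusProj ((0 : ℝ) • x₀) = J y := by
      rw [zero_smul, show torusProj 0 = 0 from rfl, add_zero]
    have h1 : W ∈ 𝓝 (J y) := hW.mem_nhds ((hJB _).1 ⟨y, hyB, rfl⟩).2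
    have h2 : ∀ᶠ x in 𝓝 (J y), x ∈ J '' B → ‖R x - y‖ < ρ / 4 := by
      have h := hR (J y) ⟨y, hyB, rfl⟩
      have h3 := h (Metric.ball_mem_nhds (R (J y)) (show 0 < ρ / 4 by positivity))
      rw [hRJ y hyB] at h3
      have h4 := mem_nhdsWithin_iff_eventually.1 h3
      filter_upwards [h4] with x hx hxB
      exact mem_ball_iff_norm.1 (hx hxB)
    have hsnd : Filter.Tendsto (fun z : ℝ × (ℝ × ℝ) => z.2) (𝓝 (0, y)) (𝓝 y) :=
      continuous_snd.continuousAt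
    have h3 : ∀ᶠ z in 𝓝 ((0 : ℝ), y), ‖z.2 - y‖ < ρ / 4 := by
      refine hsnd.eventually (p := fun z => ‖z - y‖ < ρ / 4) ?_
      filter_upwards [Metric.ball_mem_nhds y (show 0 < ρ / 4 by positivity)] with z hz
      exact mem_ball_iff_norm.1 hz
    have h4 := (hcm.continuousAt (x := (0, y))).tendsto
    simp only [hc0] at h4
    have h5 : ∀ᶠ z in 𝓝 ((0 : ℝ), y), ‖J z.2 - J y₀‖ < 1 / 16 := by
      refine hsnd.eventually (p := fun z => ‖J z - J y₀‖ < 1 / 16) ?_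
      have : IsOpen {y | ‖J y - J y₀‖ < 1 / 16} :=
        isOpen_lt (hJ.sub continuous_const).norm continuous_const
      exact this.mem_nhds (hρs y hy).2
    filter_upwards [h4.eventually h1, h4.eventually h2, h3, h5] with z z1 z2 z3 z5 z6 z7
    have hm : J z.2 + torusProj (z.1 • x₀) ∈ J '' B := by
      refine (hJB _).2 ⟨?_, z1⟩
      obtain ⟨d, hd, hdy⟩ := exists_torusProj_near (hx₀J ▸ z5)
      rw [hdy, ← torusProj_add]
      refine norm_add_push hx₀ hd ?_ z6 z7
      rw [← hdy]
      exact (F z.2).2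
    refine ⟨hm, ?_⟩
    have := norm_sub_le_norm_sub_add_norm_sub (R (J z.2 + torusProj (z.1 • x₀))) y z.2
    rw [norm_sub_rev y z.2] at this
    linarith [z2 hm, z3]
  obtain ⟨δ, hδ, hδs⟩ := Metric.eventually_nhds_iff.1 hev
  set τ := min (δ / 2) (1 / 4) with hτdef
  have hτ0 : 0 < τ := lt_min (by positivity) (by norm_num)
  have hτ1 : τ ≤ 1 / 4 := min_le_right _ _
  have hτs := hδs (y := τ) (by
    rw [dist_zero_right, Real.norm_of_nonneg hτ0.le]
    exact (min_le_left _ _).trans_lt (by linarith))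
  -- the pushed disk misses the boundary point
  let e : ℝ × ℝ → ℝ × ℝ := fun y => y₀ + ((Set.projIcc (0 : ℝ) 1 zero_le_one y.1 : ℝ) * ρ) •
    (Real.cos (2 * Real.pi * y.2), Real.sin (2 * Real.pi * y.2))
  have he : Continuous e := by
    have : Continuous fun y : ℝ × ℝ => (Set.projIcc (0 : ℝ) 1 zero_le_one y.1 : ℝ) :=
      continuous_subtype_val.comp (continuous_projIcc.comp continuous_fst)
    fun_prop
  have heb : ∀ y, e y ∈ Metric.closedBall y₀ ρ := by
    intro y
    have h := (Set.projIcc (0 : ℝ) 1 zero_le_one y.1).2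
    rw [mem_closedBall_iff_norm]
    simp only [e]
    rw [add_sub_cancel_left, norm_smul, Real.norm_of_nonneg (mul_nonneg h.1 hρ.le)]
    have h1 : ‖((Real.cos (2 * Real.pi * y.2), Real.sin (2 * Real.pi * y.2)) : ℝ × ℝ)‖ ≤ 1 :=
      max_le (Real.abs_cos_le_one _) (Real.abs_sin_le_one _)
    calc _ ≤ 1 * ρ * 1 := by gcongr; exact h.2
      _ = ρ := by ring
  have hm : ∀ y, J (e y) + torusProj (τ • x₀) ∈ J '' B := fun y =>
    (hτs _ (heb y) hτ0.le hτ1).1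
  refine false_of_winding (c := fun y => R (J (e y) + torusProj (τ • x₀)) - y₀) ?_ ?_ ?_ ?_ ?_
  · refine Continuous.sub ?_ continuous_const
    exact hR.comp_continuous ((hJ.comp he).add continuous_const) hm
  -- Reaching the boundary point after the push would require starting at `(1 - τ) • x₀`, which lies
  -- in the hole.
  · intro y h0
    obtain ⟨z, hz, hzy⟩ := hm y
    rw [← hzy, hRJ z hz, sub_eq_zero] at h0
    subst h0
    have h1 : J (e y) = torusProj ((1 - τ) • x₀) := by
      rw [sub_smul, one_smul, torusProj_sub, ← hx₀J, hzy, add_sub_cancel_right]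
    have h2 := (F (e y)).2
    change 1 / 4 ≤ ‖J (e y)‖ at h2
    rw [h1, norm_torusProj_smul hx₀ (by rw [abs_of_nonneg] <;> linarith),
      abs_of_nonneg (by linarith)] at h2
    linarith
  · intro r t
    have : e (r, t + 1) = e (r, t) := by
      simp only [e]
      rw [mul_add, mul_one, Real.cos_add_two_pi, Real.sin_add_two_pi]
    rw [this]
  · intro t
    have : e (0, t) = e (0, 0) := by simp [e]
    rw [this]
  -- On the boundary circle the push moves points by less than `ρ / 2` in each coordinate, so the
  -- pushed loop still winds once around `y₀`.
  · intro t
    have h1 := (hτs _ (heb (1, t)) hτ0.le hτ1).2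
    set q := R (J (e (1, t)) + torusProj (τ • x₀))
    have e1 := (norm_fst_le (q - e (1, t))).trans_lt h1
    have e2 := (norm_snd_le (q - e (1, t))).trans_lt h1
    have h2 : e (1, t) = y₀ + (ρ * Real.cos (2 * Real.pi * t), ρ * Real.sin (2 * Real.pi * t)) := by
      simp [e]
    rw [h2] at e1 e2
    simp only [Prod.fst_sub, Prod.snd_sub, Prod.fst_add, Prod.snd_add, Real.norm_eq_abs] at e1 e2 ⊢
    set C := Real.cos (2 * Real.pi * t)
    set D := Real.sin (2 * Real.pi * t)
    have hCD : C ^ 2 + D ^ 2 = 1 := Real.cos_sq_add_sin_sq _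
    have hC : |C| ≤ 1 := Real.abs_cos_le_one _
    have hD : |D| ≤ 1 := Real.abs_sin_le_one _
    set a := q.1 - (y₀.1 + ρ * C)
    set b := q.2 - (y₀.2 + ρ * D)
    have h3 : (q.1 - y₀.1) * C + (q.2 - y₀.2) * D = ρ * (C ^ 2 + D ^ 2) + (a * C + b * D) := by
      simp only [a, b]; ring
    have h4 : |a * C| < ρ / 2 := by
      rw [abs_mul]
      exact (mul_le_of_le_one_right (abs_nonneg _) hC).trans_lt e1
    have h5 : |b * D| < ρ / 2 := by
      rw [abs_mul]
      exact (mul_le_of_le_one_right (abs_nonneg _) hD).trans_lt e2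
    rw [h3, hCD]
    linarith [(abs_lt.1 h4).1, (abs_lt.1 h5).1]

/-! ### Tori with at most one hole -/

theorem hasInfiniteDiameter_of_isTorusWithAtMostOneHole {S : Type*} [TopologicalSpace S]
    (hS : IsTorusWithAtMostOneHole S) : HasInfiniteDiameter (sporadicCurveComplex 1 S) := by
  rcases hS with ⟨⟨φ⟩⟩ | ⟨⟨φ⟩⟩ | ⟨⟨φ⟩⟩
  · have hr : Set.range φ = Set.univ := φ.surjective.range_eq
    refine (flatCover_torusProj (ι := φ) φ.isEmbedding
      (fun f hf => φ.isOpenMap.comp hf.isOpenMap) (fun x _ => ?_)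
      (fun x => ?_)).hasInfiniteDiameter_one not_torusProj_even
    · rw [hr]; exact Filter.univ_mem
    · rw [hr]; simp
  · have hr : Set.range (Subtype.val ∘ φ) = {x : UnitAddCircle × UnitAddCircle | x ≠ 0} := by
      rw [Set.range_comp, φ.surjective.range_eq, Set.image_univ]
      exact Subtype.range_val
    have ho : IsOpen {x : UnitAddCircle × UnitAddCircle | x ≠ 0} := isOpen_ne
    refine (flatCover_torusProj (ι := Subtype.val ∘ φ) (IsEmbedding.subtypeVal.comp φ.isEmbedding)
      (fun f hf => (ho.isOpenMap_subtype_val.comp φ.isOpenMap).comp hf.isOpenMap)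
      (fun x hx => ?_) (fun x => ?_)).hasInfiniteDiameter_one not_torusProj_even
    · rw [hr]
      refine ho.mem_nhds fun h => ?_
      have := norm_torusProj_of_strip hx
      rw [h, norm_zero] at this
      norm_num at this
    · rw [hr]
      exact not_congr (torusProj_twist_eq_zero x)
  · have hr : Set.range (Subtype.val ∘ φ) =
        {x : UnitAddCircle × UnitAddCircle | 1 / 4 ≤ ‖x‖} := by
      rw [Set.range_comp, φ.surjective.range_eq, Set.image_univ]
      exact Subtype.range_val
    have ho : IsOpen {x : UnitAddCircle × UnitAddCircle | 1 / 4 < ‖x‖} :=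
      isOpen_lt continuous_const continuous_norm
    refine (flatCover_torusProj (ι := Subtype.val ∘ φ) (IsEmbedding.subtypeVal.comp φ.isEmbedding)
      ?_ (fun x hx => ?_) (fun x => ?_)).hasInfiniteDiameter_one not_torusProj_even
    -- The surface is not open in the torus; its open annuli are, since they avoid the boundary of
    -- the hole.
    · intro f hf U hU
      have hφf := φ.isOpenEmbedding.comp hf
      have hF := IsCollar.of_isOpenEmbedding hφf
      obtain ⟨W, hW, hWU⟩ := isOpen_induced_iff.1 (hφf.isOpenMap U hU)
      have : (Subtype.val ∘ φ) ∘ f '' U =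
          W ∩ {x : UnitAddCircle × UnitAddCircle | 1 / 4 < ‖x‖} := by
        ext x
        constructor
        · rintro ⟨⟨z, s⟩, hy, rfl⟩
          refine ⟨(Set.ext_iff.1 hWU _).2 ⟨_, hy, rfl⟩, ?_⟩
          obtain ⟨t, rfl⟩ := circlePar_surjective z
          exact lt_of_le_of_ne (φ (f (circlePar t, s))).2 (norm_ne_of_isCollar hF (t, s)).symm
        · rintro ⟨h1, h2⟩
          have h2 : 1 / 4 < ‖x‖ := h2
          obtain ⟨y, hy, hyx⟩ := (Set.ext_iff.1 hWU ⟨x, h2.le⟩).1 h1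
          exact ⟨y, hy, congrArg Subtype.val hyx⟩
      rw [this]
      exact hW.inter ho
    · rw [hr]
      filter_upwards [ho.mem_nhds (norm_torusProj_of_strip hx)] with z hz
      exact le_of_lt hz
    · rw [hr]
      have := not_congr (norm_torusProj_twist x le_rfl)
      rw [not_lt, not_lt] at this
      exact this

/-! ### Quotients of the plane by the lattice and the half-turns -/

/-- The points with half-integral coordinates. -/
def halfLattice : Set (ℝ × ℝ) := {x | ∃ n : ℤ × ℤ, x + x = latticePt n}

theorem add_latticePt_mem_halfLattice {x : ℝ × ℝ} {n : ℤ × ℤ} :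
    x + latticePt n ∈ halfLattice ↔ x ∈ halfLattice := by
  constructor
  · rintro ⟨m, hm⟩
    exact ⟨m - (n + n), by rw [latticePt_sub, ← hm, latticePt_add]; abel⟩
  · rintro ⟨m, hm⟩
    exact ⟨m + (n + n), by rw [latticePt_add, ← hm, latticePt_add]; abel⟩

theorem neg_mem_halfLattice {x : ℝ × ℝ} : -x ∈ halfLattice ↔ x ∈ halfLattice := by
  constructor
  · rintro ⟨m, hm⟩
    exact ⟨-m, by rw [latticePt_neg, ← hm]; abel⟩
  · rintro ⟨m, hm⟩
    exact ⟨-m, by rw [latticePt_neg, ← hm]; abel⟩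

theorem twist_mem_halfLattice {x : ℝ × ℝ} : twist x ∈ halfLattice ↔ x ∈ halfLattice := by
  have key : ∀ {n : ℤ} {t : ℝ}, t + t = n → bump t = t := by
    intro n t h
    rw [show t = (n : ℝ) / 2 by linarith, bump_half]
  constructor
  · rintro ⟨n, hn⟩
    have h1 : x.2 + x.2 = n.1 := congrArg Prod.fst hn
    have h2 : x.1 + 3 * bump x.2 + (x.1 + 3 * bump x.2) = n.2 := congrArg Prod.snd hn
    rw [key h1] at h2
    exact ⟨(n.2 - 3 * n.1, n.1), by
      ext
      · simp; linarith
      · exact h1⟩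
  · rintro ⟨n, hn⟩
    have h1 : x.1 + x.1 = n.1 := congrArg Prod.fst hn
    have h2 : x.2 + x.2 = n.2 := congrArg Prod.snd hn
    refine ⟨(n.2, n.1 + 3 * n.2), ?_⟩
    ext
    · exact h2
    · simp [twist, key h2]; linarith

/-- The quotient map of the plane by the group generated by the lattice translations and the
half-turn about the origin. -/
structure IsPillowMap {X : Type*} [TopologicalSpace X] (p : ℝ × ℝ → X) : Prop where
  cont : Continuous p
  surj : Function.Surjective p
  eq_iff : ∀ x y, p x = p y ↔ ∃ n, y = x + latticePt n ∨ y = -x + latticePt n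

namespace IsPillowMap

variable {X : Type*} [TopologicalSpace X] {p : ℝ × ℝ → X}

theorem periodic (hp : IsPillowMap p) (x : ℝ × ℝ) (n : ℤ × ℤ) : p (x + latticePt n) = p x :=
  ((hp.eq_iff _ _).2 ⟨n, Or.inl rfl⟩).symm

theorem even (hp : IsPillowMap p) (x : ℝ × ℝ) : p (-x) = p x :=
  ((hp.eq_iff _ _).2 ⟨0, Or.inr (by simp)⟩).symm

theorem mem_image_halfLattice (hp : IsPillowMap p) {x : ℝ × ℝ} :
    p x ∈ p '' halfLattice ↔ x ∈ halfLattice := by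
  constructor
  · rintro ⟨y, hy, hyx⟩
    obtain ⟨n, rfl | rfl⟩ := (hp.eq_iff _ _).1 hyx
    · exact add_latticePt_mem_halfLattice.2 hy
    · exact add_latticePt_mem_halfLattice.2 (neg_mem_halfLattice.2 hy)
  · exact fun h => ⟨x, h, rfl⟩

/-- The map factors through the compact torus, from which a continuous map to a Hausdorff space is
closed. -/
theorem isQuotientMap [T2Space X] (hp : IsPillowMap p) :
    ∃ q : UnitAddCircle × UnitAddCircle → X, Continuous q ∧ (∀ x, q (torusProj x) = p x) ∧
      IsQuotientMap p := by
  have htq : IsQuotientMap torusProj :=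
    isOpenMap_torusProj.isQuotientMap continuous_torusProj torusProj_surjective
  choose r hr using torusProj_surjective
  have hq : ∀ x, p (r (torusProj x)) = p x := by
    intro x
    obtain ⟨n, hn⟩ := torusProj_eq_iff.1 (hr (torusProj x))
    conv_rhs => rw [hn, hp.periodic]
  have hqc : Continuous (p ∘ r) := by
    rw [htq.continuous_iff]
    exact hp.cont.congr fun x => (hq x).symm
  have hqs : Function.Surjective (p ∘ r) := by
    intro z
    obtain ⟨x, rfl⟩ := hp.surj z
    exact ⟨torusProj x, hq x⟩
  refine ⟨p ∘ r, hqc, hq, ?_⟩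
  have := (hqc.isClosedMap.isQuotientMap hqc hqs).comp htq
  rwa [show (p ∘ r) ∘ torusProj = p from funext hq] at this

/-- The saturation of an open set is the union of its images under the deck group. -/
theorem isOpenMap [T2Space X] (hp : IsPillowMap p) : IsOpenMap p := by
  obtain ⟨-, -, -, hq⟩ := hp.isQuotientMap
  intro U hU
  rw [← hq.isOpen_preimage]
  have : p ⁻¹' (p '' U) = ⋃ n : ℤ × ℤ,
      ((fun x => x + latticePt n) ⁻¹' U ∪ (fun x => -x + latticePt n) ⁻¹' U) := by
    ext x
    simp only [Set.mem_preimage, Set.mem_image, Set.mem_iUnion, Set.mem_union]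
    constructor
    · rintro ⟨y, hy, hyx⟩
      obtain ⟨n, rfl | rfl⟩ := (hp.eq_iff _ _).1 hyx.symm
      · exact ⟨n, Or.inl hy⟩
      · exact ⟨n, Or.inr hy⟩
    · rintro ⟨n, h | h⟩
      · exact ⟨_, h, hp.periodic _ _⟩
      · exact ⟨_, h, (hp.periodic _ _).trans (hp.even x)⟩
  rw [this]
  exact isOpen_iUnion fun n => (hU.preimage (by fun_prop)).union (hU.preimage (by fun_prop))

/-- Two points near `x` related by `y' = -y + n` have their sum `n` near `x + x`, which is at a
positive distance from the lattice. -/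
theorem exists_injOn (hp : IsPillowMap p) {x : ℝ × ℝ} (hx : x ∉ halfLattice) :
    ∃ V, IsOpen V ∧ x ∈ V ∧ Set.InjOn p V := by
  have hcl : IsClosed (Set.range latticePt) := by
    have : Set.range latticePt = (Set.range ((↑) : ℤ → ℝ)) ×ˢ (Set.range ((↑) : ℤ → ℝ)) := by
      ext y
      constructor
      · rintro ⟨n, rfl⟩
        exact ⟨⟨n.1, rfl⟩, n.2, rfl⟩
      · rintro ⟨⟨a, ha⟩, b, hb⟩
        exact ⟨(a, b), Prod.ext ha hb⟩
    rw [this]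
    exact Int.isClosedEmbedding_coe_real.isClosed_range.prod
      Int.isClosedEmbedding_coe_real.isClosed_range
  have hx' : x + x ∉ Set.range latticePt := fun ⟨n, hn⟩ => hx ⟨n, hn.symm⟩
  obtain ⟨ε, hε, hεs⟩ := Metric.isOpen_iff.1 hcl.isOpen_compl (x + x) hx'
  refine ⟨Metric.ball x (min (ε / 2) (1 / 2)), Metric.isOpen_ball,
    Metric.mem_ball_self (lt_min (by linarith) (by norm_num)), ?_⟩
  intro y hy y' hy' h
  rw [Metric.mem_ball, lt_min_iff] at hy hy'
  obtain ⟨n, rfl | rfl⟩ := (hp.eq_iff _ _).1 h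
  · have h1 : ‖latticePt n‖ < 1 := by
      have := dist_triangle_right (y + latticePt n) y x
      rw [dist_self_add_left] at this
      linarith [hy.2, hy'.2]
    have key : ∀ k : ℤ, |(k : ℝ)| ≤ ‖latticePt n‖ → k = 0 := by
      intro k hk
      have : |(k : ℝ)| < 1 := hk.trans_lt h1
      exact Int.abs_lt_one_iff.1 (by exact_mod_cast this)
    have e1 := key n.1 (norm_fst_le (latticePt n))
    have e2 := key n.2 (norm_snd_le (latticePt n))
    have : n = 0 := Prod.ext e1 e2
    rw [this, latticePt_zero, add_zero]
  · exfalso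
    refine hεs ?_ ⟨n, rfl⟩
    rw [Metric.mem_ball]
    have := dist_add_add_le y (-y + latticePt n) x x
    rw [add_neg_cancel_left] at this
    linarith [hy.1, hy'.1]

theorem image_halfLattice_eq (hp : IsPillowMap p) :
    p '' halfLattice = Set.range fun i : Fin 2 × Fin 2 => p ((i.1 : ℕ) / 2, (i.2 : ℕ) / 2) := by
  ext z
  constructor
  · rintro ⟨x, ⟨n, hn⟩, rfl⟩
    have h1 : x.1 + x.1 = n.1 := congrArg Prod.fst hn
    have h2 : x.2 + x.2 = n.2 := congrArg Prod.snd hn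
    have key : ∀ k : ℤ, ∃ i : Fin 2, (k : ℝ) = (i : ℕ) + 2 * ((k / 2 : ℤ) : ℝ) := by
      intro k
      have e : ((k % 2 : ℤ) : ℝ) + 2 * ((k / 2 : ℤ) : ℝ) = k := by
        exact_mod_cast Int.emod_add_mul_ediv k 2
      rcases Int.emod_two_eq_zero_or_one k with h | h
      · exact ⟨0, by rw [h] at e; simpa using e.symm⟩
      · exact ⟨1, by rw [h] at e; simpa using e.symm⟩
    obtain ⟨i, hi⟩ := key n.1
    obtain ⟨j, hj⟩ := key n.2
    refine ⟨(i, j), (hp.eq_iff _ _).2 ⟨(n.1 / 2, n.2 / 2), Or.inl ?_⟩⟩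
    ext
    · simp only [Prod.fst_add, latticePt_fst]; linarith
    · simp only [Prod.snd_add, latticePt_snd]; linarith
  · rintro ⟨⟨i, j⟩, rfl⟩
    exact ⟨_, ⟨((i : ℕ), (j : ℕ)), by ext <;> simp⟩, rfl⟩

theorem injective_corner (hp : IsPillowMap p) :
    Function.Injective fun i : Fin 2 × Fin 2 => p ((i.1 : ℕ) / 2, (i.2 : ℕ) / 2) := by
  rintro ⟨i, j⟩ ⟨i', j'⟩ h
  have key : ∀ (a b : Fin 2) (n : ℤ), ((b : ℕ) : ℝ) / 2 = (a : ℕ) / 2 + n ∨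
      ((b : ℕ) : ℝ) / 2 = -((a : ℕ) / 2) + n → a = b := by
    intro a b n h
    have h' : (b : ℤ) = a + 2 * n ∨ (b : ℤ) = -a + 2 * n := by
      rcases h with h | h
      · left
        have : ((b : ℕ) : ℝ) = (a : ℕ) + 2 * n := by linarith
        exact_mod_cast this
      · right
        have : ((b : ℕ) : ℝ) = -(a : ℕ) + 2 * n := by linarith
        exact_mod_cast this
    ext
    omega
  obtain ⟨n, h | h⟩ := (hp.eq_iff _ _).1 h
  · exact Prod.ext (key _ _ n.1 (Or.inl (congrArg Prod.fst h)))
      (key _ _ n.2 (Or.inl (congrArg Prod.snd h)))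
  · exact Prod.ext (key _ _ n.1 (Or.inr (congrArg Prod.fst h)))
      (key _ _ n.2 (Or.inr (congrArg Prod.snd h)))

theorem isClosed_image_halfLattice [T2Space X] (hp : IsPillowMap p) :
    IsClosed (p '' halfLattice) := by
  rw [hp.image_halfLattice_eq]
  exact (Set.finite_range _).isClosed

/-- The map from the compact torus to the quotient is a local homeomorphism off the half-lattice, so
it is a covering over the complement of the branch points. Lift first to the torus, then to the
plane. -/
theorem exists_lift [T2Space X] (hp : IsPillowMap p) {c : ℝ × ℝ → X} (hc : Continuous c)
    (hcr : ∀ y, c y ∉ p '' halfLattice) :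
    ∃ c' : ℝ × ℝ → ℝ × ℝ, Continuous c' ∧ ∀ y, p (c' y) = c y := by
  obtain ⟨q, hq, hqp, -⟩ := hp.isQuotientMap
  have hqo : IsOpenMap q := by
    intro U hU
    rw [← Set.image_preimage_eq U torusProj_surjective, ← Set.image_comp,
      show q ∘ torusProj = p from funext hqp]
    exact hp.isOpenMap _ (hU.preimage continuous_torusProj)
  have hloc : IsLocalHomeomorphOn q (q ⁻¹' (p '' halfLattice)ᶜ) := by
    intro e he
    obtain ⟨x, rfl⟩ := torusProj_surjective e
    have hx : x ∉ halfLattice := by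
      rw [Set.mem_preimage, hqp] at he
      exact fun h => he ⟨x, h, rfl⟩
    obtain ⟨V, hV, hxV, hinj⟩ := hp.exists_injOn hx
    have hinj' : Set.InjOn q (torusProj '' V) := by
      rintro _ ⟨y, hy, rfl⟩ _ ⟨y', hy', rfl⟩ h
      rw [hqp, hqp] at h
      rw [hinj hy hy' h]
    have hVo := isOpenMap_torusProj V hV
    exact ⟨OpenPartialHomeomorph.ofContinuousOpen hinj'.toPartialEquiv hq.continuousOn hqo hVo,
      ⟨x, hxV, rfl⟩, rfl⟩
  have hcov := IsCoveringMapOn.of_isLocalHomeomorphOn hq hloc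
  obtain ⟨x₀, hx₀⟩ := hp.surj (c (0, 0))
  obtain ⟨T, ⟨-, hT⟩, -⟩ := hcov.existsUnique_continuousMap_lifts ⟨c, hc⟩ (a₀ := (0, 0))
    (e₀ := torusProj x₀) ((hqp _).trans hx₀) hcr
  obtain ⟨a, ha, ha'⟩ := exists_lift_unitAddCircle (continuous_fst.comp T.continuous)
  obtain ⟨b, hb, hb'⟩ := exists_lift_unitAddCircle (continuous_snd.comp T.continuous)
  refine ⟨fun y => (a y, b y), by fun_prop, fun y => ?_⟩
  rw [← hqp, show torusProj (a y, b y) = T y from Prod.ext (ha' y) (hb' y)]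
  exact congrFun hT y

theorem flatCover [T2Space X] (hp : IsPillowMap p) {S : Type*} [TopologicalSpace S] {ι : S → X}
    (hι : IsEmbedding ι) (hr : Set.range ι = (p '' halfLattice)ᶜ) : FlatCover ι p where
  t2 := inferInstance
  emb := hι
  cont := hp.cont
  isOpenMap := hp.isOpenMap
  surj := hp.surj
  periodic := hp.periodic
  fiber x y h := by
    obtain ⟨n, h | h⟩ := (hp.eq_iff x y).1 h
    · exact Or.inl ⟨n, h⟩
    · exact Or.inr ⟨hp.even, n, h⟩
  locInj x hx := by
    rw [hr, Set.mem_compl_iff, hp.mem_image_halfLattice] at hx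
    obtain ⟨V, hV, hxV, h⟩ := hp.exists_injOn hx
    exact ⟨V, hV.mem_nhds hxV, h⟩
  lift c hc := hp.exists_lift (hι.continuous.comp hc) fun y => by
    rw [← Set.mem_compl_iff, ← hr]
    exact ⟨c y, rfl⟩
  annulus_isOpenMap f hf := by
    have : IsOpenEmbedding ι := ⟨hι, hr ▸ hp.isClosed_image_halfLattice.isOpen_compl⟩
    exact this.isOpenMap.comp hf.isOpenMap
  range_mem_nhds x hx := by
    rw [hr]
    refine hp.isClosed_image_halfLattice.isOpen_compl.mem_nhds ?_
    rw [Set.mem_compl_iff, hp.mem_image_halfLattice]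
    rintro ⟨n, hn⟩
    have key : ∀ (t : ℝ) (k m : ℤ), t + t = k → ¬ |t - m - 3 / 8| < 1 / 8 := by
      intro t k m h1 h2
      have h2 := abs_lt.1 h2
      have e1 : ((k - 2 * m : ℤ) : ℝ) < 1 := by push_cast; linarith
      have e2 : (0 : ℝ) < ((k - 2 * m : ℤ) : ℝ) := by push_cast; linarith
      have e1 : k - 2 * m < 1 := by exact_mod_cast e1
      have e2 : 0 < k - 2 * m := by exact_mod_cast e2
      omega
    rcases hx with ⟨m, hm⟩ | ⟨m, hm⟩
    · exact key _ _ _ (congrArg Prod.fst hn) hm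
    · exact key _ _ _ (congrArg Prod.snd hn) hm
  twist_mem x := by
    rw [hr, Set.mem_compl_iff, Set.mem_compl_iff, hp.mem_image_halfLattice,
      hp.mem_image_halfLattice, twist_mem_halfLattice]

end IsPillowMap

/-! ### The pillow map onto the sphere -/

theorem cos_two_pi_eq_iff {s t : ℝ} : Real.cos (2 * Real.pi * s) = Real.cos (2 * Real.pi * t) ↔
    ∃ k : ℤ, t = s + k ∨ t = -s + k := by
  have hpi := Real.pi_pos
  rw [Real.cos_eq_cos_iff]
  refine exists_congr fun k => or_congr ?_ ?_
  · constructor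
    · intro h
      have : 2 * Real.pi * (t - (s + k)) = 0 := by linarith
      have := (mul_eq_zero.1 this).resolve_left (by positivity)
      linarith
    · rintro rfl; ring
  · constructor
    · intro h
      have : 2 * Real.pi * (t - (-s + k)) = 0 := by linarith
      have := (mul_eq_zero.1 this).resolve_left (by positivity)
      linarith
    · rintro rfl; ring

theorem sin_two_pi_add_int (s : ℝ) (k : ℤ) :
    Real.sin (2 * Real.pi * (s + k)) = Real.sin (2 * Real.pi * s) := by
  rw [show 2 * Real.pi * (s + k) = 2 * Real.pi * s + k * (2 * Real.pi) by ring,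
    Real.sin_add_int_mul_two_pi]

theorem sin_two_pi_neg (s : ℝ) : Real.sin (2 * Real.pi * -s) = -Real.sin (2 * Real.pi * s) := by
  rw [mul_neg, Real.sin_neg]

theorem exists_int_of_sin_two_pi_eq_zero {s : ℝ} (h : Real.sin (2 * Real.pi * s) = 0) :
    ∃ k : ℤ, s = -s + k := by
  have hpi := Real.pi_pos
  obtain ⟨k, hk⟩ := Real.sin_eq_zero_iff.1 h
  refine ⟨k, ?_⟩
  have : Real.pi * (2 * s - k) = 0 := by linarith
  have := (mul_eq_zero.1 this).resolve_left hpi.ne'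
  linarith

/-- The pillow surface in space. -/
noncomputable def pillowVec (x : ℝ × ℝ) : EuclideanSpace ℝ (Fin 3) :=
  !₂[Real.cos (2 * Real.pi * x.1), Real.cos (2 * Real.pi * x.2),
    Real.sin (2 * Real.pi * x.1) * Real.sin (2 * Real.pi * x.2)]

theorem continuous_pillowVec : Continuous pillowVec := by
  refine (PiLp.continuous_toLp 2 _).comp (continuous_pi fun i => ?_)
  fin_cases i <;> simp <;> fun_prop

/-- The cosines determine each coordinate up to sign modulo `1`; the product of the sines forces the
two signs to agree, unless a sine vanishes and the sign of that coordinate is immaterial. -/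
theorem pillowVec_eq_iff (x y : ℝ × ℝ) : pillowVec x = pillowVec y ↔
    ∃ n, y = x + latticePt n ∨ y = -x + latticePt n := by
  constructor
  · intro h
    have h0 : Real.cos (2 * Real.pi * x.1) = Real.cos (2 * Real.pi * y.1) :=
      congrArg (fun v : EuclideanSpace ℝ (Fin 3) => v 0) h
    have h1 : Real.cos (2 * Real.pi * x.2) = Real.cos (2 * Real.pi * y.2) :=
      congrArg (fun v : EuclideanSpace ℝ (Fin 3) => v 1) h
    have h2 : Real.sin (2 * Real.pi * x.1) * Real.sin (2 * Real.pi * x.2) =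
        Real.sin (2 * Real.pi * y.1) * Real.sin (2 * Real.pi * y.2) :=
      congrArg (fun v : EuclideanSpace ℝ (Fin 3) => v 2) h
    obtain ⟨x1, x2⟩ := x
    obtain ⟨y1, y2⟩ := y
    simp only at h0 h1 h2
    have mk : ∀ {s t : ℝ} {j k : ℤ}, y1 = s + j → y2 = t + k →
        (y1, y2) = (s, t) + latticePt (j, k) := fun h h' => Prod.ext h h'
    have fin : Real.sin (2 * Real.pi * x1) * Real.sin (2 * Real.pi * x2) = 0 →
        (∃ k : ℤ, x1 = -x1 + k) ∨ ∃ k : ℤ, x2 = -x2 + k := by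
      intro hz
      rcases mul_eq_zero.1 hz with hz | hz
      · exact Or.inl (exists_int_of_sin_two_pi_eq_zero hz)
      · exact Or.inr (exists_int_of_sin_two_pi_eq_zero hz)
    obtain ⟨j, hj | hj⟩ := cos_two_pi_eq_iff.1 h0 <;> obtain ⟨k, hk | hk⟩ := cos_two_pi_eq_iff.1 h1
    · exact ⟨_, Or.inl (mk hj hk)⟩
    · rw [hj, hk, sin_two_pi_add_int, sin_two_pi_add_int, sin_two_pi_neg] at h2
      rcases fin (by linarith) with ⟨i, hi⟩ | ⟨i, hi⟩
      · exact ⟨(i + j, k), Or.inr (mk (s := -x1) (t := -x2) (by push_cast; linarith) hk)⟩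
      · exact ⟨(j, k - i), Or.inl (mk (s := x1) (t := x2) hj (by push_cast; linarith))⟩
    · rw [hj, hk, sin_two_pi_add_int, sin_two_pi_add_int, sin_two_pi_neg] at h2
      rcases fin (by linarith) with ⟨i, hi⟩ | ⟨i, hi⟩
      · exact ⟨(j - i, k), Or.inl (mk (s := x1) (t := x2) (by push_cast; linarith) hk)⟩
      · exact ⟨(j, i + k), Or.inr (mk (s := -x1) (t := -x2) hj (by push_cast; linarith))⟩
    · exact ⟨_, Or.inr (mk (s := -x1) (t := -x2) hj hk)⟩
  · rintro ⟨n, rfl | rfl⟩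
    · have h1 := (cos_two_pi_eq_iff (s := x.1)).2 ⟨n.1, Or.inl rfl⟩
      have h2 := (cos_two_pi_eq_iff (s := x.2)).2 ⟨n.2, Or.inl rfl⟩
      simp [pillowVec, h1, h2, sin_two_pi_add_int]
    · have h1 := (cos_two_pi_eq_iff (s := x.1)).2 ⟨n.1, Or.inr rfl⟩
      have h2 := (cos_two_pi_eq_iff (s := x.2)).2 ⟨n.2, Or.inr rfl⟩
      simp [pillowVec, h1, h2, sin_two_pi_add_int]

theorem pillowVec_ne_zero (x : ℝ × ℝ) : pillowVec x ≠ 0 := by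
  intro h
  have h0 : Real.cos (2 * Real.pi * x.1) = 0 :=
    congrArg (fun v : EuclideanSpace ℝ (Fin 3) => v 0) h
  have h1 : Real.cos (2 * Real.pi * x.2) = 0 :=
    congrArg (fun v : EuclideanSpace ℝ (Fin 3) => v 1) h
  have h2 : Real.sin (2 * Real.pi * x.1) * Real.sin (2 * Real.pi * x.2) = 0 :=
    congrArg (fun v : EuclideanSpace ℝ (Fin 3) => v 2) h
  have e1 := Real.sin_sq_add_cos_sq (2 * Real.pi * x.1)
  have e2 := Real.sin_sq_add_cos_sq (2 * Real.pi * x.2)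
  rcases mul_eq_zero.1 h2 with h | h
  · rw [h, h0] at e1; norm_num at e1
  · rw [h, h1] at e2; norm_num at e2

/-- A ray from the origin meets the pillow surface only once. -/
theorem scale_le_one {A B C k : ℝ} (hC : (1 - A) * (1 - B) = C) (hA : 0 ≤ A)
    (hB : 0 ≤ B) (hkA : k * A ≤ 1) (hkB : k * B ≤ 1) (hk : (1 - k * A) * (1 - k * B) = k * C) :
    k ≤ 1 := by
  by_contra! h1
  have hA1 : A < 1 := by nlinarith
  have hB1 : B < 1 := by nlinarith
  have hCp : 0 < C := by rw [← hC]; exact mul_pos (by linarith) (by linarith)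
  have h2 : (1 - k * A) * (1 - k * B) ≤ (1 - A) * (1 - B) := by
    apply mul_le_mul <;> nlinarith
  nlinarith

/-- The pillow surface satisfies `(1 - X²)(1 - Y²) = Z²` with `X², Y² ≤ 1`. Applying `scale_le_one`
in both directions gives `r² = 1`. -/
theorem eq_of_pillowVec_eq_smul {x y : ℝ × ℝ} {r : ℝ} (hr : 0 < r)
    (h : pillowVec x = r • pillowVec y) : pillowVec x = pillowVec y := by
  have h0 : Real.cos (2 * Real.pi * x.1) = r * Real.cos (2 * Real.pi * y.1) :=
    congrArg (fun v : EuclideanSpace ℝ (Fin 3) => v 0) h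
  have h1 : Real.cos (2 * Real.pi * x.2) = r * Real.cos (2 * Real.pi * y.2) :=
    congrArg (fun v : EuclideanSpace ℝ (Fin 3) => v 1) h
  have h2 : Real.sin (2 * Real.pi * x.1) * Real.sin (2 * Real.pi * x.2) =
      r * (Real.sin (2 * Real.pi * y.1) * Real.sin (2 * Real.pi * y.2)) :=
    congrArg (fun v : EuclideanSpace ℝ (Fin 3) => v 2) h
  have a1 := Real.sin_sq_add_cos_sq (2 * Real.pi * x.1)
  have a2 := Real.sin_sq_add_cos_sq (2 * Real.pi * x.2)
  have b1 := Real.sin_sq_add_cos_sq (2 * Real.pi * y.1)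
  have b2 := Real.sin_sq_add_cos_sq (2 * Real.pi * y.2)
  set X1 := Real.cos (2 * Real.pi * x.1)
  set X2 := Real.cos (2 * Real.pi * x.2)
  set Y1 := Real.cos (2 * Real.pi * y.1)
  set Y2 := Real.cos (2 * Real.pi * y.2)
  set U1 := Real.sin (2 * Real.pi * x.1)
  set U2 := Real.sin (2 * Real.pi * x.2)
  set V1 := Real.sin (2 * Real.pi * y.1)
  set V2 := Real.sin (2 * Real.pi * y.2)
  have hx : (1 - X1 ^ 2) * (1 - X2 ^ 2) = (U1 * U2) ^ 2 := by
    rw [← a1, mul_pow]; nlinarith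
  have hy : (1 - Y1 ^ 2) * (1 - Y2 ^ 2) = (V1 * V2) ^ 2 := by
    rw [← b1, mul_pow]; nlinarith
  have e1 : X1 ^ 2 = r ^ 2 * Y1 ^ 2 := by rw [h0]; ring
  have e2 : X2 ^ 2 = r ^ 2 * Y2 ^ 2 := by rw [h1]; ring
  have e3 : (U1 * U2) ^ 2 = r ^ 2 * (V1 * V2) ^ 2 := by rw [h2]; ring
  have k1 : r ^ 2 ≤ 1 := by
    refine scale_le_one hy (sq_nonneg _) (sq_nonneg _) ?_ ?_ ?_
    · rw [← e1]; nlinarith [sq_nonneg U1]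
    · rw [← e2]; nlinarith [sq_nonneg U2]
    · rw [← e1, ← e2, ← e3, hx]
  have hr2 : 0 < r ^ 2 := by positivity
  have k2 : (r ^ 2)⁻¹ ≤ 1 := by
    have f1 : Y1 ^ 2 = (r ^ 2)⁻¹ * X1 ^ 2 := by rw [e1]; field_simp
    have f2 : Y2 ^ 2 = (r ^ 2)⁻¹ * X2 ^ 2 := by rw [e2]; field_simp
    have f3 : (V1 * V2) ^ 2 = (r ^ 2)⁻¹ * (U1 * U2) ^ 2 := by rw [e3]; field_simp
    refine scale_le_one hx (sq_nonneg _) (sq_nonneg _) ?_ ?_ ?_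
    · rw [← f1]; nlinarith [sq_nonneg V1]
    · rw [← f2]; nlinarith [sq_nonneg V2]
    · rw [← f1, ← f2, ← f3, hy]
  have k3 : 1 ≤ r ^ 2 := (inv_le_one₀ hr2).1 k2
  have : r = 1 := by nlinarith
  rw [h, this, one_smul]

/-- Every ray meets the surface: the squared scale `μ` solves `(1 - μ a²)(1 - μ b²) = μ c²` by the
intermediate value theorem. The bound `μ ≤ 1 / m` keeps the first two coordinates within the range
of the cosine. -/
theorem exists_pillowVec_eq_smul (v : EuclideanSpace ℝ (Fin 3)) (hv : v ≠ 0) :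
    ∃ (r : ℝ) (x : ℝ × ℝ), 0 < r ∧ pillowVec x = r • v := by
  have hpi := Real.pi_pos
  set m := max (v 0 ^ 2) (max (v 1 ^ 2) (v 2 ^ 2)) with hm
  have m0 : v 0 ^ 2 ≤ m := le_max_left _ _
  have m1 : v 1 ^ 2 ≤ m := (le_max_left _ _).trans (le_max_right _ _)
  have m2 : v 2 ^ 2 ≤ m := (le_max_right _ _).trans (le_max_right _ _)
  have hmpos : 0 < m := by
    by_contra! hc
    apply hv
    ext i
    have : ∀ j, v j ^ 2 ≤ m → v j = 0 := fun j hj =>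
      pow_eq_zero_iff (M₀ := ℝ) (n := 2) (by norm_num) |>.1
        (le_antisymm (hj.trans hc) (sq_nonneg (v j)))
    fin_cases i
    · exact this 0 m0
    · exact this 1 m1
    · exact this 2 m2
  let f : ℝ → ℝ := fun μ => (1 - μ * v 0 ^ 2) * (1 - μ * v 1 ^ 2) - μ * v 2 ^ 2
  have hf : Continuous f := by fun_prop
  have f0 : f 0 = 1 := by simp [f]
  have f1 : f (1 / m) ≤ 0 := by
    have e0 : v 0 ^ 2 / m ≤ 1 := (div_le_one hmpos).2 m0
    have e1 : v 1 ^ 2 / m ≤ 1 := (div_le_one hmpos).2 m1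
    have p0 : 0 ≤ v 0 ^ 2 / m := by positivity
    have p1 : 0 ≤ v 1 ^ 2 / m := by positivity
    have p2 : 0 ≤ v 2 ^ 2 / m := by positivity
    have : f (1 / m) = (1 - v 0 ^ 2 / m) * (1 - v 1 ^ 2 / m) - v 2 ^ 2 / m := by
      simp only [f]; ring
    rw [this]
    rcases max_choice (v 0 ^ 2) (max (v 1 ^ 2) (v 2 ^ 2)) with h | h
    · have : v 0 ^ 2 / m = 1 := by rw [hm, h]; exact div_self (by rw [← h, ← hm]; exact hmpos.ne')
      rw [this]; linarith
    · rcases max_choice (v 1 ^ 2) (v 2 ^ 2) with h' | h'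
      · have : v 1 ^ 2 / m = 1 := by
          rw [hm, h, h']; exact div_self (by rw [← h', ← h, ← hm]; exact hmpos.ne')
        rw [this]; linarith
      · have : v 2 ^ 2 / m = 1 := by
          rw [hm, h, h']; exact div_self (by rw [← h', ← h, ← hm]; exact hmpos.ne')
        rw [this]; nlinarith
  obtain ⟨μ, hμ, hμ0⟩ := intermediate_value_Icc' (by positivity : (0 : ℝ) ≤ 1 / m)
    hf.continuousOn ⟨f1, by rw [f0]; norm_num⟩
  have hμpos : 0 < μ := by
    rcases hμ.1.eq_or_lt with h | h
    · rw [← h, f0] at hμ0; norm_num at hμ0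
    · exact h
  have hμm : μ * m ≤ 1 := by
    have := hμ.2
    rwa [le_div_iff₀ hmpos] at this
  set r := √μ with hrdef
  have hr : 0 < r := Real.sqrt_pos.2 hμpos
  have hr2 : r ^ 2 = μ := Real.sq_sqrt hμpos.le
  have hcos : ∀ j, v j ^ 2 ≤ m → ∃ t, Real.cos (2 * Real.pi * t) = r * v j ∧
      0 ≤ Real.sin (2 * Real.pi * t) := by
    intro j hj
    have h1 : (r * v j) ^ 2 ≤ 1 := by
      rw [mul_pow, hr2]
      nlinarith
    have h2 := (sq_le_one_iff_abs_le_one _).1 h1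
    have h2 := abs_le.1 h2
    refine ⟨Real.arccos (r * v j) / (2 * Real.pi), ?_, ?_⟩
    · rw [mul_div_cancel₀ _ (by positivity), Real.cos_arccos h2.1 h2.2]
    · rw [mul_div_cancel₀ _ (by positivity), Real.sin_arccos]
      exact Real.sqrt_nonneg _
  obtain ⟨s, hs, hs'⟩ := hcos 0 m0
  obtain ⟨t, ht, ht'⟩ := hcos 1 m1
  have hsq : (Real.sin (2 * Real.pi * s) * Real.sin (2 * Real.pi * t)) ^ 2 = (r * v 2) ^ 2 := by
    have a1 := Real.sin_sq (2 * Real.pi * s)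
    have a2 := Real.sin_sq (2 * Real.pi * t)
    rw [mul_pow, a1, a2, hs, ht]
    have e1 : (r * v 0) ^ 2 = μ * v 0 ^ 2 := by rw [mul_pow, hr2]
    have e2 : (r * v 1) ^ 2 = μ * v 1 ^ 2 := by rw [mul_pow, hr2]
    have e3 : (r * v 2) ^ 2 = μ * v 2 ^ 2 := by rw [mul_pow, hr2]
    rw [e1, e2, e3]
    simp only [f] at hμ0
    linarith
  rcases sq_eq_sq_iff_eq_or_eq_neg.1 hsq with h | h
  · refine ⟨r, (s, t), hr, ?_⟩
    ext i
    fin_cases i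
    · simpa [pillowVec] using hs
    · simpa [pillowVec] using ht
    · simpa [pillowVec] using h
  -- The equation fixes the third coordinate only up to sign; negating one angle changes that sign.
  · refine ⟨r, (s, -t), hr, ?_⟩
    ext i
    fin_cases i
    · simpa [pillowVec] using hs
    · simpa [pillowVec] using ht
    · simp only [pillowVec, sin_two_pi_neg]
      simp
      simp only [mul_assoc] at h ⊢
      linarith

/-- The unit sphere in space. -/
abbrev unitSphere : Type := Metric.sphere (0 : EuclideanSpace ℝ (Fin 3)) 1

theorem exists_isPillowMap : ∃ p : ℝ × ℝ → unitSphere, IsPillowMap p := by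
  have hn : ∀ x, 0 < ‖pillowVec x‖ := fun x => norm_pos_iff.2 (pillowVec_ne_zero x)
  let p : ℝ × ℝ → unitSphere := fun x => ⟨‖pillowVec x‖⁻¹ • pillowVec x, by
    rw [mem_sphere_zero_iff_norm, norm_smul, norm_inv, norm_norm, inv_mul_cancel₀ (hn x).ne']⟩
  refine ⟨p, ?_, ?_, fun x y => ?_⟩
  · refine Continuous.subtype_mk ?_ _
    exact (continuous_pillowVec.norm.inv₀ fun x => (hn x).ne').smul continuous_pillowVec
  · intro v
    have hv : (v : EuclideanSpace ℝ (Fin 3)) ≠ 0 := ne_zero_of_mem_unit_sphere v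
    obtain ⟨r, x, hr, hx⟩ := exists_pillowVec_eq_smul v hv
    refine ⟨x, Subtype.ext ?_⟩
    change ‖pillowVec x‖⁻¹ • pillowVec x = v
    rw [hx, norm_smul, norm_eq_of_mem_sphere v, Real.norm_of_nonneg hr.le, mul_one, smul_smul,
      inv_mul_cancel₀ hr.ne', one_smul]
  · rw [← pillowVec_eq_iff]
    constructor
    · intro h
      have h : ‖pillowVec x‖⁻¹ • pillowVec x = ‖pillowVec y‖⁻¹ • pillowVec y :=
        congrArg Subtype.val h
      refine eq_of_pillowVec_eq_smul (r := ‖pillowVec x‖ * ‖pillowVec y‖⁻¹)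
        (mul_pos (hn x) (inv_pos.2 (hn y))) ?_
      rw [mul_smul, ← h, smul_smul, mul_inv_cancel₀ (hn x).ne', one_smul]
    · intro h
      apply Subtype.ext
      change ‖pillowVec x‖⁻¹ • pillowVec x = ‖pillowVec y‖⁻¹ • pillowVec y
      rw [h]

/-! ### Four-punctured spheres -/

/-- A vertical shear of the plane. -/
def shearHomeo (q : C(ℝ, ℝ)) : (ℝ × ℝ) ≃ₜ (ℝ × ℝ) where
  toFun x := (x.1, x.2 + q x.1)
  invFun x := (x.1, x.2 - q x.1)
  left_inv x := by simp
  right_inv x := by simp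
  continuous_toFun := by fun_prop
  continuous_invFun := by fun_prop

/-- A horizontal shear makes the first coordinates distinct, since only finitely many slopes are
bad. A shear by an interpolating polynomial prescribes the second coordinates, and after exchanging
the axes another one clears the remaining coordinate. -/
theorem exists_homeomorph_three_points {a : Fin 3 → ℝ × ℝ} (ha : Function.Injective a) :
    ∃ ψ : (ℝ × ℝ) ≃ₜ (ℝ × ℝ), ∀ i, ψ (a i) = (((i : ℕ) : ℝ), 0) := by
  have hinterp : ∀ v r : Fin 3 → ℝ, Function.Injective v → ∃ q : C(ℝ, ℝ), ∀ i, q (v i) = r i := by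
    intro v r hv
    refine ⟨⟨fun x => (Lagrange.interpolate Finset.univ v r).eval x, by fun_prop⟩, fun i => ?_⟩
    exact Lagrange.eval_interpolate_at_node r hv.injOn (Finset.mem_univ i)
  obtain ⟨t, ht⟩ := Set.Finite.exists_notMem
    (Set.finite_range fun i : Fin 3 × Fin 3 =>
      ((a i.1).1 - (a i.2).1) / ((a i.2).2 - (a i.1).2))
  have hb : Function.Injective fun i => (a i).1 + t * (a i).2 := by
    intro i j hij
    simp only at hij
    by_contra hne
    by_cases h : (a j).2 - (a i).2 = 0
    · refine hne (ha (Prod.ext ?_ (by linarith)))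
      have : (a j).2 = (a i).2 := by linarith
      rw [this] at hij
      linarith
    · refine ht ⟨(i, j), ?_⟩
      simp only
      rw [div_eq_iff h]
      linarith
  let e₁ : (ℝ × ℝ) ≃ₜ (ℝ × ℝ) := (Homeomorph.prodComm ℝ ℝ).trans ((shearHomeo
    ⟨fun y => t * y, by fun_prop⟩).trans (Homeomorph.prodComm ℝ ℝ))
  have h₁ : ∀ i, e₁ (a i) = ((a i).1 + t * (a i).2, (a i).2) := fun i => rfl
  obtain ⟨q, hq⟩ := hinterp _ (fun i => ((i : ℕ) : ℝ) - (a i).2) hb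
  have hi : Function.Injective fun i : Fin 3 => ((i : ℕ) : ℝ) :=
    Nat.cast_injective.comp Fin.val_injective
  obtain ⟨q', hq'⟩ := hinterp _ (fun i => -((a i).1 + t * (a i).2)) hi
  refine ⟨(e₁.trans (shearHomeo q)).trans
    ((Homeomorph.prodComm ℝ ℝ).trans (shearHomeo q')), fun i => ?_⟩
  change shearHomeo q' (Homeomorph.prodComm ℝ ℝ (shearHomeo q (e₁ (a i)))) = _
  rw [h₁]
  have h₂ : shearHomeo q ((a i).1 + t * (a i).2, (a i).2) =
      ((a i).1 + t * (a i).2, ((i : ℕ) : ℝ)) := by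
    change (_, _ + q _) = _
    rw [hq]
    simp
  rw [h₂]
  change (((i : ℕ) : ℝ), (a i).1 + t * (a i).2 + q' ((i : ℕ) : ℝ)) = _
  rw [hq']
  simp

theorem exists_homeomorph_compl_point (v : unitSphere) :
    Nonempty ({x : unitSphere // x ≠ v} ≃ₜ ℝ × ℝ) := by
  have : Fact (Module.finrank ℝ (EuclideanSpace ℝ (Fin 3)) = 2 + 1) := ⟨by simp⟩
  let e := stereographic' 2 v
  have h1 : {x : unitSphere // x ≠ v} ≃ₜ e.source :=
    Homeomorph.setCongr (by rw [stereographic'_source]; rfl)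
  have h2 : e.target ≃ₜ EuclideanSpace ℝ (Fin 2) :=
    (Homeomorph.setCongr (stereographic'_target v)).trans (Homeomorph.Set.univ _)
  have h3 : EuclideanSpace ℝ (Fin 2) ≃ₜ (Fin 2 → ℝ) :=
    (EuclideanSpace.equiv (Fin 2) ℝ).toHomeomorph
  exact ⟨((h1.trans e.toHomeomorphSourceTarget).trans h2).trans
    (h3.trans Homeomorph.finTwoArrow)⟩

/-- Stereographic projection from the last point leaves three points in the plane, which are brought
into standard position. -/
theorem exists_homeomorph_compl_four {b : Fin 4 → unitSphere} (hb : Function.Injective b) :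
    Nonempty ({x : unitSphere // x ∉ Set.range b} ≃ₜ
      {z : ℝ × ℝ // z ∉ Set.range fun i : Fin 3 => (((i : ℕ) : ℝ), (0 : ℝ))}) := by
  obtain ⟨e⟩ := exists_homeomorph_compl_point (b (Fin.last 3))
  have hne : ∀ i : Fin 3, b i.castSucc ≠ b (Fin.last 3) := fun i h =>
    i.castSucc_ne_last (hb h)
  obtain ⟨ψ, hψ⟩ := exists_homeomorph_three_points
    (a := fun i => e ⟨b i.castSucc, hne i⟩) (fun i j hij => by
      have := congrArg Subtype.val (e.injective hij)
      exact Fin.castSucc_injective 3 (hb this))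
  let E := e.trans ψ
  have hE : ∀ i : Fin 3, E ⟨b i.castSucc, hne i⟩ = (((i : ℕ) : ℝ), 0) := hψ
  have hmem : ∀ x : {x : unitSphere // x ≠ b (Fin.last 3)},
      x.1 ∈ Set.range b ↔ E x ∈ Set.range fun i : Fin 3 => (((i : ℕ) : ℝ), (0 : ℝ)) := by
    intro x
    constructor
    · rintro ⟨i, hi⟩
      induction i using Fin.lastCases with
      | last => exact absurd hi.symm x.2
      | cast i =>
        refine ⟨i, ?_⟩
        simp only
        rw [← hE i]
        exact congrArg E (Subtype.ext hi)
    · rintro ⟨i, hi⟩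
      simp only at hi
      rw [← hE i] at hi
      exact ⟨i.castSucc, congrArg Subtype.val (E.injective hi)⟩
  refine ⟨⟨⟨fun x => ⟨E ⟨x.1, fun h => x.2 ⟨_, h.symm⟩⟩, fun h => x.2 ((hmem _).2 h)⟩,
    fun z => ⟨(E.symm z.1).1, fun h => z.2 ?_⟩, fun x => ?_, fun z => ?_⟩, ?_, ?_⟩⟩
  · have := (hmem _).1 h
    rwa [E.apply_symm_apply] at this
  · apply Subtype.ext
    simp
  · apply Subtype.ext
    simp
  · exact Continuous.subtype_mk (E.continuous.comp (Continuous.subtype_mk continuous_subtype_val _)) _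
  · exact Continuous.subtype_mk (continuous_subtype_val.comp
      (E.symm.continuous.comp continuous_subtype_val)) _

/-- Any two quadruples of points have homeomorphic complements, so the punctures may be taken to be
the four branch points of the pillow map. -/
theorem exists_embedding_of_isFourPuncturedSphere {S : Type*} [TopologicalSpace S]
    (hS : IsFourPuncturedSphere S) {p : ℝ × ℝ → unitSphere} (hp : IsPillowMap p) :
    ∃ ι : S → unitSphere, IsEmbedding ι ∧ Set.range ι = (p '' halfLattice)ᶜ := by
  obtain ⟨P, hP, ⟨φ⟩⟩ := hS
  let f := P.equivFinOfCardEq hP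
  obtain ⟨e₁⟩ := exists_homeomorph_compl_four (b := fun i => (f.symm i : unitSphere))
    (Subtype.val_injective.comp f.symm.injective)
  obtain ⟨e₂⟩ := exists_homeomorph_compl_four
    (b := fun i => p (((finProdFinEquiv (m := 2) (n := 2)).symm i).1.val / 2,
      ((finProdFinEquiv (m := 2) (n := 2)).symm i).2.val / 2))
    (hp.injective_corner.comp (finProdFinEquiv (m := 2) (n := 2)).symm.injective)
  have hr₁ : (Set.range fun i => (f.symm i : unitSphere)) = (P : Set unitSphere) := by
    ext x
    constructor
    · rintro ⟨i, rfl⟩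
      exact (f.symm i).2
    · intro hx
      exact ⟨f ⟨x, hx⟩, by simp⟩
  have hr₂ : (Set.range fun i => p (((finProdFinEquiv (m := 2) (n := 2)).symm i).1.val / 2,
      ((finProdFinEquiv (m := 2) (n := 2)).symm i).2.val / 2)) = p '' halfLattice := by
    rw [hp.image_halfLattice_eq]
    exact (finProdFinEquiv (m := 2) (n := 2)).symm.surjective.range_comp
      (fun i : Fin 2 × Fin 2 => p ((i.1 : ℕ) / 2, (i.2 : ℕ) / 2))
  have e₃ : {x : unitSphere // x ∉ P} ≃ₜ {x : unitSphere // x ∉ Set.range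
      fun i => (f.symm i : unitSphere)} :=
    Homeomorph.setCongr (s := {x | x ∉ P}) (t := {x | x ∉ Set.range
      fun i => (f.symm i : unitSphere)}) (by rw [hr₁]; rfl)
  have E := ((φ.trans e₃).trans e₁).trans e₂.symm
  refine ⟨fun s => (E s).1, IsEmbedding.subtypeVal.comp E.isEmbedding, ?_⟩
  rw [show (fun s => (E s).1) = Subtype.val ∘ E from rfl, Set.range_comp, E.surjective.range_eq,
    Set.image_univ, Subtype.range_coe_subtype, hr₂]
  rfl

/-! ### Radial maps of the plane -/

/-- The map that preserves directions and changes norms by `ρ`. -/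
noncomputable def radial (ρ : ℝ → ℝ) (z : ℂ) : ℂ := ((ρ ‖z‖ / ‖z‖ : ℝ) : ℂ) * z

theorem norm_radial {ρ : ℝ → ℝ} (h0 : ρ 0 = 0) (z : ℂ) : ‖radial ρ z‖ = |ρ ‖z‖| := by
  unfold radial
  rw [norm_mul, Complex.norm_real, Real.norm_eq_abs, abs_div, abs_norm]
  by_cases h : z = 0
  · simp [h, h0]
  · have := norm_ne_zero_iff.2 h
    field_simp

theorem radial_radial {ρ ρ' : ℝ → ℝ} (h0 : ρ 0 = 0) (h0' : ρ' 0 = 0) {z : ℂ} (hz : 0 ≤ ρ ‖z‖)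
    (h : ρ' (ρ ‖z‖) = ‖z‖) : radial ρ' (radial ρ z) = z := by
  by_cases h1 : z = 0
  · simp [h1, radial]
  have hn := norm_ne_zero_iff.2 h1
  have hρ : ρ ‖z‖ ≠ 0 := fun h2 => hn (by rw [← h, h2, h0'])
  unfold radial at *
  change ((ρ' ‖radial ρ z‖ / ‖radial ρ z‖ : ℝ) : ℂ) * _ = z
  rw [norm_radial h0, abs_of_nonneg hz, h, ← mul_assoc, ← Complex.ofReal_mul,
    show ‖z‖ / ρ ‖z‖ * (ρ ‖z‖ / ‖z‖) = 1 by field_simp]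
  simp

theorem continuousAt_radial {ρ : ℝ → ℝ} (h0 : ρ 0 = 0) {z : ℂ} (hρ : ContinuousAt ρ ‖z‖) :
    ContinuousAt (radial ρ) z := by
  have hc : ContinuousAt (fun w : ℂ => ρ ‖w‖) z :=
    ContinuousAt.comp (f := fun w : ℂ => ‖w‖) hρ continuous_norm.continuousAt
  by_cases h : z = 0
  · have h2 : radial ρ z = 0 := by simp [h, radial]
    rw [ContinuousAt, h2, tendsto_zero_iff_norm_tendsto_zero]
    simp only [norm_radial h0]
    have := hc.abs
    rw [ContinuousAt] at this
    simpa [h, h0] using this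
  · unfold radial
    have hn := norm_ne_zero_iff.2 h
    exact (Complex.continuous_ofReal.continuousAt.comp
      (hc.div continuous_norm.continuousAt hn)).mul continuousAt_id

/-- `h` embeds the plane in the disk of radius `r` about `a`, with inverse `h'`, and is the identity
near `a`. -/
structure IsSqueeze (a : ℂ) (r : ℝ) (h h' : ℂ → ℂ) : Prop where
  cont : Continuous h
  mem : ∀ y, h y ∈ Metric.ball a r
  left_inv : ∀ y, h' (h y) = y
  right_inv : ∀ y ∈ Metric.ball a r, h (h' y) = y
  cont_inv : ContinuousOn h' (Metric.ball a r)
  eq_self : ∀ y ∈ Metric.ball a (r / 2), h y = y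

/-- A radial map: the radius `t` is kept up to `r / 2` and becomes `r - r² / (4t)` beyond. The two
formulas agree at `r / 2`, and writing them with `min` and `max` makes continuity automatic. -/
theorem exists_isSqueeze (a : ℂ) {r : ℝ} (hr : 0 < r) : ∃ h h', IsSqueeze a r h h' := by
  let ρ : ℝ → ℝ := fun t => min t (r / 2) + (r / 2 - r ^ 2 / (4 * max t (r / 2)))
  let ρ' : ℝ → ℝ := fun t => min t (r / 2) + (r ^ 2 / (4 * (r - max t (r / 2))) - r / 2)
  have ρ1 : ∀ t, t ≤ r / 2 → ρ t = t := fun t ht => by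
    simp only [ρ]
    rw [min_eq_left ht, max_eq_right ht]
    field_simp
    ring
  have ρ2 : ∀ t, r / 2 ≤ t → ρ t = r - r ^ 2 / (4 * t) := fun t ht => by
    simp only [ρ]
    rw [min_eq_right ht, max_eq_left ht]
    ring
  have ρ1' : ∀ t, t ≤ r / 2 → ρ' t = t := fun t ht => by
    simp only [ρ']
    rw [min_eq_left ht, max_eq_right ht]
    have : r - r / 2 ≠ 0 := by linarith
    field_simp
    ring
  have ρ2' : ∀ t, r / 2 ≤ t → ρ' t = r ^ 2 / (4 * (r - t)) := fun t ht => by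
    simp only [ρ']
    rw [min_eq_right ht, max_eq_left ht]
    ring
  have hρr : ∀ t, r / 2 ≤ t → r / 2 ≤ ρ t ∧ ρ t < r := fun t ht => by
    have htp : 0 < t := by linarith
    rw [ρ2 t ht]
    constructor
    · have : r ^ 2 / (4 * t) ≤ r / 2 := by
        rw [div_le_iff₀ (by positivity)]
        nlinarith
      linarith
    · have : 0 < r ^ 2 / (4 * t) := by positivity
      linarith
  have hρr' : ∀ t, r / 2 ≤ t → t < r → r / 2 ≤ ρ' t := fun t ht ht' => by
    rw [ρ2' t ht, le_div_iff₀ (by linarith)]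
    nlinarith
  have z0 : ρ 0 = 0 := ρ1 0 (by linarith)
  have z0' : ρ' 0 = 0 := ρ1' 0 (by linarith)
  have hρ0 : ∀ t, 0 ≤ t → 0 ≤ ρ t ∧ ρ t < r := fun t ht => by
    rcases le_total t (r / 2) with h | h
    · rw [ρ1 t h]; exact ⟨ht, by linarith⟩
    · have := hρr t h
      exact ⟨by linarith, this.2⟩
  have hρ0' : ∀ t, 0 ≤ t → t < r → 0 ≤ ρ' t := fun t ht ht' => by
    rcases le_total t (r / 2) with h | h
    · rw [ρ1' t h]; exact ht
    · have := hρr' t h ht'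
      linarith
  have inv1 : ∀ t, 0 ≤ t → ρ' (ρ t) = t := fun t ht => by
    rcases le_total t (r / 2) with h | h
    · rw [ρ1 t h, ρ1' t h]
    · rw [ρ2' _ (hρr t h).1, ρ2 t h]
      have : 0 < t := by linarith
      rw [sub_sub_cancel]
      field_simp
  have inv2 : ∀ t, 0 ≤ t → t < r → ρ (ρ' t) = t := fun t ht ht' => by
    rcases le_total t (r / 2) with h | h
    · rw [ρ1' t h, ρ1 t h]
    · rw [ρ2 _ (hρr' t h ht'), ρ2' t h]
      have : 0 < r - t := by linarith
      field_simp
      ring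
  have cρ : Continuous ρ := by
    have : ∀ t : ℝ, 4 * max t (r / 2) ≠ 0 := fun t => by
      have := le_max_right t (r / 2)
      positivity
    fun_prop (disch := assumption)
  have cρ' : ∀ t, t < r → ContinuousAt ρ' t := fun t ht => by
    have : 4 * (r - max t (r / 2)) ≠ 0 := by
      have : max t (r / 2) < r := max_lt ht (by linarith)
      have : 0 < r - max t (r / 2) := by linarith
      positivity
    have h1 : ContinuousAt (fun t : ℝ => 4 * (r - max t (r / 2))) t := by fun_prop
    exact ContinuousAt.add (by fun_prop)
      ((continuousAt_const.div h1 this).sub continuousAt_const)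
  have hb : ∀ {y : ℂ} {s : ℝ}, y ∈ Metric.ball a s ↔ ‖y - a‖ < s := by
    intro y s
    rw [Metric.mem_ball, dist_eq_norm]
  refine ⟨fun y => a + radial ρ (y - a), fun y => a + radial ρ' (y - a), ?_, ?_, ?_, ?_, ?_, ?_⟩
  · have : Continuous (radial ρ) :=
      continuous_iff_continuousAt.2 fun z => continuousAt_radial z0 cρ.continuousAt
    fun_prop
  · intro y
    have := hρ0 ‖y - a‖ (norm_nonneg _)
    rw [hb, add_sub_cancel_left, norm_radial z0, abs_of_nonneg this.1]
    exact this.2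
  · intro y
    have := hρ0 ‖y - a‖ (norm_nonneg _)
    simp only [add_sub_cancel_left]
    rw [radial_radial z0 z0' this.1 (inv1 _ (norm_nonneg _)), add_sub_cancel]
  · intro y hy
    have hy := hb.1 hy
    simp only [add_sub_cancel_left]
    rw [radial_radial z0' z0 (hρ0' _ (norm_nonneg _) hy) (inv2 _ (norm_nonneg _) hy),
      add_sub_cancel]
  · intro y hy
    have h1 := continuousAt_radial z0' (cρ' _ (hb.1 hy))
    have h2 : ContinuousAt (fun y : ℂ => y - a) y := by fun_prop
    exact (continuousAt_const.add (h1.comp (f := fun y : ℂ => y - a) h2)).continuousWithinAt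
  · intro y hy
    have hy := hb.1 hy
    have : radial ρ (y - a) = y - a := by
      unfold radial
      rw [ρ1 _ hy.le]
      by_cases h : y - a = 0
      · simp [h]
      · rw [div_self (norm_ne_zero_iff.2 h)]
        simp
    rw [this, add_sub_cancel]

namespace IsSqueeze

variable {a : ℂ} {r : ℝ} {h h' : ℂ → ℂ}

theorem isOpen_image (hs : IsSqueeze a r h h') {V : Set ℂ} (hV : IsOpen V) : IsOpen (h '' V) := by
  have : h '' V = Metric.ball a r ∩ h' ⁻¹' V := by
    ext y
    constructor
    · rintro ⟨x, hx, rfl⟩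
      exact ⟨hs.mem x, by rwa [Set.mem_preimage, hs.left_inv]⟩
    · rintro ⟨hy, hy'⟩
      exact ⟨h' y, hy', hs.right_inv y hy⟩
  rw [this]
  exact hs.cont_inv.isOpen_inter_preimage Metric.isOpen_ball hV

theorem injective (hs : IsSqueeze a r h h') : Function.Injective h :=
  Function.LeftInverse.injective hs.left_inv

theorem pos (hs : IsSqueeze a r h h') : 0 < r :=
  Metric.nonempty_ball.1 ⟨_, hs.mem a⟩

theorem center (hs : IsSqueeze a r h h') : h a = a :=
  hs.eq_self a (Metric.mem_ball_self (half_pos hs.pos))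

theorem inv_eq_self (hs : IsSqueeze a r h h') {y : ℂ} (hy : y ∈ Metric.ball a (r / 2)) :
    h' y = y := by
  conv_lhs => rw [← hs.eq_self y hy]
  exact hs.left_inv y

end IsSqueeze

/-- A piecewise linear radial map: `[0, R]` is scaled onto `[0, ε]`, `[R, R + 1]` is stretched onto
`[ε, R + 1]`, and larger radii are fixed. -/
theorem exists_contraction {ε R : ℝ} (hε : 0 < ε) (hR : ε < R) :
    ∃ T : ℂ ≃ₜ ℂ, (∀ y, ‖y‖ ≤ R → T y = ((ε / R : ℝ) : ℂ) * y) ∧ ∀ y, R + 1 ≤ ‖y‖ → T y = y := by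
  have hRp : 0 < R := hε.trans hR
  set m := R + 1 - ε with hm
  have hmp : 0 < m := by linarith
  let ρ : ℝ → ℝ := fun t =>
    ε / R * min t R + m * (min (max t R) (R + 1) - R) + (max t (R + 1) - (R + 1))
  let ρ' : ℝ → ℝ := fun t =>
    R / ε * min t ε + (min (max t ε) (R + 1) - ε) / m + (max t (R + 1) - (R + 1))
  have a1 : ∀ t, t ≤ R → ρ t = ε / R * t := fun t ht => by
    simp only [ρ]
    rw [min_eq_left ht, max_eq_right ht, max_eq_right (by linarith), min_eq_left (by linarith)]
    ring
  have a2 : ∀ t, R ≤ t → t ≤ R + 1 → ρ t = ε + m * (t - R) := fun t ht ht' => by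
    simp only [ρ]
    rw [min_eq_right ht, max_eq_left ht, max_eq_right ht', min_eq_left ht',
      div_mul_cancel₀ _ hRp.ne']
    ring
  have a3 : ∀ t, R + 1 ≤ t → ρ t = t := fun t ht => by
    simp only [ρ]
    rw [min_eq_right (by linarith), max_eq_left (by linarith), max_eq_left ht, min_eq_right ht,
      div_mul_cancel₀ _ hRp.ne']
    ring
  have b1 : ∀ t, t ≤ ε → ρ' t = R / ε * t := fun t ht => by
    simp only [ρ']
    rw [min_eq_left ht, max_eq_right ht, max_eq_right (by linarith), min_eq_left (by linarith)]
    ring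
  have b2 : ∀ t, ε ≤ t → t ≤ R + 1 → ρ' t = R + (t - ε) / m := fun t ht ht' => by
    simp only [ρ']
    rw [min_eq_right ht, max_eq_left ht, max_eq_right ht', min_eq_left ht',
      div_mul_cancel₀ _ hε.ne']
    ring
  have b3 : ∀ t, R + 1 ≤ t → ρ' t = t := fun t ht => by
    simp only [ρ']
    rw [min_eq_right (by linarith), max_eq_left (by linarith), max_eq_left ht, min_eq_right ht,
      div_mul_cancel₀ _ hε.ne', ← hm, div_self hmp.ne']
    ring
  have inv1 : ∀ t, 0 ≤ t → 0 ≤ ρ t ∧ ρ' (ρ t) = t := fun t ht => by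
    rcases le_total t R with h | h
    · have : ε / R * t ≤ ε := by
        rw [div_mul_eq_mul_div, div_le_iff₀ hRp]
        nlinarith
      rw [a1 t h, b1 _ this]
      refine ⟨by positivity, ?_⟩
      field_simp
    rcases le_total t (R + 1) with h' | h'
    · have h1 : 0 ≤ m * (t - R) := mul_nonneg hmp.le (by linarith)
      have h2 : m * (t - R) ≤ m * 1 := mul_le_mul_of_nonneg_left (by linarith) hmp.le
      rw [a2 t h h', b2 _ (by linarith) (by linarith)]
      refine ⟨by linarith, ?_⟩
      rw [add_sub_cancel_left, mul_div_cancel_left₀ _ hmp.ne']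
      ring
    · rw [a3 t h', b3 t h']
      exact ⟨ht, rfl⟩
  have inv2 : ∀ t, 0 ≤ t → 0 ≤ ρ' t ∧ ρ (ρ' t) = t := fun t ht => by
    rcases le_total t ε with h | h
    · have : R / ε * t ≤ R := by
        rw [div_mul_eq_mul_div, div_le_iff₀ hε]
        nlinarith
      rw [b1 t h, a1 _ this]
      refine ⟨by positivity, ?_⟩
      field_simp
    rcases le_total t (R + 1) with h' | h'
    · have h1 : 0 ≤ (t - ε) / m := div_nonneg (by linarith) hmp.le
      have h2 : (t - ε) / m ≤ 1 := (div_le_one hmp).2 (by linarith)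
      rw [b2 t h h', a2 _ (by linarith) (by linarith)]
      refine ⟨by linarith, ?_⟩
      rw [add_sub_cancel_left, mul_div_cancel₀ _ hmp.ne']
      ring
    · rw [b3 t h', a3 t h']
      exact ⟨ht, rfl⟩
  have z0 : ρ 0 = 0 := by rw [a1 0 hRp.le, mul_zero]
  have z0' : ρ' 0 = 0 := by rw [b1 0 hε.le, mul_zero]
  have cρ : Continuous ρ := by fun_prop
  have cρ' : Continuous ρ' := by
    have := hmp.ne'
    fun_prop (disch := assumption)
  refine ⟨⟨⟨radial ρ, radial ρ', fun z => ?_, fun z => ?_⟩, ?_, ?_⟩, fun y hy => ?_, fun y hy => ?_⟩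
  · exact radial_radial z0 z0' (inv1 _ (norm_nonneg _)).1 (inv1 _ (norm_nonneg _)).2
  · exact radial_radial z0' z0 (inv2 _ (norm_nonneg _)).1 (inv2 _ (norm_nonneg _)).2
  · exact continuous_iff_continuousAt.2 fun z => continuousAt_radial z0 cρ.continuousAt
  · exact continuous_iff_continuousAt.2 fun z => continuousAt_radial z0' cρ'.continuousAt
  · change radial ρ y = _
    unfold radial
    rw [a1 _ hy]
    by_cases h : y = 0
    · simp [h]
    · rw [mul_div_cancel_right₀ _ (norm_ne_zero_iff.2 h)]
  · change radial ρ y = _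
    unfold radial
    rw [a3 _ hy, div_self (by linarith [norm_nonneg y])]
    simp

/-! ### Homeomorphisms with support in a coordinate patch -/

theorem continuous_extend_of_compact_support {X Y : Type*} [TopologicalSpace X] [TopologicalSpace Y]
    [T2Space X] {j : Y → X} (hj : IsOpenEmbedding j) {φ : Y → Y} (hφc : Continuous φ) {K : Set Y}
    (hK : IsCompact K) (hφ : ∀ y, y ∉ K → φ y = y) :
    Continuous (Function.extend j (j ∘ φ) id) := by
  have happ : ∀ y, Function.extend j (j ∘ φ) id (j y) = j (φ y) := fun y => by
    rw [hj.injective.extend_apply]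
    rfl
  rw [continuous_iff_continuousAt]
  intro x
  by_cases hx : x ∈ Set.range j
  · obtain ⟨y, rfl⟩ := hx
    rw [← hj.continuousAt_iff]
    exact (hj.continuous.comp hφc).continuousAt.congr (.of_forall fun y => (happ y).symm)
  · have hopen : IsOpen (j '' K)ᶜ := (hK.image hj.continuous).isClosed.isOpen_compl
    have hmem : x ∈ (j '' K)ᶜ := fun h => hx (Set.image_subset_range _ _ h)
    refine continuousAt_id.congr ?_
    filter_upwards [hopen.mem_nhds hmem] with w hw
    by_cases hwr : w ∈ Set.range j
    · obtain ⟨y, rfl⟩ := hwr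
      rw [happ, hφ y fun hy => hw ⟨y, hy, rfl⟩]
      rfl
    · rw [Function.extend_apply' _ _ _ hwr]

/-- Extension by the identity is continuous because the compact support has closed image in a
Hausdorff space. -/
theorem exists_homeomorph_extension {X Y : Type*} [TopologicalSpace X] [TopologicalSpace Y]
    [T2Space X] {j : Y → X} (hj : IsOpenEmbedding j) (φ : Y ≃ₜ Y) {K : Set Y}
    (hK : IsCompact K) (hφ : ∀ y, y ∉ K → φ y = y) :
    ∃ Ψ : X ≃ₜ X, (∀ y, Ψ (j y) = j (φ y)) ∧ ∀ x, x ∉ j '' K → Ψ x = x := by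
  have happ : ∀ (g : Y → Y) y, Function.extend j (j ∘ g) id (j y) = j (g y) := fun g y => by
    rw [hj.injective.extend_apply]
    rfl
  have hinv : ∀ g g' : Y → Y, (∀ y, g' (g y) = y) → ∀ x,
      Function.extend j (j ∘ g') id (Function.extend j (j ∘ g) id x) = x := by
    intro g g' h x
    by_cases hx : x ∈ Set.range j
    · obtain ⟨y, rfl⟩ := hx
      rw [happ, happ, h]
    · have : ∀ g, Function.extend j (j ∘ g) id x = x := fun g => by
        rw [Function.extend_apply' _ _ _ hx]
        rfl
      rw [this, this]
  have hφ' : ∀ y, y ∉ K → φ.symm y = y := fun y hy => φ.symm_apply_eq.2 (hφ y hy).symm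
  refine ⟨⟨⟨Function.extend j (j ∘ φ) id, Function.extend j (j ∘ φ.symm) id,
    hinv φ φ.symm φ.symm_apply_apply, hinv φ.symm φ φ.apply_symm_apply⟩,
    continuous_extend_of_compact_support hj φ.continuous hK hφ,
    continuous_extend_of_compact_support hj φ.symm.continuous hK hφ'⟩, happ φ, fun x hx => ?_⟩
  change Function.extend j (j ∘ φ) id x = x
  by_cases hxr : x ∈ Set.range j
  · obtain ⟨y, rfl⟩ := hxr
    rw [happ, hφ y fun hy => hx ⟨y, hy, rfl⟩]
  · rw [Function.extend_apply' _ _ _ hxr]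
    rfl

/-! ### Squeezing along a map to the plane -/

section SqueezeAlong

variable {E : Type*} [TopologicalSpace E] {F : E → ℂ} {G : ℂ → E} {V T : Set ℂ} {a : ℂ} {r : ℝ}
  {h h' : ℂ → ℂ}

/-- If `G` inverts `F` near the values other than `a`, then the squeezing map `h` at `a` lifts to a
map of `E` that fixes the points near the fibre over `a`. -/
theorem exists_lift_squeeze (hF : Continuous F) (hG : ContinuousOn G (V \ T))
    (hFG : ∀ y ∈ V \ T, F (G y) = y) (hGF : ∀ x, F x ∉ T → G (F x) = x)
    (hV : Metric.ball a r ⊆ V) (hT : Metric.ball a r ∩ T ⊆ {a}) (hs : IsSqueeze a r h h') :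
    ∃ g g' : E → E, Continuous g ∧ (∀ x, F (g x) = h (F x)) ∧
      (∀ x, F x ≠ a → g x = G (h (F x))) ∧
      (∀ x, F x ∈ Metric.ball a (r / 2) → g x = x) ∧
      (∀ x, F x ∉ T \ {a} → g' (g x) = x) ∧
      (∀ y, F y ∈ h '' (V \ (T \ {a})) → g (g' y) = y) ∧
      ContinuousOn g' {y | F y ∈ h '' (V \ (T \ {a}))} := by
  classical
  have hsub : ∀ {y}, y ∈ Metric.ball a r → y ≠ a → y ∈ V \ T := fun {y} hy hya =>
    ⟨hV hy, fun hyT => hya (hT ⟨hy, hyT⟩)⟩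
  have hha : ∀ {y}, y ≠ a → h y ≠ a := fun {y} hy he => hy (hs.injective (he.trans hs.center.symm))
  have hhalf : Metric.ball a (r / 2) ⊆ Metric.ball a r :=
    Metric.ball_subset_ball (by linarith [hs.pos])
  -- On the fibre over `a`, where `G` need not invert `F`, the lift is the identity; this agrees
  -- with its values nearby because `h` fixes a neighbourhood of `a`.
  let g : E → E := fun x => if F x = a then x else G (h (F x))
  let g' : E → E := fun x => if F x = a then x else G (h' (F x))
  have g1 : ∀ x, F x = a → g x = x := fun x hx => if_pos hx
  have g2 : ∀ x, F x ≠ a → g x = G (h (F x)) := fun x hx => if_neg hx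
  have g1' : ∀ x, F x = a → g' x = x := fun x hx => if_pos hx
  have g2' : ∀ x, F x ≠ a → g' x = G (h' (F x)) := fun x hx => if_neg hx
  have hFg : ∀ x, F (g x) = h (F x) := by
    intro x
    by_cases hx : F x = a
    · rw [g1 x hx, hx, hs.center]
    · rw [g2 x hx, hFG _ (hsub (hs.mem _) (hha hx))]
  have hid : ∀ x, F x ∈ Metric.ball a (r / 2) → g x = x := by
    intro x hx
    by_cases hxa : F x = a
    · exact g1 x hxa
    · rw [g2 x hxa, hs.eq_self _ hx, hGF _ (hsub (hhalf hx) hxa).2]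
  have hid' : ∀ x, F x ∈ Metric.ball a (r / 2) → g' x = x := by
    intro x hx
    by_cases hxa : F x = a
    · exact g1' x hxa
    · rw [g2' x hxa, hs.inv_eq_self hx, hGF _ (hsub (hhalf hx) hxa).2]
  have hnear : ∀ {x}, F x ∈ Metric.ball a (r / 2) → ∀ᶠ w in 𝓝 x, F w ∈ Metric.ball a (r / 2) :=
    fun hx => hF.continuousAt.preimage_mem_nhds (Metric.isOpen_ball.mem_nhds hx)
  have hne : ∀ {x}, F x ≠ a → ∀ᶠ w in 𝓝 x, F w ≠ a := fun hx =>
    hF.continuousAt.preimage_mem_nhds (isOpen_ne.mem_nhds hx)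
  have hcenter : a ∈ Metric.ball a (r / 2) := Metric.mem_ball_self (half_pos hs.pos)
  refine ⟨g, g', ?_, hFg, g2, hid, fun x hx => ?_, fun y hy => ?_, fun y hy => ?_⟩
  · rw [continuous_iff_continuousAt]
    intro x
    by_cases hx : F x ∈ Metric.ball a (r / 2)
    · refine continuousAt_id.congr ?_
      filter_upwards [hnear hx] with w hw
      exact (hid w hw).symm
    · have hxa : F x ≠ a := fun he => hx (he ▸ hcenter)
      have h1 : ContinuousAt G (h (F x)) := by
        refine hG.continuousAt (Filter.mem_of_superset
          ((Metric.isOpen_ball.inter isOpen_ne).mem_nhds ⟨hs.mem (F x), hha hxa⟩) ?_)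
        exact fun y hy => hsub hy.1 hy.2
      refine (ContinuousAt.comp (f := fun x => h (F x)) h1
        (hs.cont.comp hF).continuousAt).congr ?_
      filter_upwards [hne hxa] with w hw
      exact (g2 w hw).symm
  · by_cases hxa : F x = a
    · rw [g1 x hxa, g1' x hxa]
    · have hxT : F x ∉ T := fun hxT => hx ⟨hxT, hxa⟩
      rw [g2' (g x) (by rw [hFg]; exact hha hxa), hFg, hs.left_inv, hGF x hxT]
  · by_cases hya : F y = a
    · rw [g1' y hya, g1 y hya]
    · obtain ⟨w, ⟨hwV, hwT⟩, hw⟩ := hy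
      have hyb : F y ∈ Metric.ball a r := hw ▸ hs.mem w
      have hwa : w ≠ a := fun he => hya (by rw [← hw, he, hs.center])
      have hinv : h' (F y) = w := by rw [← hw, hs.left_inv]
      have h1 : F (G w) = w := hFG w ⟨hwV, fun hT' => hwT ⟨hT', hwa⟩⟩
      rw [g2' y hya, hinv, g2 _ (by rwa [h1]), h1, hw, hGF y (hsub hyb hya).2]
  · by_cases hyh : F y ∈ Metric.ball a (r / 2)
    · refine (continuousAt_id.congr ?_).continuousWithinAt
      filter_upwards [hnear hyh] with w hw
      exact (hid' w hw).symm
    · have hya : F y ≠ a := fun he => hyh (he ▸ hcenter)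
      set W := {y | F y ∈ h '' (V \ (T \ {a}))} ∩ {w | F w ≠ a} with hW
      have hmaps : Set.MapsTo (fun y => h' (F y)) W (V \ T) := by
        rintro w ⟨⟨z, ⟨hzV, hzT⟩, hz⟩, hwa⟩
        have hza : z ≠ a := fun he => hwa (by rw [← hz, he, hs.center])
        change h' (F w) ∈ _
        rw [← hz, hs.left_inv]
        exact ⟨hzV, fun hT' => hzT ⟨hT', hza⟩⟩
      have hyW : y ∈ W := ⟨hy, hya⟩
      have hc : ContinuousWithinAt (fun y => h' (F y)) W y := by
        refine ContinuousWithinAt.comp (t := Metric.ball a r) (hs.cont_inv _ ?_)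
          hF.continuousWithinAt ?_
        · obtain ⟨z, _, hz⟩ := hy
          exact hz ▸ hs.mem z
        · rintro w ⟨⟨z, _, hz⟩, _⟩
          exact hz ▸ hs.mem z
      have h2 : ContinuousWithinAt g' W y := by
        refine (ContinuousWithinAt.comp (f := fun y => h' (F y)) (hG _ (hmaps hyW)) hc
          hmaps).congr (fun w hw => g2' w hw.2) (g2' y hya)
      exact (continuousWithinAt_inter (hne hya)).1 h2

end SqueezeAlong

/-! ### Discs bounded by a collared curve on the sphere -/

/-- The direction of a non-zero complex number. -/
noncomputable def circleDir (w : ℂ) : Circle :=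
  if h : w = 0 then 1 else ⟨w / ‖w‖, by
    refine mem_sphere_zero_iff_norm.2 ?_
    rw [norm_div, Complex.norm_real, norm_norm, div_self (norm_ne_zero_iff.2 h)]⟩

theorem coe_circleDir {w : ℂ} (h : w ≠ 0) : (circleDir w : ℂ) = w / ‖w‖ := by
  have : circleDir w = _ := dif_neg h
  exact congrArg Subtype.val this

theorem norm_mul_circleDir (w : ℂ) : (‖w‖ : ℂ) * circleDir w = w := by
  by_cases h : w = 0
  · simp [h]
  · rw [coe_circleDir h, mul_div_cancel₀]
    exact_mod_cast norm_ne_zero_iff.2 h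

theorem circleDir_mul {t : ℝ} (ht : 0 < t) (z : Circle) : circleDir (t * z) = z := by
  have h : (t : ℂ) * z ≠ 0 := mul_ne_zero (by exact_mod_cast ht.ne') (Circle.coe_ne_zero z)
  ext
  rw [coe_circleDir h, norm_mul, Circle.norm_coe, Complex.norm_real, Real.norm_of_nonneg ht.le,
    mul_one, mul_div_cancel_left₀]
  exact_mod_cast ht.ne'

theorem continuousAt_circleDir {w : ℂ} (h : w ≠ 0) : ContinuousAt circleDir w := by
  refine (IsEmbedding.subtypeVal (p := fun z : ℂ => z ∈ Metric.sphere 0 1)).continuousAt_iff.2 ?_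
  have h1 : ContinuousAt (fun w : ℂ => w / ‖w‖) w := by
    refine continuousAt_id.div (Complex.continuous_ofReal.comp continuous_norm).continuousAt ?_
    exact_mod_cast norm_ne_zero_iff.2 h
  refine h1.congr ?_
  filter_upwards [isOpen_ne.mem_nhds h] with z hz
  exact (coe_circleDir hz).symm

theorem exists_ramp_eq {t : ℝ} (h0 : 0 < t) (h1 : t < 1) : |2 * t - 1| < 1 ∧ ramp (2 * t - 1) = t := by
  have h : |2 * t - 1| < 1 := abs_lt.2 ⟨by linarith, by linarith⟩
  exact ⟨h, by rw [ramp_of_abs_le h.le]; ring⟩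

/-- `Φ` is a continuous function that grows from `0` to `1` across the middle part of the annulus
`f` and is `0` or `1` elsewhere. -/
structure IsCollarFunction {X : Type*} [TopologicalSpace X] (f : Circle × ℝ → X) (Φ : X → ℝ) :
    Prop where
  emb : IsOpenEmbedding f
  cont : Continuous Φ
  mem : ∀ x, 0 ≤ Φ x ∧ Φ x ≤ 1
  apply : ∀ z s, Φ (f (z, s)) = ramp s
  exists_eq : ∀ x, 0 < Φ x → Φ x < 1 → ∃ z s, |s| < 1 ∧ f (z, s) = x

namespace IsCollarFunction

variable {X : Type*} [TopologicalSpace X] {f : Circle × ℝ → X} {Φ : X → ℝ}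

/-- The angular coordinate on the annulus. -/
noncomputable def angle (f : Circle × ℝ → X) (x : X) : Circle := (Function.invFun f x).1

theorem angle_apply (h : IsCollarFunction f Φ) (z : Circle) (s : ℝ) : angle f (f (z, s)) = z := by
  unfold angle
  rw [Function.leftInverse_invFun h.emb.injective]

theorem eq_apply (h : IsCollarFunction f Φ) {x : X} (h0 : 0 < Φ x) (h1 : Φ x < 1) :
    f (angle f x, 2 * Φ x - 1) = x := by
  obtain ⟨z, s, hs, rfl⟩ := h.exists_eq x h0 h1
  rw [h.angle_apply, h.apply, ramp_of_abs_le hs.le]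
  congr 2
  ring

theorem continuousAt_angle (h : IsCollarFunction f Φ) {x : X} (hx : x ∈ Set.range f) :
    ContinuousAt (angle f) x := by
  obtain ⟨y, rfl⟩ := hx
  rw [← h.emb.continuousAt_iff]
  refine continuousAt_fst.congr (.of_forall fun y => ?_)
  exact (h.angle_apply y.1 y.2).symm

/-- A map to the plane that is injective on the middle part of the annulus except for the point
`f (1, 0)` and collapses the sides to the points `0` and `-1`. -/
noncomputable def collapse (f : Circle × ℝ → X) (Φ : X → ℝ) (x : X) : ℂ :=
  Φ x * angle f x / (1 - Φ x - Φ x * angle f x)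

/-- The inverse of `collapse`. -/
noncomputable def uncollapse (f : Circle × ℝ → X) (u : ℂ) : X :=
  f (circleDir (u / (1 + u)), 2 * (‖u‖ / (‖u‖ + ‖1 + u‖)) - 1)

theorem denom_ne_zero (h : IsCollarFunction f Φ) {x : X} (hx : x ≠ f (1, 0)) :
    (1 - Φ x - Φ x * angle f x : ℂ) ≠ 0 := by
  intro h0
  have h1 : ((1 - Φ x : ℝ) : ℂ) = Φ x * angle f x := by
    push_cast
    linear_combination h0
  have h2 := congrArg norm h1
  rw [norm_mul, Complex.norm_real, Complex.norm_real, Circle.norm_coe, mul_one,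
    Real.norm_of_nonneg (h.mem x).1, Real.norm_of_nonneg (by linarith [(h.mem x).2])] at h2
  have h3 : Φ x = 1 / 2 := by linarith
  have h4 := h.eq_apply (x := x) (by rw [h3]; norm_num) (by rw [h3]; norm_num)
  have h5 : angle f x = 1 := by
    ext
    rw [h3] at h1
    push_cast at h1
    rw [Circle.coe_one]
    linear_combination (-2) * h1
  rw [h5, h3] at h4
  exact hx (by rw [← h4]; norm_num)

theorem collapse_eq_zero_iff (h : IsCollarFunction f Φ) {x : X} (hx : x ≠ f (1, 0)) :
    collapse f Φ x = 0 ↔ Φ x = 0 := by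
  unfold collapse
  rw [div_eq_zero_iff, or_iff_left (h.denom_ne_zero hx), mul_eq_zero,
    or_iff_left (Circle.coe_ne_zero _)]
  exact Complex.ofReal_eq_zero

theorem collapse_add_one (h : IsCollarFunction f Φ) {x : X} (hx : x ≠ f (1, 0)) :
    collapse f Φ x + 1 = ((1 - Φ x : ℝ) : ℂ) / (1 - Φ x - Φ x * angle f x) := by
  have := h.denom_ne_zero hx
  unfold collapse
  rw [div_add_one this]
  congr 1
  push_cast
  ring

theorem collapse_eq_neg_one_iff (h : IsCollarFunction f Φ) {x : X} (hx : x ≠ f (1, 0)) :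
    collapse f Φ x = -1 ↔ Φ x = 1 := by
  rw [← add_eq_zero_iff_eq_neg, h.collapse_add_one hx, div_eq_zero_iff,
    or_iff_left (h.denom_ne_zero hx), Complex.ofReal_eq_zero, sub_eq_zero, eq_comm]

theorem one_sub_le_norm (h : IsCollarFunction f Φ) {x : X} (hx : x ≠ f (1, 0)) :
    1 - Φ x ≤ ‖collapse f Φ x + 1‖ := by
  have h1 := h.mem x
  have h2 : ‖(1 - Φ x - Φ x * angle f x : ℂ)‖ ≤ 1 := by
    have h3 : (1 - Φ x : ℂ) = ((1 - Φ x : ℝ) : ℂ) := by push_cast; rfl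
    refine (norm_sub_le _ _).trans ?_
    rw [h3, norm_mul, Complex.norm_real, Complex.norm_real, Circle.norm_coe,
      Real.norm_of_nonneg h1.1, Real.norm_of_nonneg (by linarith)]
    linarith
  rw [h.collapse_add_one hx, norm_div, Complex.norm_real, Real.norm_of_nonneg (by linarith),
    le_div_iff₀ (norm_pos_iff.2 (h.denom_ne_zero hx))]
  nlinarith

/-- The angle need not be continuous off the annulus, but there `Φ` is `0` or `1`. Where `Φ` is
small, so is its product with the angle; near `Φ = 1` the distance to `-1` is at most `2 (1 - Φ)`.
-/
theorem continuousAt_collapse (h : IsCollarFunction f Φ) {x : X} (hx : x ≠ f (1, 0)) :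
    ContinuousAt (collapse f Φ) x := by
  have hΦ : ContinuousAt (fun x => (Φ x : ℂ)) x :=
    (Complex.continuous_ofReal.comp h.cont).continuousAt
  have hmem := h.mem x
  rcases hmem.2.lt_or_eq with h1 | h1
  · have hA : ContinuousAt (fun x => (Φ x * angle f x : ℂ)) x := by
      rcases hmem.1.eq_or_lt with h0 | h0
      · rw [ContinuousAt, ← h0]
        simp only [Complex.ofReal_zero, zero_mul]
        rw [tendsto_zero_iff_norm_tendsto_zero]
        have h2 : Filter.Tendsto (fun x => |Φ x|) (𝓝 x) (𝓝 |Φ x|) := h.cont.abs.continuousAt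
        rw [← h0, abs_zero] at h2
        refine h2.congr fun x => ?_
        rw [norm_mul, Complex.norm_real, Circle.norm_coe, mul_one, Real.norm_eq_abs]
      · have h2 : ContinuousAt (fun x => (angle f x : ℂ)) x :=
          continuous_subtype_val.continuousAt.comp
            (h.continuousAt_angle ⟨_, h.eq_apply h0 h1⟩)
        exact hΦ.mul h2
    exact hA.div ((continuousAt_const.sub hΦ).sub hA) (h.denom_ne_zero hx)
  · have h2 : collapse f Φ x = -1 := (h.collapse_eq_neg_one_iff hx).2 h1
    rw [ContinuousAt, h2, tendsto_iff_norm_sub_tendsto_zero]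
    have h3 : Filter.Tendsto (fun x => 2 * (1 - Φ x)) (𝓝 x) (𝓝 (2 * (1 - Φ x))) := by
      have := h.cont
      exact Continuous.tendsto (by fun_prop) x
    rw [h1, sub_self, mul_zero] at h3
    have h4 : ∀ᶠ w in 𝓝 x, 3 / 4 < Φ w :=
      h.cont.continuousAt.eventually (lt_mem_nhds (by rw [h1]; norm_num))
    refine squeeze_zero' (.of_forall fun _ => norm_nonneg _) ?_ h3
    filter_upwards [h4] with w hw
    have hw1 := h.mem w
    have hwx : w ≠ f (1, 0) := by
      rintro rfl
      rw [h.apply, ramp_of_abs_le (by norm_num)] at hw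
      norm_num at hw
    rw [sub_neg_eq_add, h.collapse_add_one hwx, norm_div, Complex.norm_real,
      Real.norm_of_nonneg (by linarith), div_le_iff₀ (norm_pos_iff.2 (h.denom_ne_zero hwx))]
    have h5 : (1 / 2 : ℝ) ≤ ‖(1 - Φ w - Φ w * angle f w : ℂ)‖ := by
      have h6 : (1 - Φ w : ℂ) = ((1 - Φ w : ℝ) : ℂ) := by push_cast; rfl
      have h7 := norm_sub_norm_le (Φ w * angle f w : ℂ) (1 - Φ w)
      have h8 : ‖(Φ w * angle f w : ℂ)‖ = Φ w := by
        rw [norm_mul, Complex.norm_real, Circle.norm_coe, mul_one, Real.norm_of_nonneg hw1.1]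
      have h9 : ‖(1 - Φ w : ℂ)‖ = 1 - Φ w := by
        rw [h6, Complex.norm_real, Real.norm_of_nonneg (by linarith)]
      rw [h8, h9, norm_sub_rev] at h7
      linarith
    nlinarith

theorem uncollapse_collapse (h : IsCollarFunction f Φ) {x : X} (hx : x ≠ f (1, 0))
    (h0 : Φ x ≠ 0) (h1 : Φ x ≠ 1) : uncollapse f (collapse f Φ x) = x := by
  have h0 : 0 < Φ x := (h.mem x).1.lt_of_ne' h0
  have h1 : Φ x < 1 := (h.mem x).2.lt_of_ne h1
  have hD := h.denom_ne_zero hx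
  have hn := norm_ne_zero_iff.2 hD
  have e1 : collapse f Φ x / (1 + collapse f Φ x) = ((Φ x / (1 - Φ x) : ℝ) : ℂ) * angle f x := by
    have h2 : ((1 - Φ x : ℝ) : ℂ) ≠ 0 := by exact_mod_cast (sub_pos.2 h1).ne'
    rw [add_comm 1, h.collapse_add_one hx]
    unfold collapse
    push_cast at h2 ⊢
    field_simp
  have e2 : ‖collapse f Φ x‖ / (‖collapse f Φ x‖ + ‖1 + collapse f Φ x‖) = Φ x := by
    rw [add_comm 1, h.collapse_add_one hx]
    unfold collapse
    rw [norm_div, norm_div, norm_mul, Complex.norm_real, Complex.norm_real, Circle.norm_coe,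
      Real.norm_of_nonneg h0.le, Real.norm_of_nonneg (by linarith)]
    field_simp
    ring
  unfold uncollapse
  rw [e1, e2, circleDir_mul (div_pos h0 (by linarith)), h.eq_apply h0 h1]

theorem collapse_uncollapse (h : IsCollarFunction f Φ) {u : ℂ} (h0 : u ≠ 0) (h1 : u ≠ -1) :
    collapse f Φ (uncollapse f u) = u := by
  have h1 : 1 + u ≠ 0 := fun h2 => h1 (by linear_combination h2)
  have ha := norm_pos_iff.2 h0
  have hb := norm_pos_iff.2 h1
  set a := ‖u‖
  set b := ‖1 + u‖
  have hw : u / (1 + u) ≠ 0 := div_ne_zero h0 h1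
  have hr := exists_ramp_eq (t := a / (a + b)) (by positivity)
    ((div_lt_one (by positivity)).2 (by linarith))
  have e1 : Φ (uncollapse f u) = a / (a + b) := by
    unfold uncollapse
    rw [h.apply, hr.2]
  have e2 : (angle f (uncollapse f u) : ℂ) = u / (1 + u) / (a / b : ℝ) := by
    unfold uncollapse
    rw [h.angle_apply, coe_circleDir hw, norm_div]
  have ha' : (a : ℂ) ≠ 0 := by exact_mod_cast ha.ne'
  have hb' : (b : ℂ) ≠ 0 := by exact_mod_cast hb.ne'
  have hab : (a : ℂ) + b ≠ 0 := by exact_mod_cast (add_pos ha hb).ne'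
  have e3 : (Φ (uncollapse f u) : ℂ) * angle f (uncollapse f u) = u / (1 + u) * (b / (a + b)) := by
    rw [e1, e2]
    push_cast
    field_simp
  have e4 : (1 - Φ (uncollapse f u) : ℂ) = b / (a + b) := by
    rw [e1]
    push_cast
    field_simp
    ring
  unfold collapse
  rw [e3, e4, show (b / (a + b) - u / (1 + u) * (b / (a + b)) : ℂ) = 1 / (1 + u) * (b / (a + b)) by
    field_simp; ring]
  field_simp

theorem continuousAt_uncollapse (h : IsCollarFunction f Φ) {u : ℂ} (h0 : u ≠ 0) (h1 : u ≠ -1) :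
    ContinuousAt (uncollapse f) u := by
  have h1 : 1 + u ≠ 0 := fun h2 => h1 (by linear_combination h2)
  have ha := norm_pos_iff.2 h0
  have hb := norm_pos_iff.2 h1
  unfold uncollapse
  refine h.emb.continuous.continuousAt.comp (ContinuousAt.prodMk ?_ ?_)
  · refine ContinuousAt.comp (f := fun u : ℂ => u / (1 + u))
      (continuousAt_circleDir (div_ne_zero h0 h1)) ?_
    exact continuousAt_id.div (by fun_prop) h1
  · have : ‖u‖ + ‖1 + u‖ ≠ 0 := by positivity
    have h2 : ContinuousAt (fun u : ℂ => ‖u‖ / (‖u‖ + ‖1 + u‖)) u :=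
      ContinuousAt.div (by fun_prop) (by fun_prop) this
    fun_prop

/-- The side `{Φ = 1}` of the curve has arbitrarily small neighbourhoods that are open disks; here
it is enough that they lie on the same side of the curve. -/
theorem exists_disk_nhd [CompactSpace X] [T1Space X] (h : IsCollarFunction f Φ)
    (c : {x : X // x ≠ f (1, 0)} ≃ₜ ℂ) (hne : ∃ x, Φ x = 1) :
    ∃ k : ℂ → X, IsOpenEmbedding k ∧ (∀ y, 3 / 4 < Φ (k y)) ∧
      ∃ η > 0, ∀ x, 1 - η < Φ x → x ∈ Set.range k := by
  classical
  have hpt : Φ (f (1, 0)) = 1 / 2 := by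
    rw [h.apply, ramp_of_abs_le (by norm_num)]
    norm_num
  obtain ⟨x₁, hx₁⟩ := hne
  have hx₁' : x₁ ≠ f (1, 0) := by
    rintro rfl
    rw [hx₁] at hpt
    norm_num at hpt
  have hX : IsOpenEmbedding f := h.emb
  let E := {x : X // x ≠ f (1, 0)}
  let F : E → ℂ := fun x => collapse f Φ x
  have hF : Continuous F := continuous_iff_continuousAt.2 fun x =>
    (h.continuousAt_collapse x.2).comp continuousAt_subtype_val
  let T : Set ℂ := {0, -1}
  have hTc : ∀ {u : ℂ}, u ∉ T → u ≠ 0 ∧ u ≠ -1 := fun {u} hu => by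
    simpa [T, not_or] using hu
  have hGne : ∀ {u : ℂ}, u ∉ T → uncollapse f u ≠ f (1, 0) := by
    intro u hu he
    have h1 := h.collapse_uncollapse (hTc hu).1 (hTc hu).2
    rw [he] at h1
    unfold collapse at h1
    have h2 : angle f (f (1, 0)) = 1 := h.angle_apply 1 0
    rw [hpt, h2] at h1
    norm_num at h1
    exact (hTc hu).1 h1.symm
  let G : ℂ → E := fun u => if hu : u ∉ T then ⟨uncollapse f u, hGne hu⟩ else ⟨x₁, hx₁'⟩
  have hGu : ∀ {u : ℂ}, u ∉ T → (G u : X) = uncollapse f u := fun {u} hu => by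
    simp only [G, dif_pos hu]
  have hTopen : IsOpen Tᶜ := (Set.toFinite T).isClosed.isOpen_compl
  have hG : ContinuousOn G (Set.univ \ T) := by
    intro u hu
    refine ContinuousAt.continuousWithinAt ?_
    refine (IsEmbedding.subtypeVal (p := fun x : X => x ≠ f (1, 0))).continuousAt_iff.2 ?_
    refine (h.continuousAt_uncollapse (hTc hu.2).1 (hTc hu.2).2).congr ?_
    filter_upwards [hTopen.mem_nhds hu.2] with w hw
    exact (hGu hw).symm
  have hFG : ∀ y ∈ Set.univ \ T, F (G y) = y := fun y hy => by
    change collapse f Φ (G y) = y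
    rw [hGu hy.2, h.collapse_uncollapse (hTc hy.2).1 (hTc hy.2).2]
  have hF0 : ∀ x : E, F x = 0 ↔ Φ x = 0 := fun x => h.collapse_eq_zero_iff x.2
  have hF1 : ∀ x : E, F x = -1 ↔ Φ x = 1 := fun x => h.collapse_eq_neg_one_iff x.2
  have hGF : ∀ x, F x ∉ T → G (F x) = x := fun x hx => by
    apply Subtype.ext
    rw [hGu hx]
    exact h.uncollapse_collapse x.2 (fun h0 => (hTc hx).1 ((hF0 x).2 h0))
      (fun h0 => (hTc hx).2 ((hF1 x).2 h0))
  obtain ⟨s, s', hs⟩ := exists_isSqueeze 0 (r := 1 / 2) (by norm_num)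
  have hballT : Metric.ball (0 : ℂ) (1 / 2) ∩ T ⊆ {0} := by
    rintro y ⟨hy, rfl | rfl⟩
    · rfl
    · norm_num at hy
  -- The first squeeze is at the value `0` of the side `{Φ = 0}`. Its lift `g` is injective except
  -- that it collapses the side `{Φ = 1}` to the point `b`.
  obtain ⟨g, g', hg, hFg, hgG, -, hg'g, hgg', hg'⟩ :=
    exists_lift_squeeze hF hG hFG hGF (Set.subset_univ _) hballT hs
  have hT0 : ∀ {u : ℂ}, u ∉ T \ {0} ↔ u ≠ -1 := fun {u} => by
    by_cases hu : u = 0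
    · simp [T, hu]
    · simp [T]
  set b : E := G (s (-1)) with hb
  have hgb : ∀ x, F x = -1 → g x = b := fun x hx => by
    rw [hgG x (by rw [hx]; norm_num), hx]
  have hsT : s (-1) ∉ T := fun hT => by
    have h1 := hballT ⟨hs.mem _, hT⟩
    have h2 : (-1 : ℂ) = 0 := hs.injective (h1.trans hs.center.symm)
    norm_num at h2
  have hFb : F b = s (-1) := hFG _ ⟨trivial, hsT⟩
  have hg'g' : ∀ x, F x ≠ -1 → g' (g x) = x := fun x hx => hg'g x (hT0.2 hx)
  let F₂ : E → ℂ := fun x => c (g x)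
  let V₂ : Set ℂ := {w | F (c.symm w) ∈ Metric.ball 0 (1 / 2)}
  have hFc : Continuous fun w => F (c.symm w) := hF.comp c.symm.continuous
  have hV₂ : IsOpen V₂ := Metric.isOpen_ball.preimage hFc
  have hW : ∀ {w}, w ∈ V₂ \ {c b} → F (c.symm w) ∈ s '' (Set.univ \ (T \ {0})) := by
    rintro w ⟨hw, hwb⟩
    have hw : F (c.symm w) ∈ Metric.ball 0 (1 / 2) := hw
    refine ⟨s' (F (c.symm w)), ⟨trivial, hT0.2 fun he => hwb ?_⟩, hs.right_inv _ hw⟩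
    have h1 : F (c.symm w) = s (-1) := by rw [← he, hs.right_inv _ hw]
    have h2 : c.symm w = b := by rw [hb, ← h1, hGF _ (by rwa [h1])]
    rw [← h2]
    exact (c.apply_symm_apply w).symm
  -- Staying in `O` will keep the disk at collapsed distance less than `1/4` from `-1`, hence in
  -- `{3/4 < Φ}`.
  let O : Set ℂ := {w | F (c.symm w) ∈ s '' Metric.ball (-1) (1 / 4)}
  have hO : IsOpen O := (hs.isOpen_image Metric.isOpen_ball).preimage hFc
  have hbO : c b ∈ O ∩ V₂ := by
    constructor
    · change F (c.symm (c b)) ∈ s '' Metric.ball (-1) (1 / 4)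
      rw [c.symm_apply_apply, hFb]
      exact ⟨-1, Metric.mem_ball_self (by norm_num), rfl⟩
    · change F (c.symm (c b)) ∈ Metric.ball 0 (1 / 2)
      rw [c.symm_apply_apply, hFb]
      exact hs.mem _
  obtain ⟨r, hr, hball⟩ := Metric.isOpen_iff.1 (hO.inter hV₂) _ hbO
  obtain ⟨q, q', hq⟩ := exists_isSqueeze (c b) hr
  -- The second squeeze is at `c b`, the only value that `F₂` takes more than once. Its lift embeds
  -- the whole punctured sphere, which is a plane, and fixes a neighbourhood of the side `{Φ = 1}`.
  obtain ⟨k, k', hk, hFk, -, hkid, hk'k, hkk', hk'⟩ :=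
    exists_lift_squeeze (F := F₂) (G := fun w => g' (c.symm w)) (V := V₂) (T := {c b})
      (c.continuous.comp hg)
      (hg'.comp c.symm.continuous.continuousOn fun w hw => hW hw)
      (fun w hw => by
        change c (g (g' (c.symm w))) = w
        rw [hgg' _ (hW hw), c.apply_symm_apply])
      (fun x hx => by
        change g' (c.symm (c (g x))) = x
        rw [c.symm_apply_apply]
        refine hg'g' x fun he => hx ?_
        change c (g x) = c b
        rw [hgb x he])
      (hball.trans Set.inter_subset_right) Set.inter_subset_right hq
  simp only [sdiff_self, Set.bot_eq_empty, Set.sdiff_empty, Set.mem_empty_iff_false,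
    not_false_eq_true, true_implies] at hk'k hkk' hk'
  have hF₂V : ∀ x, F₂ x ∈ V₂ := fun x => by
    change F (c.symm (c (g x))) ∈ Metric.ball 0 (1 / 2)
    rw [c.symm_apply_apply, hFg]
    exact hs.mem _
  have hkopen : IsOpenMap k := by
    intro U hU
    have hWopen : IsOpen {y | F₂ y ∈ q '' V₂} :=
      (hq.isOpen_image hV₂).preimage (c.continuous.comp hg)
    have : k '' U = {y | F₂ y ∈ q '' V₂} ∩ k' ⁻¹' U := by
      ext y
      constructor
      · rintro ⟨x, hx, rfl⟩
        refine ⟨⟨F₂ x, hF₂V x, (hFk x).symm⟩, ?_⟩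
        rwa [Set.mem_preimage, hk'k]
      · rintro ⟨hy, hy'⟩
        exact ⟨k' y, hy', hkk' y hy⟩
    rw [this]
    exact hk'.isOpen_inter_preimage hWopen hU
  have hkemb : IsOpenEmbedding k := .of_continuous_injective_isOpenMap hk
    (Function.LeftInverse.injective hk'k) hkopen
  have hval : IsOpenEmbedding (Subtype.val : E → X) := isOpen_ne.isOpenEmbedding_subtypeVal
  refine ⟨fun w => k (c.symm w), hval.comp (hkemb.comp c.symm.isOpenEmbedding), fun y => ?_, ?_⟩
  · set x := c.symm y
    have h1 : F₂ (k x) ∈ O := by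
      rw [hFk]
      exact (hball (hq.mem _)).1
    obtain ⟨u, hu, hue⟩ : F (c.symm (c (g (k x)))) ∈ s '' Metric.ball (-1) (1 / 4) := h1
    rw [c.symm_apply_apply, hFg] at hue
    rw [hs.injective hue, Metric.mem_ball, dist_eq_norm, sub_neg_eq_add] at hu
    have := h.one_sub_le_norm (k x).2
    change ‖collapse f Φ (k x) + 1‖ < _ at hu
    linarith
  · have hN : IsOpen (Subtype.val '' (F₂ ⁻¹' Metric.ball (c b) (r / 2)) : Set X) :=
      hval.isOpenMap _ (Metric.isOpen_ball.preimage (c.continuous.comp hg))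
    have hsub : ∀ x, Φ x = 1 → x ∈ (Subtype.val '' (F₂ ⁻¹' Metric.ball (c b) (r / 2)) : Set X) := by
      intro x hx
      have hx' : x ≠ f (1, 0) := by
        rintro rfl
        rw [hx] at hpt
        norm_num at hpt
      refine ⟨⟨x, hx'⟩, ?_, rfl⟩
      change c (g ⟨x, hx'⟩) ∈ Metric.ball (c b) (r / 2)
      rw [hgb _ ((hF1 _).2 hx)]
      exact Metric.mem_ball_self (half_pos hr)
    -- Off an open neighbourhood of `{Φ = 1}` the function `Φ` attains a maximum less than `1`, by
    -- compactness.
    obtain ⟨η, hη, hηx⟩ : ∃ η > 0, ∀ x, x ∉ (Subtype.val '' (F₂ ⁻¹' Metric.ball (c b) (r / 2)) :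
        Set X) → Φ x ≤ 1 - η := by
      rcases (Subtype.val '' (F₂ ⁻¹' Metric.ball (c b) (r / 2)) : Set X)ᶜ.eq_empty_or_nonempty
        with he | he
      · exact ⟨1, one_pos, fun x hx => absurd (he ▸ hx : x ∈ (∅ : Set X)) (Set.notMem_empty x)⟩
      · obtain ⟨m, hm, hmax⟩ := hN.isClosed_compl.isCompact.exists_isMaxOn he h.cont.continuousOn
        refine ⟨1 - Φ m, sub_pos.2 ((h.mem m).2.lt_of_ne fun h1 => hm (hsub m h1)), fun x hx => ?_⟩
        rw [sub_sub_cancel]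
        exact hmax hx
    refine ⟨η, hη, fun x hx => ?_⟩
    by_contra hc
    have := hηx x fun ⟨y, hy, hyx⟩ => hc ⟨c y, by
      change ((k (c.symm (c y)) : E) : X) = x
      rw [c.symm_apply_apply, hkid y hy, hyx]⟩
    linarith

end IsCollarFunction

/-! ### Shrinking one side of a collared curve to a point -/

/-- If `ψ` pushes `D` into itself, `T` is supported in `D` and the powers of `T ∘ ψ` shrink `D` to
the point `o`, then the maps `(T ∘ ψ)ⁿ ∘ ψ⁻ⁿ` stabilize off the intersection of the sets `ψⁿ(D)`, and
their limit shrinks this intersection to `o`. -/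
theorem exists_shrinking {X : Type*} [TopologicalSpace X] (ψ T : X ≃ₜ X) {D Ω : Set X} {o : X}
    (hψ : ∀ x ∈ D, ψ x ∈ D) (hT : ∀ x, x ∉ D → T x = x)
    (hΩ : ∀ x ∈ Ω, ∃ n, ∀ᶠ w in 𝓝 x, ψ.symm^[n] w ∉ D) (hψo : ψ o = o) (hTo : T o = o)
    (ho : o ∉ Ω) (hsh : ∀ O ∈ 𝓝 o, ∃ n, ∀ x ∈ D, (fun x => T (ψ x))^[n] x ∈ O) :
    ∃ H : X → X, (∀ x ∈ Ω, ContinuousAt H x) ∧ Set.InjOn H Ω ∧ (∀ x ∈ Ω, H x ≠ o) ∧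
      (∀ x, x ∉ D → H x = x) ∧ (∀ x ∈ Ω, x ∈ D → H x ∈ D) ∧
      ∀ O ∈ 𝓝 o, ∃ n, ∀ x ∈ Ω, ψ.symm^[n] x ∈ D → H x ∈ O := by
  classical
  set Θ : X → X := fun x => T (ψ x) with hΘ
  let K : ℕ → X → X := fun n x => Θ^[n] (ψ.symm^[n] x)
  have hΘc : Continuous Θ := T.continuous.comp ψ.continuous
  have hΘi : Function.Injective Θ := T.injective.comp ψ.injective
  have hKc : ∀ n, Continuous (K n) := fun n =>
    (hΘc.iterate n).comp (ψ.symm.continuous.iterate n)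
  have hKi : ∀ n, Function.Injective (K n) := fun n =>
    (hΘi.iterate n).comp (ψ.symm.injective.iterate n)
  -- The additional `ψ` and `ψ⁻¹` cancel around `T`, which fixes points off `D`.
  have hsucc : ∀ n x, ψ.symm^[n] x ∉ D → K (n + 1) x = K n x := by
    intro n x hx
    simp only [K]
    rw [Function.iterate_succ_apply, Function.iterate_succ_apply', hΘ]
    simp only [Homeomorph.apply_symm_apply]
    rw [hT _ hx]
  have hstep : ∀ x, x ∉ D → ψ.symm x ∉ D := fun x hx hx' => hx (by simpa using hψ _ hx')
  have hmono : ∀ n j x, ψ.symm^[n] x ∉ D → ψ.symm^[n + j] x ∉ D := by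
    intro n j x hx
    induction j with
    | zero => exact hx
    | succ j ih =>
      rw [← add_assoc, Function.iterate_succ_apply']
      exact hstep _ ih
  have hstab : ∀ n j x, ψ.symm^[n] x ∉ D → K (n + j) x = K n x := by
    intro n j x hx
    induction j with
    | zero => rfl
    | succ j ih => rw [← add_assoc, hsucc _ _ (hmono n j x hx), ih]
  have hstab' : ∀ m n x, ψ.symm^[n] x ∉ D → ψ.symm^[m] x ∉ D → K m x = K n x := by
    intro m n x hn hm
    rw [← hstab n m x hn, ← hstab m n x hm, add_comm]
  let H : X → X := fun x => if h : ∃ n, ψ.symm^[n] x ∉ D then K h.choose x else x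
  have hH : ∀ n x, ψ.symm^[n] x ∉ D → H x = K n x := by
    intro n x hx
    have h : ∃ n, ψ.symm^[n] x ∉ D := ⟨n, hx⟩
    simp only [H, dif_pos h]
    exact hstab' _ _ x hx h.choose_spec
  have hex : ∀ x ∈ Ω, ∃ n, ψ.symm^[n] x ∉ D := fun x hx => by
    obtain ⟨n, hn⟩ := hΩ x hx
    exact ⟨n, hn.self_of_nhds⟩
  have hKD' : ∀ n x, x ∉ D → K n x = x := fun n x hx => by
    have := hstab 0 n x hx
    rwa [zero_add] at this
  have hKD : ∀ n x, x ∈ D → K n x ∈ D := by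
    intro n x hx
    by_contra hc
    have := hKi n (hKD' n _ hc)
    rw [this] at hc
    exact hc hx
  have hΘo : ∀ n, K n o = o := by
    intro n
    have h1 : ψ.symm o = o := by rw [Homeomorph.symm_apply_eq, hψo]
    have h2 : Θ o = o := by rw [hΘ]; simp only [hψo, hTo]
    simp only [K]
    rw [Function.iterate_fixed h1, Function.iterate_fixed h2]
  refine ⟨H, fun x hx => ?_, fun x hx y hy hxy => ?_, fun x hx hxo => ?_, fun x hx => ?_,
    fun x hx hxD => ?_, fun O hO => ?_⟩
  · obtain ⟨n, hn⟩ := hΩ x hx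
    refine (hKc n).continuousAt.congr ?_
    filter_upwards [hn] with w hw
    exact (hH n w hw).symm
  · obtain ⟨n, hn⟩ := hex x hx
    obtain ⟨m, hm⟩ := hex y hy
    have hn' := hmono n m x hn
    have hm' := hmono m n y hm
    rw [add_comm] at hm'
    rw [hH _ x hn', hH _ y hm'] at hxy
    exact hKi _ hxy
  · obtain ⟨n, hn⟩ := hex x hx
    rw [hH n x hn, ← hΘo n] at hxo
    exact ho (hKi n hxo ▸ hx)
  · exact hH 0 x hx
  · obtain ⟨n, hn⟩ := hex x hx
    rw [hH n x hn]
    exact hKD n x hxD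
  · obtain ⟨n, hn⟩ := hsh O hO
    refine ⟨n, fun x hx hxD => ?_⟩
    obtain ⟨m, hm⟩ := hex x hx
    have hm' := hmono m n x hm
    rw [add_comm] at hm'
    rw [hH _ x hm']
    have : K (n + m) x = Θ^[n] (K m (ψ.symm^[n] x)) := by
      simp only [K]
      rw [Function.iterate_add_apply, add_comm n m, Function.iterate_add_apply]
    rw [this]
    exact hn _ (hKD m _ hxD)

/-- A piecewise linear homeomorphism: `[0, 1]` is contracted towards `1` by the factor `θ`, and
`[-1, 0]` is stretched to compensate. -/
theorem exists_push {θ : ℝ} (h0 : 0 < θ) (h1 : θ < 1) : ∃ σ : ℝ ≃ₜ ℝ,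
    (∀ s, 0 ≤ s → s ≤ 1 → σ s = 1 - θ * (1 - s)) ∧ ∀ s, s ∉ Set.Icc (-1 : ℝ) 1 → σ s = s := by
  have hm : 0 < 2 - θ := by linarith
  let ρ : ℝ → ℝ := fun s => min s (-1) + (2 - θ) * (min (max s (-1)) 0 + 1) +
    θ * min (max s 0) 1 + (max s 1 - 1)
  let ρ' : ℝ → ℝ := fun s => min s (-1) + (min (max s (-1)) (1 - θ) + 1) / (2 - θ) +
    (min (max s (1 - θ)) 1 - (1 - θ)) / θ + (max s 1 - 1)
  have a0 : ∀ s, s ≤ -1 → ρ s = s := fun s hs => by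
    simp only [ρ]
    rw [min_eq_left hs, max_eq_right hs, max_eq_right (hs.trans (by norm_num)),
      max_eq_right (hs.trans (by norm_num)), min_eq_left (by norm_num), min_eq_left (by norm_num)]
    ring
  have a1 : ∀ s, -1 ≤ s → s ≤ 0 → ρ s = -1 + (2 - θ) * (s + 1) := fun s hs hs' => by
    simp only [ρ]
    rw [min_eq_right hs, max_eq_left hs, max_eq_right hs',
      max_eq_right (hs'.trans (by norm_num)), min_eq_left hs', min_eq_left (by norm_num)]
    ring
  have a2 : ∀ s, 0 ≤ s → s ≤ 1 → ρ s = 1 - θ * (1 - s) := fun s hs hs' => by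
    simp only [ρ]
    rw [min_eq_right (by linarith), max_eq_left (by linarith), max_eq_left hs,
      max_eq_right hs', min_eq_right hs, min_eq_left hs']
    ring
  have a3 : ∀ s, 1 ≤ s → ρ s = s := fun s hs => by
    simp only [ρ]
    rw [min_eq_right (by linarith), max_eq_left (by linarith), max_eq_left (by linarith),
      max_eq_left hs, min_eq_right (by linarith), min_eq_right hs]
    ring
  have b0 : ∀ s, s ≤ -1 → ρ' s = s := fun s hs => by
    simp only [ρ']
    rw [min_eq_left hs, max_eq_right hs, max_eq_right (by linarith),
      max_eq_right (by linarith), min_eq_left (by linarith), min_eq_left (by linarith)]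
    simp
  have b1 : ∀ s, -1 ≤ s → s ≤ 1 - θ → ρ' s = -1 + (s + 1) / (2 - θ) := fun s hs hs' => by
    simp only [ρ']
    rw [min_eq_right hs, max_eq_left hs, max_eq_right hs',
      max_eq_right (by linarith), min_eq_left hs', min_eq_left (by linarith)]
    simp
  have b2 : ∀ s, 1 - θ ≤ s → s ≤ 1 → ρ' s = 1 - (1 - s) / θ := fun s hs hs' => by
    simp only [ρ']
    rw [min_eq_right (by linarith), max_eq_left (by linarith), max_eq_left hs,
      max_eq_right hs', min_eq_right hs, min_eq_left hs', show 1 - θ + 1 = 2 - θ by ring,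
      div_self hm.ne']
    field_simp
    ring
  have b3 : ∀ s, 1 ≤ s → ρ' s = s := fun s hs => by
    simp only [ρ']
    rw [min_eq_right (by linarith), max_eq_left (by linarith), max_eq_left (by linarith),
      max_eq_left hs, min_eq_right (by linarith), min_eq_right hs, show 1 - θ + 1 = 2 - θ by ring,
      div_self hm.ne', sub_sub_cancel, div_self h0.ne']
    ring
  have inv1 : ∀ s, ρ' (ρ s) = s := by
    intro s
    rcases le_total s (-1) with h | h
    · rw [a0 s h, b0 s h]
    rcases le_total s 0 with h' | h'
    · have e1 : 0 ≤ (2 - θ) * (s + 1) := mul_nonneg hm.le (by linarith)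
      have e2 : (2 - θ) * (s + 1) ≤ (2 - θ) * 1 := mul_le_mul_of_nonneg_left (by linarith) hm.le
      rw [a1 s h h', b1 _ (by linarith) (by linarith)]
      field_simp
      ring
    rcases le_total s 1 with h'' | h''
    · have e1 : 0 ≤ θ * (1 - s) := mul_nonneg h0.le (by linarith)
      have e2 : θ * (1 - s) ≤ θ * 1 := mul_le_mul_of_nonneg_left (by linarith) h0.le
      rw [a2 s h' h'', b2 _ (by linarith) (by linarith)]
      field_simp
      ring
    · rw [a3 s h'', b3 s h'']
  have inv2 : ∀ s, ρ (ρ' s) = s := by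
    intro s
    rcases le_total s (-1) with h | h
    · rw [b0 s h, a0 s h]
    rcases le_total s (1 - θ) with h' | h'
    · have e1 : 0 ≤ (s + 1) / (2 - θ) := div_nonneg (by linarith) hm.le
      have e2 : (s + 1) / (2 - θ) ≤ 1 := (div_le_one hm).2 (by linarith)
      rw [b1 s h h', a1 _ (by linarith) (by linarith)]
      field_simp
      ring
    rcases le_total s 1 with h'' | h''
    · have e1 : 0 ≤ (1 - s) / θ := div_nonneg (by linarith) h0.le
      have e2 : (1 - s) / θ ≤ 1 := (div_le_one h0).2 (by linarith)
      rw [b2 s h' h'', a2 _ (by linarith) (by linarith)]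
      field_simp
      ring
    · rw [b3 s h'', a3 s h'']
  have cρ : Continuous ρ := by fun_prop
  have cρ' : Continuous ρ' := by
    have := hm.ne'
    have := h0.ne'
    fun_prop (disch := assumption)
  refine ⟨⟨⟨ρ, ρ', inv1, inv2⟩, cρ, cρ'⟩, a2, fun s hs => ?_⟩
  rw [Set.mem_Icc, not_and_or, not_le, not_le] at hs
  rcases hs with hs | hs
  · exact a0 s hs.le
  · exact a3 s hs.le

namespace IsCollarFunction

variable {X : Type*} [TopologicalSpace X] [T2Space X] {f : Circle × ℝ → X} {Φ : X → ℝ}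

/-- The one-dimensional push is applied in the annulus fibrewise and extended by the identity; it
drives the half-collar towards the side `{Φ = 1}`. -/
theorem exists_push_homeomorph (h : IsCollarFunction f Φ) {θ : ℝ} (h0 : 0 < θ) (h1 : θ < 1) :
    ∃ ψ : X ≃ₜ X, (∀ z s, 0 ≤ s → s ≤ 1 → ψ (f (z, s)) = f (z, 1 - θ * (1 - s))) ∧
      (∀ x, Φ x = 1 → ψ x = x) ∧ ∀ x, 1 / 2 ≤ Φ x → 1 - Φ (ψ x) = θ * (1 - Φ x) := by
  obtain ⟨σ, hσ, hσ'⟩ := exists_push h0 h1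
  obtain ⟨ψ, hψ, hψ'⟩ := exists_homeomorph_extension h.emb ((Homeomorph.refl Circle).prodCongr σ)
    (K := Set.univ ×ˢ Set.Icc (-1) 1) (isCompact_univ.prod isCompact_Icc) (fun y hy => by
      refine Prod.ext rfl (hσ' _ fun h => hy ⟨trivial, h⟩))
  have e1 : ∀ z s, 0 ≤ s → s ≤ 1 → ψ (f (z, s)) = f (z, 1 - θ * (1 - s)) := by
    intro z s hs hs'
    rw [hψ]
    change f (z, σ s) = _
    rw [hσ s hs hs']
  have e2 : ∀ x, Φ x = 1 → ψ x = x := by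
    intro x hx
    by_cases hx' : x ∈ f '' (Set.univ ×ˢ Set.Icc (-1) 1)
    · obtain ⟨⟨z, s⟩, ⟨-, hs⟩, rfl⟩ := hx'
      have hs1 : s = 1 := by
        rw [h.apply, ramp_of_abs_le (abs_le.2 hs)] at hx
        linarith
      subst hs1
      rw [e1 z 1 zero_le_one le_rfl]
      simp
    · exact hψ' x hx'
  refine ⟨ψ, e1, e2, fun x hx => ?_⟩
  rcases (h.mem x).2.eq_or_lt with hx1 | hx1
  · rw [e2 x hx1, hx1]
    simp
  · have h2 := h.eq_apply (by linarith) hx1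
    have h3 : 0 ≤ θ * (1 - Φ x) := mul_nonneg h0.le (by linarith)
    have h4 : θ * (1 - Φ x) ≤ 1 * (1 - Φ x) := mul_le_mul_of_nonneg_right h1.le (by linarith)
    conv_lhs => rw [← h2]
    rw [e1 _ _ (by linarith) (by linarith), h.apply,
      ramp_of_abs_le (abs_le.2 ⟨by linarith, by linarith⟩)]
    ring

/-- In the open disk `k` a radial contraction about the preimage of `o` takes the compact set `{1 -
η/2 ≤ Φ}` into a ball on which `Φ = 1`, and shrinks that ball geometrically. The sets `B r` are the
images of closed balls. -/
theorem exists_contraction_homeomorph [CompactSpace X] (h : IsCollarFunction f Φ) {k : ℂ → X}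
    (hk : IsOpenEmbedding k) {η : ℝ} (hη : ∀ x, 1 - η < Φ x → x ∈ Set.range k) (hη0 : 0 < η) {o : X}
    (ho : ∀ᶠ x in 𝓝 o, Φ x = 1) :
    ∃ (T : X ≃ₜ X) (B : ℝ → Set X) (ε q : ℝ), 0 < ε ∧ 0 < q ∧ q < 1 ∧
      (∀ x, x ∉ Set.range k → T x = x) ∧ T o = o ∧
      (∀ O ∈ 𝓝 o, ∃ δ > 0, ∀ r < δ, B r ⊆ O) ∧ (∀ x ∈ B ε, Φ x = 1) ∧
      (∀ r, ∀ x ∈ B r, r ≤ ε → T x ∈ B (q * r)) ∧ (∀ r, r ≤ ε → B r ⊆ B ε) ∧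
      ∀ x, 1 - η / 2 ≤ Φ x → T x ∈ B ε := by
  have ho1 : Φ o = 1 := ho.self_of_nhds
  obtain ⟨y, hy⟩ := hη o (by rw [ho1]; linarith)
  have hnear : ∀ O ∈ 𝓝 o, ∃ δ > 0, ∀ w, dist w y < δ → k w ∈ O := by
    intro O hO
    rw [← hy] at hO
    exact Metric.mem_nhds_iff.1 (hk.continuous.continuousAt.preimage_mem_nhds hO)
  obtain ⟨δ, hδ, hδΦ⟩ := hnear _ ho
  have hcomp : IsCompact (k ⁻¹' {x | 1 - η / 2 ≤ Φ x}) := by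
    refine hk.isInducing.isCompact_preimage_iff ?_ |>.2
      (isClosed_le continuous_const h.cont).isCompact
    intro x hx
    have : 1 - η / 2 ≤ Φ x := hx
    exact hη x (by linarith)
  obtain ⟨R₀, hR₀⟩ := hcomp.isBounded.subset_closedBall y
  set ε := δ / 2
  set R := max R₀ (ε + 1)
  have hε : 0 < ε := half_pos hδ
  have hεR : ε < R := (lt_add_one ε).trans_le (le_max_right _ _)
  have hR : 0 < R := hε.trans hεR
  obtain ⟨T₀, hT₀, hT₀'⟩ := exists_contraction hε hεR
  let φ : ℂ ≃ₜ ℂ := ((Homeomorph.subRight y).trans T₀).trans (Homeomorph.addRight y)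
  have hφ : ∀ w, φ w = T₀ (w - y) + y := fun w => rfl
  have hφd : ∀ w, dist w y ≤ R → dist (φ w) y = ε / R * dist w y := by
    intro w hw
    rw [dist_eq_norm] at hw
    rw [dist_eq_norm, dist_eq_norm, hφ, hT₀ _ hw, add_sub_cancel_right, norm_mul,
      Complex.norm_real, Real.norm_of_nonneg (by positivity)]
  obtain ⟨T, hT, hT'⟩ := exists_homeomorph_extension hk φ (isCompact_closedBall y (R + 1))
    (fun w hw => by
      rw [Metric.mem_closedBall, not_le, dist_eq_norm] at hw
      rw [hφ, hT₀' _ hw.le, sub_add_cancel])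
  refine ⟨T, fun r => k '' Metric.closedBall y r, ε, ε / R, hε, by positivity,
    (div_lt_one hR).2 hεR, fun x hx => hT' x fun hx' => hx (Set.image_subset_range _ _ hx'), ?_,
    fun O hO => ?_, ?_, ?_, fun r hr => Set.image_mono (Metric.closedBall_subset_closedBall hr),
    fun x hx => ?_⟩
  · rw [← hy, hT]
    congr 1
    have := hφd y (by rw [dist_self]; exact hR.le)
    rwa [dist_self, mul_zero, dist_eq_zero] at this
  · obtain ⟨δ', hδ', hO'⟩ := hnear O hO
    refine ⟨δ', hδ', fun r hr => ?_⟩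
    rintro _ ⟨w, hw, rfl⟩
    exact hO' w ((Metric.mem_closedBall.1 hw).trans_lt hr)
  · rintro _ ⟨w, hw, rfl⟩
    exact hδΦ w ((Metric.mem_closedBall.1 hw).trans_lt (half_lt_self hδ))
  · rintro r _ ⟨w, hw, rfl⟩ hr
    have hw := Metric.mem_closedBall.1 hw
    rw [hT]
    refine ⟨φ w, Metric.mem_closedBall.2 ?_, rfl⟩
    rw [hφd w (by linarith)]
    exact mul_le_mul_of_nonneg_left hw (by positivity)
  · obtain ⟨w, rfl⟩ := hη x (by linarith)
    have hw := (Metric.mem_closedBall.1 (hR₀ hx)).trans (le_max_left R₀ (ε + 1))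
    rw [hT]
    refine ⟨φ w, Metric.mem_closedBall.2 ?_, rfl⟩
    rw [hφd w hw, div_mul_eq_mul_div, div_le_iff₀ hR]
    exact mul_le_mul_of_nonneg_left hw hε.le

/-- The Schoenflies theorem for a collared curve, on the side `{1 / 2 ≤ Φ}`: it is the image of a
disk, whose centre may be prescribed. -/
theorem exists_disk [CompactSpace X] (h : IsCollarFunction f Φ)
    (c : {x : X // x ≠ f (1, 0)} ≃ₜ ℂ) {o : X} (ho : ∀ᶠ x in 𝓝 o, Φ x = 1) :
    ∃ d : {z : ℂ // ‖z‖ ≤ 1} → X, IsEmbedding d ∧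
      d '' {z | ‖(z : ℂ)‖ = 1} = f '' (Set.univ ×ˢ {0}) ∧ d ⟨0, by simp⟩ = o ∧
      ∀ z, 1 / 2 ≤ Φ (d z) := by
  classical
  have ho1 : Φ o = 1 := ho.self_of_nhds
  obtain ⟨k, hk, hkΦ, η, hη, hkη⟩ := h.exists_disk_nhd c ⟨o, ho1⟩
  obtain ⟨T, B, ε, q, hε, hq, hq1, hTk, hTo, hB, hBΦ, hTB, hBε, hTη⟩ :=
    h.exists_contraction_homeomorph hk hkη hη ho
  set θ := min (1 / 2) η with hθ
  have hθ0 : 0 < θ := lt_min (by norm_num) hη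
  have hθ1 : θ < 1 := (min_le_left _ _).trans_lt (by norm_num)
  have hθη : θ ≤ η := min_le_right _ _
  obtain ⟨ψ, hψ, hψ1, hψΦ⟩ := h.exists_push_homeomorph hθ0 hθ1
  have hit : ∀ n x, 1 / 2 ≤ Φ x → 1 - Φ (ψ^[n] x) = θ ^ n * (1 - Φ x) := by
    intro n x hx
    induction n with
    | zero => simp
    | succ n ih =>
      have h1 : θ ^ n * (1 - Φ x) ≤ 1 * (1 - Φ x) :=
        mul_le_mul_of_nonneg_right (pow_le_one₀ hθ0.le hθ1.le) (by linarith [(h.mem x).2])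
      rw [Function.iterate_succ_apply', hψΦ _ (by linarith), ih, pow_succ]
      ring
  have hinv : ∀ n x, ψ^[n] (ψ.symm^[n] x) = x := fun n =>
    Function.LeftInverse.iterate ψ.apply_symm_apply n
  have hpow : ∀ δ > 0, ∃ n, θ ^ n < δ := fun δ hδ => exists_pow_lt_of_lt_one hδ hθ1
  -- One application of `T ∘ ψ` takes `{3/4 < Φ}` into the ball `B ε`. There `ψ` is the identity, so
  -- further applications contract by the factor `q` towards `o`.
  obtain ⟨H, hHc, hHi, hHo, hHD, hHD', hHO⟩ := exists_shrinking ψ T (D := {x | 3 / 4 < Φ x})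
    (Ω := {x | Φ x < 1}) (o := o)
    (fun x hx => by
      have hx : 3 / 4 < Φ x := hx
      have h1 := hψΦ x (by linarith)
      have h2 : θ * (1 - Φ x) ≤ 1 * (1 - Φ x) :=
        mul_le_mul_of_nonneg_right hθ1.le (by linarith [(h.mem x).2])
      change 3 / 4 < Φ (ψ x)
      linarith)
    (fun x hx => hTk x fun ⟨y, hy⟩ => hx (hy ▸ hkΦ y))
    (fun x hx => by
      have hx : Φ x < 1 := hx
      obtain ⟨n, hn⟩ := hpow (1 - Φ x) (by linarith)
      have hlt : Φ (ψ.symm^[n] x) < 3 / 4 := by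
        by_contra! hc
        have h1 := hit n _ (by linarith : 1 / 2 ≤ Φ (ψ.symm^[n] x))
        rw [hinv] at h1
        have h2 : θ ^ n * (1 - Φ (ψ.symm^[n] x)) ≤ θ ^ n * 1 :=
          mul_le_mul_of_nonneg_left (by linarith) (by positivity)
        linarith
      refine ⟨n, ?_⟩
      have hc : Continuous fun w => Φ (ψ.symm^[n] w) :=
        h.cont.comp (ψ.symm.continuous.iterate n)
      filter_upwards [hc.continuousAt.eventually (gt_mem_nhds hlt)] with w hw hw'
      exact absurd hw (not_lt.2 (le_of_lt hw')))
    (hψ1 o ho1) hTo (by simp [ho1])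
    (fun O hO => by
      obtain ⟨δ, hδ, hδO⟩ := hB O hO
      obtain ⟨n, hn⟩ := exists_pow_lt_of_lt_one (y := q) (div_pos hδ hε) hq1
      have hstep : ∀ n x, 3 / 4 < Φ x → (fun x => T (ψ x))^[n + 1] x ∈ B (q ^ n * ε) := by
        intro n x hx
        induction n with
        | zero =>
          rw [pow_zero, one_mul]
          refine hTη _ ?_
          have h1 := hψΦ x (by linarith)
          have h2 : θ * (1 - Φ x) ≤ θ * (1 / 2) :=
            mul_le_mul_of_nonneg_left (by linarith) hθ0.le
          linarith
        | succ n ih =>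
          have hle : q ^ n * ε ≤ ε := by
            have := mul_le_mul_of_nonneg_right (pow_le_one₀ hq.le hq1.le (n := n)) hε.le
            linarith
          rw [Function.iterate_succ_apply']
          have h1 := hψ1 _ (hBΦ _ (hBε _ hle ih))
          simp only [h1]
          have h2 := hTB _ _ ih hle
          rwa [← mul_assoc, ← pow_succ'] at h2
      refine ⟨n + 1, fun x hx => hδO _ ?_ (hstep n x hx)⟩
      rwa [lt_div_iff₀ hε] at hn)
  -- Polar coordinates: the core is the unit circle, and the side `{Φ = 1}` is approached as `w`
  -- tends to `0`. The limit map `H` shrinks that side to `o`, which closes the disk.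
  let e : ℂ → X := fun w => f (circleDir w, 1 - ‖w‖)
  have hΦe : ∀ w, ‖w‖ ≤ 1 → Φ (e w) = 1 - ‖w‖ / 2 := by
    intro w hw
    have := norm_nonneg w
    simp only [e]
    rw [h.apply, ramp_of_abs_le (abs_le.2 ⟨by linarith, by linarith⟩)]
    ring
  have hΩ : ∀ w, ‖w‖ ≤ 1 → w ≠ 0 → e w ∈ {x | Φ x < 1} := by
    intro w hw hw0
    change Φ (e w) < 1
    rw [hΦe w hw]
    linarith [norm_pos_iff.2 hw0]
  have hec : ∀ w, w ≠ 0 → ContinuousAt e w := by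
    intro w hw
    exact h.emb.continuous.continuousAt.comp
      (ContinuousAt.prodMk (continuousAt_circleDir hw) (by fun_prop))
  have hei : ∀ w w', e w = e w' → w = w' := by
    intro w w' hww
    have h1 := h.emb.injective hww
    have h2 : ‖w‖ = ‖w'‖ := by linarith [congrArg Prod.snd h1]
    rw [← norm_mul_circleDir w, ← norm_mul_circleDir w', h2]
    congr 2
    exact congrArg Prod.fst h1
  -- In these coordinates `ψ⁻ⁿ` magnifies small disks by `θ⁻ⁿ`, which turns small norms into
  -- membership in the set that `H` maps close to `o`.
  have hsymm : ∀ n w, ‖w‖ ≤ θ ^ n → ψ.symm^[n] (e w) = f (circleDir w, 1 - ‖w‖ / θ ^ n) := by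
    intro n w hw
    induction n with
    | zero => simp [e]
    | succ n ih =>
      have hle : ‖w‖ ≤ θ ^ n := hw.trans (pow_le_pow_of_le_one hθ0.le hθ1.le n.le_succ)
      have h1 : ‖w‖ / θ ^ (n + 1) ≤ 1 := (div_le_one (by positivity)).2 hw
      have h2 : 0 ≤ ‖w‖ / θ ^ (n + 1) := by positivity
      rw [Function.iterate_succ_apply', ih hle, Homeomorph.symm_apply_eq,
        hψ _ _ (by linarith) (by linarith)]
      congr 2
      rw [pow_succ]
      field_simp
      ring
  let d : ℂ → X := fun w => if w = 0 then o else H (e w)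
  have d0 : d 0 = o := if_pos rfl
  have d1 : ∀ w, w ≠ 0 → d w = H (e w) := fun w hw => if_neg hw
  have hdc : ∀ z : {z : ℂ // ‖z‖ ≤ 1}, ContinuousAt (fun z : {z : ℂ // ‖z‖ ≤ 1} => d z) z := by
    intro z
    by_cases hz : (z : ℂ) = 0
    · rw [ContinuousAt, hz, d0, Filter.tendsto_def]
      intro O hO
      obtain ⟨n, hn⟩ := hHO O hO
      have h1 : ∀ᶠ w : {z : ℂ // ‖z‖ ≤ 1} in 𝓝 z, ‖(w : ℂ)‖ < θ ^ n / 2 := by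
        have h2 : Continuous fun w : {z : ℂ // ‖z‖ ≤ 1} => ‖(w : ℂ)‖ := by fun_prop
        refine h2.continuousAt.eventually (gt_mem_nhds ?_)
        change ‖(z : ℂ)‖ < _
        rw [hz, norm_zero]
        positivity
      filter_upwards [h1] with w hw
      by_cases hw0 : (w : ℂ) = 0
      · rw [Set.mem_preimage, hw0, d0]
        exact mem_of_mem_nhds hO
      · rw [Set.mem_preimage, d1 _ hw0]
        refine hn _ (hΩ _ w.2 hw0) ?_
        have hp : 0 < θ ^ n := by positivity
        have h3 : ‖(w : ℂ)‖ / θ ^ n < 1 / 2 := by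
          rw [div_lt_iff₀ hp]
          linarith
        have h4 : 0 ≤ ‖(w : ℂ)‖ / θ ^ n := by positivity
        rw [hsymm n _ (by linarith)]
        change 3 / 4 < Φ (f _)
        rw [h.apply, ramp_of_abs_le (abs_le.2 ⟨by linarith, by linarith⟩)]
        linarith
    · have h1 : ContinuousAt (fun w => H (e w)) (z : ℂ) :=
        ContinuousAt.comp (f := e) (hHc _ (hΩ _ z.2 hz)) (hec _ hz)
      have h2 : ContinuousAt d (z : ℂ) := by
        refine h1.congr ?_
        filter_upwards [isOpen_ne.mem_nhds hz] with w hw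
        exact (d1 w hw).symm
      exact ContinuousAt.comp (f := Subtype.val) h2 continuousAt_subtype_val
  have hdi : Function.Injective fun z : {z : ℂ // ‖z‖ ≤ 1} => d z := by
    intro z w hzw
    apply Subtype.ext
    simp only at hzw
    by_cases hz : (z : ℂ) = 0
    · by_cases hw : (w : ℂ) = 0
      · rw [hz, hw]
      · rw [hz, d0, d1 _ hw] at hzw
        exact absurd hzw.symm (hHo _ (hΩ _ w.2 hw))
    · by_cases hw : (w : ℂ) = 0
      · rw [hw, d0, d1 _ hz] at hzw
        exact absurd hzw (hHo _ (hΩ _ z.2 hz))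
      · rw [d1 _ hz, d1 _ hw] at hzw
        exact hei _ _ (hHi (hΩ _ z.2 hz) (hΩ _ w.2 hw) hzw)
  have : CompactSpace {z : ℂ // ‖z‖ ≤ 1} := by
    have h1 : {z : ℂ | ‖z‖ ≤ 1} = Metric.closedBall 0 1 := by ext; simp
    have h2 : IsCompact {z : ℂ | ‖z‖ ≤ 1} := h1 ▸ isCompact_closedBall (0 : ℂ) 1
    exact isCompact_iff_compactSpace.1 h2
  have hdb : ∀ w : ℂ, ‖w‖ = 1 → d w = f (circleDir w, 0) := by
    intro w hw
    have hw0 : w ≠ 0 := by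
      rintro rfl
      simp at hw
    rw [d1 w hw0, hHD]
    · simp only [e]
      rw [hw, sub_self]
    · change ¬ 3 / 4 < Φ (e w)
      rw [hΦe w hw.le, hw]
      norm_num
  refine ⟨fun z => d z, ((continuous_iff_continuousAt.2 hdc).isClosedEmbedding hdi).isEmbedding,
    ?_, d0, fun z => ?_⟩
  · ext x
    constructor
    · rintro ⟨z, hz, rfl⟩
      exact ⟨(circleDir z, 0), by simp, (hdb z hz).symm⟩
    · rintro ⟨⟨z, s⟩, ⟨-, rfl⟩, rfl⟩
      refine ⟨⟨z, z.norm_coe.le⟩, z.norm_coe, ?_⟩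
      change d z = _
      rw [hdb _ z.norm_coe]
      congr 2
      have := circleDir_mul one_pos z
      rwa [Complex.ofReal_one, one_mul] at this
  · by_cases hz : (z : ℂ) = 0
    · change 1 / 2 ≤ Φ (d z)
      rw [hz, d0, ho1]
      norm_num
    · change 1 / 2 ≤ Φ (d z)
      rw [d1 _ hz]
      have hΦz := hΦe _ z.2
      by_cases hD : e z ∈ {x | 3 / 4 < Φ x}
      · have : 3 / 4 < Φ (H (e z)) := hHD' _ (hΩ _ z.2 hz) hD
        linarith
      · rw [hHD _ hD, hΦz]
        linarith [z.2]

end IsCollarFunction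

/-! ### Collar functions on the quotient of the plane -/

theorem ramp_neg (s : ℝ) : ramp (-s) = 1 - ramp s := by
  rcases le_total 1 s with h | h
  · rw [ramp_of_one_le h, ramp_of_le_neg_one (by linarith)]
    ring
  rcases le_total s (-1) with h' | h'
  · rw [ramp_of_le_neg_one h', ramp_of_one_le (by linarith)]
    ring
  · rw [ramp_of_abs_le (abs_le.2 ⟨h', h⟩), ramp_of_abs_le (abs_le.2 ⟨by linarith, by linarith⟩)]
    ring

namespace IsCollarFunction

variable {X : Type*} [TopologicalSpace X] {f : Circle × ℝ → X} {Φ : X → ℝ}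

theorem reverse (h : IsCollarFunction f Φ) :
    IsCollarFunction (fun y => f (y.1, -y.2)) (fun x => 1 - Φ x) where
  emb := h.emb.comp ((Homeomorph.refl Circle).prodCongr (Homeomorph.neg ℝ)).isOpenEmbedding
  cont := continuous_const.sub h.cont
  mem x := ⟨by linarith [(h.mem x).2], by linarith [(h.mem x).1]⟩
  apply z s := by rw [h.apply, ramp_neg]; ring
  exists_eq x h0 h1 := by
    obtain ⟨z, s, hs, rfl⟩ := h.exists_eq x (by linarith) (by linarith)
    exact ⟨z, -s, by rwa [abs_neg], by rw [neg_neg]⟩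

/-- Away from the annulus the function is locally constant. -/
theorem eventually_eq_one [T2Space X] (h : IsCollarFunction f Φ) {x : X} (hx : x ∉ Set.range f)
    (h1 : Φ x = 1) : ∀ᶠ w in 𝓝 x, Φ w = 1 := by
  have hK : IsCompact (f '' (Set.univ ×ˢ Set.Icc (-1) 1)) :=
    (isCompact_univ.prod isCompact_Icc).image h.emb.continuous
  filter_upwards [hK.isClosed.isOpen_compl.mem_nhds
    fun hx' => hx (Set.image_subset_range _ _ hx'),
    h.cont.continuousAt.eventually (lt_mem_nhds (by rw [h1]; exact one_pos))] with w hw hw0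
  by_contra hc
  obtain ⟨z, s, hs, rfl⟩ := h.exists_eq w hw0 ((h.mem w).2.lt_of_ne hc)
  exact hw ⟨(z, s), ⟨trivial, abs_le.1 hs.le⟩, rfl⟩

end IsCollarFunction

/-- The circle-valued collar function lifts to an even function on the plane; evenness makes its
periods opposite to themselves, so it descends to the quotient as a real function. Off the annulus
it is integral. Values other than `0` and `1` there are excluded by connectedness: on the way from
`1/2` it would take the value `-1/2` or `3/2`, which is neither integral nor a value of `ramp`. -/
theorem IsPillowMap.exists_collarFunction {X : Type*} [TopologicalSpace X] [T2Space X]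
    {p : ℝ × ℝ → X} (hp : IsPillowMap p) {f : Circle × ℝ → X} (hf : IsOpenEmbedding f) :
    ∃ Φ, IsCollarFunction f Φ := by
  have hF := IsCollar.of_isOpenEmbedding hf
  set F : ℝ × ℝ → X := fun y => f (circlePar y.1, y.2) with hFdef
  have hclosed : IsClosed (F '' {y | |y.2| ≤ 1}) := by
    have h1 : F '' {y | |y.2| ≤ 1} = f '' (Set.univ ×ˢ Set.Icc (-1) 1) := by
      ext x
      constructor
      · rintro ⟨y, hy, rfl⟩
        exact ⟨_, ⟨trivial, abs_le.1 (show |y.2| ≤ 1 from hy)⟩, rfl⟩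
      · rintro ⟨⟨z, s⟩, ⟨-, hs⟩, rfl⟩
        obtain ⟨t, rfl⟩ := circlePar_surjective z
        exact ⟨(t, s), abs_le.2 hs, rfl⟩
    rw [h1]
    exact ((isCompact_univ.prod isCompact_Icc).image hf.continuous).isClosed
  obtain ⟨c, hc, hcF, hc0⟩ := exists_collar_function hF.isOpenMap
    (fun y y' h => (hF.inj _ _ _ _ h).1.symm) hclosed
  obtain ⟨G, u, hG, hGc, hGu⟩ := exists_equivariant_lift (hc.comp hp.cont)
    (fun x n => congrArg c (hp.periodic x n))
  have heven : ∀ x, G (-x) = G x := by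
    obtain ⟨k, hk⟩ := exists_const_of_int_valued (f := fun x => G (-x) - G x) (by fun_prop)
      (fun x => by
        have h1 : (G x : UnitAddCircle) = G (-x) := by
          rw [hGc, hGc, Function.comp_apply, Function.comp_apply, hp.even]
        obtain ⟨k, hk⟩ := coe_eq_coe_unitAddCircle.1 h1
        exact ⟨k, by rw [hk]; ring⟩)
    intro x
    have h0 := hk 0
    simp only [neg_zero, sub_self] at h0
    have := hk x
    rw [← h0] at this
    linarith
  have hper : ∀ x n, G (x + latticePt n) = G x := by
    intro x n
    have h1 := hGu x n
    have h2 := hGu (-x - latticePt n) n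
    rw [sub_add_cancel, heven, show -x - latticePt n = -(x + latticePt n) by abel, heven] at h2
    linarith
  have hfib : ∀ x y, p x = p y → G x = G y := by
    intro x y hxy
    obtain ⟨n, rfl | rfl⟩ := (hp.eq_iff x y).1 hxy
    · rw [hper]
    · rw [hper, heven]
  choose r hr using hp.surj
  have hr' : ∀ x, G (r (p x)) = G x := fun x => hfib _ _ (hr _)
  obtain ⟨-, -, -, hq⟩ := hp.isQuotientMap
  have hΨ : Continuous fun x => G (r x) := by
    rw [hq.continuous_iff]
    exact hG.congr fun x => (hr' x).symm
  have hΨc : ∀ x, (G (r x) : UnitAddCircle) = c x := fun x => by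
    rw [hGc, Function.comp_apply, hr]
  have hFc := hF.cont
  have hrc := continuous_ramp
  obtain ⟨k, hk⟩ := exists_const_of_int_valued (f := fun y => G (r (F y)) - ramp y.2)
    ((hΨ.comp hFc).sub (hrc.comp continuous_snd)) (fun y => by
      obtain ⟨k, hk⟩ := coe_eq_coe_unitAddCircle.1 ((hΨc (F y)).trans (hcF y))
      exact ⟨-k, by rw [hk]; push_cast; ring⟩)
  let Φ : X → ℝ := fun x => G (r x) - k
  have hΦ : Continuous Φ := hΨ.sub continuous_const
  have hΦF : ∀ y, Φ (F y) = ramp y.2 := fun y => by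
    have := hk y
    simp only [Φ]
    linarith
  have hΦ0 : ∀ x, x ∉ F '' {y | |y.2| < 1} → ∃ j : ℤ, Φ x = j := by
    intro x hx
    obtain ⟨j, hj⟩ := coe_unitAddCircle_eq_zero.1 ((hΨc x).trans (hc0 x hx))
    exact ⟨j - k, by simp only [Φ]; rw [hj]; push_cast; rfl⟩
  have : ConnectedSpace X := hp.surj.connectedSpace hp.cont
  have hex : ∀ x, (∀ j : ℤ, Φ x ≠ j) → ∃ z s, |s| < 1 ∧ f (z, s) = x := by
    intro x hx
    by_contra hc
    obtain ⟨j, hj⟩ := hΦ0 x (by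
      rintro ⟨y, hy, rfl⟩
      exact hc ⟨_, _, hy, rfl⟩)
    exact hx j hj
  have hΦf : ∀ z s, Φ (f (z, s)) = ramp s := by
    intro z s
    obtain ⟨t, rfl⟩ := circlePar_surjective z
    exact hΦF (t, s)
  have hnot : ∀ x (m : ℤ), Φ x = m + 1 / 2 → m = 0 := by
    intro x m hm
    obtain ⟨z, s, hs, rfl⟩ := hex x fun j hj => by
      have h2 : (2 * j : ℝ) = 2 * m + 1 := by linarith
      have h3 : 2 * j = 2 * m + 1 := by exact_mod_cast h2
      omega
    rw [hΦf] at hm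
    have h1 := ramp_mem s
    have e1 : (m : ℝ) < 1 := by linarith
    have e2 : (-1 : ℝ) < m := by linarith
    have e1 : m < 1 := by exact_mod_cast e1
    have e2 : -1 < m := by exact_mod_cast e2
    omega
  have hhalf : Φ (F (0, 0)) = 1 / 2 := by
    rw [hΦF, ramp_of_abs_le (by simp)]
    norm_num
  have hint : ∀ x, (Φ x < 0 ∨ 1 < Φ x) → ∃ j : ℤ, Φ x = j := by
    intro x hx
    by_contra! hc
    obtain ⟨z, s, hs, rfl⟩ := hex x hc
    rw [hΦf] at hx
    have := ramp_mem s
    rcases hx with h | h <;> linarith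
  refine ⟨Φ, hf, hΦ, fun x => ⟨?_, ?_⟩, hΦf, fun x h0 h1 => hex x fun j hj => ?_⟩
  · by_contra! h
    obtain ⟨j, hj⟩ := hint x (Or.inl h)
    have : j < 0 := by exact_mod_cast hj ▸ h
    have : (j : ℝ) ≤ -1 := by exact_mod_cast (by omega : j ≤ -1)
    obtain ⟨w, hw⟩ := intermediate_value_univ x (F (0, 0)) hΦ
      (show (((-1 : ℤ) : ℝ) + 1 / 2) ∈ Set.Icc (Φ x) (Φ (F (0, 0))) from
        ⟨by push_cast; linarith, by push_cast; linarith⟩)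
    have := hnot w (-1) hw
    omega
  · by_contra! h
    obtain ⟨j, hj⟩ := hint x (Or.inr h)
    have : 1 < j := by exact_mod_cast hj ▸ h
    have : (2 : ℝ) ≤ j := by exact_mod_cast (by omega : 2 ≤ j)
    obtain ⟨w, hw⟩ := intermediate_value_univ (F (0, 0)) x hΦ
      (show (((1 : ℤ) : ℝ) + 1 / 2) ∈ Set.Icc (Φ (F (0, 0))) (Φ x) from
        ⟨by push_cast; linarith, by push_cast; linarith⟩)
    have := hnot w 1 hw
    omega
  · rw [hj] at h0 h1
    have h0 : 0 < j := by exact_mod_cast h0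
    have h1 : j < 1 := by exact_mod_cast h1
    omega

/-! ### The punctures on the two sides of an essential curve -/

/-- Punctures lie off the annulus, where `Φ` takes only the values `0` and `1`. -/
theorem IsCollarFunction.eq_one_of_notMem_range {S X : Type*} [TopologicalSpace X] {ι : S → X}
    {f : Circle × ℝ → S} {Φ : X → ℝ} (h : IsCollarFunction (ι ∘ f) Φ) {x : X}
    (hx : x ∉ Set.range ι) (h2 : 1 / 2 ≤ Φ x) : Φ x = 1 := by
  by_contra hc
  obtain ⟨z, s, -, rfl⟩ := h.exists_eq x (by linarith) ((h.mem x).2.lt_of_ne hc)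
  exact hx ⟨_, rfl⟩

/-- An essential curve has two punctures on each of its sides. -/
theorem exists_two_punctures {S : Type*} [TopologicalSpace S] {ι : S → unitSphere}
    {f : Circle × ℝ → S} {Φ : unitSphere → ℝ} (hι : IsEmbedding ι) (h : IsCollarFunction (ι ∘ f) Φ)
    (he : IsEssentialCurve (f '' (Set.univ ×ˢ {0}))) :
    ∃ P Q, P ∉ Set.range ι ∧ Q ∉ Set.range ι ∧ P ≠ Q ∧ Φ P = 1 ∧ Φ Q = 1 := by
  by_contra hcon
  obtain ⟨c₀⟩ := exists_homeomorph_compl_point ((ι ∘ f) (1, 0))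
  let c := c₀.trans Complex.equivRealProdCLM.symm.toHomeomorph
  have himg : ∀ {B : Type} (d : B → S) (A : Set B), (ι ∘ d) '' A = (ι ∘ f) '' (Set.univ ×ˢ {0}) →
      d '' A = f '' (Set.univ ×ˢ {0}) := by
    intro B d A hA
    rw [Set.image_comp, Set.image_comp] at hA
    exact hι.injective.image_injective hA
  -- If there is one puncture, the Schoenflies disk is centred at it and becomes a punctured disk in
  -- the surface. If there is none, any centre gives a disk in the surface.
  by_cases hP : ∃ P, P ∉ Set.range ι ∧ Φ P = 1
  · obtain ⟨P, hPι, hP1⟩ := hP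
    obtain ⟨d, hd, hdb, hd0, hdΦ⟩ := h.exists_disk c
      (h.eventually_eq_one (fun ⟨y, hy⟩ => hPι ⟨_, hy⟩) hP1)
    have hdι : ∀ z, d z ≠ P → d z ∈ Set.range ι := by
      intro z hz
      by_contra hc
      exact hcon ⟨P, d z, hPι, hc, hz.symm, hP1, h.eq_one_of_notMem_range hc (hdΦ z)⟩
    let j : {z : ℂ // 0 < ‖z‖ ∧ ‖z‖ ≤ 1} → {z : ℂ // ‖z‖ ≤ 1} := fun z => ⟨z, z.2.2⟩
    have hj : IsEmbedding j := by
      refine IsEmbedding.of_comp (g := Subtype.val) (by fun_prop) continuous_subtype_val ?_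
      exact IsEmbedding.subtypeVal
    have hjP : ∀ z, d (j z) ≠ P := by
      intro z hz
      rw [← hd0] at hz
      have := congrArg Subtype.val (hd.injective hz)
      have h1 : (z : ℂ) = 0 := this
      have h2 := z.2.1
      rw [h1, norm_zero] at h2
      exact lt_irrefl _ h2
    choose d' hd' using fun z => hdι (j z) (hjP z)
    have hcomp : ι ∘ d' = d ∘ j := funext hd'
    have hιd : IsEmbedding (ι ∘ d') := hcomp ▸ hd.comp hj
    have hd'e : IsEmbedding d' := by
      have hc : Continuous d' := hι.continuous_iff.2 hιd.continuous
      exact IsEmbedding.of_comp hc hι.continuous hιd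
    refine he.not_boundsPuncturedDisk ⟨d', ⟨hd'e, ?_⟩, himg _ _ ?_⟩
    · have hcompact : CompactSpace {z : ℂ // ‖z‖ ≤ 1} := by
        have h1 : {z : ℂ | ‖z‖ ≤ 1} = Metric.closedBall 0 1 := by ext; simp
        have h2 : IsCompact {z : ℂ | ‖z‖ ≤ 1} := h1 ▸ isCompact_closedBall (0 : ℂ) 1
        exact isCompact_iff_compactSpace.1 h2
      have h1 : Set.range d' = ι ⁻¹' Set.range d := by
        ext s
        constructor
        · rintro ⟨z, rfl⟩
          exact ⟨j z, (hd' z).symm⟩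
        · rintro ⟨z, hz⟩
          have hz0 : 0 < ‖(z : ℂ)‖ := by
            refine norm_pos_iff.2 fun h0 => hPι ⟨s, ?_⟩
            rw [← hz, ← hd0]
            exact congrArg d (Subtype.ext h0)
          refine ⟨⟨z, hz0, z.2⟩, hι.injective ?_⟩
          rw [hd', ← hz]
      rw [h1]
      exact (isCompact_range hd.continuous).isClosed.preimage hι.continuous
    · rw [hcomp, ← hdb]
      ext x
      constructor
      · rintro ⟨z, hz, rfl⟩
        exact ⟨j z, hz, rfl⟩
      · rintro ⟨z, hz, rfl⟩
        have hz : ‖(z : ℂ)‖ = 1 := hz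
        exact ⟨⟨z, by rw [hz]; exact one_pos, z.2⟩, hz, rfl⟩
  · have ho : ∀ᶠ x in 𝓝 ((ι ∘ f) (1, 2)), Φ x = 1 := by
      refine Filter.mem_of_superset (h.emb.isOpenMap.image_mem_nhds
        ((isOpen_lt continuous_const continuous_snd).mem_nhds
          (show ((1 : Circle), (2 : ℝ)) ∈ {y : Circle × ℝ | 1 < y.2} by
            change (1 : ℝ) < 2; norm_num))) ?_
      rintro _ ⟨⟨z, s⟩, hs, rfl⟩
      have hs : 1 < s := hs
      change Φ ((ι ∘ f) (z, s)) = 1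
      rw [h.apply, ramp_of_one_le hs.le]
    obtain ⟨d, hd, hdb, -, hdΦ⟩ := h.exists_disk c ho
    have hdι : ∀ z, d z ∈ Set.range ι := by
      intro z
      by_contra hc
      exact hP ⟨d z, hc, h.eq_one_of_notMem_range hc (hdΦ z)⟩
    choose d' hd' using hdι
    have hcomp : ι ∘ d' = d := funext hd'
    have hιd : IsEmbedding (ι ∘ d') := hcomp ▸ hd
    exact he.not_boundsDisk ⟨d', IsEmbedding.of_comp (hι.continuous_iff.2 hιd.continuous)
      hι.continuous hιd, himg _ _ (hcomp ▸ hdb)⟩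

/-! ### Classes of essential curves on the four-punctured sphere -/

/-- The function `G` is eventually constant if it takes integer values off a compact set. -/
theorem exists_const_of_int_valued_off_compact {G : ℝ × ℝ → ℝ} (hG : Continuous G)
    {K : Set (ℝ × ℝ)} (hK : IsCompact K) (h : ∀ x, x ∉ K → ∃ k : ℤ, G x = k) :
    ∃ (k : ℤ) (R : ℝ), ∀ x, R < ‖x‖ → G x = k := by
  let j := Complex.equivRealProdCLM.toHomeomorph
  have hK' : IsCompact (j ⁻¹' K) := j.isCompact_preimage.2 hK
  obtain ⟨R₀, hR₀⟩ := hK'.isBounded.subset_closedBall 0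
  set R := max R₀ 0
  -- The exterior of a disk is parametrized by the whole plane, so an integral function on it is
  -- constant.
  let γ : ℝ × ℝ → ℂ := fun y => ((R + Real.exp y.1 : ℝ) : ℂ) * Complex.exp (y.2 * Complex.I)
  have hγn : ∀ y, R < ‖γ y‖ := by
    intro y
    have h1 : 0 < Real.exp y.1 := Real.exp_pos _
    have h2 : 0 ≤ R := le_max_right _ _
    simp only [γ]
    rw [norm_mul, Complex.norm_exp_ofReal_mul_I, mul_one, Complex.norm_real,
      Real.norm_of_nonneg (by linarith)]
    linarith
  obtain ⟨k, hk⟩ := exists_const_of_int_valued (f := fun y => G (j (γ y)))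
    (hG.comp (j.continuous.comp (by fun_prop))) (fun y => h _ fun hy => by
      have h1 := mem_closedBall_zero_iff.1 (hR₀ (show γ y ∈ j ⁻¹' K from hy))
      exact absurd (hγn y) (not_lt.2 (h1.trans (le_max_left _ _))))
  refine ⟨k, R, fun x hx => ?_⟩
  set z := j.symm x with hz
  have hxz : ‖x‖ ≤ ‖z‖ := by
    have hx1 : x = (z.re, z.im) := (j.apply_symm_apply x).symm
    rw [hx1]
    exact max_le (Complex.abs_re_le_norm z) (Complex.abs_im_le_norm z)
  have hzR : 0 < ‖z‖ - R := by linarith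
  have h1 : γ (Real.log (‖z‖ - R), Complex.arg z) = z := by
    simp only [γ]
    rw [Real.exp_log hzR, add_sub_cancel, Complex.norm_mul_exp_arg_mul_I]
  have h2 := hk (Real.log (‖z‖ - R), Complex.arg z)
  simp only [h1] at h2
  rwa [hz, Homeomorph.apply_symm_apply] at h2

/-- An annulus `F` in `S`, a lift `L` to the plane and a collar function `Φ`. -/
structure IsLiftedCollar {S X : Type*} [TopologicalSpace S] [TopologicalSpace X] (ι : S → X)
    (p : ℝ × ℝ → X) (F : ℝ × ℝ → S) (L : ℝ × ℝ → ℝ × ℝ) (Φ : X → ℝ) : Prop where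
  collar : IsCollar F
  contL : Continuous L
  isOpenMap : IsOpenMap L
  lift : ∀ y, p (L y) = ι (F y)
  cont : Continuous Φ
  apply : ∀ y, Φ (ι (F y)) = ramp y.2
  exists_eq : ∀ x, 0 < Φ x → Φ x < 1 → ∃ y, |y.2| < 1 ∧ ι (F y) = x

namespace IsLiftedCollar

variable {S X : Type*} [TopologicalSpace S] [TopologicalSpace X] {ι : S → X}
  {p : ℝ × ℝ → X} {F : ℝ × ℝ → S} {L : ℝ × ℝ → ℝ × ℝ} {Φ : X → ℝ}

theorem reverse (h : IsLiftedCollar ι p F L Φ) :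
    IsLiftedCollar ι p (fun y => F (y.1, -y.2)) (fun y => L (y.1, -y.2)) (fun x => 1 - Φ x) := by
  have ho := ((Homeomorph.refl ℝ).prodCongr (Homeomorph.neg ℝ)).isOpenMap
  have hF := h.collar.cont
  have hL := h.contL
  refine ⟨⟨by fun_prop, h.collar.isOpenMap.comp ho, fun t s => h.collar.periodic t _,
    fun t s t' s' hh => ?_⟩, by fun_prop, h.isOpenMap.comp ho, fun y => h.lift _,
    continuous_const.sub h.cont, fun y => ?_, fun x h0 h1 => ?_⟩
  · have := h.collar.inj _ _ _ _ hh
    exact ⟨neg_injective this.1, this.2⟩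
  · rw [h.apply, ramp_neg]
    ring
  · obtain ⟨y, hy, rfl⟩ := h.exists_eq x (by linarith) (by linarith)
    exact ⟨(y.1, -y.2), by rwa [abs_neg], by simp⟩

theorem apply_lift (h : IsLiftedCollar ι p F L Φ) (y : ℝ × ℝ) : Φ (p (L y)) = ramp y.2 := by
  rw [h.lift, h.apply]

/-- The component of the lifted side `{Φ < 1 / 2}` that is adjacent to the lifted annulus. -/
def side (p : ℝ × ℝ → X) (L : ℝ × ℝ → ℝ × ℝ) (Φ : X → ℝ) : Set (ℝ × ℝ) :=
  connectedComponentIn {x | Φ (p x) < 1 / 2} (L (0, -1 / 2))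

theorem mem_side (h : IsLiftedCollar ι p F L Φ) {y : ℝ × ℝ} (hy : y.2 ∈ Set.Ioo (-1 : ℝ) 0) :
    L y ∈ side p L Φ := by
  have hc : IsPreconnected (L '' (Set.univ ×ˢ Set.Ioo (-1) 0)) :=
    (isPreconnected_univ.prod isPreconnected_Ioo).image _ h.contL.continuousOn
  refine hc.subset_connectedComponentIn ⟨(0, -1 / 2), ⟨trivial, by norm_num⟩, rfl⟩ ?_
    ⟨y, ⟨trivial, hy⟩, rfl⟩
  rintro _ ⟨w, ⟨-, hw⟩, rfl⟩
  change Φ (p (L w)) < 1 / 2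
  rw [h.apply_lift, ramp_of_abs_le (abs_le.2 ⟨hw.1.le, by linarith [hw.2]⟩)]
  linarith [hw.2]

theorem lt_half_of_mem_side {X : Type*} {p : ℝ × ℝ → X} {Φ : X → ℝ} {x : ℝ × ℝ}
    (hx : x ∈ side p L Φ) : Φ (p x) < 1 / 2 :=
  connectedComponentIn_subset {x | Φ (p x) < 1 / 2} _ hx

theorem eq_of_mem {A : Set (ℝ × ℝ)} {x : ℝ × ℝ} (hx : x ∈ connectedComponentIn A (L (0, -1 / 2))) :
    connectedComponentIn A x = connectedComponentIn A (L (0, -1 / 2)) :=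
  (connectedComponentIn_eq hx).symm

/-- Symmetries of the lifted side that move one of its points into the component preserve the
component. -/
theorem map_side {X : Type*} {p : ℝ × ℝ → X} {Φ : X → ℝ} (φ : ℝ × ℝ → ℝ × ℝ) (hφ : Continuous φ) (hp : ∀ x, p (φ x) = p x)
    {D : Set (ℝ × ℝ)} (hD : IsPreconnected D) (hDs : ∀ x ∈ D, Φ (p x) < 1 / 2) {z : ℝ × ℝ}
    (hz : z ∈ D) (hz' : φ z ∈ side p L Φ) {x : ℝ × ℝ} (hx : x ∈ D) : φ x ∈ side p L Φ := by
  have h1 : φ '' D ⊆ connectedComponentIn {x | Φ (p x) < 1 / 2} (φ z) := by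
    refine (hD.image _ hφ.continuousOn).subset_connectedComponentIn ⟨z, hz, rfl⟩ ?_
    rintro _ ⟨w, hw, rfl⟩
    change Φ (p (φ w)) < 1 / 2
    rw [hp]
    exact hDs w hw
  have h2 := h1 ⟨x, hx, rfl⟩
  rwa [eq_of_mem hz'] at h2

/-- The component of `e` in the lifted side must reach the lifted annulus up to deck
transformations; otherwise it would be closed as well as open, hence the whole plane. The deck
transformation found there carries the component to the distinguished one. -/
theorem exists_mem_side (hp : IsPillowMap p) (h : IsLiftedCollar ι p F L Φ) {e : ℝ × ℝ}
    (he : Φ (p e) < 1 / 2) : ∃ e', p e' = p e ∧ e' ∈ side p L Φ := by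
  set A : Set (ℝ × ℝ) := {x | Φ (p x) < 1 / 2} with hA
  have hΨ : Continuous fun x => Φ (p x) := h.cont.comp hp.cont
  have hAo : IsOpen A := isOpen_lt hΨ continuous_const
  set D := connectedComponentIn A e with hD
  have hDo : IsOpen D := hAo.connectedComponentIn
  have heD : e ∈ D := mem_connectedComponentIn he
  have hDc : IsPreconnected D := isPreconnected_connectedComponentIn
  have key : ∃ z ∈ D, ∃ y : ℝ × ℝ, y.2 ∈ Set.Ioo (-1 : ℝ) 0 ∧ p z = p (L y) := by
    by_contra! hcon
    have hcl : IsClosed D := by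
      refine isClosed_of_closure_subset fun x hx => ?_
      have hle : Φ (p x) ≤ 1 / 2 := by
        have h1 : closure D ⊆ {x | Φ (p x) ≤ 1 / 2} :=
          closure_minimal (fun w hw => le_of_lt (a := Φ (p w)) (connectedComponentIn_subset A e hw))
            (isClosed_le hΨ continuous_const)
        exact h1 hx
      rcases hle.lt_or_eq with hlt | heq
      · have hxA : x ∈ A := hlt
        obtain ⟨w, hw1, hw2⟩ := mem_closure_iff.1 hx _ hAo.connectedComponentIn
          (mem_connectedComponentIn hxA)
        have h1 := connectedComponentIn_eq hw1
        have h2 := connectedComponentIn_eq hw2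
        rw [hD, h2, ← h1]
        exact mem_connectedComponentIn hxA
      · obtain ⟨w, hw1, hw2⟩ := mem_closure_iff.1 hx {w | 0 < Φ (p w)}
          (isOpen_lt continuous_const hΨ) (by change 0 < Φ (p x); rw [heq]; norm_num)
        have hw1 : 0 < Φ (p w) := hw1
        have hw3 : Φ (p w) < 1 / 2 := connectedComponentIn_subset A e hw2
        obtain ⟨y, hy, hyw⟩ := h.exists_eq _ hw1 (by linarith)
        have hr := h.apply y
        rw [hyw, ramp_of_abs_le hy.le] at hr
        exact absurd (by rw [h.lift, hyw] : p w = p (L y))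
          (hcon w hw2 y ⟨(abs_lt.1 hy).1, by linarith⟩)
    have hall : D = Set.univ := IsClopen.eq_univ ⟨hcl, hDo⟩ ⟨e, heD⟩
    have h0 : L (0, 0) ∈ D := by rw [hall]; trivial
    have h1 : Φ (p (L (0, 0))) < 1 / 2 := connectedComponentIn_subset A e h0
    rw [h.apply_lift, ramp_of_abs_le (by simp)] at h1
    norm_num at h1
  obtain ⟨z, hzD, y, hy, hzy⟩ := key
  have hside := h.mem_side hy
  have hDs : ∀ x ∈ D, Φ (p x) < 1 / 2 := fun x hx => connectedComponentIn_subset A e hx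
  obtain ⟨n, hn | hn⟩ := (hp.eq_iff _ _).1 hzy
  · have hφ : ∀ x, p (x + latticePt n) = p x := fun x => hp.periodic x n
    exact ⟨e + latticePt n, hφ e, map_side (fun x => x + latticePt n) (by fun_prop) hφ hDc hDs hzD
      (hn ▸ hside) heD⟩
  · have hφ : ∀ x, p (-x + latticePt n) = p x := fun x => by rw [hp.periodic, hp.even]
    exact ⟨-e + latticePt n, hφ e, map_side (fun x => -x + latticePt n) (by fun_prop) hφ hDc hDs hzD
      (hn ▸ hside) heD⟩

/-- The half-turn about a half-lattice point is a deck transformation fixing that point, so it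
preserves the component containing the point. -/
theorem reflect_mem_side (hp : IsPillowMap p) {e x : ℝ × ℝ}
    (he : e ∈ halfLattice) (hes : e ∈ side p L Φ) (hx : x ∈ side p L Φ) :
    e + e - x ∈ side p L Φ := by
  obtain ⟨n, hn⟩ := he
  have hφ : ∀ x, p (e + e - x) = p x := fun x => by
    rw [hn, sub_eq_neg_add, hp.periodic, hp.even]
  refine map_side (fun x => e + e - x) (by fun_prop) hφ
    (isPreconnected_connectedComponentIn (F := {x | Φ (p x) < 1 / 2}) (x := L (0, -1 / 2)))
    (fun x hx => lt_half_of_mem_side hx) hes ?_ hx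
  simpa using hes

/-- Lifts `a` and `b` of the two punctures lie in the component, and the product of the half-turns
about them is the translation by `2 (b - a)`. Iterating it leaves every bounded set. -/
theorem exists_mem_side_norm_gt (hp : IsPillowMap p) (h : IsLiftedCollar ι p F L Φ)
    {P Q : X} (hP : P ∈ p '' halfLattice) (hQ : Q ∈ p '' halfLattice) (hPQ : P ≠ Q)
    (hP1 : Φ P < 1 / 2) (hQ1 : Φ Q < 1 / 2) (R : ℝ) : ∃ x ∈ side p L Φ, R < ‖x‖ := by
  have key : ∀ P ∈ p '' halfLattice, Φ P < 1 / 2 →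
      ∃ e, p e = P ∧ e ∈ side p L Φ ∧ e ∈ halfLattice := by
    rintro _ ⟨e, he, rfl⟩ h1
    obtain ⟨e', he', hs⟩ := exists_mem_side hp h h1
    exact ⟨e', he', hs, hp.mem_image_halfLattice.1 ⟨e, he, he'.symm⟩⟩
  obtain ⟨a, rfl, ha, ha'⟩ := key P hP hP1
  obtain ⟨b, rfl, hb, hb'⟩ := key Q hQ hQ1
  set c := b + b - (a + a) with hc
  have hc0 : c ≠ 0 := by
    intro h0
    apply hPQ
    have h1 : (2 : ℝ) • b = (2 : ℝ) • a := by
      rw [two_smul, two_smul]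
      exact sub_eq_zero.1 h0
    rw [smul_right_injective _ (two_ne_zero' ℝ) h1]
  have hmem : ∀ k : ℕ, a + (k : ℝ) • c ∈ side p L Φ := by
    intro k
    induction k with
    | zero => simpa using ha
    | succ k ih =>
      have := reflect_mem_side hp hb' hb (reflect_mem_side hp ha' ha ih)
      convert this using 1
      rw [hc]
      push_cast
      module
  obtain ⟨k, hk⟩ := exists_nat_gt ((R + ‖a‖) / ‖c‖)
  refine ⟨_, hmem k, ?_⟩
  rw [div_lt_iff₀ (norm_pos_iff.2 hc0)] at hk
  have h1 : ‖(k : ℝ) • c‖ = k * ‖c‖ := by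
    rw [norm_smul, Real.norm_of_nonneg (Nat.cast_nonneg k)]
  have h2 := norm_sub_le (a + (k : ℝ) • c) a
  rw [add_sub_cancel_left, h1] at h2
  linarith

/-- Otherwise the dual function takes the value `1/2` on the connected side. It is integral off the
lifted annulus, and on the annulus it coincides with `Φ ∘ p`, which is below `1/2` there. -/
theorem dual_lt_half_of_mem_side (h : IsLiftedCollar ι p F L Φ) {G : ℝ × ℝ → ℝ} (hG : Continuous G)
    (hGL : ∀ y, G (L y) = ramp y.2) (hG0 : ∀ x, x ∉ L '' {y | |y.2| < 1} → ∃ k : ℤ, G x = k)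
    {x : ℝ × ℝ} (hx : x ∈ side p L Φ) : G x < 1 / 2 := by
  by_contra! hc
  have h0 : L (0, -1 / 2) ∈ side p L Φ := h.mem_side (by norm_num)
  have h1 : G (L (0, -1 / 2)) ≤ 1 / 2 := by
    rw [hGL, ramp_of_abs_le (abs_le.2 (by norm_num))]
    norm_num
  obtain ⟨w, hw, hw1⟩ := (isPreconnected_connectedComponentIn (F := {x | Φ (p x) < 1 / 2})
    (x := L (0, -1 / 2))).intermediate_value h0 hx hG.continuousOn ⟨h1, hc⟩
  by_cases hwL : w ∈ L '' {y | |y.2| < 1}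
  · obtain ⟨y, hy, rfl⟩ := hwL
    have h2 := lt_half_of_mem_side hw
    rw [h.apply_lift, ← hGL, hw1] at h2
    exact lt_irrefl _ h2
  · obtain ⟨k, hk⟩ := hG0 w hwL
    rw [hk] at hw1
    have h2 : (2 * k : ℝ) = 1 := by linarith
    have h3 : 2 * k = 1 := by exact_mod_cast h2
    omega

/-- If the lifted curve closed up, its dual function would be constant near infinity. Both lifted
sides are unbounded, since each contains two punctures, and the function is below `1/2` on one and
above `1/2` on the other. -/
theorem not_periodic (hp : IsPillowMap p) (hι : Function.Injective ι)
    (h : IsLiftedCollar ι p F L Φ) {P Q P' Q' : X} (hP : P ∈ p '' halfLattice)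
    (hQ : Q ∈ p '' halfLattice) (hPQ : P ≠ Q) (hP1 : Φ P = 0) (hQ1 : Φ Q = 0)
    (hP' : P' ∈ p '' halfLattice) (hQ' : Q' ∈ p '' halfLattice) (hPQ' : P' ≠ Q') (hP1' : Φ P' = 1)
    (hQ1' : Φ Q' = 1) (hper : ∀ t s, L (t + 2, s) = L (t, s)) : False := by
  obtain ⟨hK, G, hG, hGL, hG0⟩ := exists_dual_function_of_periodic h.contL h.isOpenMap
    (fun y y' hy => (h.collar.inj _ _ _ _ (hι (by rw [← h.lift, ← h.lift, hy]))).1)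
    (k := 2) two_pos (by exact_mod_cast hper)
  obtain ⟨k, R, hkR⟩ := exists_const_of_int_valued_off_compact hG hK (fun x hx => hG0 x fun hx' =>
    by
      obtain ⟨y, hy, rfl⟩ := hx'
      exact hx ⟨y, le_of_lt (a := |y.2|) hy, rfl⟩)
  obtain ⟨x, hx, hxR⟩ := exists_mem_side_norm_gt hp h hP hQ hPQ (by rw [hP1]; norm_num)
    (by rw [hQ1]; norm_num) R
  obtain ⟨x', hx', hxR'⟩ := exists_mem_side_norm_gt hp h.reverse hP' hQ' hPQ'
    (by rw [hP1']; norm_num) (by rw [hQ1']; norm_num) R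
  have h1 := h.dual_lt_half_of_mem_side hG hGL hG0 hx
  have h2 := h.reverse.dual_lt_half_of_mem_side (G := fun x => 1 - G x) (continuous_const.sub hG)
    (fun y => by rw [hGL, ramp_neg]; ring) (fun x hx => by
      obtain ⟨j, hj⟩ := hG0 x (by
        rintro ⟨y, hy, rfl⟩
        exact hx ⟨(y.1, -y.2), by change |-y.2| < 1; rwa [abs_neg], by simp⟩)
      exact ⟨1 - j, by rw [hj]; push_cast; rfl⟩) hx'
  rw [hkR x hxR] at h1
  rw [hkR x' hxR'] at h2
  linarith

/-- If a point and its negative both lie in the translates of the lifted annulus, they are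
half-lattice points. -/
theorem mem_halfLattice_of_neg (hp : IsPillowMap p) (hι : Function.Injective ι)
    (h : IsLiftedCollar ι p F L Φ) {v : ℤ × ℤ} (hv : ∀ t s, L (t + 1, s) = L (t, s) + latticePt v)
    {x y y' : ℝ × ℝ} {n n' : ℤ × ℤ} (hy : x = L y + latticePt n) (hy' : -x = L y' + latticePt n') :
    x ∈ halfLattice := by
  have h1 : ι (F y) = ι (F y') := by
    rw [← h.lift, ← h.lift, ← hp.periodic (L y) n, ← hy, ← hp.periodic (L y') n', ← hy', hp.even]
  obtain ⟨h2, k, hk⟩ := h.collar.inj _ _ _ _ (hι h1)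
  have h3 : L y' = L y + latticePt (k • v) := by
    have := add_int_of_add_one (f := fun t => L (t, y.2)) (fun t => hv t _) y.1 k
    rw [← this, ← hk, ← h2]
  refine ⟨n - n' - k • v, ?_⟩
  rw [h3] at hy'
  have h4 : x + x = x - -x := by abel
  rw [h4, hy', latticePt_sub, latticePt_sub, hy]
  abel

/-- If `u = 0`, then `G x + G (-x) - Φ (p x)` is continuous and integral, hence constant. At
half-lattice points the first two terms are equal integers, so `Φ` would have the same parity at all
punctures; but it is `0` at one and `1` at another. -/
theorem dual_ne_zero (hp : IsPillowMap p) (hι : Function.Injective ι)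
    (hr : Set.range ι = (p '' halfLattice)ᶜ)
    (h : IsLiftedCollar ι p F L Φ) (hΦ : ∀ x, 0 ≤ Φ x ∧ Φ x ≤ 1) {v : ℤ × ℤ}
    (hv : ∀ t s, L (t + 1, s) = L (t, s) + latticePt v) {G : ℝ × ℝ → ℝ} {u : ℤ × ℤ}
    (hG : Continuous G)
    (hGu : ∀ x n, G (x + latticePt n) = G x + ((u.1 * n.1 + u.2 * n.2 : ℤ) : ℝ))
    (hGL : ∀ y, G (L y) = ramp y.2)
    (hG0 : ∀ x, (∀ y n, |y.2| < 1 → x ≠ L y + latticePt n) → ∃ k : ℤ, G x = k)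
    {P Q : X} (hP : P ∈ p '' halfLattice) (hQ : Q ∈ p '' halfLattice) (hP1 : Φ P = 0)
    (hQ1 : Φ Q = 1) : u ≠ 0 := by
  rintro rfl
  have hper : ∀ x n, G (x + latticePt n) = G x := fun x n => by simp [hGu]
  have hΨ : Continuous fun x => Φ (p x) := h.cont.comp hp.cont
  have hΨL : ∀ y n, Φ (p (L y + latticePt n)) = ramp y.2 := fun y n => by
    rw [hp.periodic, h.apply_lift]
  have hhalf : ∀ x ∈ halfLattice, Φ (p x) ∉ Set.Ioo (0 : ℝ) 1 := by
    rintro x hx ⟨h0, h1⟩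
    obtain ⟨y, -, hy⟩ := h.exists_eq _ h0 h1
    have : ι (F y) ∈ (p '' halfLattice)ᶜ := hr ▸ Set.mem_range_self _
    exact this ⟨x, hx, hy.symm⟩
  have hIoo : ∀ y : ℝ × ℝ, |y.2| < 1 → ramp y.2 ∈ Set.Ioo (0 : ℝ) 1 := fun y hy => by
    rw [ramp_of_abs_le hy.le]
    have := abs_lt.1 hy
    exact ⟨by linarith, by linarith⟩
  -- On the lifted annulus `G` and `Φ ∘ p` cancel. The negative of the point lies in no translate of
  -- the annulus, for otherwise the point would belong to the half-lattice.
  have hcase : ∀ (x y : ℝ × ℝ) (n : ℤ × ℤ), |y.2| < 1 → x = L y + latticePt n →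
      ∃ k : ℤ, G x + G (-x) - Φ (p x) = k := by
    intro x y n hy hx
    obtain ⟨k, hk⟩ := hG0 (-x) fun y' n' _ hx' => by
      refine hhalf x (h.mem_halfLattice_of_neg hp hι hv hx hx') ?_
      rw [hx, hΨL]
      exact hIoo y hy
    refine ⟨k, ?_⟩
    rw [hk, hx, hΨL, hper, hGL]
    ring
  obtain ⟨c, hc⟩ := exists_const_of_int_valued (f := fun x => G x + G (-x) - Φ (p x))
    ((hG.add (hG.comp continuous_neg)).sub hΨ) (fun x => by
      by_cases h1 : ∃ y n, |y.2| < 1 ∧ x = L y + latticePt n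
      · obtain ⟨y, n, hy, hx⟩ := h1
        exact hcase x y n hy hx
      by_cases h2 : ∃ y n, |y.2| < 1 ∧ -x = L y + latticePt n
      · obtain ⟨y, n, hy, hx⟩ := h2
        obtain ⟨k, hk⟩ := hcase (-x) y n hy hx
        rw [neg_neg, hp.even] at hk
        exact ⟨k, by rw [← hk]; ring⟩
      obtain ⟨k, hk⟩ := hG0 x fun y n hy hx => h1 ⟨y, n, hy, hx⟩
      obtain ⟨k', hk'⟩ := hG0 (-x) fun y n hy hx => h2 ⟨y, n, hy, hx⟩
      obtain ⟨j, hj⟩ : ∃ j : ℤ, Φ (p x) = j := by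
        rcases (hΦ (p x)).1.eq_or_lt with h3 | h3
        · exact ⟨0, by rw [← h3]; simp⟩
        rcases (hΦ (p x)).2.eq_or_lt with h4 | h4
        · exact ⟨1, by rw [h4]; simp⟩
        obtain ⟨y, hy, hyx⟩ := h.exists_eq _ h3 h4
        rw [← h.lift] at hyx
        obtain ⟨n, hn | hn⟩ := (hp.eq_iff _ _).1 hyx
        · exact absurd ⟨y, n, hy, hn⟩ h1
        · refine absurd ⟨y, -n, hy, ?_⟩ h2
          rw [hn, latticePt_neg]
          abel
      exact ⟨k + k' - j, by rw [hk, hk', hj]; push_cast; ring⟩)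
  have hval : ∀ x ∈ halfLattice, ∃ k : ℤ, 2 * (k : ℝ) - Φ (p x) = c := by
    intro x hx
    obtain ⟨k, hk⟩ := hG0 x fun y n hy hxy => hhalf x hx (by rw [hxy, hΨL]; exact hIoo y hy)
    obtain ⟨n, hn⟩ := hx
    have h1 : G (-x) = G x := by
      rw [← hper (-x) n, ← hn]
      simp
    have h2 := hc x
    simp only [h1, hk] at h2
    exact ⟨k, by linarith⟩
  obtain ⟨x, hx, rfl⟩ := hP
  obtain ⟨y, hy, rfl⟩ := hQ
  obtain ⟨k, hk⟩ := hval x hx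
  obtain ⟨j, hj⟩ := hval y hy
  rw [hP1] at hk
  rw [hQ1] at hj
  have h1 : (2 * k : ℝ) = 2 * j - 1 := by linarith
  have h2 : 2 * k = 2 * j - 1 := by exact_mod_cast h1
  omega

end IsLiftedCollar

/-- Every essential curve on the four-punctured sphere has a class, and a dual class. -/
theorem exists_class_of_isEssentialCurve {S : Type*} [TopologicalSpace S] {ι : S → unitSphere}
    {p : ℝ × ℝ → unitSphere} (hp : IsPillowMap p) (hι : IsEmbedding ι)
    (hr : Set.range ι = (p '' halfLattice)ᶜ) {α : Set S} (hα : IsEssentialCurve α) :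
    ∃ (F : ℝ × ℝ → S) (L : ℝ × ℝ → ℝ × ℝ) (Φ : unitSphere → ℝ) (v : ℤ × ℤ) (G : ℝ × ℝ → ℝ)
      (u : ℤ × ℤ), IsLiftedCollar ι p F L Φ ∧ (Set.range fun t => F (t, 0)) = α ∧ v ≠ 0 ∧ u ≠ 0 ∧
      (∀ t s, L (t + 1, s) = L (t, s) + latticePt v) ∧ Continuous G ∧
      (∀ x n, G (x + latticePt n) = G x + ((u.1 * n.1 + u.2 * n.2 : ℤ) : ℝ)) ∧
      (∀ y, G (L y) = ramp y.2) ∧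
      (∀ x, (∀ y n, |y.2| < 1 → x ≠ L y + latticePt n) → ∃ k : ℤ, G x = k) ∧
      u.1 * v.1 + u.2 * v.2 = 0 := by
  obtain ⟨f, hf, rfl⟩ := hα.isSimpleClosedCurve
  have hq := hp.flatCover hι hr
  have hιo : IsOpenEmbedding ι := ⟨hι, hr ▸ hp.isClosed_image_halfLattice.isOpen_compl⟩
  obtain ⟨Φ, hΦ⟩ := hp.exists_collarFunction (hιo.comp hf)
  have hF := IsCollar.of_isOpenEmbedding hf
  obtain ⟨L, hL, hLF⟩ := hq.lift _ hF.cont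
  have h : IsLiftedCollar ι p (fun y => f (circlePar y.1, y.2)) L Φ :=
    { collar := hF
      contL := hL
      isOpenMap := hq.isOpenMap_lift hL (hq.isOpenMap_collar hf) hLF
      lift := hLF
      cont := hΦ.cont
      apply := fun y => hΦ.apply _ _
      exists_eq := fun x h0 h1 => by
        obtain ⟨z, s, hs, hx⟩ := hΦ.exists_eq x h0 h1
        obtain ⟨t, rfl⟩ := circlePar_surjective z
        exact ⟨(t, s), hs, hx⟩ }
  obtain ⟨P', Q', hP', hQ', hPQ', hP1', hQ1'⟩ := exists_two_punctures hι hΦ hα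
  have himg : (fun y : Circle × ℝ => f (y.1, -y.2)) '' (Set.univ ×ˢ {0}) =
      f '' (Set.univ ×ˢ {0}) := by
    ext x
    constructor
    · rintro ⟨⟨z, s⟩, ⟨-, rfl⟩, rfl⟩
      exact ⟨(z, 0), by simp, by simp⟩
    · rintro ⟨⟨z, s⟩, ⟨-, rfl⟩, rfl⟩
      exact ⟨(z, 0), by simp, by simp⟩
  obtain ⟨P, Q, hP, hQ, hPQ, hP1, hQ1⟩ := exists_two_punctures
    (f := fun y => f (y.1, -y.2)) hι hΦ.reverse (himg ▸ hα)
  rw [hr, Set.notMem_compl_iff] at hP hQ hP' hQ'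
  have hP1 : Φ P = 0 := by linarith
  have hQ1 : Φ Q = 0 := by linarith
  have hno := h.not_periodic hp hι.injective hP hQ hPQ hP1 hQ1 hP' hQ' hPQ' hP1' hQ1'
  have hb : p (L (0, 0)) = p (L (0 + 1, 0)) := by rw [hLF, hLF, hF.periodic]
  obtain ⟨v, hv⟩ : ∃ v, L (0 + 1, 0) = L (0, 0) + latticePt v := by
    obtain ⟨n, hn | hn⟩ := (hp.eq_iff _ _).1 hb
    · exact ⟨n, hn⟩
    -- When one turn acts on the lift as a half-turn of the plane, two turns act trivially, so the
    -- lift closes up.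
    · exfalso
      refine hno fun t s => ?_
      have hall := hq.lift_unique (c := fun y => L (y.1 + 1, y.2))
        (c' := fun y => -L y + latticePt n) (a₀ := (0, 0)) (by fun_prop) (by fun_prop)
        (fun y => by rw [hp.periodic, hp.even, hLF, hLF, hF.periodic])
        (fun y => ⟨_, (hLF _).symm⟩) hn
      have h1 : ∀ t s, L (t + 1, s) = -L (t, s) + latticePt n := fun t s => congrFun hall (t, s)
      rw [show t + 2 = t + 1 + 1 by ring, h1, h1]
      abel
  have hvall : ∀ t s, L (t + 1, s) = L (t, s) + latticePt v := fun t s =>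
    hq.lift_period hL hLF (σ := fun y => (y.1 + 1, y.2)) (by fun_prop)
      (fun y => hF.periodic _ _) (a₀ := (0, 0)) hv (t, s)
  have hv0 : v ≠ 0 := by
    rintro rfl
    refine hno fun t s => ?_
    rw [show t + 2 = t + 1 + 1 by ring, hvall, hvall]
    simp
  obtain ⟨G, u, hG, hGu, hGL, hG0, huv⟩ := exists_dual_function hL h.isOpenMap
    (fun y y' n hn => by
      have : ι (f (circlePar y.1, y.2)) = ι (f (circlePar y'.1, y'.2)) := by
        rw [← hLF, ← hLF, hn, hp.periodic]
      exact (hF.inj _ _ _ _ (hι.injective this)).1) hvall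
  have hu := h.dual_ne_zero hp hι.injective hr hΦ.mem hvall hG hGu hGL hG0 hP hP' hP1 hP1'
  exact ⟨_, L, Φ, v, G, u, h, (core_eq_range f).symm, hv0, hu, hvall, hG, hGu, hGL, hG0, huv⟩

theorem exists_eq_of_add_one {h : ℝ → ℝ} (hh : Continuous h) {d : ℤ} (hd : d ≠ 0)
    (hper : ∀ t, h (t + 1) = h t + d) (c : ℝ) : ∃ t, h t = c := by
  have hk : ∀ k : ℕ, h k = h 0 + k * d ∧ h (-k) = h 0 - k * d := by
    intro k
    induction k with
    | zero => simp
    | succ k ih =>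
      constructor
      · push_cast
        rw [hper, ih.1]
        ring
      · have := hper (-((k + 1 : ℕ) : ℝ))
        push_cast at this ⊢
        rw [show -((k : ℝ) + 1) + 1 = -k by ring, ih.2] at this
        linarith
  have hd1 : (1 : ℝ) ≤ |(d : ℝ)| := by exact_mod_cast Int.one_le_abs hd
  obtain ⟨k, hk'⟩ := exists_nat_ge |c - h 0|
  have h1 : |c - h 0| ≤ |k * (d : ℝ)| := by
    rw [abs_mul, Nat.abs_cast]
    nlinarith [abs_nonneg (c - h 0)]
  have h2 := abs_le.1 h1
  rcases abs_choice (k * (d : ℝ)) with h3 | h3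
  · rw [h3] at h2
    obtain ⟨t, -, ht⟩ := exists_mem_eq_of_between hh (a := -(k : ℝ)) (b := k) (c := c)
      (by rw [(hk k).2]; linarith) (by rw [(hk k).1]; linarith)
    exact ⟨t, ht⟩
  · rw [h3] at h2
    obtain ⟨t, -, ht⟩ := exists_mem_eq_of_between hh (a := (k : ℝ)) (b := -(k : ℝ)) (c := c)
      (by rw [(hk k).1]; linarith) (by rw [(hk k).2]; linarith)
    exact ⟨t, ht⟩

/-- If `|u · w| ≥ 2`, the dual function of `α` takes two inequivalent half-integral values along one
turn of a lift of `β`, and another along the negative of that lift. These give three different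
intersection points. -/
theorem exists_classes_of_meet_twice {S : Type*} [TopologicalSpace S] {ι : S → unitSphere}
    {p : ℝ × ℝ → unitSphere} (hp : IsPillowMap p) (hι : IsEmbedding ι)
    (hr : Set.range ι = (p '' halfLattice)ᶜ) {α β : Set S} (hα : IsEssentialCurve α)
    (hβ : IsEssentialCurve β) (hm : MeetTransversely 2 α β) :
    ∃ u v w : ℤ × ℤ, u ≠ 0 ∧ v ≠ 0 ∧ w ≠ 0 ∧ HasClass ι p α v ∧ HasClass ι p β w ∧
      u.1 * v.1 + u.2 * v.2 = 0 ∧ |u.1 * w.1 + u.2 * w.2| ≤ 1 := by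
  obtain ⟨F, L, Φ, v, G, u, h, rfl, hv0, hu0, hv, hG, hGu, hGL, hG0, huv⟩ :=
    exists_class_of_isEssentialCurve hp hι hr hα
  obtain ⟨F', L', Φ', w, -, -, h', rfl, hw0, -, hw, -⟩ :=
    exists_class_of_isEssentialCurve hp hι hr hβ
  refine ⟨u, v, w, hu0, hv0, hw0, hasClass_of_collar h.collar h.contL h.lift hv,
    hasClass_of_collar h'.collar h'.contL h'.lift hw, huv, ?_⟩
  by_contra! hd
  set d := u.1 * w.1 + u.2 * w.2 with hddef
  have hL' := h'.contL
  have hd0 : d ≠ 0 := by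
    rintro h0
    rw [h0] at hd
    norm_num at hd
  have hper₁ : ∀ t, G (L' (t + 1, 0)) = G (L' (t, 0)) + d := fun t => by rw [hw, hGu]
  have hper₂ : ∀ t, G (-L' (t + 1, 0)) = G (-L' (t, 0)) + (-d : ℤ) := fun t => by
    rw [hw, neg_add, ← latticePt_neg, hGu, hddef]
    congr 2
    simp only [Prod.fst_neg, Prod.snd_neg]
    ring
  obtain ⟨t₁, ht₁⟩ := exists_eq_of_add_one (h := fun t => G (L' (t, 0))) (by fun_prop) hd0 hper₁
    (((0 : ℤ) : ℝ) + 1 / 2)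
  obtain ⟨t₂, ht₂⟩ := exists_eq_of_add_one (h := fun t => G (L' (t, 0))) (by fun_prop) hd0 hper₁
    (((1 : ℤ) : ℝ) + 1 / 2)
  obtain ⟨t₃, ht₃⟩ := exists_eq_of_add_one (h := fun t => G (-L' (t, 0))) (by fun_prop)
    (neg_ne_zero.2 hd0) hper₂ (((0 : ℤ) : ℝ) + 1 / 2)
  have hmem₁ : ∀ t (m : ℤ), G (L' (t, 0)) = m + 1 / 2 → F' (t, 0) ∈ Set.range fun t => F (t, 0) := by
    intro t m ht
    obtain ⟨a, n, han⟩ := exists_half_of_eq_int_add_half hGu hGL hG0 ht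
    exact ⟨a, hι.injective (by rw [← h.lift, ← h'.lift, han, hp.periodic])⟩
  have hmem₂ : ∀ t (m : ℤ), G (-L' (t, 0)) = m + 1 / 2 →
      F' (t, 0) ∈ Set.range fun t => F (t, 0) := by
    intro t m ht
    obtain ⟨a, n, han⟩ := exists_half_of_eq_int_add_half hGu hGL hG0 ht
    exact ⟨a, hι.injective (by rw [← h.lift, ← h'.lift, ← hp.even (L' _), han, hp.periodic])⟩
  have hadd₁ : ∀ t (k : ℤ), G (L' (t + k, 0)) = G (L' (t, 0)) + (k * d : ℤ) := by
    intro t k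
    have := add_int_of_add_one (f := fun t => L' (t, 0)) (fun t => hw t 0) t k
    rw [this, hGu, hddef]
    congr 2
    simp only [Prod.smul_fst, Prod.smul_snd, smul_eq_mul]
    ring
  have hne₁₂ : F' (t₁, 0) ≠ F' (t₂, 0) := by
    intro he
    obtain ⟨-, k, rfl⟩ := h'.collar.inj _ _ _ _ he
    rw [hadd₁, ht₁] at ht₂
    have h1 : ((k * d : ℤ) : ℝ) = (1 : ℤ) := by
      push_cast at ht₂ ⊢
      linarith
    have h2 : k * d = 1 := by exact_mod_cast h1
    have h3 : |d| = 1 := by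
      rcases Int.eq_one_or_neg_one_of_mul_eq_one' h2 with h | h <;> simp [h.2]
    omega
  -- A coincidence would place a point of the lift and its negative on translates of the lift of
  -- `α`; that point would belong to the half-lattice, so a puncture would lie on the curve.
  have hne₃ : ∀ t (m : ℤ), G (L' (t, 0)) = m + 1 / 2 → F' (t, 0) ≠ F' (t₃, 0) := by
    intro t m ht he
    obtain ⟨-, k, rfl⟩ := h'.collar.inj _ _ _ _ he
    obtain ⟨a, n, han⟩ := exists_half_of_eq_int_add_half hGu hGL hG0 ht
    obtain ⟨b, n', hbn⟩ := exists_half_of_eq_int_add_half hGu hGL hG0 ht₃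
    have hk := add_int_of_add_one (f := fun t => L' (t, 0)) (fun t => hw t 0) t k
    have h1 : L' (t, 0) ∈ halfLattice := by
      refine h.mem_halfLattice_of_neg hp hι.injective hv han (y' := (b, 0))
        (n' := n' + k • w) ?_
      rw [latticePt_add, ← add_assoc, ← hbn, hk]
      abel
    have h2 : ι (F' (t, 0)) ∈ (p '' halfLattice)ᶜ := hr ▸ Set.mem_range_self _
    exact h2 ⟨_, h1, h'.lift _⟩
  have hsub : ({F' (t₁, 0), F' (t₂, 0), F' (t₃, 0)} : Set S) ⊆
      (Set.range fun t => F (t, 0)) ∩ Set.range fun t => F' (t, 0) := by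
    rintro _ (rfl | rfl | rfl)
    · exact ⟨hmem₁ _ _ ht₁, _, rfl⟩
    · exact ⟨hmem₁ _ _ ht₂, _, rfl⟩
    · exact ⟨hmem₂ _ _ ht₃, _, rfl⟩
  have hcard := Set.encard_le_encard hsub
  rw [hm.1, Set.encard_eq_three.2 ⟨_, _, _, hne₁₂, hne₃ _ _ ht₁, hne₃ _ _ ht₂, rfl⟩] at hcard
  norm_num at hcard

theorem hasInfiniteDiameter_of_isFourPuncturedSphere {S : Type*} [TopologicalSpace S]
    (hS : IsFourPuncturedSphere S) : HasInfiniteDiameter (sporadicCurveComplex 2 S) := by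
  obtain ⟨p, hp⟩ := exists_isPillowMap
  obtain ⟨ι, hι, hr⟩ := exists_embedding_of_isFourPuncturedSphere hS hp
  have hq := hp.flatCover hι hr
  exact hq.hasInfiniteDiameter 2 (fun T hT => hq.meetTransversely_two hT hp.even)
    fun α β hα hβ h => exists_classes_of_meet_twice hp hι hr hα hβ h

theorem mainTheorem6 :
    (∀ (n : ℕ) (a : List ℕ) (r : ℚ), 2 ≤ n → a.length = n - 1 → (∀ i ∈ a, 3 ≤ i) →
      r = contFrac a →
      ∃ K : fareyGraph.Walk ∞ (r : OnePoint ℚ),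
        (∀ K' : fareyGraph.Walk ∞ (r : OnePoint ℚ), IsSpine K' ↔ K' = K) ∧
        K.length = n ∧
        ∀ P : fareyGraph.Walk ∞ (r : OnePoint ℚ), IsGeodesicWalk P ↔ P = K) ∧
    (∀ (S : Type*) [TopologicalSpace S], IsFourPuncturedSphere S →
      HasInfiniteDiameter (sporadicCurveComplex 2 S)) ∧
    (∀ (S : Type*) [TopologicalSpace S], IsTorusWithAtMostOneHole S →
      HasInfiniteDiameter (sporadicCurveComplex 1 S)) := by
  refine ⟨?_, fun S _ hS => hasInfiniteDiameter_of_isFourPuncturedSphere hS,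
    fun S _ hS => hasInfiniteDiameter_of_isTorusWithAtMostOneHole hS⟩
  rintro n a r hn ha h3 rfl
  obtain ⟨K, h1, h2, h4⟩ := exists_unique_spine h3 (by
    rintro rfl
    simp only [List.length_nil] at ha
    omega)
  exact ⟨K, h1, by omega, h4⟩
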